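/- **Model.** Fix $\hbar,m,\eta,c>0$, $e\in\mathbb R$, and measurable fields $u_1,u_2:\mathbb R^3\to\mathbb R^3$ such that $u_1(k),u_2(k),k/|k|$ are orthonormal for every $k\neq0$. Assume that $\frac{\eta e^2}{3mc^3}\le 1$ and let $\varphi\in[0,\frac\pi2]$ be the angle with $\sin\varphi=\frac{\eta}{3mc^3}e^2$. Put $\omega(k)=c|k|$ and, for $C>0$, $\chi_C=1_{\{|k|<C\}}$. Let $\mathcal F=\bigoplus_{n\ge0}L^2_{\rm sym}(\mathbb R^{3n})$ be the symmetric Fock space over $L^2(\mathbb R^3)$ with creation and annihilation operators $a^*(g),a(g)$, and let $a^{(*)}(\cdot,\sigma)$ denote these operators in the $\sigma$-th factor of $\mathcal F\otimes\mathcal F$, $\sigma=1,2$. In $L^2(\mathbb R^3,dq)\otimes\mathcal F\otimes\mathcal F$ consider $$H=-\hbar^2\tfrac m2\eta^2\Delta_q+\tfrac1{2m}q^2+H_{\rm r}+H_{\rm f}+\tfrac em\sum_{\sigma=1,2}\int\chi_C(k)\sqrt{\tfrac{\hbar}{4\pi^2\omega(k)}}\,(q\cdot u_\sigma(k))\,\big(a^*(k,\sigma)+a(k,\sigma)\big)\,dk,$$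 $$H_{\rm f}=\hbar\sum_{\sigma=1,2}\int\omega(k)\,a^*(k,\sigma)a(k,\sigma)\,dk .$$ For $N\ge1$ let $\Lambda_j$ ($j\in J_N$) be the half-open cubes of volume $V=N^{-3}$ with vertices in $(\frac1N\mathbb Z)^3$ which meet the ball $B(0,N)$, let $\bar f_j$ be the mean value of $f$ over $\Lambda_j$, let $P_N$ be the orthogonal projection of $L^2(\mathbb R^3)$ onto the span of the $1_{\Lambda_j}$, $j\in J_N$, and $\boldsymbol P_N$ its second quantization on $\mathcal F$. Let $H_{{\rm f},N}$ be the compression of $H_{\rm f}$ to the range of $\boldsymbol P_N\otimes\boldsymbol P_N$, and $H_N$ the compression of $H$ to the range of $1\otimes\boldsymbol P_N\otimes\boldsymbol P_N$, where the mass and energy renormalization $H_{\rm r}$ is taken in the discretized form $$H_{{\rm r},N}=\sum_{j\in J_N}\sum_{\sigma=1,2}V\,\frac{e^2}{4\pi^2m^2}\,\frac{(\bar y_{\sigma j}\cdot q)^2}{\bar\omega_j}-\sum_{j\in J_N}V\,\hbar\,\frac{e^2\eta^2}{4\pi^2m}\,\frac{(\overline{\chi_C})_j}{\bar\omega_j^2(\bar\omega_j+\eta)},\qquad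 y_\sigma=\frac{\chi_C\,u_\sigma}{\sqrt\omega}.$$ For $\beta>0$ and $\gamma>0$ let $C=\gamma\eta/c$ and define the cutoff partition function $$Z(\beta;\gamma)=\lim_{N\to\infty}\frac{\operatorname{Tr}e^{-\frac\beta\hbar H_N}}{\operatorname{Tr}e^{-\frac\beta\hbar H_{{\rm f},N}}},$$ the traces being taken in the ranges of the respective projections. **Theorem.** For all $\beta,\gamma>0$ the operators $e^{-\frac\beta\hbar H_N}$ and $e^{-\frac\beta\hbar H_{{\rm f},N}}$ are trace class for every $N\ge1$, and the limit $Z(\beta;\gamma)$ exists. For every $\beta>0$ the limit $Z(\beta):=\lim_{\gamma\to\infty}Z(\beta;\gamma)$ exists and, with $\rho=\frac{\eta\beta}{2\pi}$, $$Z(\beta)=\left[\frac{\rho}{2\pi}\,e^{-2\rho\ln(\rho)\sin\varphi}\,\big|\Gamma(i\rho e^{-i\varphi})\big|^2\right]^3 .$$ Moreover there is a positive Borel measure $\mu$ supported in $[0,\infty)$ with $Z(\beta)=\int e^{-\beta\omega}\,d\mu(\omega)$ for all $\beta>0$. -/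

import Mathlib

open MeasureTheory Filter Topology

/-- Space `ℝ³` with its Euclidean norm. It serves both for the particle momentum `q` and for the
photon wave vector `k`. -/
abbrev E3 : Type := EuclideanSpace ℝ (Fin 3)

/-! ### Symmetric Fock space over `L²(ℝ³)`

The `n`-particle component consists of functions of `(k₁, …, kₙ) ∈ (ℝ³)ⁿ`, so the full Fock space
is a space of functions on the disjoint union of all `(ℝ³)ⁿ`. -/

/-- The disjoint union of the spaces `(ℝ³)ⁿ`, `n = 0, 1, 2, …`. -/
abbrev FockConf : Type := Σ n : ℕ, (Fin n → E3)

/-- The measure on `⨆ₙ (ℝ³)ⁿ` which is Lebesgue measure on every `(ℝ³)ⁿ` (a unit mass for `n = 0`).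
Thus `L²` of this measure is the Hilbert sum of the spaces `L²(ℝ³ⁿ)`. -/
noncomputable def fockMeasure : Measure FockConf :=
  Measure.sum fun n : ℕ => (volume : Measure (Fin n → E3)).map (Sigma.mk n)

/-- A core of Fock space vectors, forming a dense subspace of the symmetric Fock space: symmetric
bounded measurable functions with boundedly many particles and bounded wave vectors. -/
def IsFockCore (F : FockConf → ℂ) : Prop :=
  Measurable F ∧
  (∀ (n : ℕ) (π : Equiv.Perm (Fin n)) (k : Fin n → E3), F ⟨n, fun i => k (π i)⟩ = F ⟨n, k⟩) ∧
  (∃ B : ℝ, ∀ x, ‖F x‖ ≤ B) ∧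
  (∃ M : ℕ, ∀ (n : ℕ) (k : Fin n → E3), M < n → F ⟨n, k⟩ = 0) ∧
  (∃ R : ℝ, ∀ (n : ℕ) (k : Fin n → E3), (∃ i, R < ‖k i‖) → F ⟨n, k⟩ = 0)

/-- The creation operator `a*(g) = ∫ g(k) a*(k) dk` for real `g`. -/
noncomputable def creation (g : E3 → ℝ) (F : FockConf → ℂ) : FockConf → ℂ
  | ⟨0, _⟩ => 0
  | ⟨n + 1, k⟩ =>
      ((1 / Real.sqrt ((n : ℝ) + 1) : ℝ) : ℂ) *
        ∑ j : Fin (n + 1), (g (k j) : ℂ) * F ⟨n, fun i => k (j.succAbove i)⟩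

/-- The annihilation operator `a(g) = ∫ g(k) a(k) dk` for real `g`. -/
noncomputable def annihilation (g : E3 → ℝ) (F : FockConf → ℂ) : FockConf → ℂ
  | ⟨n, k⟩ =>
      ((Real.sqrt ((n : ℝ) + 1) : ℝ) : ℂ) *
        ∫ x : E3, (g x : ℂ) * F ⟨n + 1, Fin.cons x k⟩

/-- The operator `∫ w(k) a*(k) a(k) dk`, i.e. multiplication by `∑ⱼ w(kⱼ)`. -/
noncomputable def dGamma (w : E3 → ℝ) (F : FockConf → ℂ) : FockConf → ℂ
  | ⟨n, k⟩ => ((∑ j : Fin n, w (k j) : ℝ) : ℂ) * F ⟨n, k⟩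

/-! ### Discretization by cubes -/

/-- The half open cube of side `1/N` whose lower corner is the lattice point `z/N`. -/
def cube (N : ℕ) (z : Fin 3 → ℤ) : Set E3 := {x | ∀ i, ⌊(N : ℝ) * x i⌋ = z i}

/-- The index of the cube of side `1/N` which contains `x`. -/
noncomputable def cubeIndex (N : ℕ) (x : E3) : Fin 3 → ℤ := fun i => ⌊(N : ℝ) * x i⌋

/-- The indices of those cubes of side `1/N` that meet the ball of radius `N` centred at `0`. -/
def cubeIndices (N : ℕ) : Set (Fin 3 → ℤ) := {z | (cube N z ∩ Metric.ball (0 : E3) N).Nonempty}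

theorem cubeIndices_finite (N : ℕ) : (cubeIndices N).Finite := by
  refine (Set.Finite.pi (t := fun _ : Fin 3 => Set.Icc (-((N : ℤ) * N)) ((N : ℤ) * N))
    fun _ => Set.finite_Icc _ _).subset ?_
  rintro z ⟨x, hx, hb⟩ i -
  have hn : ‖x‖ < N := by simpa using hb
  have h1 : |x i| < N := lt_of_le_of_lt (by simpa using PiLp.norm_apply_le x i) hn
  obtain ⟨h2, h3⟩ := abs_lt.mp h1
  have hN : (0 : ℝ) ≤ N := Nat.cast_nonneg N
  rw [← hx i]
  constructor
  · apply Int.le_floor.mpr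
    push_cast
    nlinarith
  · have : (⌊(N : ℝ) * x i⌋ : ℝ) ≤ ((N * N : ℤ) : ℝ) := by
      push_cast
      exact (Int.floor_le _).trans (by nlinarith)
    exact_mod_cast this

open Classical in
/-- The second quantization of the orthogonal projection of `L²(ℝ³)` onto the span of the
indicator functions of the cubes with index in `cubeIndices N`: in every variable a function is
replaced by its mean value over the cube containing this variable, and by `0` off these cubes. -/
noncomputable def fockProj (N : ℕ) (F : FockConf → ℂ) : FockConf → ℂ
  | ⟨n, k⟩ =>
      if ∀ i, cubeIndex N (k i) ∈ cubeIndices N then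
        ⨍ k' in Set.univ.pi (fun i => cube N (cubeIndex N (k i))), F ⟨n, k'⟩
      else 0

/-- The volume `N⁻³` of a cube. -/
noncomputable def cubeVol (N : ℕ) : ℝ := 1 / (N : ℝ) ^ 3

/-! ### Operators on `𝓕 ⊗ 𝓕`, one factor for each polarization -/

/-- `A ⊗ 1`. -/
def onFst (A : (FockConf → ℂ) → FockConf → ℂ) (F : FockConf × FockConf → ℂ) :
    FockConf × FockConf → ℂ :=
  fun p => A (fun x => F (x, p.2)) p.1

/-- `1 ⊗ A`. -/
def onSnd (A : (FockConf → ℂ) → FockConf → ℂ) (F : FockConf × FockConf → ℂ) :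
    FockConf × FockConf → ℂ :=
  fun p => A (fun x => F (p.1, x)) p.2

/-- The second quantized projection on `𝓕 ⊗ 𝓕`. -/
noncomputable def fieldProj (N : ℕ) (F : FockConf × FockConf → ℂ) : FockConf × FockConf → ℂ :=
  onFst (fockProj N) (onSnd (fockProj N) F)

/-! ### Partition functions of operators with discrete spectrum -/

/-- Let `G` be the graph of an operator `T` in a Hilbert space. `HasHeatTrace G t τ` says that `T`
is symmetric, that in the closed span of the domain of `T` the closure of `T` has an orthonormal
basis of eigenvectors (so that it is self-adjoint there, with pure point spectrum), and that the
trace of `exp (-t T)` in this space, i.e. the sum of `exp (-t λ)` over the eigenvalues with their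
multiplicities, converges to `τ`. -/
def HasHeatTrace {H : Type*} [NormedAddCommGroup H] [InnerProductSpace ℂ H]
    (G : Set (H × H)) (t τ : ℝ) : Prop :=
  (∀ p ∈ G, ∀ p' ∈ G, inner ℂ p.2 p'.1 = inner ℂ p.1 p'.2) ∧
  ∃ (ι : Type) (b : ι → H) (lam : ι → ℝ),
    Orthonormal ℂ b ∧
    (∀ p ∈ G, p.1 ∈ (Submodule.span ℂ (Set.range b)).topologicalClosure) ∧
    (∀ i, (b i, (lam i : ℂ) • b i) ∈ closure G) ∧
    HasSum (fun i => Real.exp (-t * lam i)) τ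

/-! ### The model -/

/-- The constants of the model, and the two fields of polarization vectors, which together with
`k/|k|` form an orthonormal frame. -/
structure OscillatorModel where
  /-- Planck's constant -/
  hbar : ℝ
  /-- the particle mass -/
  m : ℝ
  /-- the frequency of the external harmonic potential -/
  η : ℝ
  /-- the velocity of light -/
  c : ℝ
  /-- the charge of the particle -/
  e : ℝ
  /-- the polarization vectors -/
  u : Fin 2 → E3 → E3
  hbar_pos : 0 < hbar
  m_pos : 0 < m
  η_pos : 0 < η
  c_pos : 0 < c
  u_measurable : ∀ σ, Measurable (u σ)
  u_orthonormal : ∀ k : E3, k ≠ 0 → Orthonormal ℝ ![u 0 k, u 1 k, ‖k‖⁻¹ • k]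

namespace OscillatorModel

variable (S : OscillatorModel)

/-- The photon dispersion relation `ω(k) = c |k|`. -/
noncomputable def ω (k : E3) : ℝ := S.c * ‖k‖

open Classical in
/-- The ultraviolet cutoff `1_{|k| < C}`. -/
noncomputable def cutoff (C : ℝ) (k : E3) : ℝ := if ‖k‖ < C then 1 else 0

/-- The mean value of `ω` over a cube. -/
noncomputable def ωMean (N : ℕ) (z : Fin 3 → ℤ) : ℝ := ⨍ k in cube N z, S.ω k

/-- The mean value over a cube of the vector field `y_σ = χ_C u_σ / √ω`. -/
noncomputable def yMean (C : ℝ) (N : ℕ) (σ : Fin 2) (z : Fin 3 → ℤ) : E3 :=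
  ⨍ k in cube N z, (cutoff C k / Real.sqrt (S.ω k)) • S.u σ k

/-- The mean value of the cutoff function over a cube. -/
noncomputable def cutoffMean (C : ℝ) (N : ℕ) (z : Fin 3 → ℤ) : ℝ := ⨍ k in cube N z, cutoff C k

/-- The (discretized) renormalization terms, as a function of the momentum `q`: mass
renormalization and energy renormalization. -/
noncomputable def renorm (C : ℝ) (N : ℕ) (q : E3) : ℝ :=
  (∑ᶠ z ∈ cubeIndices N, ∑ σ : Fin 2,
    cubeVol N * (S.e ^ 2 / (4 * Real.pi ^ 2 * S.m ^ 2)) *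
      (1 / S.ωMean N z) * (inner ℝ (S.yMean C N σ z) q) ^ 2)
  - ∑ᶠ z ∈ cubeIndices N,
    cubeVol N * S.hbar * (S.e ^ 2 * S.η ^ 2 / (4 * Real.pi ^ 2 * S.m)) *
      (cutoffMean C N z / ((S.ωMean N z) ^ 2 * (S.ωMean N z + S.η)))

/-- The energy of the free field, acting in `𝓕 ⊗ 𝓕`. -/
noncomputable def fieldEnergy (F : FockConf × FockConf → ℂ) : FockConf × FockConf → ℂ :=
  fun p => onFst (dGamma fun k => S.hbar * S.ω k) F p + onSnd (dGamma fun k => S.hbar * S.ω k) F p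

/-- The coupling function `(e/m) χ_C(k) √(ħ / (4π² ω(k))) (q · u_σ(k))`. -/
noncomputable def coupling (C : ℝ) (σ : Fin 2) (q k : E3) : ℝ :=
  S.e / S.m * cutoff C k * Real.sqrt (S.hbar / (4 * Real.pi ^ 2 * S.ω k)) * inner ℝ q (S.u σ k)

/-- The interaction of the particle with the field; at fixed particle momentum `q` it is an
operator in `𝓕 ⊗ 𝓕`. -/
noncomputable def interaction (C : ℝ) (q : E3) (F : FockConf × FockConf → ℂ) :
    FockConf × FockConf → ℂ :=
  fun p =>
    onFst (creation (S.coupling C 0 q)) F p + onFst (annihilation (S.coupling C 0 q)) F p +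
    onSnd (creation (S.coupling C 1 q)) F p + onSnd (annihilation (S.coupling C 1 q)) F p

/-- The energy `-ħ² (m/2) η² Δ_q + q²/(2m)` of the harmonically bound particle, in momentum
representation. -/
noncomputable def particleEnergy (f : E3 → ℂ) (q : E3) : ℂ :=
  -((S.hbar ^ 2 * (S.m / 2) * S.η ^ 2 : ℝ) : ℂ) * (Laplacian.laplacian f : E3 → ℂ) q +
    ((‖q‖ ^ 2 / (2 * S.m) : ℝ) : ℂ) * f q

/-- The Hamiltonian of the particle coupled to the field (with the renormalization terms in
their discretized form), acting on functions on `ℝ³ × FockConf × FockConf`. -/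
noncomputable def hamiltonian (C : ℝ) (N : ℕ) (Ψ : E3 × FockConf × FockConf → ℂ) :
    E3 × FockConf × FockConf → ℂ :=
  fun p =>
    S.particleEnergy (fun q => Ψ (q, p.2)) p.1 +
    (S.renorm C N p.1 : ℂ) * Ψ p +
    S.fieldEnergy (fun x => Ψ (p.1, x)) p.2 +
    S.interaction C p.1 (fun x => Ψ (p.1, x)) p.2

/-- The operator `1 ⊗ 𝐏_N ⊗ 𝐏_N` on functions on `ℝ³ × FockConf × FockConf`. -/
noncomputable def jointProj (N : ℕ) (Ψ : E3 × FockConf × FockConf → ℂ) :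
    E3 × FockConf × FockConf → ℂ :=
  fun p => fieldProj N (fun x => Ψ (p.1, x)) p.2

/-- A core for the projected free field: the algebraic tensor product of two copies of the
projection of the Fock space core. -/
noncomputable def fieldCore (N : ℕ) : Submodule ℂ (FockConf × FockConf → ℂ) :=
  Submodule.span ℂ {Ψ | ∃ F₁ F₂ : FockConf → ℂ, IsFockCore F₁ ∧ IsFockCore F₂ ∧
    Ψ = fun p => fockProj N F₁ p.1 * fockProj N F₂ p.2}

/-- A core for the projected coupled system: the algebraic tensor product of the Schwartz space on
`ℝ³` with two copies of the projection of the Fock space core. -/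
noncomputable def jointCore (N : ℕ) : Submodule ℂ (E3 × FockConf × FockConf → ℂ) :=
  Submodule.span ℂ {Ψ | ∃ (f : SchwartzMap E3 ℂ) (F₁ F₂ : FockConf → ℂ),
    IsFockCore F₁ ∧ IsFockCore F₂ ∧
    Ψ = fun p => f p.1 * (fockProj N F₁ p.2.1 * fockProj N F₂ p.2.2)}

/-- The graph of the discretized free field Hamiltonian `(𝐏_N ⊗ 𝐏_N) H_f (𝐏_N ⊗ 𝐏_N)`, on its
core. -/
noncomputable def fieldGraph (N : ℕ) :
    Set (Lp ℂ 2 (fockMeasure.prod fockMeasure) × Lp ℂ 2 (fockMeasure.prod fockMeasure)) :=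
  {p | ∃ Ψ ∈ fieldCore N,
    p.1 =ᵐ[fockMeasure.prod fockMeasure] Ψ ∧
    p.2 =ᵐ[fockMeasure.prod fockMeasure] fieldProj N (S.fieldEnergy Ψ)}

/-- The graph of the discretized Hamiltonian `(1 ⊗ 𝐏_N ⊗ 𝐏_N) H (1 ⊗ 𝐏_N ⊗ 𝐏_N)` of the coupled
system, on its core. -/
noncomputable def jointGraph (C : ℝ) (N : ℕ) :
    Set (Lp ℂ 2 ((volume : Measure E3).prod (fockMeasure.prod fockMeasure)) ×
      Lp ℂ 2 ((volume : Measure E3).prod (fockMeasure.prod fockMeasure))) :=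
  {p | ∃ Ψ ∈ jointCore N,
    p.1 =ᵐ[(volume : Measure E3).prod (fockMeasure.prod fockMeasure)] Ψ ∧
    p.2 =ᵐ[(volume : Measure E3).prod (fockMeasure.prod fockMeasure)]
      jointProj N (S.hamiltonian C N Ψ)}

/-- `z` is the value `Z(β; γ)` of the cutoff partition function: with the cutoff `C = γ η / c`, the
traces of `exp (-(β/ħ) H_N)` and `exp (-(β/ħ) H_{f,N})` exist for every `N ≥ 1`, and their ratio
converges to `z` as `N → ∞`. -/
def IsCutoffPartitionFunction (β γ z : ℝ) : Prop :=
  ∃ Tr TrF : ℕ → ℝ,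
    (∀ N : ℕ, 1 ≤ N →
      HasHeatTrace (S.jointGraph (γ * S.η / S.c) N) (β / S.hbar) (Tr N) ∧
      HasHeatTrace (S.fieldGraph N) (β / S.hbar) (TrF N)) ∧
    Tendsto (fun N => Tr N / TrF N) atTop (𝓝 z)

end OscillatorModel

/-- The closed form `[(ρ/2π) exp(-2 ρ ln ρ sin φ) |Γ(i ρ exp(-i φ))|²]³`. -/
noncomputable def closedForm (φ ρ : ℝ) : ℝ :=
  (ρ / (2 * Real.pi) * Real.exp (-2 * ρ * Real.log ρ * Real.sin φ) *
    ‖Complex.Gamma (Complex.I * ρ * Complex.exp (-Complex.I * φ))‖ ^ 2) ^ 3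

/-! After discretization only finitely many field modes remain: a symmetric function averaged over
products of cubes depends on the occupation numbers of the cubes alone, so `1 ⊗ 𝐏_N ⊗ 𝐏_N` projects
onto the state space of the particle and two oscillators per cube. In a basis of Hermite functions
times occupation number states the compressed `H_N` is, up to an additive constant, `ħ` times a
quadratic Hamiltonian with frequencies `η` (three times) and `ν_i = ω̄_j`. The mass renormalization
is exactly the term which completes the square, so the potential is `η|X|² + ∑ ν_i (x_i +
g_i(X)/ν_i)²` up to a factor `1/2`. It is positive definite, a linear change of variables decouples
it into normal modes (`exists_normal_form`), and the trace is a product of factors `(2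
sinh(βΩ/2))⁻¹`, where the `Ω²` are the eigenvalues of `freqMatrix` (`hasHeatTrace_of_ladder`).

No normal frequency is ever computed. Euler's product for `sinh` turns the quotient of the traces
into a product over `y_n = 2πn/β`, `n ≥ 1`, of `det(y_n² + A)` divided by its counterpart for the
free field, and elimination of the field block by a Schur complement leaves `3 × 3` determinants
(`tendsto_prod_det_responseMatrix`). Their entries are Riemann sums over the cubes. By the Lebesgue
differentiation theorem and dominated convergence they tend to isotropic integrals, and with `s =
sin φ` the `n`-th determinant tends to the cube of `1 + ρ²/n² + (4/π) s (ρ/n) arctan(γρ/n)`. The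
bound by a multiple of `n⁻²` is uniform in `N`, so limit and product may be exchanged; the energy
renormalization contributes the factor `(1+γ)^(2ρs)` per degree of freedom. This is
`isCutoffPartitionFunction`.

As `γ → ∞` the arctangent tends to `π/2` and the product diverges like the exponential of `2sρ`
times a regularized harmonic series. The identity `(2/π) ∑ n⁻¹ arctan(Λ/n) = ln Λ + γ_E + o(1)`,
with Euler's constant `γ_E`, shows that this divergence is cancelled by the energy renormalization.
What remains is the product of `(1 + 2sρ/n + ρ²/n²) exp(-2sρ/n)`. Since `w = iρ exp(-iφ)` has `|w| =
ρ` and `Re w = sρ`, the first factor is `|w + n|²/n²`, and Euler's limit for the Gamma function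
gives `|Γ(w)|²`.

For the Laplace representation it suffices to treat one of the three equal factors. The functional
`f(ρ) - (2-ρ) f(1) - (ρ-1) f(2)` annihilates affine functions. Applied to the logarithm of the Gamma
limit it leaves logarithms of `|w + j|²`, which are Frullani integrals of `exp(-jt sin φ) cos(jt cos
φ)`; summed over `j` they form a geometric series. Removing the part which cancels `ln ρ` and `ρ ln
ρ` leaves the density `sinh u/(cosh u - cos v) - 2 sin φ/t`, with `u = t sin φ` and `v = t cos φ`.
It is nonnegative, because `2 sin φ/t` is only the contribution of the pole at the origin. Hence the
logarithm of the factor is a Laplace transform of a positive measure plus `A + Bρ`; a growth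
estimate gives `B ≤ 0`, and exponentials of Laplace transforms are Laplace transforms. For `sin φ =
0` the factor is `(2 sinh πρ)⁻¹`, a geometric series. -/

/-! ### Hermite functions as Schwartz functions, and their ladder relations -/

section Hermite
open scoped SchwartzMap LineDeriv

/-- The Gaussian `exp (-‖x‖² / 2)` as a Schwartz function. -/
noncomputable def gaussianSchwartz (E : Type*) [NormedAddCommGroup E] [InnerProductSpace ℝ E] :
    𝓢(E, ℝ) where
  toFun x := Real.exp (-(1 / 2) * ‖x‖ ^ 2)
  smooth' := Real.contDiff_exp.comp (contDiff_const.mul (contDiff_norm_sq ℝ))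
  decay' := by
    intro k n
    have hg : Function.HasTemperateGrowth (fun x : E => -(1 / 2) * ‖x‖ ^ 2) := by
      fun_prop
    obtain ⟨l, C, hC, hb⟩ := hg.norm_iteratedFDeriv_le_uniform n
    -- The chain rule estimate bounds the `n`-th derivative by `n! ((1+C)(1+r)^l)^n exp(-r²/2)` with
    -- `r = ‖x‖`. Together with `r^k` the powers are at most `exp((k+ln) r)`, and `a r - r²/2 ≤
    -- a²/2` gives the constant.
    refine ⟨(n.factorial : ℝ) * (1 + C) ^ n * Real.exp (((k + l * n : ℕ) : ℝ) ^ 2 / 2 ), fun x => ?_⟩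
    have h1 := norm_iteratedFDeriv_comp_le (𝕜 := ℝ) (g := Real.exp)
      (f := fun x : E => -(1 / 2) * ‖x‖ ^ 2) (n := n) (N := ⊤)
      Real.contDiff_exp (contDiff_const.mul (contDiff_norm_sq ℝ)) (by exact_mod_cast le_top) x
      (C := Real.exp (-(1 / 2) * ‖x‖ ^ 2)) (D := (1 + C) * (1 + ‖x‖) ^ l)
      (fun i _ => by
        rw [norm_iteratedFDeriv_eq_norm_iteratedDeriv, iteratedDeriv_eq_iterate, Real.iter_deriv_exp]
        simp)
      (fun i hi hin => by
        have h2 := hb i hin x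
        have h3 : (1 : ℝ) ≤ (1 + ‖x‖) ^ l := one_le_pow₀ (by linarith [norm_nonneg x])
        have h4 : (1 : ℝ) ≤ (1 + C) * (1 + ‖x‖) ^ l := by nlinarith
        refine h2.trans (le_trans ?_ (le_self_pow₀ h4 (by omega)))
        gcongr; linarith)
    have h5 : ‖x‖ ^ k * (1 + ‖x‖) ^ (l * n) ≤ Real.exp ((k + l * n : ℕ) * ‖x‖) := by
      have h6 : 1 + ‖x‖ ≤ Real.exp ‖x‖ := by linarith [Real.add_one_le_exp ‖x‖]
      calc ‖x‖ ^ k * (1 + ‖x‖) ^ (l * n) ≤ (1 + ‖x‖) ^ k * (1 + ‖x‖) ^ (l * n) := by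
            gcongr; linarith
        _ = (1 + ‖x‖) ^ (k + l * n) := (pow_add _ _ _).symm
        _ ≤ Real.exp ‖x‖ ^ (k + l * n) := by gcongr
        _ = _ := by rw [← Real.exp_nat_mul]
    have h7 : ‖x‖ ^ k * (1 + ‖x‖) ^ (l * n) * Real.exp (-(1 / 2) * ‖x‖ ^ 2) ≤
        Real.exp (((k + l * n : ℕ) : ℝ) ^ 2 / 2) := by
      refine (mul_le_mul_of_nonneg_right h5 (Real.exp_pos _).le).trans ?_
      rw [← Real.exp_add]
      refine Real.exp_le_exp.mpr ?_
      nlinarith [sq_nonneg (((k + l * n : ℕ) : ℝ) - ‖x‖)]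
    calc ‖x‖ ^ k * ‖iteratedFDeriv ℝ n (fun x : E => Real.exp (-(1 / 2) * ‖x‖ ^ 2)) x‖
        ≤ ‖x‖ ^ k * ((n.factorial : ℝ) * Real.exp (-(1 / 2) * ‖x‖ ^ 2) *
          ((1 + C) * (1 + ‖x‖) ^ l) ^ n) := by gcongr; exact h1
      _ = (n.factorial : ℝ) * (1 + C) ^ n *
          (‖x‖ ^ k * (1 + ‖x‖) ^ (l * n) * Real.exp (-(1 / 2) * ‖x‖ ^ 2)) := by
          rw [mul_pow, ← pow_mul]; ring
      _ ≤ _ := by gcongr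

theorem gaussianSchwartz_apply {E : Type*} [NormedAddCommGroup E] [InnerProductSpace ℝ E] (x : E) :
    gaussianSchwartz E x = Real.exp (-(1 / 2) * ‖x‖ ^ 2) := rfl

/-- The Hermite functions on the line, normalized in `L²`. -/
noncomputable def hermiteFun : ℕ → ℝ → ℝ
  | 0, x => Real.pi ^ (-(1 / 4) : ℝ) * Real.exp (-(1 / 2) * x ^ 2)
  | 1, x => √2 * x * (Real.pi ^ (-(1 / 4) : ℝ) * Real.exp (-(1 / 2) * x ^ 2))
  | n + 2, x => (√2 * x * hermiteFun (n + 1) x - √((n : ℝ) + 1) * hermiteFun n x) / √((n : ℝ) + 2)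

/-- One recurrence for all `n`: at `n = 0` the index `n - 1` is truncated to `0`, but its
coefficient `√0` vanishes. All lowering relations below rely on this convention. -/
theorem hermiteFun_succ (n : ℕ) (x : ℝ) :
    √((n : ℝ) + 1) * hermiteFun (n + 1) x =
      √2 * x * hermiteFun n x - √(n : ℝ) * hermiteFun (n - 1) x := by
  cases n with
  | zero => simp [hermiteFun]
  | succ n =>
    have h : √((n : ℝ) + 2) ≠ 0 := by positivity
    have h2 : ((n + 1 : ℕ) : ℝ) + 1 = n + 2 := by push_cast; ring
    rw [h2, hermiteFun]
    simp only [Nat.add_sub_cancel]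
    push_cast
    field_simp

/-- The lowering relation `(x + d/dx) hₙ = √(2n) hₙ₋₁`, obtained by differentiating the recurrence
and inserting the relations for the two preceding indices. -/
theorem hasDerivAt_hermiteFun (n : ℕ) (x : ℝ) :
    HasDerivAt (hermiteFun n) (√2 * √(n : ℝ) * hermiteFun (n - 1) x - x * hermiteFun n x) x := by
  have h0 : HasDerivAt (fun x : ℝ => Real.pi ^ (-(1 / 4) : ℝ) * Real.exp (-(1 / 2) * x ^ 2))
      (-x * (Real.pi ^ (-(1 / 4) : ℝ) * Real.exp (-(1 / 2) * x ^ 2))) x := by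
    have := ((((hasDerivAt_pow 2 x).const_mul (-(1 / 2) : ℝ)).exp).const_mul
      (Real.pi ^ (-(1 / 4) : ℝ)))
    convert! this using 1
    norm_num
    ring
  induction n using Nat.strong_induction_on with
  | _ n ih =>
    match n, ih with
    | 0, _ =>
      convert! h0 using 1
      simp [hermiteFun]
    | 1, _ =>
      have := ((hasDerivAt_id x).const_mul √2).mul h0
      convert! this using 1
      simp [hermiteFun]
      ring
    | n + 2, ih =>
      have h1 := ih (n + 1) (by omega)
      have h2 := ih n (by omega)
      have h3 := (((((hasDerivAt_id x).const_mul √2).mul h1).sub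
        (h2.const_mul √((n : ℝ) + 1))).div_const √((n : ℝ) + 2))
      convert! h3 using 1
      have e1 := hermiteFun_succ n x
      have e2 := hermiteFun_succ (n + 1) x
      have hp : √((n : ℝ) + 2) ≠ 0 := by positivity
      have hq : √((n : ℝ) + 2) * √((n : ℝ) + 2) = n + 2 := Real.mul_self_sqrt (by positivity)
      have hr : √((n : ℝ) + 1) * √((n : ℝ) + 1) = n + 1 := Real.mul_self_sqrt (by positivity)
      have e3 : ((n + 1 : ℕ) : ℝ) + 1 = n + 2 := by push_cast; ring
      rw [e3] at e2
      rw [eq_div_iff hp]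
      simp only [Nat.add_sub_cancel, id, show n + 2 - 1 = n + 1 from rfl, show n + 1 + 1 = n + 2 from rfl] at *
      push_cast at *
      linear_combination √2 * hermiteFun (n + 1) x * hq - √2 * hermiteFun (n + 1) x * hr
        - x * e2 + (√2 * √((n : ℝ) + 1)) * e1

variable {ι : Type*} [Fintype ι]

/-- The product Hermite functions on `ℝ^ι`. -/
noncomputable def hermiteProd (α : ι → ℕ) (x : EuclideanSpace ℝ ι) : ℝ :=
  ∏ i, hermiteFun (α i) (x i)

/-- Multiplication of Schwartz functions by the coordinate `x i`. -/
noncomputable def mulCoord (i : ι) :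
    𝓢(EuclideanSpace ℝ ι, ℂ) →L[ℂ] 𝓢(EuclideanSpace ℝ ι, ℂ) :=
  SchwartzMap.smulLeftCLM ℂ (fun x : EuclideanSpace ℝ ι => ((x i : ℝ) : ℂ))

theorem mulCoord_apply (i : ι) (f : 𝓢(EuclideanSpace ℝ ι, ℂ)) (x : EuclideanSpace ℝ ι) :
    mulCoord i f x = (x i : ℂ) * f x := by
  have h : Function.HasTemperateGrowth (fun x : EuclideanSpace ℝ ι => ((x i : ℝ) : ℂ)) := by
    have : (fun x : EuclideanSpace ℝ ι => ((x i : ℝ) : ℂ)) =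
      (Complex.ofRealCLM ∘L (EuclideanSpace.proj i : EuclideanSpace ℝ ι →L[ℝ] ℝ)) := by
        ext; simp
    rw [this]
    exact ContinuousLinearMap.hasTemperateGrowth _
  rw [mulCoord, SchwartzMap.smulLeftCLM_apply_apply h, smul_eq_mul]

variable [DecidableEq ι]

theorem mul_hermiteProd (α : ι → ℕ) (i : ι) (x : EuclideanSpace ℝ ι) :
    √((α i : ℝ) + 1) * hermiteProd (α + Pi.single i 1) x =
      √2 * x i * hermiteProd α x - √(α i : ℝ) * hermiteProd (α - Pi.single i 1) x := by
  have key : ∀ β : ι → ℕ, (∀ j ≠ i, β j = α j) → hermiteProd β x =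
      hermiteFun (β i) (x i) * ∏ j ∈ Finset.univ.erase i, hermiteFun (α j) (x j) := by
    intro β hβ
    rw [hermiteProd, ← Finset.mul_prod_erase _ _ (Finset.mem_univ i)]
    congr 1
    exact Finset.prod_congr rfl fun j hj => by rw [hβ j (Finset.ne_of_mem_erase hj)]
  rw [key α (fun _ _ => rfl), key (α + Pi.single i 1) (fun j hj => by simp [hj]),
    key (α - Pi.single i 1) (fun j hj => by simp [hj])]
  have := hermiteFun_succ (α i) (x i)
  simp only [Pi.add_apply, Pi.sub_apply, Pi.single_eq_same]
  linear_combination (∏ j ∈ Finset.univ.erase i, hermiteFun (α j) (x j)) * this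

theorem hasLineDerivAt_hermiteProd (α : ι → ℕ) (i : ι) (x : EuclideanSpace ℝ ι) :
    HasLineDerivAt ℝ (hermiteProd α)
      (√2 * √(α i : ℝ) * hermiteProd (α - Pi.single i 1) x - x i * hermiteProd α x) x
      (EuclideanSpace.single i (1 : ℝ)) := by
  have key : ∀ β : ι → ℕ, (∀ j ≠ i, β j = α j) → ∀ t : ℝ,
      hermiteProd β (x + t • EuclideanSpace.single i (1 : ℝ)) =
      hermiteFun (β i) (x i + t) * ∏ j ∈ Finset.univ.erase i, hermiteFun (α j) (x j) := by
    intro β hβ t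
    rw [hermiteProd, ← Finset.mul_prod_erase _ _ (Finset.mem_univ i)]
    congr 1
    · simp
    · refine Finset.prod_congr rfl fun j hj => ?_
      rw [hβ j (Finset.ne_of_mem_erase hj)]
      simp [Finset.ne_of_mem_erase hj]
  rw [HasLineDerivAt]
  have e0 := key α (fun _ _ => rfl)
  have e1 := key α (fun _ _ => rfl) 0
  have e2 := key (α - Pi.single i 1) (fun j hj => by simp [hj]) 0
  simp only [zero_smul, add_zero] at e1 e2
  simp_rw [e0, e1, e2]
  have h := (hasDerivAt_hermiteFun (α i) (x i + 0)).comp_const_add (x i) 0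
  have h2 := h.mul_const (∏ j ∈ Finset.univ.erase i, hermiteFun (α j) (x j))
  convert! h2 using 1
  simp only [Pi.sub_apply, Pi.single_eq_same, add_zero]
  ring

/-- Induction on the total degree: degree zero is a Gaussian, and the recurrence in one coordinate
expresses a higher product through products of lower degree, using only multiplication by a
coordinate, which preserves the Schwartz space. -/
theorem exists_schwartz_hermiteProd (α : ι → ℕ) :
    ∃ f : 𝓢(EuclideanSpace ℝ ι, ℂ), ∀ x, f x = hermiteProd α x := by
  induction hn : ∑ i, α i using Nat.strong_induction_on generalizing α with
  | _ n ih =>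
    by_cases h0 : ∀ i, α i = 0
    · refine ⟨((Real.pi ^ (-(1 / 4) : ℝ)) ^ (Fintype.card ι) : ℝ) •
        SchwartzMap.postcompCLM Complex.ofRealCLM (gaussianSchwartz (EuclideanSpace ℝ ι)), ?_⟩
      intro x
      have : hermiteProd α x = (Real.pi ^ (-(1 / 4) : ℝ)) ^ (Fintype.card ι) *
          Real.exp (-(1 / 2) * ‖x‖ ^ 2) := by
        simp only [hermiteProd, h0, hermiteFun, Finset.prod_mul_distrib, Finset.prod_const,
          Finset.card_univ, ← Real.exp_sum, ← Finset.mul_sum]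
        rw [EuclideanSpace.norm_sq_eq]
        simp
      rw [this]
      simp [gaussianSchwartz_apply, SchwartzMap.postcompCLM_apply]
    · push Not at h0
      obtain ⟨i, hi⟩ := h0
      set β := α - Pi.single i 1 with hβ
      have hα : α = β + Pi.single i 1 := by
        ext j
        by_cases hj : j = i
        · subst hj; simp [hβ]; omega
        · simp [hβ, hj]
      have hs : ∑ j, α j = ∑ j, β j + 1 := by
        rw [hα]
        simp [Finset.sum_add_distrib]
      have hle : ∑ j, (β - Pi.single i 1 : ι → ℕ) j ≤ ∑ j, β j :=
        Finset.sum_le_sum fun j _ => by simp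
      obtain ⟨f, hf⟩ := ih _ (by omega) β rfl
      obtain ⟨g, hg⟩ := ih _ (by omega) (β - Pi.single i 1) rfl
      refine ⟨(1 / √((β i : ℝ) + 1)) • ((√2 : ℝ) • mulCoord i f - (√(β i : ℝ)) • g), fun x => ?_⟩
      have h1 := mul_hermiteProd β i x
      rw [← hα] at h1
      have h2 : √((β i : ℝ) + 1) ≠ 0 := by positivity
      have h3 : hermiteProd α x = (1 / √((β i : ℝ) + 1)) *
        (√2 * x i * hermiteProd β x - √(β i : ℝ) * hermiteProd (β - Pi.single i 1) x) := by
        rw [← h1]; field_simp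
      rw [h3]
      simp [mulCoord_apply, hf, hg, mul_assoc]

/-- The Hermite functions on `ℝ^ι` as Schwartz functions. -/
noncomputable def hermiteS (α : ι → ℕ) : 𝓢(EuclideanSpace ℝ ι, ℂ) :=
  (exists_schwartz_hermiteProd α).choose

theorem hermiteS_apply (α : ι → ℕ) (x : EuclideanSpace ℝ ι) :
    hermiteS α x = hermiteProd α x := (exists_schwartz_hermiteProd α).choose_spec x

/-- The action of a coordinate on a family indexed by multi-indices which transforms like the
Hermite functions. -/
noncomputable def ladderX {M : Type*} [AddCommGroup M] [Module ℂ M] (v : (ι → ℕ) → M) (i : ι)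
    (α : ι → ℕ) : M :=
  ((1 / √2 : ℝ) : ℂ) • (((√((α i : ℝ) + 1) : ℝ) : ℂ) • v (α + Pi.single i 1) +
    ((√(α i : ℝ) : ℝ) : ℂ) • v (α - Pi.single i 1))

theorem mulCoord_hermiteS (α : ι → ℕ) (i : ι) :
    mulCoord i (hermiteS α) = ladderX hermiteS i α := by
  ext x
  have h := mul_hermiteProd α i x
  have h2 : x i * hermiteProd α x = (1 / √2) * (√((α i : ℝ) + 1) * hermiteProd (α + Pi.single i 1) x
    + √(α i : ℝ) * hermiteProd (α - Pi.single i 1) x) := by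
    rw [h]; field_simp; ring
  simp only [mulCoord_apply, hermiteS_apply, ladderX, smul_apply, add_apply, smul_eq_mul]
  rw [← Complex.ofReal_mul, h2]
  push_cast
  ring

theorem lineDeriv_hermiteS (α : ι → ℕ) (i : ι) :
    ∂_{EuclideanSpace.single i (1 : ℝ)} (hermiteS α) =
      ((√2 * √(α i : ℝ) : ℝ) : ℂ) • hermiteS (α - Pi.single i 1) - mulCoord i (hermiteS α) := by
  ext x
  rw [SchwartzMap.lineDerivOp_apply]
  have h1 := hasLineDerivAt_hermiteProd α i x
  have h2 : HasLineDerivAt ℝ (hermiteS α) (((√2 * √(α i : ℝ) * hermiteProd (α - Pi.single i 1) x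
      - x i * hermiteProd α x : ℝ)) : ℂ) x (EuclideanSpace.single i (1 : ℝ)) := by
    have : (hermiteS α : EuclideanSpace ℝ ι → ℂ) = fun x => (hermiteProd α x : ℂ) :=
      funext fun x => hermiteS_apply α x
    rw [this]
    exact HasDerivAt.ofReal_comp (f := fun t : ℝ => hermiteProd α (x + t • _)) h1
  rw [h2.lineDeriv]
  simp [mulCoord_apply, hermiteS_apply]

end Hermite

/-! ### Oscillator eigenvalues and orthonormality of the Hermite functions -/

section HermiteL2
open scoped SchwartzMap LineDeriv ComplexConjugate

/-- The class of a Schwartz function in `L²`. -/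
noncomputable def toL2 {ι : Type*} [Fintype ι] :
    𝓢(EuclideanSpace ℝ ι, ℂ) →L[ℂ] Lp ℂ 2 (volume : Measure (EuclideanSpace ℝ ι)) :=
  SchwartzMap.toLpCLM ℂ ℂ 2 volume

theorem inner_toL2 {ι : Type*} [Fintype ι] (f g : 𝓢(EuclideanSpace ℝ ι, ℂ)) :
    inner ℂ (toL2 f) (toL2 g) = ∫ x, conj (f x) * g x := by
  simp only [toL2, SchwartzMap.toLpCLM_apply, SchwartzMap.inner_toL2_toL2_eq]
  simp [RCLike.inner_apply, mul_comm]

theorem inner_mulCoord {ι : Type*} [Fintype ι] (i : ι) (f g : 𝓢(EuclideanSpace ℝ ι, ℂ)) :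
    inner ℂ (toL2 (mulCoord i f)) (toL2 g) = inner ℂ (toL2 f) (toL2 (mulCoord i g)) := by
  simp only [inner_toL2]
  refine integral_congr_ae (Eventually.of_forall fun x => ?_)
  simp [mulCoord_apply]
  ring

theorem inner_lineDeriv {ι : Type*} [Fintype ι] (v : EuclideanSpace ℝ ι)
    (f g : 𝓢(EuclideanSpace ℝ ι, ℂ)) :
    inner ℂ (toL2 (∂_{v} f)) (toL2 g) = - inner ℂ (toL2 f) (toL2 (∂_{v} g)) := by
  simp only [inner_toL2]
  have := SchwartzMap.integral_bilinear_lineDerivOp_right_eq_neg_left (μ := volume) f g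
    ((ContinuousLinearMap.mul ℝ ℂ).comp (Complex.conjCLE : ℂ →L[ℝ] ℂ)) v
  simp only [ContinuousLinearMap.comp_apply, ContinuousLinearEquiv.coe_coe,
    Complex.conjCLE_apply, ContinuousLinearMap.mul_apply'] at this
  rw [this, neg_neg]

theorem multiIndex_add_sub {ι : Type*} [DecidableEq ι] (α : ι → ℕ) (i : ι) : α + Pi.single i 1 - Pi.single i 1 = α := by
  ext j; simp

theorem multiIndex_sub_add {ι : Type*} [DecidableEq ι] {α : ι → ℕ} {i : ι} (h : α i ≠ 0) :
    α - Pi.single i 1 + Pi.single i 1 = α := by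
  ext j
  by_cases hj : j = i
  · subst hj; simp; omega
  · simp [hj]

theorem hermiteProd_zero {ι : Type*} [Fintype ι] (x : EuclideanSpace ℝ ι) :
    hermiteProd (0 : ι → ℕ) x = (Real.pi ^ (-(1 / 4) : ℝ)) ^ (Fintype.card ι) *
          Real.exp (-(1 / 2) * ‖x‖ ^ 2) := by
  simp only [hermiteProd, hermiteFun, Finset.prod_mul_distrib, Finset.prod_const,
          Finset.card_univ, ← Real.exp_sum, ← Finset.mul_sum]
  rw [EuclideanSpace.norm_sq_eq]
  simp

variable {ι : Type*} [Fintype ι] [DecidableEq ι]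

/-- The energy of the oscillator in the coordinate `i`. -/
noncomputable def oscEnergy (i : ι) (f : 𝓢(EuclideanSpace ℝ ι, ℂ)) : 𝓢(EuclideanSpace ℝ ι, ℂ) :=
  (1 / 2 : ℂ) • (mulCoord i (mulCoord i f) -
    ∂_{EuclideanSpace.single i (1 : ℝ)} (∂_{EuclideanSpace.single i (1 : ℝ)} f))

theorem inner_oscEnergy (i : ι) (f g : 𝓢(EuclideanSpace ℝ ι, ℂ)) :
    inner ℂ (toL2 (oscEnergy i f)) (toL2 g) = inner ℂ (toL2 f) (toL2 (oscEnergy i g)) := by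
  simp only [oscEnergy, map_smul, map_sub, inner_smul_left, inner_smul_right, inner_sub_left,
    inner_sub_right, inner_mulCoord, inner_lineDeriv]
  simp [Complex.conj_ofNat]

theorem lineDeriv_hermiteS' (α : ι → ℕ) (i : ι) :
    ∂_{EuclideanSpace.single i (1 : ℝ)} (hermiteS α) =
      ((1 / √2 : ℝ) : ℂ) • (((√(α i : ℝ) : ℝ) : ℂ) • hermiteS (α - Pi.single i 1) -
      ((√((α i : ℝ) + 1) : ℝ) : ℂ) • hermiteS (α + Pi.single i 1)) := by
  rw [lineDeriv_hermiteS, mulCoord_hermiteS, ladderX, smul_add, smul_sub, ← sub_sub, sub_right_comm,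
    smul_smul, smul_smul, ← sub_smul]
  congr 2
  have : (√2 : ℝ) * √2 = 2 := Real.mul_self_sqrt (by norm_num)
  have h2 : √2 * √(α i : ℝ) - 1 / √2 * √(α i : ℝ) = 1 / √2 * √(α i : ℝ) := by
    field_simp
    linear_combination √(α i : ℝ) * this
  exact_mod_cast h2

/-- Coordinate and derivative are the sum and the difference of the same two ladder terms. In `x² -
∂²` the shifts by two quanta therefore cancel and only the diagonal terms survive. -/
theorem oscEnergy_hermiteS (α : ι → ℕ) (i : ι) :
    oscEnergy i (hermiteS α) = ((α i : ℂ) + 1 / 2) • hermiteS α := by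
  have hs : (√2 : ℝ) * √2 = 2 := Real.mul_self_sqrt (by norm_num)
  have hp : √((α i : ℝ) + 1) * √((α i : ℝ) + 1) = α i + 1 := Real.mul_self_sqrt (by positivity)
  have hm : √((α i : ℝ)) * √((α i : ℝ)) = α i := Real.mul_self_sqrt (by positivity)
  set c : ℂ := ((1 / √2 : ℝ) : ℂ) with hc
  have hcc : c * c = 1 / 2 := by
    rw [hc, ← Complex.ofReal_mul]
    have : 1 / √2 * (1 / √2) = 1 / 2 := by field_simp; linarith
    rw [this]; norm_num
  have h2 : ∀ (β : ι → ℕ), mulCoord i (hermiteS β) = ladderX hermiteS i β :=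
    fun β => mulCoord_hermiteS β i
  have hd := fun β => lineDeriv_hermiteS' (ι := ι) β i
  have hdz : ∀ f : 𝓢(EuclideanSpace ℝ ι, ℂ), ∂_{EuclideanSpace.single i (1 : ℝ)} f =
    LineDeriv.lineDerivOpCLM ℂ 𝓢(EuclideanSpace ℝ ι, ℂ) (EuclideanSpace.single i (1 : ℝ)) f := fun f => rfl
  -- Lowering followed by raising returns to `α` except when `α i = 0`, where truncated subtraction
  -- would produce `α + eᵢ`; the coefficient `√(α i)` removes that case.
  have key : ((√(α i : ℝ) : ℝ) : ℂ) • hermiteS (α - Pi.single i 1 + Pi.single i 1) =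
      ((√(α i : ℝ) : ℝ) : ℂ) • hermiteS α := by
    by_cases h : α i = 0
    · simp [h]
    · rw [multiIndex_sub_add h]
  have key2 : √(((α - Pi.single i 1 : ι → ℕ) i : ℝ) + 1) * √(α i : ℝ) = α i := by
    by_cases h : α i = 0
    · simp [h]
    · have : ((α - Pi.single i 1 : ι → ℕ) i : ℝ) + 1 = α i := by
        simp only [Pi.sub_apply, Pi.single_eq_same]
        have : 1 ≤ α i := by omega
        push_cast [this]; ring
      rw [this, hm]
  rw [oscEnergy, h2, hd]
  simp only [ladderX, hdz, map_smul, map_add, map_sub]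
  simp only [← hdz, hd, h2, ladderX, multiIndex_add_sub]
  simp only [← hc, smul_add, smul_sub, smul_smul, Pi.add_apply, Pi.single_eq_same]
  push_cast
  have hpC : (((√((α i : ℝ) + 1) : ℝ) : ℂ)) * ((√((α i : ℝ) + 1) : ℝ) : ℂ) = α i + 1 := by
    exact_mod_cast hp
  have key2C : (((√(((α - Pi.single i 1 : ι → ℕ) i : ℝ) + 1) : ℝ) : ℂ)) * ((√(α i : ℝ) : ℝ) : ℂ)
    = α i := by exact_mod_cast key2
  have key3 : ∀ z : ℂ, (z * ((√(((α - Pi.single i 1 : ι → ℕ) i : ℝ) + 1) : ℝ) : ℂ) * ((√(α i : ℝ) : ℝ) : ℂ)) •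
     hermiteS (α - Pi.single i 1 + Pi.single i 1) = (z * α i) • hermiteS α := by
    intro z
    by_cases h : α i = 0
    · simp [h]
    · rw [multiIndex_sub_add h, mul_assoc, key2C]
  set A := ((√((α i : ℝ) + 1) : ℝ) : ℂ)
  set B := ((√(α i : ℝ) : ℝ) : ℂ)
  set D := ((√(((α - Pi.single i 1 : ι → ℕ) i : ℝ) + 1) : ℝ) : ℂ)
  have e1 : (1 / 2 * (c * (B * (c * D)))) • hermiteS (α - Pi.single i 1 + Pi.single i 1) =
      (1 / 4 * (α i : ℂ)) • hermiteS α := by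
    have := key3 (1 / 2 * (c * c))
    rw [hcc] at this
    convert this using 2
    · linear_combination (1 / 2 * B * D) * hcc
    · ring
  have e2 : (1 / 2 * (c * (A * (c * A)))) = (1 / 4 * ((α i : ℂ) + 1)) := by
    linear_combination (1 / 2 * A * A) * hcc + 1 / 4 * hpC
  rw [e1, e2]
  module

theorem raise_hermiteS (α : ι → ℕ) (i : ι) :
    mulCoord i (hermiteS α) - ∂_{EuclideanSpace.single i (1 : ℝ)} (hermiteS α) =
      ((√2 * √((α i : ℝ) + 1) : ℝ) : ℂ) • hermiteS (α + Pi.single i 1) := by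
  rw [lineDeriv_hermiteS', mulCoord_hermiteS, ladderX]
  have hs : (√2 : ℝ) * √2 = 2 := Real.mul_self_sqrt (by norm_num)
  have : ((√2 * √((α i : ℝ) + 1) : ℝ) : ℂ) = 2 * (((1 / √2 : ℝ) : ℂ)) * ((√((α i : ℝ) + 1) : ℝ) : ℂ) := by
    have : √2 * √((α i : ℝ) + 1) = 2 * (1 / √2) * √((α i : ℝ) + 1) := by
      field_simp; linarith
    exact_mod_cast this
  rw [this]
  module

theorem lower_hermiteS (α : ι → ℕ) (i : ι) :
    mulCoord i (hermiteS α) + ∂_{EuclideanSpace.single i (1 : ℝ)} (hermiteS α) =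
      ((√2 * √(α i : ℝ) : ℝ) : ℂ) • hermiteS (α - Pi.single i 1) := by
  rw [lineDeriv_hermiteS]
  abel

theorem inner_hermiteS_zero :
    inner ℂ (toL2 (hermiteS (0 : ι → ℕ))) (toL2 (hermiteS (0 : ι → ℕ))) = (1 : ℂ) := by
  rw [inner_toL2]
  have h : ∀ x : EuclideanSpace ℝ ι, conj (hermiteS (0 : ι → ℕ) x) * hermiteS (0 : ι → ℕ) x =
      (((Real.pi ^ (-(1 / 4) : ℝ)) ^ (Fintype.card ι) * (Real.pi ^ (-(1 / 4) : ℝ)) ^ (Fintype.card ι)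
        * Real.exp (-1 * ‖x‖ ^ 2) : ℝ) : ℂ) := by
    intro x
    rw [hermiteS_apply, hermiteProd_zero, Complex.conj_ofReal, ← Complex.ofReal_mul]
    congr 1
    have : Real.exp (-1 * ‖x‖ ^ 2) = Real.exp (-(1 / 2) * ‖x‖ ^ 2) * Real.exp (-(1 / 2) * ‖x‖ ^ 2) := by
      rw [← Real.exp_add]; ring_nf
    rw [this]; ring
  simp_rw [h]
  rw [integral_complex_ofReal, integral_const_mul, GaussianFourier.integral_rexp_neg_mul_sq_norm one_pos]
  rw [finrank_euclideanSpace, ← mul_pow, ← Real.rpow_add Real.pi_pos, ← Real.rpow_natCast,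
    ← Real.rpow_mul Real.pi_pos.le, div_one, ← Real.rpow_add Real.pi_pos]
  have : (-(1 / 4) + -(1 / 4) : ℝ) * (Fintype.card ι : ℝ) + (Fintype.card ι : ℝ) / 2 = 0 := by ring
  rw [this]; simp

/-- The operators `x - ∂` and `x + ∂` are adjoint to each other by partial integration; on Hermite
functions they raise and lower. -/
theorem inner_raise_hermiteS (α : ι → ℕ) (i : ι) (β : ι → ℕ) :
    (√((α i : ℝ) + 1) : ℂ) * inner ℂ (toL2 (hermiteS (α + Pi.single i 1))) (toL2 (hermiteS β)) =
      (√(β i : ℝ) : ℂ) * inner ℂ (toL2 (hermiteS α)) (toL2 (hermiteS (β - Pi.single i 1))) := by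
  have h : inner ℂ (toL2 (mulCoord i (hermiteS α) - ∂_{EuclideanSpace.single i (1 : ℝ)} (hermiteS α)))
      (toL2 (hermiteS β)) = inner ℂ (toL2 (hermiteS α))
      (toL2 (mulCoord i (hermiteS β) + ∂_{EuclideanSpace.single i (1 : ℝ)} (hermiteS β))) := by
    simp only [map_sub, map_add, inner_sub_left, inner_add_right, inner_mulCoord, inner_lineDeriv]
    ring
  rw [raise_hermiteS, lower_hermiteS, map_smul, map_smul, inner_smul_left, inner_smul_right] at h
  have h2 : ((√2 : ℝ) : ℂ) ≠ 0 := by simp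
  rw [Complex.conj_ofReal] at h
  push_cast at h ⊢
  apply mul_left_cancel₀ h2
  linear_combination h

/-- Induction on the total degree of `α`: adjointness removes one quanta from both sides, until
either the left side is the Gaussian or the right side has no quantum in that coordinate and the
product vanishes. -/
theorem inner_hermiteS (α β : ι → ℕ) :
    inner ℂ (toL2 (hermiteS α)) (toL2 (hermiteS β)) = if α = β then (1 : ℂ) else 0 := by
  induction hn : ∑ i, α i using Nat.strong_induction_on generalizing α β with
  | _ n ih =>
    have hne : ∀ (γ : ι → ℕ) (i : ι), ((√((γ i : ℝ) + 1) : ℝ) : ℂ) ≠ 0 := fun γ i => by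
      have : √((γ i : ℝ) + 1) ≠ 0 := by positivity
      exact_mod_cast this
    by_cases h0 : α = 0
    · subst h0
      by_cases h1 : β = 0
      · subst h1; rw [if_pos rfl, inner_hermiteS_zero]
      · obtain ⟨i, hi⟩ := Function.ne_iff.mp h1
        have := inner_raise_hermiteS (β - Pi.single i 1) i 0
        rw [multiIndex_sub_add hi] at this
        simp only [Pi.zero_apply, Nat.cast_zero, Real.sqrt_zero, Complex.ofReal_zero, zero_mul,
          mul_eq_zero] at this
        have h2 := this.resolve_left (hne _ i)
        rw [if_neg (Ne.symm h1), ← inner_conj_symm, h2, map_zero]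
    · obtain ⟨i, hi⟩ := Function.ne_iff.mp h0
      have h := inner_raise_hermiteS (α - Pi.single i 1) i β
      rw [multiIndex_sub_add hi] at h
      have hsum : ∑ j, α j = ∑ j, (α - Pi.single i 1 : ι → ℕ) j + 1 := by
        conv_lhs => rw [← multiIndex_sub_add hi]
        simp [Finset.sum_add_distrib]
      rw [ih _ (by omega) _ (β - Pi.single i 1) rfl] at h
      by_cases hb : β i = 0
      · rw [if_neg (by rintro rfl; exact hi hb)]
        simp only [hb, Nat.cast_zero, Real.sqrt_zero, Complex.ofReal_zero, zero_mul, mul_eq_zero] at h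
        exact h.resolve_left (hne _ i)
      · by_cases hab : α = β
        · subst hab
          have h2 : ((α - Pi.single i 1 : ι → ℕ) i : ℝ) + 1 = α i := by
            simp only [Pi.sub_apply, Pi.single_eq_same]
            have : 1 ≤ α i := by omega
            push_cast [this]; ring
          have h3 := hne (α - Pi.single i 1) i
          rw [h2] at h h3
          simp only [if_true, mul_one] at h ⊢
          exact mul_left_cancel₀ h3 (by rw [h, mul_one])
        · rw [if_neg hab]
          rw [if_neg (fun h' => hab (by
            rw [← multiIndex_sub_add hi, ← multiIndex_sub_add hb, h'])), mul_zero] at h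
          exact (mul_eq_zero.mp h).resolve_left (hne _ i)

theorem orthonormal_hermiteS : Orthonormal ℂ fun α : ι → ℕ => toL2 (hermiteS α) := by
  rw [orthonormal_iff_ite]
  exact inner_hermiteS

end HermiteL2

/-! ### Completeness of the Hermite functions in `L²` -/

section Totality
open scoped SchwartzMap LineDeriv ComplexConjugate FourierTransform

variable {ι : Type*} [Fintype ι]

/-- An integrable function whose Fourier transform vanishes is zero almost everywhere. -/
theorem ae_eq_zero_of_fourier_eq_zero {G : EuclideanSpace ℝ ι → ℂ} (hG : Integrable G)
    (h : ∀ ξ, 𝓕 G ξ = 0) : G =ᵐ[volume] 0 := by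
  refine ae_eq_zero_of_integral_contDiff_smul_eq_zero hG.locallyIntegrable fun g hg hc => ?_
  have hg' : ContDiff ℝ (⊤ : ℕ∞) (fun x => (g x : ℂ)) := Complex.ofRealCLM.contDiff.comp hg
  have hc' : HasCompactSupport (fun x => (g x : ℂ)) := hc.comp_left (g := Complex.ofReal) rfl
  set φ : 𝓢(EuclideanSpace ℝ ι, ℂ) := hc'.toSchwartzMap hg' with hφ
  -- Every test function is the Fourier transform of a Schwartz function, so its pairing with `G`
  -- can be moved onto the transform of `G`, which is zero.
  have h1 : ∫ ξ, 𝓕 (𝓕⁻ φ : 𝓢(EuclideanSpace ℝ ι, ℂ)) ξ • G ξ =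
      ∫ x, (𝓕⁻ φ : 𝓢(EuclideanSpace ℝ ι, ℂ)) x • 𝓕 G x := by
    have h0 := VectorFourier.integral_fourierIntegral_smul_eq_flip (L := innerₗ _)
      Real.continuous_fourierChar continuous_inner
      (SchwartzMap.integrable (μ := volume) (𝓕⁻ φ : 𝓢(EuclideanSpace ℝ ι, ℂ))) hG
    rw [flip_innerₗ] at h0
    exact h0
  rw [FourierTransform.fourier_fourierInv_eq] at h1
  simp only [h, smul_zero, integral_zero] at h1
  rw [← h1]
  refine integral_congr_ae (Eventually.of_forall fun x => ?_)
  simp [hφ]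

/-- Completing the square bounds `a r - b r²` by `a²/(2b) - (b/2) r²`, which leaves half of the
Gaussian decay. -/
theorem integrable_exp_mul_gaussian (a b : ℝ) (hb : 0 < b) :
    Integrable fun x : EuclideanSpace ℝ ι => Real.exp (a * ‖x‖ - b * ‖x‖ ^ 2) := by
  have h1 : Integrable fun x : EuclideanSpace ℝ ι => Real.exp (-(b / 2) * ‖x‖ ^ 2) := by
    have := GaussianFourier.integrable_cexp_neg_mul_sq_norm_add (V := EuclideanSpace ℝ ι)
      (b := ((b / 2 : ℝ) : ℂ)) (by rw [Complex.ofReal_re]; linarith) 0 0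
    have h2 := this.norm
    refine h2.congr (Eventually.of_forall fun x => ?_)
    have e : -((b / 2 : ℝ) : ℂ) * (‖x‖ : ℂ) ^ 2 + 0 * ((inner ℝ (0 : EuclideanSpace ℝ ι) x : ℝ) : ℂ) =
        ((-(b / 2) * ‖x‖ ^ 2 : ℝ) : ℂ) := by push_cast; ring
    simp only [e]
    rw [← Complex.ofReal_exp, Complex.norm_real, Real.norm_of_nonneg (Real.exp_pos _).le]
  refine (h1.const_mul (Real.exp (a ^ 2 / (2 * b)))).mono' (by fun_prop) (Eventually.of_forall fun x => ?_)
  rw [Real.norm_of_nonneg (Real.exp_pos _).le, ← Real.exp_add]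
  refine Real.exp_le_exp.mpr ?_
  have h3 : a ^ 2 / (2 * b) + -(b / 2) * ‖x‖ ^ 2 - (a * ‖x‖ - b * ‖x‖ ^ 2) = (a - b * ‖x‖) ^ 2 / (2 * b) := by
    field_simp; ring
  have h4 : 0 ≤ (a - b * ‖x‖) ^ 2 / (2 * b) := by positivity
  linarith

/-- Multiplication of Schwartz functions by a linear functional. -/
noncomputable def mulInner (ξ : EuclideanSpace ℝ ι) (f : 𝓢(EuclideanSpace ℝ ι, ℂ)) :
    𝓢(EuclideanSpace ℝ ι, ℂ) := ∑ i, (ξ i : ℂ) • mulCoord i f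

theorem mulInner_apply (ξ : EuclideanSpace ℝ ι) (f : 𝓢(EuclideanSpace ℝ ι, ℂ))
    (x : EuclideanSpace ℝ ι) : mulInner ξ f x = (inner ℝ x ξ : ℝ) * f x := by
  simp [mulInner, sum_apply, smul_apply, mulCoord_apply, PiLp.inner_apply, Finset.sum_mul, mul_assoc]

variable [DecidableEq ι]

theorem mulInner_mem_span (ξ : EuclideanSpace ℝ ι) {f : 𝓢(EuclideanSpace ℝ ι, ℂ)}
    (hf : f ∈ Submodule.span ℂ (Set.range (hermiteS (ι := ι)))) :
    mulInner ξ f ∈ Submodule.span ℂ (Set.range (hermiteS (ι := ι))) := by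
  refine Submodule.sum_mem _ fun i _ => Submodule.smul_mem _ _ ?_
  have : Submodule.span ℂ (Set.range (hermiteS (ι := ι))) ≤
      (Submodule.span ℂ (Set.range (hermiteS (ι := ι)))).comap
        (mulCoord i : 𝓢(EuclideanSpace ℝ ι, ℂ) →L[ℂ] 𝓢(EuclideanSpace ℝ ι, ℂ)).toLinearMap := by
    rw [Submodule.span_le]
    rintro _ ⟨α, rfl⟩
    simp only [Submodule.comap_coe, Set.mem_preimage, ContinuousLinearMap.coe_coe, SetLike.mem_coe]
    rw [mulCoord_hermiteS, ladderX]
    exact Submodule.smul_mem _ _ (Submodule.add_mem _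
      (Submodule.smul_mem _ _ (Submodule.subset_span ⟨_, rfl⟩))
      (Submodule.smul_mem _ _ (Submodule.subset_span ⟨_, rfl⟩)))
  exact this hf

/-- The span of the Hermite functions is stable under multiplication by linear functionals, so all
moments `⟨x,ξ⟩^k` of the Gaussian times `g` vanish. The Fourier transform of this product is the
series of these moments; the interchange is dominated by `exp(2π‖ξ‖‖x‖)` times the Gaussian times
`|g|`, a product of two functions in `L²`. Hence the transform is zero, and a Gaussian has no zeros.
-/
theorem hermiteS_total {g : EuclideanSpace ℝ ι → ℂ} (hg : MemLp g 2)
    (h : ∀ α : ι → ℕ, ∫ x, hermiteS α x * g x = 0) : g =ᵐ[volume] 0 := by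
  have hint : ∀ f : 𝓢(EuclideanSpace ℝ ι, ℂ), Integrable fun x => f x * g x := fun f =>
    (f.memLp 2).integrable_mul hg
  have hspan : ∀ f ∈ Submodule.span ℂ (Set.range (hermiteS (ι := ι))), ∫ x, f x * g x = 0 := by
    intro f hf
    induction hf using Submodule.span_induction with
    | mem f hf => obtain ⟨α, rfl⟩ := hf; exact h α
    | zero => simp
    | add f₁ f₂ _ _ h₁ h₂ =>
      simp only [add_apply, add_mul]
      rw [integral_add (hint f₁) (hint f₂), h₁, h₂, add_zero]
    | smul c f _ hf =>
      simp only [smul_apply, smul_eq_mul, mul_assoc]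
      rw [integral_const_mul, hf, mul_zero]
  have hpow : ∀ (ξ : EuclideanSpace ℝ ι) (k : ℕ),
      ∫ x, ((inner ℝ x ξ : ℝ) : ℂ) ^ k * (hermiteS (0 : ι → ℕ) x * g x) = 0 := by
    intro ξ k
    have : ∃ f ∈ Submodule.span ℂ (Set.range (hermiteS (ι := ι))), ∀ x,
        f x = ((inner ℝ x ξ : ℝ) : ℂ) ^ k * hermiteS (0 : ι → ℕ) x := by
      induction k with
      | zero => exact ⟨hermiteS 0, Submodule.subset_span ⟨_, rfl⟩, by simp⟩
      | succ k ih =>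
        obtain ⟨f, hf, hfx⟩ := ih
        refine ⟨mulInner ξ f, mulInner_mem_span ξ hf, fun x => ?_⟩
        rw [mulInner_apply, hfx, pow_succ]; ring
    obtain ⟨f, hf, hfx⟩ := this
    rw [← hspan f hf]
    simp_rw [hfx, mul_assoc]
  set c : ℝ := (Real.pi ^ (-(1 / 4) : ℝ)) ^ (Fintype.card ι) with hc
  have hcpos : 0 < c := by positivity
  have hnorm : ∀ x, ‖hermiteS (0 : ι → ℕ) x‖ = c * Real.exp (-(1 / 2) * ‖x‖ ^ 2) := by
    intro x
    rw [hermiteS_apply, hermiteProd_zero, Complex.norm_real, Real.norm_of_nonneg (by positivity)]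
  have hF : ∀ ξ, 𝓕 (fun x => hermiteS (0 : ι → ℕ) x * g x) ξ = 0 := by
    intro ξ
    rw [Real.fourier_eq']
    simp only [smul_eq_mul]
    have hs := hasSum_integral_of_dominated_convergence (μ := (volume : Measure (EuclideanSpace ℝ ι)))
      (F := fun (k : ℕ) x => (((-2 * Real.pi * inner ℝ x ξ : ℝ) : ℂ) * Complex.I) ^ k / (k.factorial : ℂ) *
        (hermiteS (0 : ι → ℕ) x * g x))
      (f := fun x => Complex.exp (((-2 * Real.pi * inner ℝ x ξ : ℝ) : ℂ) * Complex.I) *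
        (hermiteS (0 : ι → ℕ) x * g x))
      (fun k x => (2 * Real.pi * ‖ξ‖ * ‖x‖) ^ k / (k.factorial : ℝ) * ‖hermiteS (0 : ι → ℕ) x * g x‖)
      (fun k => by
        refine AEStronglyMeasurable.mul ?_ (hint _).aestronglyMeasurable
        exact Continuous.aestronglyMeasurable (by fun_prop))
      (fun k => Eventually.of_forall fun x => by
        rw [norm_mul]
        refine mul_le_mul_of_nonneg_right ?_ (norm_nonneg _)
        rw [norm_div, norm_pow, norm_mul, Complex.norm_I, mul_one, Complex.norm_real, Complex.norm_natCast]
        gcongr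
        rw [norm_mul, norm_mul, norm_neg, Real.norm_of_nonneg Real.pi_pos.le]
        have := norm_inner_le_norm (𝕜 := ℝ) x ξ
        have h2 := mul_le_mul_of_nonneg_left this (by positivity : (0 : ℝ) ≤ 2 * Real.pi)
        norm_num at h2 ⊢
        linarith)
      (Eventually.of_forall fun x => (Real.summable_pow_div_factorial _).mul_right _)
      (by
        have e : ∀ x : EuclideanSpace ℝ ι, ∑' k : ℕ, (2 * Real.pi * ‖ξ‖ * ‖x‖) ^ k / (k.factorial : ℝ) *
            ‖hermiteS (0 : ι → ℕ) x * g x‖ =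
            (Real.exp (2 * Real.pi * ‖ξ‖ * ‖x‖ - 1 / 2 * ‖x‖ ^ 2)) * (c * ‖g x‖) := by
          intro x
          rw [tsum_mul_right, norm_mul, hnorm, sub_eq_add_neg, Real.exp_add]
          have : ∑' k : ℕ, (2 * Real.pi * ‖ξ‖ * ‖x‖) ^ k / (k.factorial : ℝ) =
            Real.exp (2 * Real.pi * ‖ξ‖ * ‖x‖) := by
            rw [Real.exp_eq_exp_ℝ, NormedSpace.exp_eq_tsum_div]
          rw [this, show -(1 / 2) * ‖x‖ ^ 2 = -(1 / 2 * ‖x‖ ^ 2) by ring]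
          ring
        simp_rw [e]
        have hm : MemLp (fun x : EuclideanSpace ℝ ι =>
            Real.exp (2 * Real.pi * ‖ξ‖ * ‖x‖ - 1 / 2 * ‖x‖ ^ 2)) 2 := by
          rw [memLp_two_iff_integrable_sq (Continuous.aestronglyMeasurable (by fun_prop))]
          refine (integrable_exp_mul_gaussian (ι := ι) (4 * Real.pi * ‖ξ‖) 1 one_pos).congr
            (Eventually.of_forall fun x => ?_)
          simp only
          rw [← Real.exp_nat_mul]
          congr 1
          push_cast; ring
        exact hm.integrable_mul (hg.norm.const_mul c))
      (Eventually.of_forall fun x => by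
        refine HasSum.mul_right _ ?_
        rw [Complex.exp_eq_exp_ℂ]
        exact NormedSpace.expSeries_div_hasSum_exp _)
    have hz : ∀ k : ℕ, ∫ x, (((-2 * Real.pi * inner ℝ x ξ : ℝ) : ℂ) * Complex.I) ^ k / (k.factorial : ℂ) *
        (hermiteS (0 : ι → ℕ) x * g x) = 0 := by
      intro k
      have : ∀ x : EuclideanSpace ℝ ι, (((-2 * Real.pi * inner ℝ x ξ : ℝ) : ℂ) * Complex.I) ^ k / (k.factorial : ℂ) *
        (hermiteS (0 : ι → ℕ) x * g x) = ((-2 * Real.pi * Complex.I) ^ k / (k.factorial : ℂ)) *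
        (((inner ℝ x ξ : ℝ) : ℂ) ^ k * (hermiteS (0 : ι → ℕ) x * g x)) := by
        intro x
        push_cast
        rw [mul_right_comm, mul_pow]
        ring
      simp_rw [this]
      rw [integral_const_mul, hpow, mul_zero]
    simp only [hz] at hs
    rw [← hs.unique hasSum_zero]
  have hz := ae_eq_zero_of_fourier_eq_zero (hint _) hF
  filter_upwards [hz] with x hx
  have hne : hermiteS (0 : ι → ℕ) x ≠ 0 := by
    rw [← norm_pos_iff, hnorm]; positivity
  simpa [hne] using hx

theorem span_hermiteS_orthogonal :
    (Submodule.span ℂ (Set.range fun α : ι → ℕ => toL2 (hermiteS α)))ᗮ = ⊥ := by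
  rw [eq_bot_iff]
  intro g hg
  rw [Submodule.mem_orthogonal] at hg
  rw [Submodule.mem_bot, Lp.eq_zero_iff_ae_eq_zero]
  refine hermiteS_total (Lp.memLp g) fun α => ?_
  have := hg _ (Submodule.subset_span ⟨α, rfl⟩)
  rw [L2.inner_def] at this
  rw [← this]
  refine integral_congr_ae ?_
  filter_upwards [(hermiteS α).coeFn_toLp 2 volume] with x hx
  have h2 : toL2 (hermiteS α) x = hermiteS α x := hx
  rw [RCLike.inner_apply, h2, hermiteS_apply, Complex.conj_ofReal, mul_comm]

/-- The Hermite functions form a Hilbert basis of `L²(ℝ^ι)`. -/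
noncomputable def hermiteBasis :
    HilbertBasis (ι → ℕ) ℂ (Lp ℂ 2 (volume : Measure (EuclideanSpace ℝ ι))) :=
  HilbertBasis.mkOfOrthogonalEqBot orthonormal_hermiteS span_hermiteS_orthogonal

theorem hermiteBasis_apply (α : ι → ℕ) : hermiteBasis α = toL2 (hermiteS α) := by
  simp [hermiteBasis]

end Totality

/-- Multiple series over multi-indices with factorized nonnegative terms can be summed factorwise. -/
def HasSumPi (ι : Type*) [Fintype ι] : Prop := ∀ (f : ι → ℕ → ℝ) (s : ι → ℝ),
    (∀ i n, 0 ≤ f i n) → (∀ i, HasSum (f i) (s i)) →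
    HasSum (fun α : ι → ℕ => ∏ i, f i (α i)) (∏ i, s i)
theorem HasSumPi.of_equiv {α β : Type*} [Fintype α] [Fintype β] (e : α ≃ β) (ih : HasSumPi α) : HasSumPi β := by
  intro f s h0 h
  have := ih (fun a => f (e a)) (fun a => s (e a)) (fun i => h0 _) (fun i => h _)
  rw [← (e.symm.arrowCongr (Equiv.refl ℕ)).hasSum_iff, e.prod_comp s] at this
  have e1 : (fun γ : β → ℕ => ∏ b, f b (γ b)) =
        (fun γ : α → ℕ => ∏ a, f (e a) (γ a)) ∘ (e.symm.arrowCongr (Equiv.refl ℕ)) := by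
      funext γ
      exact (e.prod_comp fun b => f b (γ b)).symm
  rw [e1]
  exact this
theorem hasSumPi_pempty : HasSumPi PEmpty := by
  intro f s h0 h
  simp
theorem HasSumPi.option {α : Type*} [Fintype α] (ih : HasSumPi α) : HasSumPi (Option α) := by
    intro f s h0 h
    have h1 := ih (f := fun a => f (some a)) (s := fun a => s (some a)) (fun i => h0 _) (fun i => h _)
    have h2 := (h none).mul h1 ((h none).summable.mul_of_nonneg h1.summable (h0 none)
      (fun γ => Finset.prod_nonneg fun i _ => h0 _ _))
    rw [← (Equiv.piOptionEquivProd (β := fun _ : Option α => ℕ)).hasSum_iff] at h2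
    rw [Fintype.prod_option]
    have e : (fun γ : Option α → ℕ => ∏ i, f i (γ i)) = (fun p : ℕ × (α → ℕ) => f none p.1 * ∏ a, f (some a) (p.2 a)) ∘ 
      (Equiv.piOptionEquivProd (β := fun _ : Option α => ℕ)) := by
      funext γ
      simp only [Function.comp_apply, Fintype.prod_option]
      rfl
    rw [e]
    exact h2
-- Induction on the finite index type up to bijection, adding one index at a time; nonnegativity
-- provides the summability of each double series.
theorem hasSumPi (ι : Type*) [Fintype ι] : HasSumPi ι := by
  refine Fintype.induction_empty_option (P := fun ι [Fintype ι] => HasSumPi ι) ?_ hasSumPi_pempty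
    (fun _ _ ih => ih.option) ι
  intro α β _ e ih
  exact @HasSumPi.of_equiv α β (Fintype.ofEquiv β e.symm) _ e ih

theorem hasSum_prod_pi {ι : Type*} [Fintype ι] {f : ι → ℕ → ℝ} {s : ι → ℝ}
    (h0 : ∀ i n, 0 ≤ f i n) (h : ∀ i, HasSum (f i) (s i)) :
    HasSum (fun α : ι → ℕ => ∏ i, f i (α i)) (∏ i, s i) :=
  hasSumPi ι f s h0 h

/-! ### Quadratic Hamiltonians and convergence of Hermite expansions in the graph norm -/

section Quadratic
open scoped SchwartzMap LineDeriv ComplexConjugate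

variable {ι : Type*} [Fintype ι] [DecidableEq ι]

/-- A sum of oscillators with frequencies `w` and a quadratic perturbation `V`. -/
noncomputable def quadHam (w : ι → ℝ) (V : Matrix ι ι ℝ) (f : 𝓢(EuclideanSpace ℝ ι, ℂ)) :
    𝓢(EuclideanSpace ℝ ι, ℂ) :=
  ∑ i, (w i : ℂ) • oscEnergy i f + (1 / 2 : ℂ) • ∑ i, ∑ j, (V i j : ℂ) • mulCoord i (mulCoord j f)

/-- The action of `quadHam` on a family which transforms like the Hermite functions. -/
noncomputable def ladderHam {M : Type*} [AddCommGroup M] [Module ℂ M] (w : ι → ℝ)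
    (V : Matrix ι ι ℝ) (v : (ι → ℕ) → M) (α : ι → ℕ) : M :=
  ∑ i, ((w i : ℂ) * ((α i : ℂ) + 1 / 2)) • v α +
    (1 / 2 : ℂ) • ∑ i, ∑ j, (V i j : ℂ) • ladderX (ladderX v i) j α

theorem map_ladderX {ι : Type*} [DecidableEq ι] {M M' : Type*} [AddCommGroup M] [Module ℂ M]
    [AddCommGroup M'] [Module ℂ M'] (L : M →ₗ[ℂ] M') (v : (ι → ℕ) → M) (i : ι) (α : ι → ℕ) :
    L (ladderX v i α) = ladderX (fun β => L (v β)) i α := by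
  simp [ladderX]

theorem map_ladderHam {M M' : Type*} [AddCommGroup M] [Module ℂ M] [AddCommGroup M'] [Module ℂ M']
    (L : M →ₗ[ℂ] M') (w : ι → ℝ) (V : Matrix ι ι ℝ) (v : (ι → ℕ) → M) (α : ι → ℕ) :
    L (ladderHam w V v α) = ladderHam w V (fun β => L (v β)) α := by
  simp only [ladderHam, map_add, map_sum, map_smul, map_ladderX]

theorem quadHam_hermiteS (w : ι → ℝ) (V : Matrix ι ι ℝ) (α : ι → ℕ) :
    quadHam w V (hermiteS α) = ladderHam w V hermiteS α := by
  -- The order of the ladders is reversed: the outer one expands the coordinate `j`, which acts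
  -- first, and the coordinate `i` then acts by linearity on each of the resulting terms.
  have h : ∀ i j, mulCoord i (mulCoord j (hermiteS α)) = ladderX (ladderX hermiteS i) j α := by
    intro i j
    rw [mulCoord_hermiteS]
    have := map_ladderX (mulCoord i : 𝓢(EuclideanSpace ℝ ι, ℂ) →L[ℂ] _).toLinearMap hermiteS j α
    refine this.trans ?_
    congr 1
    ext1 β
    exact mulCoord_hermiteS β i
  simp only [quadHam, ladderHam, oscEnergy_hermiteS, h, smul_smul]

theorem mulCoord_comm {ι : Type*} [Fintype ι] (i j : ι) (f : 𝓢(EuclideanSpace ℝ ι, ℂ)) :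
    mulCoord i (mulCoord j f) = mulCoord j (mulCoord i f) := by
  ext x
  simp only [mulCoord_apply]
  ring

theorem inner_quadHam (w : ι → ℝ) (V : Matrix ι ι ℝ) (f g : 𝓢(EuclideanSpace ℝ ι, ℂ)) :
    inner ℂ (toL2 (quadHam w V f)) (toL2 g) = inner ℂ (toL2 f) (toL2 (quadHam w V g)) := by
  simp only [quadHam, map_add, map_sum, map_smul, inner_add_left, inner_add_right, sum_inner,
    inner_sum, inner_smul_left, inner_smul_right, inner_oscEnergy, inner_mulCoord,
    Complex.conj_ofReal]
  congr 1
  simp only [map_div₀, map_one, Complex.conj_ofNat]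
  congr 1
  refine Finset.sum_congr rfl fun i _ => Finset.sum_congr rfl fun j _ => ?_
  rw [mulCoord_comm]

/-- The operator `oscEnergy i + 1/2` is symmetric, preserves the Schwartz space and has eigenvalue
`α i + 1`, so its powers multiply Hermite coefficients. Coefficients thus decay like
`multiWeight⁻⁴`: two powers absorb the growth of the quadratic Hamiltonian, and two make the series
summable. -/
theorem exists_schwartz_coeff (f : 𝓢(EuclideanSpace ℝ ι, ℂ)) (s : Finset ι) :
    ∃ g : 𝓢(EuclideanSpace ℝ ι, ℂ), ∀ α : ι → ℕ,
      inner ℂ (toL2 (hermiteS α)) (toL2 g) =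
        (∏ i ∈ s, ((α i : ℂ) + 1) ^ 4) * inner ℂ (toL2 (hermiteS α)) (toL2 f) := by
  have step : ∀ (i : ι) (n : ℕ) (f : 𝓢(EuclideanSpace ℝ ι, ℂ)),
      ∃ g : 𝓢(EuclideanSpace ℝ ι, ℂ), ∀ α : ι → ℕ,
      inner ℂ (toL2 (hermiteS α)) (toL2 g) =
        ((α i : ℂ) + 1) ^ n * inner ℂ (toL2 (hermiteS α)) (toL2 f) := by
    intro i n f
    induction n with
    | zero => exact ⟨f, by simp⟩
    | succ n ih =>
      obtain ⟨g, hg⟩ := ih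
      refine ⟨oscEnergy i g + (1 / 2 : ℂ) • g, fun α => ?_⟩
      rw [map_add, map_smul, inner_add_right, inner_smul_right, ← inner_oscEnergy,
        oscEnergy_hermiteS, map_smul, inner_smul_left, hg]
      simp only [map_add, map_natCast, map_div₀, map_one, Complex.conj_ofNat]
      ring
  induction s using Finset.induction_on with
  | empty => exact ⟨f, by simp⟩
  | insert i s hi ih =>
    obtain ⟨g, hg⟩ := ih
    obtain ⟨g', hg'⟩ := step i 4 g
    refine ⟨g', fun α => ?_⟩
    rw [hg', hg, Finset.prod_insert hi, mul_assoc]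

/-- The weight `∏ (α i + 1)` of a multi-index. -/
def multiWeight {ι : Type*} [Fintype ι] (α : ι → ℕ) : ℝ := ∏ i, ((α i : ℝ) + 1)

theorem le_multiWeight {ι : Type*} [Fintype ι] (α : ι → ℕ) (i : ι) :
    (α i : ℝ) + 1 ≤ multiWeight α := by
  classical
  rw [multiWeight, ← Finset.mul_prod_erase _ _ (Finset.mem_univ i)]
  refine le_mul_of_one_le_right (by positivity) ?_
  exact Finset.one_le_prod fun j _ => by simp

theorem one_le_multiWeight {ι : Type*} [Fintype ι] (α : ι → ℕ) : 1 ≤ multiWeight α :=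
  Finset.one_le_prod fun j _ => by simp

theorem multiWeight_sub_le (α : ι → ℕ) (i : ι) : multiWeight (α - Pi.single i 1) ≤ multiWeight α := by
  refine Finset.prod_le_prod (fun j _ => by positivity) fun j _ => ?_
  have : (α - Pi.single i 1 : ι → ℕ) j ≤ α j := by simp
  gcongr

theorem multiWeight_add_le (α : ι → ℕ) (i : ι) :
    multiWeight (α + Pi.single i 1) ≤ 2 * multiWeight α := by
  rw [multiWeight, multiWeight, ← Finset.mul_prod_erase _ _ (Finset.mem_univ i),
    ← Finset.mul_prod_erase _ _ (Finset.mem_univ i), ← mul_assoc]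
  have : ∏ j ∈ Finset.univ.erase i, ((((α + Pi.single i 1 : ι → ℕ) j : ℕ) : ℝ) + 1) =
      ∏ j ∈ Finset.univ.erase i, ((α j : ℝ) + 1) :=
    Finset.prod_congr rfl fun j hj => by simp [Finset.ne_of_mem_erase hj]
  rw [this]
  refine mul_le_mul_of_nonneg_right ?_ (Finset.prod_nonneg fun j _ => by positivity)
  simp
  linarith [Nat.cast_nonneg (α := ℝ) (α i)]

/-- Each coordinate costs one power of the weight. The raised index contributes the factor `2^n`,
since raising at most doubles the weight, and the lowered one contributes `1`. -/
theorem norm_ladderX_le {M : Type*} [NormedAddCommGroup M] [NormedSpace ℂ M] {v : (ι → ℕ) → M}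
    {K : ℝ} {n : ℕ} (hK : 0 ≤ K) (h : ∀ α, ‖v α‖ ≤ K * multiWeight α ^ n) (i : ι) (α : ι → ℕ) :
    ‖ladderX v i α‖ ≤ (K * (2 ^ n + 1)) * multiWeight α ^ (n + 1) := by
  have hw := one_le_multiWeight α
  have h1 : √((α i : ℝ) + 1) ≤ multiWeight α := by
    refine le_trans ?_ (le_multiWeight α i)
    exact Real.sqrt_le_self_iff.mpr (Or.inr (by simp))
  have h2 : √(α i : ℝ) ≤ multiWeight α := (Real.sqrt_le_sqrt (by linarith)).trans h1
  have h3 : (1 : ℝ) / √2 ≤ 1 := by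
    rw [div_le_one (by positivity)]
    exact Real.one_le_sqrt.mpr (by norm_num)
  have h4 : ‖v (α + Pi.single i 1)‖ ≤ K * (2 * multiWeight α) ^ n := by
    refine (h _).trans ?_
    have := multiWeight_add_le α i
    have h0 : 0 ≤ multiWeight (α + Pi.single i 1) := zero_le_one.trans (one_le_multiWeight _)
    gcongr
  have h5 : ‖v (α - Pi.single i 1)‖ ≤ K * multiWeight α ^ n := by
    refine (h _).trans ?_
    have := multiWeight_sub_le α i
    have h0 : 0 ≤ multiWeight (α - Pi.single i 1) := zero_le_one.trans (one_le_multiWeight _)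
    gcongr
  rw [ladderX, norm_smul, Complex.norm_real, Real.norm_of_nonneg (by positivity)]
  calc 1 / √2 * ‖(√((α i : ℝ) + 1) : ℂ) • v (α + Pi.single i 1) + (√(α i : ℝ) : ℂ) • v (α - Pi.single i 1)‖
      ≤ 1 * (‖(√((α i : ℝ) + 1) : ℂ) • v (α + Pi.single i 1)‖ + ‖(√(α i : ℝ) : ℂ) • v (α - Pi.single i 1)‖) := by
        gcongr
        exact norm_add_le _ _
    _ = √((α i : ℝ) + 1) * ‖v (α + Pi.single i 1)‖ + √(α i : ℝ) * ‖v (α - Pi.single i 1)‖ := by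
        rw [norm_smul, norm_smul, Complex.norm_real, Complex.norm_real,
          Real.norm_of_nonneg (by positivity), Real.norm_of_nonneg (by positivity), one_mul]
    _ ≤ multiWeight α * (K * (2 * multiWeight α) ^ n) + multiWeight α * (K * multiWeight α ^ n) := by
        gcongr
    _ = _ := by rw [mul_pow]; ring

theorem exists_norm_ladderHam_le {M : Type*} [NormedAddCommGroup M] [NormedSpace ℂ M]
    (w : ι → ℝ) (V : Matrix ι ι ℝ) {v : (ι → ℕ) → M} (h : ∀ α, ‖v α‖ ≤ 1) :
    ∃ K, ∀ α, ‖ladderHam w V v α‖ ≤ K * multiWeight α ^ 2 := by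
  refine ⟨∑ i, |w i| + ∑ i, ∑ j, |V i j| * 6, fun α => ?_⟩
  have hw := one_le_multiWeight α
  -- Two coordinates in succession: `(2⁰ + 1)(2¹ + 1) = 6`.
  have h1 : ∀ i j, ‖ladderX (ladderX v i) j α‖ ≤ 6 * multiWeight α ^ 2 := by
    intro i j
    have e1 := norm_ladderX_le (v := v) (K := 1) (n := 0) zero_le_one (by simpa using h) i
    have e2 := norm_ladderX_le (by norm_num) e1 j α
    norm_num at e2
    exact e2
  rw [ladderHam, add_mul]
  refine (norm_add_le _ _).trans (add_le_add ?_ ?_)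
  · refine (norm_sum_le _ _).trans ?_
    rw [Finset.sum_mul]
    refine Finset.sum_le_sum fun i _ => ?_
    rw [norm_smul, norm_mul, Complex.norm_real, mul_assoc]
    refine mul_le_mul_of_nonneg_left ?_ (abs_nonneg _)
    have h2 : ‖(α i : ℂ) + 1 / 2‖ ≤ multiWeight α := by
      refine le_trans ?_ (le_multiWeight α i)
      refine (norm_add_le _ _).trans ?_
      simp
      norm_num
    calc ‖(α i : ℂ) + 1 / 2‖ * ‖v α‖ ≤ multiWeight α * 1 := by
          gcongr; exact h α
      _ ≤ multiWeight α ^ 2 := by nlinarith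
  · rw [norm_smul]
    have : ‖(1 / 2 : ℂ)‖ ≤ 1 := by norm_num
    refine (mul_le_of_le_one_left (norm_nonneg _) this).trans ?_
    refine (norm_sum_le _ _).trans ?_
    rw [Finset.sum_mul]
    refine Finset.sum_le_sum fun i _ => (norm_sum_le _ _).trans ?_
    rw [Finset.sum_mul]
    refine Finset.sum_le_sum fun j _ => ?_
    rw [norm_smul, Complex.norm_real, mul_assoc]
    exact mul_le_mul_of_nonneg_left (h1 i j) (abs_nonneg _)

theorem summable_multiWeight {ι : Type*} [Fintype ι] : Summable fun α : ι → ℕ => (multiWeight α ^ 2)⁻¹ := by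
  have h : Summable fun n : ℕ => (((n : ℝ) + 1) ^ 2)⁻¹ := by
    have := (summable_nat_add_iff 1).mpr (Real.summable_nat_pow_inv.mpr one_lt_two)
    simpa using this
  have := (hasSum_prod_pi (ι := ι) (f := fun _ n => (((n : ℝ) + 1) ^ 2)⁻¹) (fun i n => by positivity)
    (fun i => h.hasSum)).summable
  refine this.congr fun α => ?_
  rw [multiWeight, ← Finset.prod_pow, Finset.prod_inv_distrib]

/-- The Hermite expansion of a Schwartz function converges in the graph norm of `quadHam w V`. -/
theorem hasSum_quadHam (w : ι → ℝ) (V : Matrix ι ι ℝ) (f : 𝓢(EuclideanSpace ℝ ι, ℂ)) :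
    HasSum (fun α : ι → ℕ => (inner ℂ (toL2 (hermiteS α)) (toL2 f) : ℂ) •
      (toL2 (hermiteS α), toL2 (quadHam w V (hermiteS α)))) (toL2 f, toL2 (quadHam w V f)) := by
  have h1 : ∀ f : 𝓢(EuclideanSpace ℝ ι, ℂ), HasSum (fun α : ι → ℕ =>
      (inner ℂ (toL2 (hermiteS α)) (toL2 f) : ℂ) • toL2 (hermiteS α)) (toL2 f) := by
    intro f
    have := hermiteBasis.hasSum_repr (toL2 f)
    simpa only [HilbertBasis.repr_apply_apply, hermiteBasis_apply] using this
  obtain ⟨g, hg⟩ := exists_schwartz_coeff f Finset.univ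
  have hn : ∀ α : ι → ℕ, ‖toL2 (hermiteS α)‖ = 1 := orthonormal_hermiteS.1
  obtain ⟨K, hK⟩ := exists_norm_ladderHam_le w V (v := fun α : ι → ℕ => toL2 (hermiteS α))
    (fun α => (hn α).le)
  have hT : ∀ α : ι → ℕ, toL2 (quadHam w V (hermiteS α)) =
      ladderHam w V (fun α : ι → ℕ => toL2 (hermiteS α)) α := fun α => by
    rw [quadHam_hermiteS]
    exact map_ladderHam (toL2 (ι := ι)).toLinearMap w V hermiteS α
  have hs : Summable fun α : ι → ℕ => (inner ℂ (toL2 (hermiteS α)) (toL2 f) : ℂ) •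
      toL2 (quadHam w V (hermiteS α)) := by
    refine Summable.of_norm_bounded (summable_multiWeight.mul_left (‖toL2 g‖ * K)) fun α => ?_
    have hw := one_le_multiWeight α
    have hw0 : 0 < multiWeight α := by linarith
    have e1 : ‖(inner ℂ (toL2 (hermiteS α)) (toL2 g) : ℂ)‖ ≤ ‖toL2 g‖ := by
      refine (norm_inner_le_norm _ _).trans ?_
      rw [hn, one_mul]
    have e2 : ‖(inner ℂ (toL2 (hermiteS α)) (toL2 g) : ℂ)‖ =
        multiWeight α ^ 4 * ‖(inner ℂ (toL2 (hermiteS α)) (toL2 f) : ℂ)‖ := by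
      rw [hg, norm_mul, norm_prod, multiWeight, ← Finset.prod_pow]
      congr 1
      refine Finset.prod_congr rfl fun i _ => ?_
      rw [norm_pow]
      congr 1
      exact_mod_cast Complex.norm_natCast (α i + 1)
    have e3 : ‖(inner ℂ (toL2 (hermiteS α)) (toL2 f) : ℂ)‖ ≤ ‖toL2 g‖ / multiWeight α ^ 4 := by
      rw [le_div_iff₀ (by positivity), mul_comm, ← e2]; exact e1
    rw [norm_smul, hT]
    calc _ ≤ ‖toL2 g‖ / multiWeight α ^ 4 * (K * multiWeight α ^ 2) := by
          gcongr
          exact hK α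
      _ = _ := by field_simp
  have hsum := hs.hasSum
  -- The sum of the images is identified weakly: paired with a Hermite function, the symmetric
  -- operator moves to the other side, where the plain Hermite expansion applies. No closedness of
  -- the operator is needed.
  have key : ∑' α : ι → ℕ, (inner ℂ (toL2 (hermiteS α)) (toL2 f) : ℂ) •
      toL2 (quadHam w V (hermiteS α)) = toL2 (quadHam w V f) := by
    apply hermiteBasis.repr.injective
    ext β
    simp only [HilbertBasis.repr_apply_apply, hermiteBasis_apply]
    have a1 := (innerSL ℂ (toL2 (hermiteS β))).hasSum hsum
    have a2 := (innerSL ℂ (toL2 (quadHam w V (hermiteS β)))).hasSum (h1 f)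
    simp only [innerSL_apply_apply] at a1 a2
    rw [← inner_quadHam]
    refine a1.unique ?_
    convert a2 using 1
    ext α
    simp only [inner_smul_right]
    rw [inner_quadHam]
  rw [key] at hsum
  exact (h1 f).prodMk hsum

end Quadratic

/-! ### Linear changes of variables and decoupling -/

section LinearChange
open scoped SchwartzMap LineDeriv ComplexConjugate

variable {ι : Type*} [Fintype ι]

theorem integral_comp_linearEquiv (L : EuclideanSpace ℝ ι ≃L[ℝ] EuclideanSpace ℝ ι)
    (F : EuclideanSpace ℝ ι → ℂ) :
    ∫ x, F (L x) = (|(LinearMap.det (L : EuclideanSpace ℝ ι →ₗ[ℝ] EuclideanSpace ℝ ι))⁻¹| : ℝ) *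
      ∫ x, F x := by
  have hd : LinearMap.det (L : EuclideanSpace ℝ ι →ₗ[ℝ] EuclideanSpace ℝ ι) ≠ 0 :=
    (LinearEquiv.isUnit_det' L.toLinearEquiv).ne_zero
  have h1 := Measure.map_linearMap_addHaar_eq_smul_addHaar
    (volume : Measure (EuclideanSpace ℝ ι)) hd
  have h2 := L.toHomeomorph.measurableEmbedding.integral_map (μ := volume) F
  have h3 : Measure.map (L.toHomeomorph) (volume : Measure (EuclideanSpace ℝ ι)) =
      ENNReal.ofReal |(LinearMap.det (L : EuclideanSpace ℝ ι →ₗ[ℝ] EuclideanSpace ℝ ι))⁻¹| • volume := h1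
  rw [h3, integral_smul_measure, ENNReal.toReal_ofReal (abs_nonneg _)] at h2
  rw [← Complex.real_smul]
  exact h2.symm

theorem memLp_comp_linearEquiv (L : EuclideanSpace ℝ ι ≃L[ℝ] EuclideanSpace ℝ ι)
    {g : EuclideanSpace ℝ ι → ℂ} (hg : MemLp g 2) : MemLp (fun x => g (L x)) 2 := by
  have hd : LinearMap.det (L : EuclideanSpace ℝ ι →ₗ[ℝ] EuclideanSpace ℝ ι) ≠ 0 :=
    (LinearEquiv.isUnit_det' L.toLinearEquiv).ne_zero
  have h1 : Measure.map (L.toHomeomorph) (volume : Measure (EuclideanSpace ℝ ι)) =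
      ENNReal.ofReal |(LinearMap.det (L : EuclideanSpace ℝ ι →ₗ[ℝ] EuclideanSpace ℝ ι))⁻¹| • volume :=
    Measure.map_linearMap_addHaar_eq_smul_addHaar (volume : Measure (EuclideanSpace ℝ ι)) hd
  have h2 : MemLp g 2 (Measure.map (L.toHomeomorph) (volume : Measure (EuclideanSpace ℝ ι))) := by
    rw [h1]; exact hg.smul_measure ENNReal.ofReal_ne_top
  exact (L.toHomeomorph.measurableEmbedding.memLp_map_measure_iff).mp h2

variable [DecidableEq ι]

/-- Hermite functions after a linear change of variables, normalized in `L²`. -/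
noncomputable def hermiteComp (L : EuclideanSpace ℝ ι ≃L[ℝ] EuclideanSpace ℝ ι) (α : ι → ℕ) :
    𝓢(EuclideanSpace ℝ ι, ℂ) :=
  ((√|LinearMap.det (L : EuclideanSpace ℝ ι →ₗ[ℝ] EuclideanSpace ℝ ι)| : ℝ) : ℂ) •
    SchwartzMap.compCLMOfContinuousLinearEquiv ℂ L (hermiteS α)

theorem hermiteComp_apply (L : EuclideanSpace ℝ ι ≃L[ℝ] EuclideanSpace ℝ ι) (α : ι → ℕ)
    (x : EuclideanSpace ℝ ι) : hermiteComp L α x =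
      ((√|LinearMap.det (L : EuclideanSpace ℝ ι →ₗ[ℝ] EuclideanSpace ℝ ι)| : ℝ) : ℂ) *
        hermiteS α (L x) := by
  simp [hermiteComp, smul_apply]

theorem orthonormal_hermiteComp (L : EuclideanSpace ℝ ι ≃L[ℝ] EuclideanSpace ℝ ι) :
    Orthonormal ℂ fun α => toL2 (hermiteComp L α) := by
  rw [orthonormal_iff_ite]
  intro α β
  have hd : LinearMap.det (L : EuclideanSpace ℝ ι →ₗ[ℝ] EuclideanSpace ℝ ι) ≠ 0 :=
    (LinearEquiv.isUnit_det' L.toLinearEquiv).ne_zero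
  rw [inner_toL2, ← inner_hermiteS, inner_toL2]
  simp only [hermiteComp_apply, map_mul, Complex.conj_ofReal]
  set d := LinearMap.det (L : EuclideanSpace ℝ ι →ₗ[ℝ] EuclideanSpace ℝ ι)
  have : ∀ x, (√|d| : ℂ) * conj (hermiteS α (L x)) * ((√|d| : ℂ) * hermiteS β (L x)) =
      ((|d| : ℝ) : ℂ) * (conj (hermiteS α (L x)) * hermiteS β (L x)) := by
    intro x
    have : (√|d| : ℂ) * (√|d| : ℂ) = ((|d| : ℝ) : ℂ) := by
      exact_mod_cast Real.mul_self_sqrt (abs_nonneg d)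
    linear_combination (conj (hermiteS α (L x)) * hermiteS β (L x)) * this
  simp_rw [this]
  rw [integral_const_mul, integral_comp_linearEquiv L fun x => conj (hermiteS α x) * hermiteS β x,
    ← mul_assoc, ← Complex.ofReal_mul, abs_inv, mul_inv_cancel₀ (abs_ne_zero.mpr hd)]
  simp

theorem hermiteComp_total (L : EuclideanSpace ℝ ι ≃L[ℝ] EuclideanSpace ℝ ι) :
    (Submodule.span ℂ (Set.range fun α : ι → ℕ => toL2 (hermiteComp L α)))ᗮ = ⊥ := by
  rw [eq_bot_iff]
  intro g hg
  rw [Submodule.mem_orthogonal] at hg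
  rw [Submodule.mem_bot, Lp.eq_zero_iff_ae_eq_zero]
  have hd : LinearMap.det (L : EuclideanSpace ℝ ι →ₗ[ℝ] EuclideanSpace ℝ ι) ≠ 0 :=
    (LinearEquiv.isUnit_det' L.toLinearEquiv).ne_zero
  have hz : (fun x => g (L.symm x)) =ᵐ[volume] 0 := by
    refine hermiteS_total (memLp_comp_linearEquiv L.symm (Lp.memLp g)) fun α => ?_
    have h1 := hg _ (Submodule.subset_span ⟨α, rfl⟩)
    rw [L2.inner_def] at h1
    have h2 : ∫ x, ((√|LinearMap.det (L : EuclideanSpace ℝ ι →ₗ[ℝ] EuclideanSpace ℝ ι)| : ℝ) : ℂ) *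
        (hermiteS α (L x) * g x) = 0 := by
      rw [← h1]
      refine integral_congr_ae ?_
      filter_upwards [(hermiteComp L α).coeFn_toLp 2 volume] with x hx
      have h2 : toL2 (hermiteComp L α) x = hermiteComp L α x := hx
      rw [RCLike.inner_apply, h2, hermiteComp_apply, hermiteS_apply, map_mul, Complex.conj_ofReal,
        Complex.conj_ofReal]
      ring
    rw [integral_const_mul] at h2
    have h3 := h2
    have h4 := integral_comp_linearEquiv L fun x => hermiteS α x * g (L.symm x)
    simp only [ContinuousLinearEquiv.symm_apply_apply] at h4
    rw [h4] at h3
    have h5 : √|LinearMap.det (L : EuclideanSpace ℝ ι →ₗ[ℝ] EuclideanSpace ℝ ι)| ≠ 0 :=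
      (Real.sqrt_pos.mpr (abs_pos.mpr hd)).ne'
    have h6 : |(LinearMap.det (L : EuclideanSpace ℝ ι →ₗ[ℝ] EuclideanSpace ℝ ι))⁻¹| ≠ 0 :=
      abs_ne_zero.mpr (inv_ne_zero hd)
    rcases mul_eq_zero.mp h3 with h | h
    · exact absurd h (by exact_mod_cast h5)
    · exact (mul_eq_zero.mp h).resolve_left (by exact_mod_cast h6)
  have hq : Measure.QuasiMeasurePreserving L.toHomeomorph
      (volume : Measure (EuclideanSpace ℝ ι)) volume := by
    refine ⟨L.toHomeomorph.measurableEmbedding.measurable, ?_⟩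
    have h1 : Measure.map (L.toHomeomorph) (volume : Measure (EuclideanSpace ℝ ι)) =
        ENNReal.ofReal |(LinearMap.det (L : EuclideanSpace ℝ ι →ₗ[ℝ] EuclideanSpace ℝ ι))⁻¹| • volume :=
      Measure.map_linearMap_addHaar_eq_smul_addHaar (volume : Measure (EuclideanSpace ℝ ι)) hd
    rw [h1]
    exact Measure.smul_absolutelyContinuous
  have := hq.ae hz
  filter_upwards [this] with x hx
  simpa using hx

theorem lineDeriv_lineDeriv_comp (L : EuclideanSpace ℝ ι ≃L[ℝ] EuclideanSpace ℝ ι)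
    (M : Matrix ι ι ℝ) (hM : ∀ x k, L x k = ∑ i, M k i * x i) (i : ι)
    (f : 𝓢(EuclideanSpace ℝ ι, ℂ)) (x : EuclideanSpace ℝ ι) :
    (∂_{EuclideanSpace.single i (1 : ℝ)} (∂_{EuclideanSpace.single i (1 : ℝ)}
      (SchwartzMap.compCLMOfContinuousLinearEquiv ℂ L f))) x =
    ∑ k, ∑ l, ((M k i : ℂ) * (M l i : ℂ)) * (∂_{EuclideanSpace.single k (1 : ℝ)}
      (∂_{EuclideanSpace.single l (1 : ℝ)} f)) (L x) := by
  have hL : L (EuclideanSpace.single i (1 : ℝ)) = ∑ k, M k i • EuclideanSpace.single k (1 : ℝ) := by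
    ext k
    rw [hM]
    simp [Pi.single_apply]
  have hlin : ∀ g : 𝓢(EuclideanSpace ℝ ι, ℂ), ∀ y,
      (∂_{∑ k, M k i • EuclideanSpace.single k (1 : ℝ)} g) y =
      ∑ k, (M k i : ℂ) * (∂_{EuclideanSpace.single k (1 : ℝ)} g) y := by
    intro g y
    simp [SchwartzMap.lineDerivOp_apply_eq_fderiv]
  have hlin' : ∀ g : 𝓢(EuclideanSpace ℝ ι, ℂ),
      (∂_{∑ k, M k i • EuclideanSpace.single k (1 : ℝ)} g) =
      ∑ k, (M k i : ℂ) • (∂_{EuclideanSpace.single k (1 : ℝ)} g) := by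
    intro g
    ext y
    rw [hlin]
    simp [sum_apply, smul_apply]
  have hdz : ∀ (m : EuclideanSpace ℝ ι) (f : 𝓢(EuclideanSpace ℝ ι, ℂ)), ∂_{m} f =
    LineDeriv.lineDerivOpCLM ℂ 𝓢(EuclideanSpace ℝ ι, ℂ) m f := fun m f => rfl
  rw [SchwartzMap.lineDerivOp_compCLMOfContinuousLinearEquiv,
    SchwartzMap.lineDerivOp_compCLMOfContinuousLinearEquiv, hL,
    SchwartzMap.compCLMOfContinuousLinearEquiv_apply]
  simp only [Function.comp_apply]
  rw [hlin]
  refine Finset.sum_congr rfl fun k _ => ?_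
  rw [hlin', hdz (EuclideanSpace.single k (1 : ℝ)), map_sum]
  simp only [map_smul]
  simp only [← hdz, sum_apply, smul_apply, smul_eq_mul, Finset.mul_sum, mul_assoc]

/-- The two matrix identities are the two halves of the decoupling: `h1` diagonalizes the kinetic
form, as second derivatives transform with `M w Mᵀ`, and `h2` diagonalizes the potential, whose form
in the new variables pulls back with `Mᵀ Ω M`. -/
theorem quadHam_comp (L : EuclideanSpace ℝ ι ≃L[ℝ] EuclideanSpace ℝ ι)
    {M : Matrix ι ι ℝ} (hM : ∀ x k, L x k = ∑ i, M k i * x i) {w Ω : ι → ℝ} {V : Matrix ι ι ℝ}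
    (h1 : M * Matrix.diagonal w * M.transpose = Matrix.diagonal Ω)
    (h2 : M.transpose * Matrix.diagonal Ω * M = Matrix.diagonal w + V)
    (f : 𝓢(EuclideanSpace ℝ ι, ℂ)) :
    quadHam w V (SchwartzMap.compCLMOfContinuousLinearEquiv ℂ L f) =
      SchwartzMap.compCLMOfContinuousLinearEquiv ℂ L (∑ k, (Ω k : ℂ) • oscEnergy k f) := by
  have h1' : ∀ k l, ∑ i, (w i : ℂ) * ((M k i : ℂ) * (M l i : ℂ)) = if k = l then (Ω k : ℂ) else 0 := by
    intro k l
    have := congrFun (congrFun h1 k) l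
    rw [Matrix.mul_apply] at this
    simp only [Matrix.mul_diagonal, Matrix.transpose_apply, Matrix.diagonal_apply] at this
    have e : ∑ i, w i * (M k i * M l i) = if k = l then Ω k else 0 := by
      rw [← this]; exact Finset.sum_congr rfl fun i _ => by ring
    rw [← Complex.ofReal_zero, ← apply_ite Complex.ofReal, ← e]
    push_cast
    rfl
  have h2' : ∀ i j, ∑ k, M k i * Ω k * M k j = (if i = j then w i else 0) + V i j := by
    intro i j
    have := congrFun (congrFun h2 i) j
    rw [Matrix.mul_apply] at this
    simpa [Matrix.mul_diagonal, Matrix.diagonal_apply, Matrix.add_apply] using this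
  ext x
  have hq : ∑ k, Ω k * (L x k * L x k) = ∑ i, w i * (x i * x i) + ∑ i, ∑ j, V i j * (x i * x j) := by
    have e1 : ∑ k, Ω k * (L x k * L x k) = ∑ i, ∑ j, (∑ k, M k i * Ω k * M k j) * (x i * x j) := by
      simp only [hM, Finset.mul_sum, Finset.sum_mul]
      rw [Finset.sum_comm]
      refine Finset.sum_congr rfl fun i _ => ?_
      rw [Finset.sum_comm]
      refine Finset.sum_congr rfl fun j _ => Finset.sum_congr rfl fun k _ => ?_
      ring
    rw [e1]
    simp only [h2', add_mul, Finset.sum_add_distrib, ite_mul, zero_mul, Finset.sum_ite_eq,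
      Finset.mem_univ, if_true]
  have hqC : ∑ k, (Ω k : ℂ) * ((L x k : ℂ) * (L x k : ℂ)) = ∑ i, (w i : ℂ) * ((x i : ℂ) * (x i : ℂ))
      + ∑ i, ∑ j, (V i j : ℂ) * ((x i : ℂ) * (x j : ℂ)) := by exact_mod_cast congrArg Complex.ofReal hq
  have hD : ∑ i, (w i : ℂ) * (∂_{EuclideanSpace.single i (1 : ℝ)} (∂_{EuclideanSpace.single i (1 : ℝ)}
      (SchwartzMap.compCLMOfContinuousLinearEquiv ℂ L f))) x =
      ∑ k, (Ω k : ℂ) * (∂_{EuclideanSpace.single k (1 : ℝ)}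
      (∂_{EuclideanSpace.single k (1 : ℝ)} f)) (L x) := by
    simp only [lineDeriv_lineDeriv_comp L M hM, Finset.mul_sum]
    rw [Finset.sum_comm]
    refine Finset.sum_congr rfl fun k _ => ?_
    rw [Finset.sum_comm]
    simp only [← mul_assoc]
    simp only [← Finset.sum_mul]
    have : ∀ l, (∑ i, (w i : ℂ) * (M k i : ℂ) * (M l i : ℂ)) = if k = l then (Ω k : ℂ) else 0 := by
      intro l; rw [← h1' k l]; exact Finset.sum_congr rfl fun i _ => by ring
    simp [this]
  simp only [quadHam, oscEnergy, SchwartzMap.compCLMOfContinuousLinearEquiv_apply,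
    Function.comp_apply, add_apply, sum_apply, smul_apply, sub_apply, smul_eq_mul, mulCoord_apply] at hD ⊢
  have s1 : ∀ (g : ι → ℂ) (c : ι → ℂ) (d : ι → ℂ), ∑ i, c i * (1 / 2 * (g i - d i)) =
    1 / 2 * (∑ i, c i * g i - ∑ i, c i * d i) := by
    intro g c d
    rw [← Finset.sum_sub_distrib, Finset.mul_sum]
    exact Finset.sum_congr rfl fun i _ => by ring
  rw [s1, s1, hD]
  have s2 : ∑ i, (w i : ℂ) * ((x i : ℂ) * ((x i : ℂ) * f (L x))) =
      (∑ i, (w i : ℂ) * ((x i : ℂ) * (x i : ℂ))) * f (L x) := by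
    rw [Finset.sum_mul]; exact Finset.sum_congr rfl fun i _ => by ring
  have s3 : ∑ i, (Ω i : ℂ) * ((L x i : ℂ) * ((L x i : ℂ) * f (L x))) =
      (∑ i, (Ω i : ℂ) * ((L x i : ℂ) * (L x i : ℂ))) * f (L x) := by
    rw [Finset.sum_mul]; exact Finset.sum_congr rfl fun i _ => by ring
  have s4 : ∑ i, ∑ j, (V i j : ℂ) * ((x i : ℂ) * ((x j : ℂ) * f (L x))) =
      (∑ i, ∑ j, (V i j : ℂ) * ((x i : ℂ) * (x j : ℂ))) * f (L x) := by
    simp only [Finset.sum_mul]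
    exact Finset.sum_congr rfl fun i _ => Finset.sum_congr rfl fun j _ => by ring
  rw [s2, s3, s4, hqC]
  ring

end LinearChange

/-! ### Normal modes and the trace of the heat semigroup -/

section HeatTrace
open scoped SchwartzMap LineDeriv ComplexConjugate

variable {ι : Type} [Fintype ι] [DecidableEq ι]

/-- The matrix `√w (diag w + V) √w` whose eigenvalues are the squares of the eigenfrequencies of
the quadratic Hamiltonian `quadHam w V`. -/
noncomputable def freqMatrix (w : ι → ℝ) (V : Matrix ι ι ℝ) : Matrix ι ι ℝ :=
  Matrix.diagonal (fun i => √(w i)) * (Matrix.diagonal w + V) * Matrix.diagonal fun i => √(w i)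

/-- With an orthogonal matrix `U` of eigenvectors of `freqMatrix w V` the choice is `M = √Ω Uᵀ
w^(-1/2)`. Kinetic and potential forms then have the same diagonal `Ω`, the square roots of the
eigenvalues, so each mode is a standard oscillator. -/
theorem exists_normal_form {w : ι → ℝ} (hw : ∀ i, 0 < w i) {V : Matrix ι ι ℝ}
    (hA : (freqMatrix w V).PosDef) :
    ∃ (L : EuclideanSpace ℝ ι ≃L[ℝ] EuclideanSpace ℝ ι) (M : Matrix ι ι ℝ),
      (∀ x k, L x k = ∑ i, M k i * x i) ∧
      M * Matrix.diagonal w * M.transpose = Matrix.diagonal (fun i => √(hA.1.eigenvalues i)) ∧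
      M.transpose * Matrix.diagonal (fun i => √(hA.1.eigenvalues i)) * M = Matrix.diagonal w + V := by
  set Ω : ι → ℝ := fun i => √(hA.1.eigenvalues i) with hΩ
  have hΩ0 : ∀ i, 0 < Ω i := fun i => Real.sqrt_pos.mpr (hA.eigenvalues_pos i)
  set U : Matrix ι ι ℝ := (hA.1.eigenvectorUnitary : Matrix ι ι ℝ) with hU
  have hU1 : U.transpose * U = 1 := by
    have := Unitary.coe_star_mul_self hA.1.eigenvectorUnitary
    rwa [Matrix.star_eq_conjTranspose, Matrix.conjTranspose_eq_transpose_of_trivial] at this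
  have hspec : freqMatrix w V = U * Matrix.diagonal (fun i => Ω i * Ω i) * U.transpose := by
    have h := hA.1.spectral_theorem
    rw [Unitary.conjStarAlgAut_apply] at h
    have h2 : (fun i => Ω i * Ω i) = (RCLike.ofReal ∘ hA.1.eigenvalues : ι → ℝ) := by
      funext i
      simp only [hΩ, Function.comp_apply]
      rw [Real.mul_self_sqrt (hA.eigenvalues_pos i).le]
      rfl
    rw [h2]
    exact h
  set R : Matrix ι ι ℝ := Matrix.diagonal fun i => (√(w i))⁻¹ with hR
  set Q : Matrix ι ι ℝ := Matrix.diagonal fun i => √(Ω i) with hQ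
  have hsw : ∀ i, √(w i) ≠ 0 := fun i => (Real.sqrt_pos.mpr (hw i)).ne'
  have hQQ : Q * Q = Matrix.diagonal Ω := by
    rw [hQ, Matrix.diagonal_mul_diagonal]
    congr 1; funext i; exact Real.mul_self_sqrt (hΩ0 i).le
  have hRwR : R * Matrix.diagonal w * R = 1 := by
    rw [hR, Matrix.diagonal_mul_diagonal, Matrix.diagonal_mul_diagonal, ← Matrix.diagonal_one]
    congr 1; funext i
    have := Real.mul_self_sqrt (hw i).le
    have h3 := hsw i
    field_simp
    simpa [sq] using this.symm
  have hRs : R * Matrix.diagonal (fun i => √(w i)) = 1 := by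
    rw [hR, Matrix.diagonal_mul_diagonal, ← Matrix.diagonal_one]
    congr 1; funext i; exact inv_mul_cancel₀ (hsw i)
  have hsR : Matrix.diagonal (fun i => √(w i)) * R = 1 := by
    rw [hR, Matrix.diagonal_mul_diagonal, ← Matrix.diagonal_one]
    congr 1; funext i; exact mul_inv_cancel₀ (hsw i)
  set M := Q * U.transpose * R with hM
  have hMt : M.transpose = R * U * Q := by
    rw [hM, Matrix.transpose_mul, Matrix.transpose_mul, Matrix.transpose_transpose, hR, hQ,
      Matrix.diagonal_transpose, Matrix.diagonal_transpose, Matrix.mul_assoc]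
  have e1 : M * Matrix.diagonal w * M.transpose = Matrix.diagonal Ω := by
    rw [hMt, hM]
    calc Q * U.transpose * R * Matrix.diagonal w * (R * U * Q)
        = Q * U.transpose * (R * Matrix.diagonal w * R) * U * Q := by simp only [Matrix.mul_assoc]
      _ = Q * (U.transpose * U) * Q := by rw [hRwR]; simp only [Matrix.mul_assoc, Matrix.one_mul]
      _ = _ := by rw [hU1, Matrix.mul_one, hQQ]
  have e2 : M.transpose * Matrix.diagonal Ω * M = Matrix.diagonal w + V := by
    have hΩΩ : Q * Matrix.diagonal Ω * Q = Matrix.diagonal (fun i => Ω i * Ω i) := by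
      rw [hQ, Matrix.diagonal_mul_diagonal, Matrix.diagonal_mul_diagonal]
      congr 1; funext i
      have := Real.mul_self_sqrt (hΩ0 i).le
      linear_combination Ω i * this
    rw [hMt, hM]
    calc R * U * Q * Matrix.diagonal Ω * (Q * U.transpose * R)
        = R * (U * (Q * Matrix.diagonal Ω * Q) * U.transpose) * R := by simp only [Matrix.mul_assoc]
      _ = R * freqMatrix w V * R := by rw [hΩΩ, hspec]
      _ = (R * Matrix.diagonal (fun i => √(w i))) * (Matrix.diagonal w + V) *
          (Matrix.diagonal (fun i => √(w i)) * R) := by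
          rw [freqMatrix]; simp only [Matrix.mul_assoc]
      _ = _ := by rw [hRs, hsR, Matrix.one_mul, Matrix.mul_one]
  have hinj : Function.Injective (Matrix.toEuclideanLin M) := by
    have hdet : IsUnit M := by
      have : IsUnit (M * (Matrix.diagonal w * M.transpose)) := by
        rw [← Matrix.mul_assoc, e1, Matrix.isUnit_iff_isUnit_det, Matrix.det_diagonal]
        exact (Finset.prod_ne_zero_iff.mpr fun i _ => (hΩ0 i).ne').isUnit
      exact isUnit_of_mul_isUnit_left this
    have h := Matrix.mulVec_injective_of_isUnit hdet
    intro x y hxy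
    have h3 : M.mulVec x.ofLp = M.mulVec y.ofLp := by
      have := congrArg (fun z : EuclideanSpace ℝ ι => z.ofLp) hxy
      simpa [Matrix.toEuclideanLin] using this
    have := h h3
    ext i
    exact congrFun this i
  refine ⟨(LinearEquiv.ofInjectiveEndo _ hinj).toContinuousLinearEquiv, M, fun x k => ?_, e1, e2⟩
  simp [Matrix.toEuclideanLin, Matrix.mulVec, dotProduct]

/-- The trace of the heat semigroup of a system which is unitarily equivalent to a positive definite
quadratic Hamiltonian. -/
theorem hasHeatTrace_of_ladder {H : Type*} [NormedAddCommGroup H] [InnerProductSpace ℂ H]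
    [CompleteSpace H] (𝒢 : Submodule ℂ (H × H)) {v : (ι → ℕ) → H} (hv : Orthonormal ℂ v)
    {w : ι → ℝ} (hw : ∀ i, 0 < w i) {V : Matrix ι ι ℝ} (hA : (freqMatrix w V).PosDef)
    {κ e₀ t : ℝ} (hκ : 0 < κ) (ht : 0 < t)
    (hmem : ∀ α, (v α, (κ : ℂ) • ladderHam w V v α + (e₀ : ℂ) • v α) ∈ 𝒢)
    (hsymm : ∀ p ∈ 𝒢, ∀ p' ∈ 𝒢, inner ℂ p.2 p'.1 = inner ℂ p.1 p'.2)
    (hdom : ∀ p ∈ 𝒢, p.1 ∈ (Submodule.span ℂ (Set.range v)).topologicalClosure) :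
    HasHeatTrace (𝒢 : Set (H × H)) t (Real.exp (-t * e₀) *
      ∏ i, (2 * Real.sinh (t * κ * √(hA.1.eigenvalues i) / 2))⁻¹) := by
  obtain ⟨L, M, hL, h1, h2⟩ := exists_normal_form hw hA
  set Ω : ι → ℝ := fun i => √(hA.1.eigenvalues i) with hΩ
  have hΩ0 : ∀ i, 0 < Ω i := fun i => Real.sqrt_pos.mpr (hA.eigenvalues_pos i)
  -- The isometry which carries Hermite functions to the given family; the spectral problem is
  -- solved in `L²(ℝ^ι)` and transported.
  set U : Lp ℂ 2 (volume : Measure (EuclideanSpace ℝ ι)) →ₗᵢ[ℂ] H :=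
    hv.orthogonalFamily.linearIsometry.comp
      (hermiteBasis (ι := ι)).repr.toLinearIsometry with hU
  have hUv : ∀ α, U (toL2 (hermiteS α)) = v α := by
    intro α
    rw [← hermiteBasis_apply]
    change hv.orthogonalFamily.linearIsometry (hermiteBasis.repr (hermiteBasis α)) = v α
    rw [HilbertBasis.repr_self, OrthogonalFamily.linearIsometry_apply_single]
    simp
  refine ⟨hsymm, ι → ℕ, fun α => U (toL2 (hermiteComp L α)),
    fun α => κ * ∑ i, Ω i * (α i + 1 / 2) + e₀, (orthonormal_hermiteComp L).comp_linearIsometry U,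
    ?_, ?_, ?_⟩
  · have hdense : (Submodule.span ℂ (Set.range fun α : ι → ℕ => toL2 (hermiteComp L α))).topologicalClosure = ⊤ := by
      rw [Submodule.topologicalClosure_eq_top_iff]
      exact hermiteComp_total L
    have hsub : Submodule.span ℂ (Set.range v) ≤ (Submodule.span ℂ
        (Set.range fun α => U (toL2 (hermiteComp L α)))).topologicalClosure := by
      rw [Submodule.span_le]
      rintro _ ⟨α, rfl⟩
      have h3 := Submodule.topologicalClosure_map U.toContinuousLinearMap
        (Submodule.span ℂ (Set.range fun α : ι → ℕ => toL2 (hermiteComp L α)))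
      rw [hdense, Submodule.map_span, ← Set.range_comp] at h3
      rw [← hUv]
      exact h3 (Submodule.mem_map_of_mem (Submodule.mem_top (x := toL2 (hermiteS α))))
    intro p hp
    exact Submodule.topologicalClosure_minimal _ hsub
      (Submodule.isClosed_topologicalClosure _) (hdom p hp)
  · intro α
    -- An eigenvector is an infinite series in the given family, hence it lies only in the domain of
    -- the closure. Convergence of its expansion in the graph norm is what places the eigenpair in
    -- the closure of the graph.
    have hs := hasSum_quadHam w V (hermiteComp L α)
    have hT : quadHam w V (hermiteComp L α) = ((∑ i, Ω i * (α i + 1 / 2) : ℝ) : ℂ) • hermiteComp L α := by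
      have h3 : ∀ (c : ℂ) (f : 𝓢(EuclideanSpace ℝ ι, ℂ)), quadHam w V (c • f) = c • quadHam w V f := by
        intro c f
        have hdz : ∀ (m : EuclideanSpace ℝ ι) (f : 𝓢(EuclideanSpace ℝ ι, ℂ)), ∂_{m} f =
          LineDeriv.lineDerivOpCLM ℂ 𝓢(EuclideanSpace ℝ ι, ℂ) m f := fun m f => rfl
        simp only [quadHam, oscEnergy, hdz, map_smul, smul_add, Finset.smul_sum, smul_sub]
        simp only [smul_comm c]
      rw [hermiteComp, h3, quadHam_comp L hL h1 h2]
      simp only [oscEnergy_hermiteS, smul_smul, ← Finset.sum_smul, map_smul]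
      rw [mul_comm]
      push_cast
      rfl
    rw [hT] at hs
    have hcl : closure (𝒢 : Set (H × H)) = 𝒢.topologicalClosure := rfl
    set Φ : (Lp ℂ 2 (volume : Measure (EuclideanSpace ℝ ι)) ×
        Lp ℂ 2 (volume : Measure (EuclideanSpace ℝ ι))) →L[ℂ] H × H :=
      (U.toContinuousLinearMap.comp (ContinuousLinearMap.fst ℂ _ _)).prod
        ((κ : ℂ) • U.toContinuousLinearMap.comp (ContinuousLinearMap.snd ℂ _ _) +
          (e₀ : ℂ) • U.toContinuousLinearMap.comp (ContinuousLinearMap.fst ℂ _ _)) with hΦ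
    have hΦa : ∀ a b, Φ (a, b) = (U a, (κ : ℂ) • U b + (e₀ : ℂ) • U a) := fun a b => rfl
    have hs2 := Φ.hasSum hs
    rw [hΦa] at hs2
    have hmem2 : ∀ β, Φ (toL2 (hermiteS β), toL2 (quadHam w V (hermiteS β))) ∈ 𝒢 := by
      intro β
      rw [hΦa, quadHam_hermiteS, hUv]
      have h4 : U (toL2 (ladderHam w V hermiteS β)) = ladderHam w V v β := by
        have := map_ladderHam (U.toLinearMap ∘ₗ (toL2 (ι := ι)).toLinearMap) w V hermiteS β
        refine this.trans ?_
        congr 1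
        ext1 γ
        exact hUv γ
      rw [h4]
      exact hmem β
    have h5 : (U (toL2 (hermiteComp L α)), (κ : ℂ) • U (toL2 (((∑ i, Ω i * (α i + 1 / 2) : ℝ) : ℂ) •
        hermiteComp L α)) + (e₀ : ℂ) • U (toL2 (hermiteComp L α))) ∈ closure (𝒢 : Set (H × H)) := by
      refine mem_closure_of_tendsto hs2 (Eventually.of_forall fun s => ?_)
      refine Submodule.sum_mem _ fun β _ => ?_
      rw [map_smul]
      exact Submodule.smul_mem _ _ (hmem2 β)
    convert h5 using 2
    rw [map_smul, map_smul, smul_smul, ← add_smul]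
    push_cast
    rfl
  -- The zero-point energy `1/2` makes the geometric sum over the levels of one mode equal to `1/(2
  -- sinh)`.
  · have hgeo : ∀ i, HasSum (fun n : ℕ => Real.exp (-(t * κ * Ω i) * (n + 1 / 2)))
        (2 * Real.sinh (t * κ * Ω i / 2))⁻¹ := by
      intro i
      have ha : 0 < t * κ * Ω i := mul_pos (mul_pos ht hκ) (hΩ0 i)
      set a := t * κ * Ω i with haa
      have hg := (hasSum_geometric_of_lt_one (Real.exp_pos (-a)).le
        (by rw [← Real.exp_zero]; exact Real.exp_lt_exp.mpr (by linarith))).mul_left (Real.exp (-(a / 2)))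
      have e1 : (fun n : ℕ => Real.exp (-a * (n + 1 / 2))) =
          fun n : ℕ => Real.exp (-(a / 2)) * Real.exp (-a) ^ n := by
        funext n
        rw [← Real.exp_nat_mul, ← Real.exp_add]
        congr 1; ring
      have e2 : (2 * Real.sinh (a / 2))⁻¹ = Real.exp (-(a / 2)) * (1 - Real.exp (-a))⁻¹ := by
        rw [Real.sinh_eq]
        have h6 : Real.exp (-a) = Real.exp (-(a / 2)) * Real.exp (-(a / 2)) := by
          rw [← Real.exp_add]; ring_nf
        have h7 : Real.exp (a / 2) * Real.exp (-(a / 2)) = 1 := by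
          rw [← Real.exp_add]; simp
        have h8 : 2 * ((Real.exp (a / 2) - Real.exp (-(a / 2))) / 2) * Real.exp (-(a / 2)) =
          1 - Real.exp (-a) := by rw [h6]; linear_combination h7
        rw [← h8, mul_inv]
        field_simp
      rw [e1, e2]
      exact hg
    have hprod := (hasSum_prod_pi (fun i n => (Real.exp_pos _).le) hgeo).mul_left (Real.exp (-t * e₀))
    have e : (fun α : ι → ℕ => Real.exp (-t * (κ * ∑ i, Ω i * (α i + 1 / 2) + e₀))) =
        fun α : ι → ℕ => Real.exp (-t * e₀) * ∏ i, Real.exp (-(t * κ * Ω i) * (α i + 1 / 2)) := by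
      funext α
      rw [← Real.exp_sum, ← Real.exp_add, mul_add, Finset.mul_sum, Finset.mul_sum, add_comm]
      congr 2
      exact Finset.sum_congr rfl fun i _ => by ring
    rw [e]
    exact hprod

end HeatTrace

/-! ### Half-open cubes, their volumes and mean values -/

section Cubes

noncomputable instance cubeIndicesFintype (N : ℕ) : Fintype (cubeIndices N) :=
  (cubeIndices_finite N).fintype

theorem mem_cube_iff {N : ℕ} {z : Fin 3 → ℤ} {x : E3} : x ∈ cube N z ↔ cubeIndex N x = z := by
  simp [cube, cubeIndex, funext_iff]

theorem measurable_cubeIndex (N : ℕ) : Measurable (cubeIndex N) := by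
  refine measurable_pi_lambda _ fun i => Int.measurable_floor.comp ?_
  fun_prop

theorem measurableSet_cube (N : ℕ) (z : Fin 3 → ℤ) : MeasurableSet (cube N z) := by
  have : cube N z = cubeIndex N ⁻¹' {z} := by ext x; simp [mem_cube_iff]
  rw [this]
  exact measurable_cubeIndex N (measurableSet_singleton z)

theorem cube_eq_preimage {N : ℕ} (hN : 1 ≤ N) (z : Fin 3 → ℤ) :
    cube N z = (WithLp.ofLp : E3 → Fin 3 → ℝ) ⁻¹'
      Set.univ.pi fun i => Set.Ico ((z i : ℝ) / N) (((z i : ℝ) + 1) / N) := by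
  have hN0 : (0 : ℝ) < N := by exact_mod_cast hN
  ext x
  simp only [cube, Set.mem_preimage, Set.mem_pi, Set.mem_univ, true_implies, Set.mem_Ico]
  refine forall_congr' fun i => ?_
  rw [Int.floor_eq_iff, div_le_iff₀ hN0, lt_div_iff₀ hN0, mul_comm]

theorem volume_cube {N : ℕ} (hN : 1 ≤ N) (z : Fin 3 → ℤ) :
    volume (cube N z) = ENNReal.ofReal (cubeVol N) := by
  have hN0 : (0 : ℝ) < N := by exact_mod_cast hN
  rw [cube_eq_preimage hN, (PiLp.volume_preserving_ofLp (Fin 3)).measure_preimage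
    (MeasurableSet.univ_pi fun i => measurableSet_Ico).nullMeasurableSet, volume_pi_pi]
  have : ∀ i, volume (Set.Ico ((z i : ℝ) / N) (((z i : ℝ) + 1) / N)) = ENNReal.ofReal (1 / N) := by
    intro i
    rw [Real.volume_Ico]
    congr 1
    field_simp
    ring
  simp only [this, Finset.prod_const, Finset.card_univ, Fintype.card_fin]
  rw [← ENNReal.ofReal_pow (by positivity), cubeVol, one_div_pow]

theorem cubeVol_pos {N : ℕ} (hN : 1 ≤ N) : 0 < cubeVol N := by
  have hN0 : (0 : ℝ) < N := by exact_mod_cast hN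
  rw [cubeVol]; positivity

theorem volumeReal_cube {N : ℕ} (hN : 1 ≤ N) (z : Fin 3 → ℤ) :
    volume.real (cube N z) = cubeVol N := by
  rw [Measure.real, volume_cube hN, ENNReal.toReal_ofReal (cubeVol_pos hN).le]

theorem setIntegral_cube {N : ℕ} (hN : 1 ≤ N) (z : Fin 3 → ℤ) {F : Type*} [NormedAddCommGroup F]
    [NormedSpace ℝ F] (g : E3 → F) :
    ∫ x in cube N z, g x = cubeVol N • ⨍ x in cube N z, g x := by
  rw [setAverage_eq, volumeReal_cube hN, smul_smul, mul_inv_cancel₀ (cubeVol_pos hN).ne', one_smul]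

/-- A product of cubes in `(ℝ³)ⁿ`. -/
def piCube (N : ℕ) {n : ℕ} (s : Fin n → Fin 3 → ℤ) : Set (Fin n → E3) :=
  Set.univ.pi fun i => cube N (s i)

theorem measurableSet_piCube (N : ℕ) {n : ℕ} (s : Fin n → Fin 3 → ℤ) :
    MeasurableSet (piCube N s) := MeasurableSet.univ_pi fun i => measurableSet_cube N (s i)

theorem volume_piCube {N : ℕ} (hN : 1 ≤ N) {n : ℕ} (s : Fin n → Fin 3 → ℤ) :
    volume (piCube N s) = ENNReal.ofReal (cubeVol N ^ n) := by
  rw [piCube, volume_pi_pi]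
  simp [volume_cube hN, ENNReal.ofReal_pow (cubeVol_pos hN).le]

theorem volumeReal_piCube {N : ℕ} (hN : 1 ≤ N) {n : ℕ} (s : Fin n → Fin 3 → ℤ) :
    volume.real (piCube N s) = cubeVol N ^ n := by
  rw [Measure.real, volume_piCube hN, ENNReal.toReal_ofReal (pow_pos (cubeVol_pos hN) n).le]

theorem mem_piCube_iff {N : ℕ} {n : ℕ} {s : Fin n → Fin 3 → ℤ} {k : Fin n → E3} :
    k ∈ piCube N s ↔ ∀ i, cubeIndex N (k i) = s i := by
  simp [piCube, mem_cube_iff]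

theorem average_piCube_eval {N : ℕ} (hN : 1 ≤ N) {n : ℕ} (s : Fin n → Fin 3 → ℤ) (j : Fin n)
    (g : E3 → ℂ) : ⨍ k in piCube N s, g (k j) = ⨍ x in cube N (s j), g x := by
  have hV := (cubeVol_pos hN).ne'
  have h1 : ∫ k in piCube N s, g (k j) = (cubeVol N : ℂ) ^ (n - 1) * ∫ x in cube N (s j), g x := by
    have h2 : ∀ k : Fin n → E3, g (k j) = ∏ i, (if i = j then g else fun _ => 1) (k i) := by
      intro k
      rw [← Finset.mul_prod_erase _ _ (Finset.mem_univ j), if_pos rfl, Finset.prod_eq_one, mul_one]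
      intro i hi
      rw [if_neg (Finset.ne_of_mem_erase hi)]
    simp_rw [h2]
    rw [piCube, volume_pi, Measure.restrict_pi_pi]
    rw [integral_fintype_prod_eq_prod (fun i => (if i = j then g else fun _ => (1 : ℂ))),
      ← Finset.mul_prod_erase _ _ (Finset.mem_univ j), if_pos rfl, mul_comm]
    congr 1
    rw [Finset.prod_congr rfl (g := fun _ => (cubeVol N : ℂ)), Finset.prod_const,
      Finset.card_erase_of_mem (Finset.mem_univ j), Finset.card_univ, Fintype.card_fin]
    intro i hi
    rw [if_neg (Finset.ne_of_mem_erase hi)]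
    simp [volumeReal_cube hN]
  rw [setAverage_eq, h1, setAverage_eq, volumeReal_piCube hN, volumeReal_cube hN]
  obtain ⟨m, rfl⟩ : ∃ m, n = m + 1 := ⟨n - 1, by have := j.2; omega⟩
  simp only [Nat.add_sub_cancel, Complex.real_smul, Complex.ofReal_inv, Complex.ofReal_pow]
  have hVC : (cubeVol N : ℂ) ≠ 0 := by exact_mod_cast hV
  field_simp
  ring

theorem integrableOn_piCube_eval {N : ℕ} {n : ℕ} (hN : 1 ≤ N) (s : Fin n → Fin 3 → ℤ) (j : Fin n)
    {g : E3 → ℂ} (hg : IntegrableOn g (cube N (s j))) :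
    IntegrableOn (fun k => g (k j)) (piCube N s) := by
  rw [IntegrableOn, piCube, volume_pi, Measure.restrict_pi_pi]
  have : ∀ i, IsFiniteMeasure (volume.restrict (cube N (s i))) := fun i =>
    ⟨by rw [Measure.restrict_apply_univ, volume_cube hN]; exact ENNReal.ofReal_lt_top⟩
  have h2 : (fun k : Fin n → E3 => g (k j)) = fun k => ∏ i, (if i = j then g else fun _ => 1) (k i) := by
    funext k
    rw [← Finset.mul_prod_erase _ _ (Finset.mem_univ j), if_pos rfl, Finset.prod_eq_one, mul_one]
    intro i hi
    rw [if_neg (Finset.ne_of_mem_erase hi)]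
  rw [h2]
  refine Integrable.fintype_prod_dep (f := fun i => (if i = j then g else fun _ => (1 : ℂ))) fun i => ?_
  by_cases h : i = j
  · subst h; rw [if_pos rfl]; exact hg
  · simp only [if_neg h]
    exact integrable_const _

theorem average_ofReal_cube (N : ℕ) (z : Fin 3 → ℤ) (g : E3 → ℝ) :
    ⨍ x in cube N z, (g x : ℂ) = ((⨍ x in cube N z, g x : ℝ) : ℂ) := by
  rw [setAverage_eq, setAverage_eq, integral_complex_ofReal]
  simp

end Cubes

/-! ### Occupation number states and the compressed field operators -/

section Occupation

/-- All wave vectors of the configuration lie in the cubes meeting the ball. -/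
def InCubes (N : ℕ) (x : FockConf) : Prop := ∀ i, cubeIndex N (x.2 i) ∈ cubeIndices N

/-- The occupation numbers of the cubes. -/
noncomputable def occupation (N : ℕ) (x : FockConf) (z : cubeIndices N) : ℕ :=
  ∑ i, if cubeIndex N (x.2 i) = z then 1 else 0

variable {N : ℕ}

theorem sum_apply_cubeIndex {x : FockConf} (hx : InCubes N x) {M : Type*} [AddCommMonoid M]
    (f : (Fin 3 → ℤ) → M) : ∑ i, f (cubeIndex N (x.2 i)) = ∑ z : cubeIndices N, occupation N x z • f z := by
  have h1 : ∀ i, f (cubeIndex N (x.2 i)) =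
      ∑ z : cubeIndices N, (if cubeIndex N (x.2 i) = z then 1 else 0 : ℕ) • f z := by
    intro i
    rw [Finset.sum_eq_single ⟨_, hx i⟩]
    · simp
    · intro z _ hz
      rw [if_neg, zero_smul]
      rintro h
      exact hz (Subtype.ext h.symm)
    · simp
  simp_rw [h1]
  rw [Finset.sum_comm]
  simp_rw [← Finset.sum_smul]
  rfl

theorem sum_occupation {x : FockConf} (hx : InCubes N x) : ∑ z, occupation N x z = x.1 := by
  have := sum_apply_cubeIndex hx (fun _ => (1 : ℕ))
  simpa using this.symm

theorem occupation_succAbove {n : ℕ} {k : Fin (n + 1) → E3} (hk : InCubes N ⟨n + 1, k⟩)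
    (j : Fin (n + 1)) : occupation N ⟨n + 1, k⟩ =
      occupation N ⟨n, fun i => k (j.succAbove i)⟩ + Pi.single ⟨_, hk j⟩ 1 := by
  funext z
  simp only [occupation, Pi.add_apply]
  rw [Fin.sum_univ_succAbove _ j, add_comm]
  congr 1
  rw [Pi.single_apply]
  by_cases h : cubeIndex N (k j) = z
  · rw [if_pos h, if_pos (Subtype.ext h.symm)]
  · rw [if_neg h, if_neg (fun h' => h (by rw [h']))]

theorem inCubes_succAbove {n : ℕ} {k : Fin (n + 1) → E3} (hk : InCubes N ⟨n + 1, k⟩)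
    (j : Fin (n + 1)) : InCubes N ⟨n, fun i => k (j.succAbove i)⟩ := fun i => hk (j.succAbove i)

/-- The normalization constant of an occupation number state. -/
noncomputable def modeConst (N : ℕ) (a : cubeIndices N → ℕ) : ℝ :=
  √((∏ z, ((a z).factorial : ℝ)) / ((∑ z, a z).factorial * cubeVol N ^ (∑ z, a z)))

theorem modeConst_pos (hN : 1 ≤ N) (a : cubeIndices N → ℕ) : 0 < modeConst N a := by
  have := cubeVol_pos hN
  refine Real.sqrt_pos.mpr (div_pos (Finset.prod_pos fun z _ => ?_) (by positivity))
  exact_mod_cast Nat.factorial_pos _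

theorem prod_factorial_add_single {J : Type*} [Fintype J] [DecidableEq J] (a : J → ℕ) (z : J) :
    ∏ y, (((a + Pi.single z 1 : J → ℕ) y).factorial) = (a z + 1) * ∏ y, (a y).factorial := by
  rw [← Finset.mul_prod_erase _ _ (Finset.mem_univ z), ← Finset.mul_prod_erase _ (fun y => (a y).factorial)
    (Finset.mem_univ z), ← mul_assoc]
  congr 1
  · simp [Nat.factorial_succ]
  · exact Finset.prod_congr rfl fun y hy => by simp [Finset.ne_of_mem_erase hy]

/-- This ratio of normalizations turns the combinatorial factors of creation and annihilation into
the oscillator factors `√(a z + 1)` and `√(a z)`, each with one `√V`. -/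
theorem modeConst_add_single (hN : 1 ≤ N) (a : cubeIndices N → ℕ) (z : cubeIndices N) :
    √(cubeVol N) * √((∑ y, a y : ℕ) + 1) * modeConst N (a + Pi.single z 1) =
      √((a z : ℝ) + 1) * modeConst N a := by
  have hV := cubeVol_pos hN
  have hs : ∑ y, (a + Pi.single z 1 : cubeIndices N → ℕ) y = ∑ y, a y + 1 := by
    simp [Finset.sum_add_distrib]
  have hp : ∏ y, (((a + Pi.single z 1 : cubeIndices N → ℕ) y).factorial : ℝ) =
      ((a z : ℝ) + 1) * ∏ y, ((a y).factorial : ℝ) := by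
    exact_mod_cast prod_factorial_add_single a z
  rw [modeConst, modeConst, hs, hp, ← Real.sqrt_mul hV.le, ← Real.sqrt_mul (by positivity),
    ← Real.sqrt_mul (by positivity)]
  congr 1
  rw [Nat.factorial_succ, pow_succ]
  push_cast
  field_simp

open Classical in
/-- The normalized occupation number state, for given occupation numbers of the cubes. -/
noncomputable def modeFun (N : ℕ) (a : cubeIndices N → ℕ) (x : FockConf) : ℂ :=
  if InCubes N x ∧ occupation N x = a then (modeConst N a : ℂ) else 0

theorem modeFun_of_not_inCubes {x : FockConf} (hx : ¬ InCubes N x) (a : cubeIndices N → ℕ) :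
    modeFun N a x = 0 := by
  simp [modeFun, hx]

theorem modeFun_of_inCubes {x : FockConf} (hx : InCubes N x) (a : cubeIndices N → ℕ) :
    modeFun N a x = if occupation N x = a then (modeConst N a : ℂ) else 0 := by
  simp [modeFun, hx]

theorem inCubes_congr {n : ℕ} {k k' : Fin n → E3} (h : ∀ i, cubeIndex N (k i) = cubeIndex N (k' i)) :
    InCubes N ⟨n, k⟩ ↔ InCubes N ⟨n, k'⟩ := by
  simp only [InCubes, h]

theorem occupation_congr {n : ℕ} {k k' : Fin n → E3} (h : ∀ i, cubeIndex N (k i) = cubeIndex N (k' i)) :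
    occupation N ⟨n, k⟩ = occupation N ⟨n, k'⟩ := by
  funext z; simp only [occupation, h]

theorem modeFun_congr {n : ℕ} {k k' : Fin n → E3} (h : ∀ i, cubeIndex N (k i) = cubeIndex N (k' i))
    (a : cubeIndices N → ℕ) : modeFun N a ⟨n, k⟩ = modeFun N a ⟨n, k'⟩ := by
  unfold modeFun
  rw [inCubes_congr h, occupation_congr h]

theorem fockProj_of_not_inCubes {F : FockConf → ℂ} {x : FockConf} (hx : ¬ InCubes N x) :
    fockProj N F x = 0 := by
  obtain ⟨n, k⟩ := x
  exact if_neg hx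

theorem fockProj_of_inCubes {F : FockConf → ℂ} {n : ℕ} {k : Fin n → E3} (hx : InCubes N ⟨n, k⟩) :
    fockProj N F ⟨n, k⟩ = ⨍ k' in piCube N (fun i => cubeIndex N (k i)), F ⟨n, k'⟩ := by
  exact if_pos hx

/-- Functions on Fock space which are integrable over products of cubes. -/
def CubeIntegrable (N : ℕ) (F : FockConf → ℂ) : Prop :=
  ∀ (n : ℕ) (s : Fin n → Fin 3 → ℤ), IntegrableOn (fun k => F ⟨n, k⟩) (piCube N s)

theorem CubeIntegrable.add {F G : FockConf → ℂ} (hF : CubeIntegrable N F) (hG : CubeIntegrable N G) :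
    CubeIntegrable N (fun x => F x + G x) := fun n s => (hF n s).add (hG n s)

theorem CubeIntegrable.const_mul {F : FockConf → ℂ} (hF : CubeIntegrable N F) (c : ℂ) :
    CubeIntegrable N (fun x => c * F x) := fun n s => (hF n s).const_mul c

theorem cubeIntegrable_zero : CubeIntegrable N (fun _ => 0) := fun _ _ => integrableOn_zero

theorem fockProj_add {F G : FockConf → ℂ} (hF : CubeIntegrable N F) (hG : CubeIntegrable N G) :
    fockProj N (fun x => F x + G x) = fun x => fockProj N F x + fockProj N G x := by
  funext ⟨n, k⟩
  by_cases hx : InCubes N ⟨n, k⟩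
  · simp only [fockProj_of_inCubes hx, setAverage_eq]
    rw [integral_add (hF n _) (hG n _), smul_add]
  · simp [fockProj_of_not_inCubes hx]

theorem fockProj_const_mul (c : ℂ) (F : FockConf → ℂ) :
    fockProj N (fun x => c * F x) = fun x => c * fockProj N F x := by
  funext ⟨n, k⟩
  by_cases hx : InCubes N ⟨n, k⟩
  · simp only [fockProj_of_inCubes hx, setAverage_eq]
    rw [integral_const_mul, mul_smul_comm]
  · simp [fockProj_of_not_inCubes hx]

theorem average_piCube_const (hN : 1 ≤ N) {n : ℕ} (s : Fin n → Fin 3 → ℤ) (c : ℂ) :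
    ⨍ _ in piCube N s, c = c := by
  refine setAverage_const ?_ ?_ c
  · rw [volume_piCube hN]
    exact (ENNReal.ofReal_pos.mpr (pow_pos (cubeVol_pos hN) n)).ne'
  · rw [volume_piCube hN]; exact ENNReal.ofReal_ne_top

/-- A function which is constant on products of cubes is reproduced by the projection. -/
theorem fockProj_eq_of_forall (hN : 1 ≤ N) {F : FockConf → ℂ} {n : ℕ} {k : Fin n → E3}
    (hx : InCubes N ⟨n, k⟩) {c : ℂ}
    (h : ∀ k' : Fin n → E3, (∀ i, cubeIndex N (k' i) = cubeIndex N (k i)) → F ⟨n, k'⟩ = c) :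
    fockProj N F ⟨n, k⟩ = c := by
  rw [fockProj_of_inCubes hx, ← average_piCube_const hN (fun i => cubeIndex N (k i)) c]
  refine setAverage_congr_fun (measurableSet_piCube N _) (Eventually.of_forall fun k' hk' => ?_)
  exact h k' (mem_piCube_iff.mp hk')

theorem fockProj_modeFun (hN : 1 ≤ N) (a : cubeIndices N → ℕ) :
    fockProj N (modeFun N a) = modeFun N a := by
  funext ⟨n, k⟩
  by_cases hx : InCubes N ⟨n, k⟩
  · exact fockProj_eq_of_forall hN hx fun k' hk' => modeFun_congr hk' a
  · rw [fockProj_of_not_inCubes hx, modeFun_of_not_inCubes hx]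

theorem cubeIntegrable_modeFun (hN : 1 ≤ N) (a : cubeIndices N → ℕ) :
    CubeIntegrable N (modeFun N a) := by
  intro n s
  have hfin : volume (piCube N s) ≠ ⊤ := by rw [volume_piCube hN]; exact ENNReal.ofReal_ne_top
  by_cases h : ∃ k, k ∈ piCube N s
  · obtain ⟨k, hk⟩ := h
    refine (integrableOn_const (C := modeFun N a ⟨n, k⟩) hfin).congr_fun (fun k' hk' => ?_)
      (measurableSet_piCube N s)
    have hkk : ∀ i, cubeIndex N (k' i) = cubeIndex N (k i) := fun i => by
      rw [mem_piCube_iff.mp hk i, mem_piCube_iff.mp hk' i]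
    exact (modeFun_congr hkk a).symm
  · rw [Set.not_nonempty_iff_eq_empty.mp h]
    exact integrableOn_empty

/-- Averaging over a product of cubes replaces each `w(k_j)` by its mean over the cube containing
`k_j`. The result depends on the occupation numbers only, so the state becomes an eigenvector. -/
theorem fockProj_dGamma (hN : 1 ≤ N) {w : E3 → ℝ} (hw : ∀ z, IntegrableOn w (cube N z))
    (a : cubeIndices N → ℕ) : fockProj N (dGamma w (modeFun N a)) =
      fun x => ((∑ z : cubeIndices N, (a z : ℝ) * ⨍ k in cube N z, w k : ℝ) : ℂ) * modeFun N a x := by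
  funext ⟨n, k⟩
  by_cases hx : InCubes N ⟨n, k⟩
  · rw [fockProj_of_inCubes hx]
    have h1 : ⨍ k' in piCube N (fun i => cubeIndex N (k i)), dGamma w (modeFun N a) ⟨n, k'⟩ =
        ⨍ k' in piCube N (fun i => cubeIndex N (k i)), (∑ j, (w (k' j) : ℂ)) * modeFun N a ⟨n, k⟩ := by
      refine setAverage_congr_fun (measurableSet_piCube N _) (Eventually.of_forall fun k' hk' => ?_)
      rw [dGamma, modeFun_congr (mem_piCube_iff.mp hk') a]
      push_cast
      rfl
    have h3 : ∀ j ∈ (Finset.univ : Finset (Fin n)), Integrable (fun k' : Fin n → E3 => (w (k' j) : ℂ))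
        (volume.restrict (piCube N fun i => cubeIndex N (k i))) := fun j _ =>
      integrableOn_piCube_eval (g := fun x => (w x : ℂ)) hN _ j (hw _).ofReal
    rw [h1, setAverage_eq, integral_mul_const, ← smul_mul_assoc, integral_finsetSum _ h3,
      Finset.smul_sum]
    have h2 : ∀ j, (volume.real (piCube N fun i => cubeIndex N (k i)))⁻¹ •
        ∫ k' in piCube N (fun i => cubeIndex N (k i)), (w (k' j) : ℂ) =
        ((⨍ x in cube N (cubeIndex N (k j)), w x : ℝ) : ℂ) := by
      intro j
      rw [← setAverage_eq, average_piCube_eval hN _ j (fun x => (w x : ℂ)), average_ofReal_cube]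
    simp_rw [h2]
    rw [sum_apply_cubeIndex hx (fun z => ((⨍ x in cube N z, w x : ℝ) : ℂ)), modeFun_of_inCubes hx]
    by_cases ho : occupation N ⟨n, k⟩ = a
    · rw [ho]; push_cast; simp
    · simp [ho]
  · rw [fockProj_of_not_inCubes hx, modeFun_of_not_inCubes hx, mul_zero]

theorem cubeIntegrable_dGamma (hN : 1 ≤ N) {w : E3 → ℝ} (hw : ∀ z, IntegrableOn w (cube N z))
    (a : cubeIndices N → ℕ) : CubeIntegrable N (dGamma w (modeFun N a)) := by
  intro n s
  by_cases h : ∃ k, k ∈ piCube N s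
  · obtain ⟨k, hk⟩ := h
    have h2 : IntegrableOn (fun k' : Fin n → E3 => (∑ j, (w (k' j) : ℂ)) * modeFun N a ⟨n, k⟩)
        (piCube N s) :=
      (integrable_finsetSum _ fun j _ => integrableOn_piCube_eval (g := fun x => (w x : ℂ)) hN _ j (hw _).ofReal).mul_const _
    refine h2.congr_fun (fun k' hk' => ?_) (measurableSet_piCube N s)
    simp only [dGamma]
    have hkk : ∀ i, cubeIndex N (k' i) = cubeIndex N (k i) := fun i => by
      rw [mem_piCube_iff.mp hk i, mem_piCube_iff.mp hk' i]
    rw [modeFun_congr hkk a]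
    push_cast
    rfl
  · rw [Set.not_nonempty_iff_eq_empty.mp h]
    exact integrableOn_empty

/-- In a configuration with occupation `a + e_z`, exactly `a z + 1` particles can be the added one,
namely those in the cube `z`. Each contributes the mean of `g` there, and the prefactor `1/√(n+1)`
combines with the change of normalization to `√V √(a z + 1)`. -/
theorem fockProj_creation (hN : 1 ≤ N) {g : E3 → ℝ} (hg : ∀ z, IntegrableOn g (cube N z))
    (a : cubeIndices N → ℕ) : fockProj N (creation g (modeFun N a)) =
      fun x => ∑ z : cubeIndices N, ((√(cubeVol N) * √((a z : ℝ) + 1) * ⨍ k in cube N z, g k : ℝ) : ℂ) *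
        modeFun N (a + Pi.single z 1) x := by
  classical
  funext ⟨n, k⟩
  by_cases hx : InCubes N ⟨n, k⟩
  · rw [fockProj_of_inCubes hx]
    match n, k, hx with
    | 0, k, hx =>
      have h0 : occupation N ⟨0, k⟩ = 0 := by funext z; simp [occupation]
      rw [Finset.sum_eq_zero]
      · simp [creation]
      · intro z _
        rw [modeFun_of_inCubes hx, if_neg, mul_zero]
        rw [h0]
        intro h
        have := congrFun h z
        simp at this
    | n + 1, k, hx =>
      have h1 : ⨍ k' in piCube N (fun i => cubeIndex N (k i)), creation g (modeFun N a) ⟨n + 1, k'⟩ =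
          ⨍ k' in piCube N (fun i => cubeIndex N (k i)), ((1 / √((n : ℝ) + 1) : ℝ) : ℂ) *
          ∑ j, (g (k' j) : ℂ) * modeFun N a ⟨n, fun i => k (j.succAbove i)⟩ := by
        refine setAverage_congr_fun (measurableSet_piCube N _) (Eventually.of_forall fun k' hk' => ?_)
        rw [creation]
        congr 1
        refine Finset.sum_congr rfl fun j _ => ?_
        congr 1
        exact modeFun_congr (fun i => mem_piCube_iff.mp hk' (j.succAbove i)) a
      have h3 : ∀ j ∈ (Finset.univ : Finset (Fin (n + 1))), Integrable (fun k' : Fin (n + 1) → E3 =>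
          (g (k' j) : ℂ) * modeFun N a ⟨n, fun i => k (j.succAbove i)⟩)
          (volume.restrict (piCube N fun i => cubeIndex N (k i))) := fun j _ =>
        (integrableOn_piCube_eval (g := fun x => (g x : ℂ)) hN _ j (hg _).ofReal).mul_const _
      rw [h1, setAverage_eq, integral_const_mul, ← mul_smul_comm, integral_finsetSum _ h3,
        Finset.smul_sum]
      -- The contribution of a particle is written as a function of its cube alone, set to `0` off
      -- `cubeIndices N`, so that the sum over particles can be regrouped by occupation numbers.
      let f : (Fin 3 → ℤ) → ℂ := fun z =>
        ((⨍ x in cube N z, g x : ℝ) : ℂ) * (if h : z ∈ cubeIndices N then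
          (if occupation N ⟨n + 1, k⟩ = a + Pi.single ⟨z, h⟩ 1 then (modeConst N a : ℂ) else 0) else 0)
      have hf : ∀ z, f z = ((⨍ x in cube N z, g x : ℝ) : ℂ) * (if h : z ∈ cubeIndices N then
          (if occupation N ⟨n + 1, k⟩ = a + Pi.single ⟨z, h⟩ 1 then (modeConst N a : ℂ) else 0)
          else 0) := fun _ => rfl
      clear_value f
      have h2 : ∀ j : Fin (n + 1), (volume.real (piCube N fun i => cubeIndex N (k i)))⁻¹ •
          ∫ k' in piCube N (fun i => cubeIndex N (k i)), (g (k' j) : ℂ) *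
            modeFun N a ⟨n, fun i => k (j.succAbove i)⟩ =
          f (cubeIndex N (k j)) := by
        intro j
        rw [hf]
        rw [integral_mul_const, ← smul_mul_assoc, ← setAverage_eq,
          average_piCube_eval hN _ j (fun x => (g x : ℂ)), average_ofReal_cube]
        simp only [dif_pos (hx j)]
        rw [modeFun_of_inCubes (inCubes_succAbove hx j), occupation_succAbove hx j]
        simp only [add_left_inj]
      simp_rw [h2]
      rw [sum_apply_cubeIndex hx, Finset.mul_sum]
      refine Finset.sum_congr rfl fun z _ => ?_
      rw [modeFun_of_inCubes hx, hf]
      simp only [dif_pos z.2]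
      by_cases ho : occupation N ⟨n + 1, k⟩ = a + Pi.single z 1
      · have hn : ∑ y, a y = n := by
          have h3 := sum_occupation hx
          rw [ho] at h3
          simpa [Finset.sum_add_distrib] using h3
        have hoz : occupation N ⟨n + 1, k⟩ z = a z + 1 := by rw [ho]; simp
        rw [if_pos ho, if_pos ho, hoz]
        have h3 := modeConst_add_single hN a z
        rw [hn] at h3
        have h4 : √((a z : ℝ) + 1) * √((a z : ℝ) + 1) = a z + 1 := Real.mul_self_sqrt (by positivity)
        have h5 : √((n : ℝ) + 1) ≠ 0 := by positivity
        have h6 : 1 / √((n : ℝ) + 1) * ((a z + 1) * ((⨍ x in cube N z, g x) * modeConst N a)) =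
            √(cubeVol N) * √((a z : ℝ) + 1) * (⨍ x in cube N z, g x) *
              modeConst N (a + Pi.single z 1) := by
          rw [div_mul_eq_mul_div, div_eq_iff h5]
          linear_combination (-(⨍ x in cube N z, g x) * √((a z : ℝ) + 1)) * h3 -
            (⨍ x in cube N z, g x) * modeConst N a * h4
        rw [nsmul_eq_mul]
        exact_mod_cast congrArg Complex.ofReal h6
      · rw [if_neg ho, if_neg ho]; simp
  · rw [fockProj_of_not_inCubes hx, Finset.sum_eq_zero]
    intro z _
    rw [modeFun_of_not_inCubes hx, mul_zero]

theorem cubeIntegrable_creation (hN : 1 ≤ N) {g : E3 → ℝ} (hg : ∀ z, IntegrableOn g (cube N z))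
    (a : cubeIndices N → ℕ) : CubeIntegrable N (creation g (modeFun N a)) := by
  intro n s
  by_cases h : ∃ k, k ∈ piCube N s
  · obtain ⟨k, hk⟩ := h
    match n, s, k, hk with
    | 0, s, k, hk => exact integrableOn_zero
    | n + 1, s, k, hk =>
      have h2 : IntegrableOn (fun k' : Fin (n + 1) → E3 => ((1 / √((n : ℝ) + 1) : ℝ) : ℂ) *
          ∑ j, (g (k' j) : ℂ) * modeFun N a ⟨n, fun i => k (j.succAbove i)⟩) (piCube N s) :=
        (integrable_finsetSum _ fun j _ =>
          (integrableOn_piCube_eval (g := fun x => (g x : ℂ)) hN _ j (hg _).ofReal).mul_const _).const_mul _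
      refine h2.congr_fun (fun k' hk' => ?_) (measurableSet_piCube N s)
      simp only [creation]
      congr 1
      refine Finset.sum_congr rfl fun j _ => ?_
      have hkk : ∀ i, cubeIndex N (k i) = cubeIndex N (k' i) := fun i => by
        rw [mem_piCube_iff.mp hk i, mem_piCube_iff.mp hk' i]
      rw [modeFun_congr (fun i => hkk (j.succAbove i)) a]
  · rw [Set.not_nonempty_iff_eq_empty.mp h]
    exact integrableOn_empty

theorem modeFun_cons (a : cubeIndices N → ℕ) {n : ℕ} {k : Fin n → E3} (hk : InCubes N ⟨n, k⟩) (x : E3) :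
    modeFun N a ⟨n + 1, Fin.cons x k⟩ = ∑ z : cubeIndices N, (cube N z).indicator
      (fun _ => if occupation N ⟨n, k⟩ + Pi.single z 1 = a then (modeConst N a : ℂ) else 0) x := by
  by_cases hx : cubeIndex N x ∈ cubeIndices N
  · have hc : InCubes N ⟨n + 1, (Fin.cons x k : Fin (n + 1) → E3)⟩ := by
      intro i
      refine Fin.cases ?_ (fun i => ?_) i
      · simpa using hx
      · simpa using hk i
    rw [modeFun_of_inCubes hc, Finset.sum_eq_single ⟨_, hx⟩]
    · rw [Set.indicator_of_mem (mem_cube_iff.mpr rfl), occupation_succAbove hc 0]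
      simp
    · intro z _ hz
      refine Set.indicator_of_notMem (fun h => hz ?_) _
      exact Subtype.ext (mem_cube_iff.mp h).symm
    · simp
  · rw [modeFun_of_not_inCubes, Finset.sum_eq_zero]
    · intro z _
      refine Set.indicator_of_notMem (fun h => hx ?_) _
      rw [mem_cube_iff.mp h]; exact z.2
    · intro h
      exact hx (by simpa using h 0)

theorem annihilation_modeFun_integrable {g : E3 → ℝ} (hg : ∀ z, IntegrableOn g (cube N z))
    (a : cubeIndices N → ℕ) (n : ℕ) (k : Fin n → E3) :
    Integrable fun x : E3 => (g x : ℂ) * modeFun N a ⟨n + 1, Fin.cons x k⟩ := by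
  by_cases hk : InCubes N ⟨n, k⟩
  · simp_rw [modeFun_cons a hk, Finset.mul_sum]
    refine integrable_finsetSum _ fun z _ => ?_
    set c : ℂ := if occupation N ⟨n, k⟩ + Pi.single z 1 = a then (modeConst N a : ℂ) else 0
    have : (fun x => (g x : ℂ) * (cube N z).indicator (fun _ => c) x) =
        (cube N z).indicator fun x => (g x : ℂ) * c := by
      funext x
      by_cases hx : x ∈ cube N z <;> simp [hx]
    rw [this, integrable_indicator_iff (measurableSet_cube N z)]
    exact (hg z).ofReal.mul_const c
  · have : ∀ x : E3, modeFun N a ⟨n + 1, Fin.cons x k⟩ = 0 := by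
      intro x
      refine modeFun_of_not_inCubes (fun h => hk fun i => ?_) a
      simpa using h i.succ
    simp [this]

/-- The integration over the removed particle splits into the cubes. A cube `z` contributes only if
the remaining particles have occupation `a - e_z`; the volume `V` from the integral becomes `√V`
after the change of normalization. -/
theorem annihilation_modeFun (hN : 1 ≤ N) {g : E3 → ℝ} (hg : ∀ z, IntegrableOn g (cube N z))
    (a : cubeIndices N → ℕ) {n : ℕ} {k : Fin n → E3} (hk : InCubes N ⟨n, k⟩) :
    annihilation g (modeFun N a) ⟨n, k⟩ =
      ∑ z : cubeIndices N, ((√(cubeVol N) * √(a z : ℝ) * ⨍ k in cube N z, g k : ℝ) : ℂ) *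
        modeFun N (a - Pi.single z 1) ⟨n, k⟩ := by
  have hV := cubeVol_pos hN
  rw [annihilation]
  simp_rw [modeFun_cons a hk, Finset.mul_sum]
  have h1 : ∀ z : cubeIndices N, ∀ c : ℂ, (fun x => (g x : ℂ) * (cube N z).indicator (fun _ => c) x) =
      (cube N z).indicator fun x => (g x : ℂ) * c := by
    intro z c
    funext x
    by_cases hx : x ∈ cube N z <;> simp [hx]
  rw [integral_finsetSum, Finset.mul_sum]
  · refine Finset.sum_congr rfl fun z _ => ?_
    rw [h1, integral_indicator (measurableSet_cube N z), integral_mul_const, setIntegral_cube hN,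
      average_ofReal_cube, modeFun_of_inCubes hk]
    by_cases hz : a z = 0
    · rw [if_neg]
      · simp [hz]
      · intro h
        have := congrFun h z
        simp [hz] at this
    · have hiff : occupation N ⟨n, k⟩ + Pi.single z 1 = a ↔ occupation N ⟨n, k⟩ = a - Pi.single z 1 := by
        constructor
        · intro h; rw [← h, multiIndex_add_sub]
        · intro h; rw [h, multiIndex_sub_add hz]
      by_cases ho : occupation N ⟨n, k⟩ = a - Pi.single z 1
      · rw [if_pos (hiff.mpr ho), if_pos ho]
        have h3 := modeConst_add_single hN (a - Pi.single z 1) z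
        rw [multiIndex_sub_add hz] at h3
        have hn : ∑ y, (a - Pi.single z 1 : cubeIndices N → ℕ) y = n := by
          rw [← ho]; exact sum_occupation hk
        have haz : (((a - Pi.single z 1 : cubeIndices N → ℕ) z : ℕ) : ℝ) + 1 = a z := by
          simp only [Pi.sub_apply, Pi.single_eq_same]
          have : 1 ≤ a z := by omega
          push_cast [this]; ring
        rw [hn, haz] at h3
        have h4 : √(cubeVol N) * √(cubeVol N) = cubeVol N := Real.mul_self_sqrt hV.le
        have h5 : √((n : ℝ) + 1) * (cubeVol N * (⨍ x in cube N z, g x) * modeConst N a) =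
            √(cubeVol N) * √(a z : ℝ) * (⨍ x in cube N z, g x) * modeConst N (a - Pi.single z 1) := by
          linear_combination (√(cubeVol N) * (⨍ x in cube N z, g x)) * h3 -
            (√((n : ℝ) + 1) * (⨍ x in cube N z, g x) * modeConst N a) * h4
        rw [Complex.real_smul]
        exact_mod_cast congrArg Complex.ofReal h5
      · rw [if_neg (fun h => ho (hiff.mp h)), if_neg ho]; simp
  · intro z _
    rw [h1, integrable_indicator_iff (measurableSet_cube N z)]
    exact (hg z).ofReal.mul_const _

/-- Annihilation keeps an occupation number state constant on products of cubes and zero outside, so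
the projection changes nothing here; only creation and energy genuinely need averaging. -/
theorem fockProj_annihilation (hN : 1 ≤ N) {g : E3 → ℝ} (hg : ∀ z, IntegrableOn g (cube N z))
    (a : cubeIndices N → ℕ) : fockProj N (annihilation g (modeFun N a)) =
      fun x => ∑ z : cubeIndices N, ((√(cubeVol N) * √(a z : ℝ) * ⨍ k in cube N z, g k : ℝ) : ℂ) *
        modeFun N (a - Pi.single z 1) x := by
  funext ⟨n, k⟩
  by_cases hx : InCubes N ⟨n, k⟩
  · refine fockProj_eq_of_forall hN hx fun k' hk' => ?_
    rw [annihilation_modeFun hN hg a ((inCubes_congr hk').mpr hx)]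
    refine Finset.sum_congr rfl fun z _ => ?_
    rw [modeFun_congr hk']
  · rw [fockProj_of_not_inCubes hx, Finset.sum_eq_zero]
    intro z _
    rw [modeFun_of_not_inCubes hx, mul_zero]

theorem cubeIntegrable_annihilation (hN : 1 ≤ N) (g : E3 → ℝ) (a : cubeIndices N → ℕ) : CubeIntegrable N (annihilation g (modeFun N a)) := by
  intro n s
  have hfin : volume (piCube N s) ≠ ⊤ := by rw [volume_piCube hN]; exact ENNReal.ofReal_ne_top
  by_cases h : ∃ k, k ∈ piCube N s
  · obtain ⟨k, hk⟩ := h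
    refine (integrableOn_const (C := annihilation g (modeFun N a) ⟨n, k⟩) hfin).congr_fun
      (fun k' hk' => ?_) (measurableSet_piCube N s)
    have hkk : ∀ i, cubeIndex N (k i) = cubeIndex N (k' i) := fun i => by
      rw [mem_piCube_iff.mp hk i, mem_piCube_iff.mp hk' i]
    simp only [annihilation]
    congr 1
    refine integral_congr_ae (Eventually.of_forall fun x => ?_)
    simp only
    rw [modeFun_congr (k := Fin.cons x k) (k' := Fin.cons x k') (fun i => ?_) a]
    refine Fin.cases ?_ (fun i => ?_) i
    · simp
    · simpa using hkk i
  · rw [Set.not_nonempty_iff_eq_empty.mp h]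
    exact integrableOn_empty

end Occupation

/-! ### The multinomial count -/

section Counting

variable {J : Type*} [Fintype J] [DecidableEq J]

/-- Induction on `n` by the value `x` of the first entry: the remaining words have one letter `x`
less, so after multiplication by the factorials they contribute `a x · n!`, and the `a x` sum to `n
+ 1`. -/
theorem card_filter_occupation (n : ℕ) (a : J → ℕ) (ha : ∑ z, a z = n) :
    (Finset.univ.filter fun s : Fin n → J => ∀ z, (∑ i, if s i = z then 1 else 0) = a z).card *
      ∏ z, (a z).factorial = n.factorial := by
  induction n generalizing a with
  | zero =>
    have h0 : ∀ z, a z = 0 := fun z => by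
      simpa using (Finset.sum_eq_zero_iff.mp ha) z (Finset.mem_univ z)
    simp [h0]
  | succ n ih =>
    have h1 : (Finset.univ.filter fun s : Fin (n + 1) → J =>
        ∀ z, (∑ i, if s i = z then 1 else 0) = a z).card = ∑ x : J, (Finset.univ.filter
        fun t : Fin n → J => ∀ z, (if x = z then 1 else 0) + (∑ i, if t i = z then 1 else 0) = a z).card := by
      simp only [Finset.card_filter]
      rw [← Fintype.sum_prod_type', ← (Fin.consEquiv (fun _ => J)).sum_comp]
      refine Finset.sum_congr rfl fun p _ => ?_
      simp only [Fin.consEquiv_apply, Fin.sum_univ_succ, Fin.cons_zero, Fin.cons_succ]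
    rw [h1, Finset.sum_mul, Nat.factorial_succ, ← ha, Finset.sum_mul]
    refine Finset.sum_congr rfl fun x _ => ?_
    by_cases hx : a x = 0
    · rw [Finset.card_eq_zero.mpr, hx, zero_mul, zero_mul]
      refine Finset.filter_eq_empty_iff.mpr fun t _ h => ?_
      have := h x
      simp [hx] at this
    · have h2 := multiIndex_sub_add hx
      have h3 : ∑ z, (a - Pi.single x 1 : J → ℕ) z = n := by
        have h4 : ∑ z, (a - Pi.single x 1 + Pi.single x 1 : J → ℕ) z = n + 1 := by rw [h2, ha]
        simpa [Finset.sum_add_distrib] using h4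
      have h5 := ih _ h3
      have h6 := prod_factorial_add_single (a - Pi.single x 1) x
      rw [h2] at h6
      have h7 : ((a - Pi.single x 1 : J → ℕ) x) + 1 = a x := by
        have := congrFun h2 x; simpa using this
      rw [h7] at h6
      rw [h6, ← h5, ← mul_assoc, mul_comm _ (a x), mul_assoc]
      congr 2
      congr 1
      ext t
      simp only [Finset.mem_filter, Finset.mem_univ, true_and]
      refine forall_congr' fun z => ?_
      by_cases hz : x = z
      · subst hz; simp only [if_true, ← h7]; omega
      · simp [hz, Ne.symm hz]

end Counting

/-! ### Measure and normalization of the occupation number states -/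

section FockMeasure

instance : SFinite fockMeasure := by unfold fockMeasure; infer_instance

theorem measurable_sigmaMk (n : ℕ) : Measurable (fun k : Fin n → E3 => (⟨n, k⟩ : FockConf)) := by
  intro s hs
  exact (MeasurableSpace.measurableSet_iInf.mp hs) n

theorem measurable_fockConf {β : Type*} [MeasurableSpace β] {F : FockConf → β}
    (h : ∀ n, Measurable fun k : Fin n → E3 => F ⟨n, k⟩) : Measurable F := by
  intro s hs
  exact MeasurableSpace.measurableSet_iInf.mpr fun n => h n hs

variable {N : ℕ}

/-- Functions on Fock space which only depend on the cubes containing the wave vectors. -/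
theorem measurable_of_cubeIndex {β : Type*} [MeasurableSpace β] [Nonempty β] {F : FockConf → β}
    (h : ∀ (n : ℕ) (k k' : Fin n → E3), (∀ i, cubeIndex N (k i) = cubeIndex N (k' i)) →
      F ⟨n, k⟩ = F ⟨n, k'⟩) : Measurable F := by
  refine measurable_fockConf fun n => ?_
  have h1 : Function.FactorsThrough (fun k : Fin n → E3 => F ⟨n, k⟩)
      (fun k i => cubeIndex N (k i)) := fun k k' hk => h n k k' fun i => congrFun hk i
  obtain ⟨e, he⟩ := (Function.factorsThrough_iff _).mp h1
  rw [he]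
  refine (measurable_of_countable e).comp ?_
  exact measurable_pi_lambda _ fun i => (measurable_cubeIndex N).comp (measurable_pi_apply i)

theorem measurable_modeFun (a : cubeIndices N → ℕ) : Measurable (modeFun N a) :=
  measurable_of_cubeIndex fun _ _ _ h => modeFun_congr h a

/-- The configurations with given occupation numbers. -/
def modeSet (N : ℕ) (a : cubeIndices N → ℕ) : Set FockConf := {x | InCubes N x ∧ occupation N x = a}

theorem measurableSet_modeSet (a : cubeIndices N → ℕ) : MeasurableSet (modeSet N a) := by
  have h : Measurable fun x : FockConf => (InCubes N x ∧ occupation N x = a : Prop) := by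
    refine measurable_of_cubeIndex (N := N) fun n k k' h => ?_
    rw [inCubes_congr h, occupation_congr h]
  exact measurableSet_setOfPred.mpr h

/-- The set is a disjoint union of products of cubes, one for each assignment of cubes to particles
with the prescribed occupation numbers. Their number is multinomial, and each has volume `V^n`. -/
theorem volume_preimage_modeSet (hN : 1 ≤ N) (a : cubeIndices N → ℕ) (n : ℕ) (ha : ∑ z, a z = n) :
    volume ((fun k : Fin n → E3 => (⟨n, k⟩ : FockConf)) ⁻¹' modeSet N a) =
      ENNReal.ofReal ((n.factorial : ℝ) / (∏ z, ((a z).factorial : ℝ)) * cubeVol N ^ n) := by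
  classical
  have h1 : ((fun k : Fin n → E3 => (⟨n, k⟩ : FockConf)) ⁻¹' modeSet N a) =
      ⋃ s ∈ (Finset.univ.filter fun s : Fin n → cubeIndices N =>
        ∀ z, (∑ i, if s i = z then 1 else 0) = a z), piCube N fun i => (s i : Fin 3 → ℤ) := by
    ext k
    simp only [Set.mem_preimage, modeSet, Set.mem_ofPred_eq, Set.mem_iUnion, Finset.mem_filter,
      Finset.mem_univ, true_and, exists_prop, mem_piCube_iff]
    constructor
    · rintro ⟨hk, ho⟩
      refine ⟨fun i => ⟨_, hk i⟩, fun z => ?_, fun i => rfl⟩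
      rw [← ho]
      exact Finset.sum_congr rfl fun i _ => by simp only [Subtype.ext_iff]
    · rintro ⟨s, hs, hk⟩
      refine ⟨fun i => by simp only [hk]; exact (s i).2, ?_⟩
      funext z
      rw [← hs z]
      exact Finset.sum_congr rfl fun i _ => by simp only [hk, Subtype.ext_iff]
  rw [h1, measure_biUnion_finset]
  · simp only [volume_piCube hN, Finset.sum_const, nsmul_eq_mul]
    rw [← ENNReal.ofReal_natCast, ← ENNReal.ofReal_mul (Nat.cast_nonneg _)]
    congr 2
    rw [eq_div_iff (Finset.prod_ne_zero_iff.mpr fun z _ => by exact_mod_cast Nat.factorial_ne_zero _)]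
    exact_mod_cast card_filter_occupation n a ha
  · intro s _ t _ hst
    refine Set.disjoint_left.mpr fun k hk hk' => hst ?_
    funext i
    exact Subtype.ext ((mem_piCube_iff.mp hk i).symm.trans (mem_piCube_iff.mp hk' i))
  · exact fun s _ => measurableSet_piCube N _

theorem fockMeasure_modeSet (hN : 1 ≤ N) (a : cubeIndices N → ℕ) :
    fockMeasure (modeSet N a) = ENNReal.ofReal ((modeConst N a ^ 2)⁻¹) := by
  have hV := cubeVol_pos hN
  rw [fockMeasure, Measure.sum_apply _ (measurableSet_modeSet a), tsum_eq_single (∑ z, a z)]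
  · rw [Measure.map_apply (measurable_sigmaMk _) (measurableSet_modeSet a),
      volume_preimage_modeSet hN a _ rfl, modeConst, Real.sq_sqrt (by positivity), inv_div]
    congr 1
    ring
  · intro n hn
    rw [Measure.map_apply (measurable_sigmaMk _) (measurableSet_modeSet a)]
    have : ((fun k : Fin n → E3 => (⟨n, k⟩ : FockConf)) ⁻¹' modeSet N a) = ∅ := by
      refine Set.eq_empty_of_forall_notMem fun k hk => hn ?_
      rw [← hk.2]
      exact (sum_occupation hk.1).symm
    rw [this, measure_empty]

theorem modeFun_eq_indicator (a : cubeIndices N → ℕ) :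
    modeFun N a = (modeSet N a).indicator fun _ => (modeConst N a : ℂ) := by
  classical
  funext x
  rw [Set.indicator_apply]
  exact if_congr Iff.rfl rfl rfl

theorem memLp_modeFun (hN : 1 ≤ N) (a : cubeIndices N → ℕ) : MemLp (modeFun N a) 2 fockMeasure := by
  rw [modeFun_eq_indicator]
  refine memLp_indicator_const 2 (measurableSet_modeSet a) _ (Or.inr ?_)
  rw [fockMeasure_modeSet hN]
  exact ENNReal.ofReal_ne_top

open ComplexConjugate in
theorem integral_modeFun_mul (hN : 1 ≤ N) (a b : cubeIndices N → ℕ) :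
    ∫ x, conj (modeFun N a x) * modeFun N b x ∂fockMeasure = if a = b then 1 else 0 := by
  have hc := modeConst_pos hN a
  split_ifs with h
  · subst h
    have h1 : ∀ x, conj (modeFun N a x) * modeFun N a x =
        (modeSet N a).indicator (fun _ => ((modeConst N a ^ 2 : ℝ) : ℂ)) x := by
      intro x
      rw [modeFun_eq_indicator]
      by_cases hx : x ∈ modeSet N a
      · simp [hx, sq]
      · simp [hx]
    simp_rw [h1]
    rw [integral_indicator (measurableSet_modeSet a), setIntegral_const, Measure.real,
      fockMeasure_modeSet hN, ENNReal.toReal_ofReal (by positivity), Complex.real_smul,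
      ← Complex.ofReal_mul, inv_mul_cancel₀ (by positivity), Complex.ofReal_one]
  · have h1 : ∀ x, conj (modeFun N a x) * modeFun N b x = 0 := by
      intro x
      simp only [modeFun]
      by_cases hx : InCubes N x ∧ occupation N x = a
      · rw [if_neg (c := InCubes N x ∧ occupation N x = b), mul_zero]
        exact fun hx' => h (hx.2.symm.trans hx'.2)
      · rw [if_neg hx, map_zero, zero_mul]
    simp [h1]

end FockMeasure

/-! ### The projected core is spanned by occupation number states -/

section FockCore

variable {N : ℕ}

theorem exists_norm_le_of_mem_cube (hN : 1 ≤ N) (z : Fin 3 → ℤ) :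
    ∃ R : ℝ, ∀ x ∈ cube N z, ‖x‖ ≤ R := by
  have hN0 : (0 : ℝ) < N := by exact_mod_cast hN
  refine ⟨√(∑ i, ((|(z i : ℝ)| + 1) / N) ^ 2), fun x hx => ?_⟩
  rw [EuclideanSpace.norm_eq]
  refine Real.sqrt_le_sqrt (Finset.sum_le_sum fun i _ => ?_)
  refine pow_le_pow_left₀ (norm_nonneg _) ?_ 2
  rw [le_div_iff₀ hN0, Real.norm_eq_abs]
  have h2 := Int.floor_eq_iff.mp (hx i)
  have h3 : |x i| * N = |(N : ℝ) * x i| := by rw [abs_mul, abs_of_pos hN0, mul_comm]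
  rw [h3, abs_le]
  constructor
  · linarith [neg_abs_le (z i : ℝ)]
  · linarith [le_abs_self (z i : ℝ)]

theorem isFockCore_modeFun (hN : 1 ≤ N) (a : cubeIndices N → ℕ) : IsFockCore (modeFun N a) := by
  have hc := modeConst_pos hN a
  refine ⟨measurable_modeFun a, fun n π k => ?_, ⟨modeConst N a, fun x => ?_⟩,
    ⟨∑ z, a z, fun n k hn => ?_⟩, ?_⟩
  · have h1 : InCubes N ⟨n, fun i => k (π i)⟩ ↔ InCubes N ⟨n, k⟩ :=
      π.forall_congr_left.trans (by simp [InCubes])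
    have h2 : occupation N ⟨n, fun i => k (π i)⟩ = occupation N ⟨n, k⟩ := by
      funext z
      exact Equiv.sum_comp π fun i => if cubeIndex N (k i) = z then 1 else 0
    unfold modeFun
    rw [h1, h2]
  · unfold modeFun
    split_ifs
    · simp [abs_of_pos hc]
    · simpa using hc.le
  · refine if_neg fun h => ?_
    have := sum_occupation h.1
    rw [h.2] at this
    simp only at this
    omega
  · have h1 : ∀ z : cubeIndices N, ∃ R : ℝ, ∀ x ∈ cube N z, ‖x‖ ≤ R :=
      fun z => exists_norm_le_of_mem_cube hN z
    choose R hR using h1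
    refine ⟨∑ z, |R z|, fun n k ⟨i, hi⟩ => if_neg fun h => ?_⟩
    have h2 := hR ⟨_, h.1 i⟩ (k i) (mem_cube_iff.mpr rfl)
    have h3 := Finset.single_le_sum (f := fun z => |R z|) (fun z _ => abs_nonneg _)
      (Finset.mem_univ (⟨_, h.1 i⟩ : cubeIndices N))
    simp only at h3
    linarith [le_abs_self (R ⟨_, h.1 i⟩)]

theorem fockProj_congr {F : FockConf → ℂ} {n : ℕ} {k k' : Fin n → E3}
    (h : ∀ i, cubeIndex N (k i) = cubeIndex N (k' i)) :
    fockProj N F ⟨n, k⟩ = fockProj N F ⟨n, k'⟩ := by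
  have h1 : (fun i => cubeIndex N (k i)) = fun i => cubeIndex N (k' i) := funext h
  by_cases hx : InCubes N ⟨n, k⟩
  · rw [fockProj_of_inCubes hx, fockProj_of_inCubes ((inCubes_congr h).mp hx), h1]
  · rw [fockProj_of_not_inCubes hx, fockProj_of_not_inCubes (fun hx' => hx ((inCubes_congr h).mpr hx'))]

theorem fockProj_perm {F : FockConf → ℂ}
    (hF : ∀ (n : ℕ) (π : Equiv.Perm (Fin n)) (k : Fin n → E3), F ⟨n, fun i => k (π i)⟩ = F ⟨n, k⟩)
    {n : ℕ} (π : Equiv.Perm (Fin n)) (k : Fin n → E3) :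
    fockProj N F ⟨n, fun i => k (π i)⟩ = fockProj N F ⟨n, k⟩ := by
  have h1 : InCubes N ⟨n, fun i => k (π i)⟩ ↔ InCubes N ⟨n, k⟩ :=
    π.forall_congr_left.trans (by simp [InCubes])
  by_cases hx : InCubes N ⟨n, k⟩
  · rw [fockProj_of_inCubes hx, fockProj_of_inCubes (h1.mpr hx)]
    have hp := volume_measurePreserving_piCongrLeft (fun _ : Fin n => E3) π.symm
    have h2 : ∀ x : Fin n → E3, MeasurableEquiv.piCongrLeft (fun _ : Fin n => E3) π.symm x =
        fun i => x (π i) := by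
      intro x
      funext i
      simp [MeasurableEquiv.coe_piCongrLeft, Equiv.piCongrLeft_apply]
    have h3 : MeasurableEquiv.piCongrLeft (fun _ : Fin n => E3) π.symm ⁻¹'
        piCube N (fun i => cubeIndex N (k (π i))) = piCube N (fun i => cubeIndex N (k i)) := by
      ext x
      simp only [Set.mem_preimage, h2, mem_piCube_iff]
      exact π.forall_congr_left.trans (by simp)
    have h4 := hp.setIntegral_preimage_emb (MeasurableEquiv.measurableEmbedding _)
      (fun x => F ⟨n, x⟩) (piCube N (fun i => cubeIndex N (k (π i))))
    have h5 := hp.measure_preimage (measurableSet_piCube N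
      (fun i => cubeIndex N (k (π i)))).nullMeasurableSet
    rw [h3] at h4 h5
    rw [setAverage_eq, setAverage_eq, ← h4, Measure.real, Measure.real, h5]
    simp only [h2, hF]
  · rw [fockProj_of_not_inCubes hx, fockProj_of_not_inCubes (fun h => hx (h1.mp h))]

/-- Equal occupation numbers mean that over each cube the two configurations have equally many
particles. Gluing bijections of these fibres gives a permutation, after which corresponding
particles share their cubes; symmetry and constancy on cubes conclude. -/
theorem fockProj_eq_of_occupation_eq {F : FockConf → ℂ}
    (hF : ∀ (n : ℕ) (π : Equiv.Perm (Fin n)) (k : Fin n → E3), F ⟨n, fun i => k (π i)⟩ = F ⟨n, k⟩)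
    {x y : FockConf} (hx : InCubes N x) (hy : InCubes N y) (h : occupation N x = occupation N y) :
    fockProj N F x = fockProj N F y := by
  have hn : x.1 = y.1 := by rw [← sum_occupation hx, ← sum_occupation hy, h]
  obtain ⟨n, k⟩ := x
  obtain ⟨n', k'⟩ := y
  simp only at hn
  subst hn
  classical
  have h1 : ∀ z : Fin 3 → ℤ, Nonempty ({i // cubeIndex N (k' i) = z} ≃ {i // cubeIndex N (k i) = z}) := by
    intro z
    by_cases hz : z ∈ cubeIndices N
    · refine ⟨Fintype.equivOfCardEq ?_⟩
      rw [Fintype.card_subtype, Fintype.card_subtype, Finset.card_filter, Finset.card_filter]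
      exact (congrFun h ⟨z, hz⟩).symm
    · have : IsEmpty {i // cubeIndex N (k' i) = z} := ⟨fun i => hz (i.2 ▸ hy i.1)⟩
      have : IsEmpty {i // cubeIndex N (k i) = z} := ⟨fun i => hz (i.2 ▸ hx i.1)⟩
      exact ⟨Equiv.equivOfIsEmpty _ _⟩
  set π : Equiv.Perm (Fin n) := Equiv.ofFiberEquiv (fun z => (h1 z).some) with hπ
  have h2 : ∀ i, cubeIndex N (k (π i)) = cubeIndex N (k' i) := fun i =>
    Equiv.ofFiberEquiv_map (f := fun i => cubeIndex N (k' i)) (g := fun i => cubeIndex N (k i))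
      (fun z => (h1 z).some) i
  rw [← fockProj_perm hF π k]
  exact fockProj_congr h2

/-- A projected symmetric function is a function of the occupation numbers. Boundedness of the
particle number leaves finitely many of these, so the expansion is a finite sum and no completion is
involved. -/
theorem fockProj_mem_span {F : FockConf → ℂ} (hN : 1 ≤ N) (hF : IsFockCore F) :
    fockProj N F ∈ Submodule.span ℂ (Set.range (modeFun N)) := by
  classical
  obtain ⟨_, hsymm, _, ⟨M, hM⟩, _⟩ := hF
  -- The coefficient is read off at any configuration with the given occupation; the value `0` for
  -- unrealized occupations is never used.
  set coef : (cubeIndices N → ℕ) → ℂ := fun a =>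
    if h : ∃ x, InCubes N x ∧ occupation N x = a then fockProj N F h.choose / modeConst N a else 0
    with hcoef
  have h1 : fockProj N F = ∑ a ∈ Fintype.piFinset (fun _ : cubeIndices N => Finset.range (M + 1)),
      coef a • modeFun N a := by
    funext x
    rw [Finset.sum_apply]
    simp only [Pi.smul_apply, smul_eq_mul]
    by_cases hx : InCubes N x
    · simp only [modeFun_of_inCubes hx, mul_ite, mul_zero]
      rw [Finset.sum_ite_eq]
      split_ifs with ho
      · have he : ∃ y, InCubes N y ∧ occupation N y = occupation N x := ⟨x, hx, rfl⟩
        simp only [hcoef, dif_pos he]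
        rw [div_mul_cancel₀ _ (by exact_mod_cast (modeConst_pos hN _).ne')]
        exact fockProj_eq_of_occupation_eq hsymm hx he.choose_spec.1 he.choose_spec.2.symm
      · obtain ⟨n, k⟩ := x
        have hn : M < n := by
          by_contra! hn
          refine ho (Fintype.mem_piFinset.mpr fun z => Finset.mem_range.mpr ?_)
          have h2 := Finset.single_le_sum (f := occupation N ⟨n, k⟩) (fun z _ => Nat.zero_le _)
            (Finset.mem_univ z)
          rw [sum_occupation hx] at h2
          simp only at h2
          omega
        rw [fockProj_of_inCubes hx]
        simp [hM n _ hn]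
    · rw [fockProj_of_not_inCubes hx, Finset.sum_eq_zero]
      intro a _
      rw [modeFun_of_not_inCubes hx, mul_zero]
  rw [h1]
  exact Submodule.sum_mem _ fun a _ => Submodule.smul_mem _ _ (Submodule.subset_span ⟨a, rfl⟩)

end FockCore

/-! ### Projection of tensor products of the two polarizations -/

section FieldProj

variable {N : ℕ}

/-- `Φ` is sufficiently integrable to be averaged over products of cubes, with result `Φ'`. -/
def ProjTo (N : ℕ) (Φ Φ' : FockConf × FockConf → ℂ) : Prop :=
  (∀ x, CubeIntegrable N fun y => Φ (x, y)) ∧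
  (∀ y, CubeIntegrable N fun x => fockProj N (fun y' => Φ (x, y')) y) ∧ fieldProj N Φ = Φ'

theorem fieldProj_apply (Φ : FockConf × FockConf → ℂ) (p : FockConf × FockConf) :
    fieldProj N Φ p = fockProj N (fun x => fockProj N (fun y => Φ (x, y)) p.2) p.1 := rfl

theorem ProjTo.add {Φ Φ' Ψ Ψ' : FockConf × FockConf → ℂ} (h : ProjTo N Φ Φ') (h' : ProjTo N Ψ Ψ') :
    ProjTo N (fun p => Φ p + Ψ p) (fun p => Φ' p + Ψ' p) := by
  obtain ⟨h1, h2, rfl⟩ := h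
  obtain ⟨h1', h2', rfl⟩ := h'
  refine ⟨fun x => (h1 x).add (h1' x), fun y => ?_, ?_⟩
  · have := (h2 y).add (h2' y)
    simpa only [fockProj_add (h1 _) (h1' _)] using this
  · funext p
    simp only [fieldProj_apply, fockProj_add (h1 _) (h1' _)]
    rw [fockProj_add (h2 _) (h2' _)]

theorem ProjTo.const_mul {Φ Φ' : FockConf × FockConf → ℂ} (h : ProjTo N Φ Φ') (c : ℂ) :
    ProjTo N (fun p => c * Φ p) (fun p => c * Φ' p) := by
  obtain ⟨h1, h2, rfl⟩ := h
  refine ⟨fun x => (h1 x).const_mul c, fun y => ?_, ?_⟩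
  · have := (h2 y).const_mul c
    simpa only [fockProj_const_mul] using this
  · funext p
    simp only [fieldProj_apply, fockProj_const_mul]

theorem projTo_zero : ProjTo N (fun _ => 0) (fun _ => 0) := by
  have h0 : fockProj N (fun _ => 0) = fun _ => 0 := by
    simpa using fockProj_const_mul (N := N) 0 (fun _ => 0)
  refine ⟨fun x => cubeIntegrable_zero, fun y => ?_, ?_⟩
  · simp only [h0]; exact cubeIntegrable_zero
  · funext p; simp only [fieldProj_apply, h0]

theorem ProjTo.sum {κ : Type*} (s : Finset κ) {Φ Φ' : κ → FockConf × FockConf → ℂ}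
    (h : ∀ i ∈ s, ProjTo N (Φ i) (Φ' i)) :
    ProjTo N (fun p => ∑ i ∈ s, Φ i p) (fun p => ∑ i ∈ s, Φ' i p) := by
  classical
  induction s using Finset.induction_on with
  | empty => simpa using projTo_zero
  | insert a s ha ih =>
    simp only [Finset.sum_insert ha]
    exact (h a (Finset.mem_insert_self a s)).add (ih fun i hi => h i (Finset.mem_insert_of_mem hi))

theorem CubeIntegrable.mul_const {F : FockConf → ℂ} (hF : CubeIntegrable N F) (c : ℂ) :
    CubeIntegrable N (fun x => F x * c) := fun n s => (hF n s).mul_const c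

theorem fockProj_mul_const (c : ℂ) (F : FockConf → ℂ) :
    fockProj N (fun x => F x * c) = fun x => fockProj N F x * c := by
  simp only [mul_comm _ c, fockProj_const_mul]

theorem projTo_tensor {A B : FockConf → ℂ} (hA : CubeIntegrable N A) (hB : CubeIntegrable N B) :
    ProjTo N (fun p => A p.1 * B p.2) (fun p => fockProj N A p.1 * fockProj N B p.2) := by
  refine ⟨fun x => hB.const_mul (A x), fun y => ?_, ?_⟩
  · simp only [fockProj_const_mul]
    exact hA.mul_const _
  · funext p
    simp only [fieldProj_apply, fockProj_const_mul, fockProj_mul_const]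

/-- Normalized states of the two fields with given occupation numbers of the cubes. -/
noncomputable def fieldMode (N : ℕ) (α : Fin 2 × cubeIndices N → ℕ) (p : FockConf × FockConf) : ℂ :=
  modeFun N (fun z => α (0, z)) p.1 * modeFun N (fun z => α (1, z)) p.2

theorem projTo_fieldMode (hN : 1 ≤ N) (α : Fin 2 × cubeIndices N → ℕ) :
    ProjTo N (fieldMode N α) (fieldMode N α) := by
  have := projTo_tensor (cubeIntegrable_modeFun hN fun z => α (0, z))
    (cubeIntegrable_modeFun hN fun z => α (1, z))
  rw [fockProj_modeFun hN, fockProj_modeFun hN] at this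
  exact this

theorem dGamma_mul_const (w : E3 → ℝ) (F : FockConf → ℂ) (c : ℂ) :
    dGamma w (fun x => F x * c) = fun x => dGamma w F x * c := by
  funext ⟨n, k⟩; simp only [dGamma, mul_assoc]

theorem creation_mul_const (g : E3 → ℝ) (F : FockConf → ℂ) (c : ℂ) :
    creation g (fun x => F x * c) = fun x => creation g F x * c := by
  funext ⟨n, k⟩
  match n, k with
  | 0, k => simp [creation]
  | n + 1, k => simp only [creation, mul_assoc, Finset.sum_mul]

theorem annihilation_mul_const (g : E3 → ℝ) (F : FockConf → ℂ) (c : ℂ) :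
    annihilation g (fun x => F x * c) = fun x => annihilation g F x * c := by
  funext ⟨n, k⟩
  simp only [annihilation, mul_assoc, ← integral_mul_const]

theorem onFst_tensor {A : (FockConf → ℂ) → FockConf → ℂ}
    (hA : ∀ F c, A (fun x => F x * c) = fun x => A F x * c) (α : Fin 2 × cubeIndices N → ℕ) :
    onFst A (fieldMode N α) = fun p => A (modeFun N fun z => α (0, z)) p.1 *
      modeFun N (fun z => α (1, z)) p.2 := by
  funext p; simp only [onFst, fieldMode, hA]

theorem onSnd_tensor {A : (FockConf → ℂ) → FockConf → ℂ}
    (hA : ∀ F c, A (fun x => F x * c) = fun x => A F x * c) (α : Fin 2 × cubeIndices N → ℕ) :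
    onSnd A (fieldMode N α) = fun p => modeFun N (fun z => α (0, z)) p.1 *
      A (modeFun N fun z => α (1, z)) p.2 := by
  funext p
  have : A (fun x => modeFun N (fun z => α (0, z)) p.1 * modeFun N (fun z => α (1, z)) x) =
      fun x => modeFun N (fun z => α (0, z)) p.1 * A (modeFun N fun z => α (1, z)) x := by
    simp only [mul_comm (modeFun N (fun z => α (0, z)) p.1), hA]
  simp only [onSnd, fieldMode, this]

theorem add_single_apply_of_eq {J : Type*} [DecidableEq J] (α : Fin 2 × J → ℕ) (σ : Fin 2) (z : J) :
    (fun y => (α + Pi.single (σ, z) 1 : Fin 2 × J → ℕ) (σ, y)) = (fun y => α (σ, y)) + Pi.single z 1 := by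
  funext y
  by_cases h : y = z
  · subst h; simp
  · simp [h]

theorem sub_single_apply_of_eq {J : Type*} [DecidableEq J] (α : Fin 2 × J → ℕ) (σ : Fin 2) (z : J) :
    (fun y => (α - Pi.single (σ, z) 1 : Fin 2 × J → ℕ) (σ, y)) = (fun y => α (σ, y)) - Pi.single z 1 := by
  funext y
  by_cases h : y = z
  · subst h; simp
  · simp [h]

theorem add_single_apply_of_ne {J : Type*} [DecidableEq J] (α : Fin 2 × J → ℕ) {σ τ : Fin 2}
    (h : σ ≠ τ) (z : J) : (fun y => (α + Pi.single (τ, z) 1 : Fin 2 × J → ℕ) (σ, y)) = fun y => α (σ, y) := by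
  funext y
  simp [h]

theorem sub_single_apply_of_ne {J : Type*} [DecidableEq J] (α : Fin 2 × J → ℕ) {σ τ : Fin 2}
    (h : σ ≠ τ) (z : J) : (fun y => (α - Pi.single (τ, z) 1 : Fin 2 × J → ℕ) (σ, y)) = fun y => α (σ, y) := by
  funext y
  simp [h]

theorem ladderX_fieldMode_zero (α : Fin 2 × cubeIndices N → ℕ) (z : cubeIndices N)
    (p : FockConf × FockConf) : ((√2 : ℝ) : ℂ) * ladderX (fieldMode N) (0, z) α p =
      ((√((α (0, z) : ℝ) + 1) : ℝ) : ℂ) * (modeFun N ((fun y => α (0, y)) + Pi.single z 1) p.1 *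
        modeFun N (fun y => α (1, y)) p.2) +
      ((√(α (0, z) : ℝ) : ℝ) : ℂ) * (modeFun N ((fun y => α (0, y)) - Pi.single z 1) p.1 *
        modeFun N (fun y => α (1, y)) p.2) := by
  have h2 : ((√2 : ℝ) : ℂ) ≠ 0 := by simp
  have h3 : ladderX (fieldMode N) (0, z) α p = ((1 / √2 : ℝ) : ℂ) *
      (((√((α (0, z) : ℝ) + 1) : ℝ) : ℂ) * fieldMode N (α + Pi.single (0, z) 1) p +
        ((√(α (0, z) : ℝ) : ℝ) : ℂ) * fieldMode N (α - Pi.single (0, z) 1) p) := rfl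
  rw [h3, fieldMode, fieldMode, add_single_apply_of_eq, sub_single_apply_of_eq,
    add_single_apply_of_ne α (show (1 : Fin 2) ≠ 0 by decide),
    sub_single_apply_of_ne α (show (1 : Fin 2) ≠ 0 by decide)]
  push_cast
  field_simp

theorem ladderX_fieldMode_one (α : Fin 2 × cubeIndices N → ℕ) (z : cubeIndices N)
    (p : FockConf × FockConf) : ((√2 : ℝ) : ℂ) * ladderX (fieldMode N) (1, z) α p =
      ((√((α (1, z) : ℝ) + 1) : ℝ) : ℂ) * (modeFun N (fun y => α (0, y)) p.1 *
        modeFun N ((fun y => α (1, y)) + Pi.single z 1) p.2) +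
      ((√(α (1, z) : ℝ) : ℝ) : ℂ) * (modeFun N (fun y => α (0, y)) p.1 *
        modeFun N ((fun y => α (1, y)) - Pi.single z 1) p.2) := by
  have h2 : ((√2 : ℝ) : ℂ) ≠ 0 := by simp
  have h3 : ladderX (fieldMode N) (1, z) α p = ((1 / √2 : ℝ) : ℂ) *
      (((√((α (1, z) : ℝ) + 1) : ℝ) : ℂ) * fieldMode N (α + Pi.single (1, z) 1) p +
        ((√(α (1, z) : ℝ) : ℝ) : ℂ) * fieldMode N (α - Pi.single (1, z) 1) p) := rfl
  rw [h3, fieldMode, fieldMode, add_single_apply_of_eq, sub_single_apply_of_eq,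
    add_single_apply_of_ne α (show (0 : Fin 2) ≠ 1 by decide),
    sub_single_apply_of_ne α (show (0 : Fin 2) ≠ 1 by decide)]
  push_cast
  field_simp

/-- Creation plus annihilation is `√2` times the oscillator coordinate, so the smeared field of one
polarization becomes a combination of the coordinates of its cubes with weights `√V √2` times the
means of `g`. -/
theorem projTo_fst (hN : 1 ≤ N) {g : E3 → ℝ} (hg : ∀ z, IntegrableOn g (cube N z))
    (α : Fin 2 × cubeIndices N → ℕ) :
    ProjTo N (fun p => onFst (creation g) (fieldMode N α) p + onFst (annihilation g) (fieldMode N α) p)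
      (fun p => ∑ z : cubeIndices N, ((√(cubeVol N) * √2 * ⨍ k in cube N z, g k : ℝ) : ℂ) *
        ladderX (fieldMode N) (0, z) α p) := by
  rw [onFst_tensor (creation_mul_const g), onFst_tensor (annihilation_mul_const g)]
  have h := (projTo_tensor (cubeIntegrable_creation hN hg fun z => α (0, z))
    (cubeIntegrable_modeFun hN fun z => α (1, z))).add
    (projTo_tensor (cubeIntegrable_annihilation hN g fun z => α (0, z))
    (cubeIntegrable_modeFun hN fun z => α (1, z)))
  rw [fockProj_creation hN hg, fockProj_annihilation hN hg, fockProj_modeFun hN] at h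
  refine ⟨h.1, h.2.1, h.2.2.trans ?_⟩
  funext p
  rw [Finset.sum_mul, Finset.sum_mul, ← Finset.sum_add_distrib]
  refine Finset.sum_congr rfl fun z _ => ?_
  have h3 := ladderX_fieldMode_zero α z p
  push_cast at h3 ⊢
  linear_combination (-(√(cubeVol N) : ℂ) * (⨍ k in cube N z, g k : ℝ)) * h3

theorem projTo_snd (hN : 1 ≤ N) {g : E3 → ℝ} (hg : ∀ z, IntegrableOn g (cube N z))
    (α : Fin 2 × cubeIndices N → ℕ) :
    ProjTo N (fun p => onSnd (creation g) (fieldMode N α) p + onSnd (annihilation g) (fieldMode N α) p)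
      (fun p => ∑ z : cubeIndices N, ((√(cubeVol N) * √2 * ⨍ k in cube N z, g k : ℝ) : ℂ) *
        ladderX (fieldMode N) (1, z) α p) := by
  rw [onSnd_tensor (creation_mul_const g), onSnd_tensor (annihilation_mul_const g)]
  have h := (projTo_tensor (cubeIntegrable_modeFun hN fun z => α (0, z))
    (cubeIntegrable_creation hN hg fun z => α (1, z))).add
    (projTo_tensor (cubeIntegrable_modeFun hN fun z => α (0, z))
    (cubeIntegrable_annihilation hN g fun z => α (1, z)))
  rw [fockProj_creation hN hg, fockProj_annihilation hN hg, fockProj_modeFun hN] at h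
  refine ⟨h.1, h.2.1, h.2.2.trans ?_⟩
  funext p
  rw [Finset.mul_sum, Finset.mul_sum, ← Finset.sum_add_distrib]
  refine Finset.sum_congr rfl fun z _ => ?_
  have h3 := ladderX_fieldMode_one α z p
  push_cast at h3 ⊢
  linear_combination (-(√(cubeVol N) : ℂ) * (⨍ k in cube N z, g k : ℝ)) * h3

theorem projTo_dGamma (hN : 1 ≤ N) {w : E3 → ℝ} (hw : ∀ z, IntegrableOn w (cube N z))
    (α : Fin 2 × cubeIndices N → ℕ) :
    ProjTo N (fun p => onFst (dGamma w) (fieldMode N α) p + onSnd (dGamma w) (fieldMode N α) p)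
      (fun p => ((∑ i, (α i : ℝ) * ⨍ k in cube N i.2, w k : ℝ) : ℂ) * fieldMode N α p) := by
  rw [onFst_tensor (dGamma_mul_const w), onSnd_tensor (dGamma_mul_const w)]
  have h := (projTo_tensor (cubeIntegrable_dGamma hN hw fun z => α (0, z))
    (cubeIntegrable_modeFun hN fun z => α (1, z))).add
    (projTo_tensor (cubeIntegrable_modeFun hN fun z => α (0, z))
    (cubeIntegrable_dGamma hN hw fun z => α (1, z)))
  rw [fockProj_dGamma hN hw, fockProj_dGamma hN hw, fockProj_modeFun hN, fockProj_modeFun hN] at h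
  refine ⟨h.1, h.2.1, h.2.2.trans ?_⟩
  funext p
  rw [Fintype.sum_prod_type, Fin.sum_univ_two, fieldMode]
  push_cast
  ring

end FieldProj

/-! ### Linearity of the field operators on finite superpositions -/

section FieldSums

variable {N : ℕ} {κ : Type*}

theorem dGamma_sum (w : E3 → ℝ) (s : Finset κ) (d : κ → ℂ) (F : κ → FockConf → ℂ) :
    dGamma w (fun x => ∑ i ∈ s, d i * F i x) = fun x => ∑ i ∈ s, d i * dGamma w (F i) x := by
  funext ⟨n, k⟩
  simp only [dGamma, Finset.mul_sum]
  exact Finset.sum_congr rfl fun i _ => by ring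

theorem creation_sum (g : E3 → ℝ) (s : Finset κ) (d : κ → ℂ) (F : κ → FockConf → ℂ) :
    creation g (fun x => ∑ i ∈ s, d i * F i x) = fun x => ∑ i ∈ s, d i * creation g (F i) x := by
  funext ⟨n, k⟩
  match n, k with
  | 0, k => simp [creation]
  | n + 1, k =>
    simp only [creation, Finset.mul_sum]
    rw [Finset.sum_comm]
    exact Finset.sum_congr rfl fun i _ => Finset.sum_congr rfl fun j _ => by ring

/-- Additivity happens under an integral and needs integrability, so it is available for
superpositions of occupation number states rather than for arbitrary functions. The two lemmas on
`onFst` and `onSnd` below assume linearity in this restricted form for that reason. -/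
theorem annihilation_sum {g : E3 → ℝ} (hg : ∀ z, IntegrableOn g (cube N z)) (s : Finset κ)
    (d : κ → ℂ) (a : κ → cubeIndices N → ℕ) :
    annihilation g (fun x => ∑ i ∈ s, d i * modeFun N (a i) x) =
      fun x => ∑ i ∈ s, d i * annihilation g (modeFun N (a i)) x := by
  funext ⟨n, k⟩
  simp only [annihilation, Finset.mul_sum]
  rw [integral_finsetSum, Finset.mul_sum]
  · refine Finset.sum_congr rfl fun i _ => ?_
    have h : ∫ x : E3, (g x : ℂ) * (d i * modeFun N (a i) ⟨n + 1, Fin.cons x k⟩) =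
        d i * ∫ x : E3, (g x : ℂ) * modeFun N (a i) ⟨n + 1, Fin.cons x k⟩ := by
      rw [← integral_const_mul]
      exact integral_congr_ae (Eventually.of_forall fun x => by simp only; ring)
    rw [h]
    ring
  · intro i _
    refine ((annihilation_modeFun_integrable hg (a i) n k).const_mul (d i)).congr
      (Eventually.of_forall fun x => by simp only; ring)

theorem onFst_sum {A : (FockConf → ℂ) → FockConf → ℂ} (s : Finset κ)
    (β : κ → Fin 2 × cubeIndices N → ℕ)
    (hA : ∀ d : κ → ℂ, A (fun x => ∑ i ∈ s, d i * modeFun N (fun z => β i (0, z)) x) =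
      fun x => ∑ i ∈ s, d i * A (modeFun N (fun z => β i (0, z))) x)
    (hA' : ∀ F c, A (fun x => F x * c) = fun x => A F x * c) (d : κ → ℂ) :
    onFst A (fun p => ∑ i ∈ s, d i * fieldMode N (β i) p) =
      fun p => ∑ i ∈ s, d i * onFst A (fieldMode N (β i)) p := by
  simp only [onFst_tensor hA']
  funext p
  have h := congrFun (hA fun i => d i * modeFun N (fun z => β i (1, z)) p.2) p.1
  have e : (fun x => ∑ i ∈ s, d i * fieldMode N (β i) (x, p.2)) = fun x => ∑ i ∈ s,
      (d i * modeFun N (fun z => β i (1, z)) p.2) * modeFun N (fun z => β i (0, z)) x := by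
    funext x
    exact Finset.sum_congr rfl fun i _ => by rw [fieldMode]; ring
  simp only [onFst]
  rw [e, h]
  exact Finset.sum_congr rfl fun i _ => by ring

theorem onSnd_sum {A : (FockConf → ℂ) → FockConf → ℂ} (s : Finset κ)
    (β : κ → Fin 2 × cubeIndices N → ℕ)
    (hA : ∀ d : κ → ℂ, A (fun x => ∑ i ∈ s, d i * modeFun N (fun z => β i (1, z)) x) =
      fun x => ∑ i ∈ s, d i * A (modeFun N (fun z => β i (1, z))) x)
    (hA' : ∀ F c, A (fun x => F x * c) = fun x => A F x * c) (d : κ → ℂ) :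
    onSnd A (fun p => ∑ i ∈ s, d i * fieldMode N (β i) p) =
      fun p => ∑ i ∈ s, d i * onSnd A (fieldMode N (β i)) p := by
  simp only [onSnd_tensor hA']
  funext p
  have h := congrFun (hA fun i => d i * modeFun N (fun z => β i (0, z)) p.1) p.2
  have e : (fun x => ∑ i ∈ s, d i * fieldMode N (β i) (p.1, x)) = fun x => ∑ i ∈ s,
      (d i * modeFun N (fun z => β i (0, z)) p.1) * modeFun N (fun z => β i (1, z)) x := by
    funext x
    exact Finset.sum_congr rfl fun i _ => by rw [fieldMode]; ring
  simp only [onSnd]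
  rw [e, h]
  exact Finset.sum_congr rfl fun i _ => by ring

end FieldSums

/-! ### Cube means of the frequency and of the coupling functions -/

namespace OscillatorModel

variable (S : OscillatorModel)

/-- The vector field `χ_C u_σ / √ω`. -/
noncomputable def yField (C : ℝ) (σ : Fin 2) (k : E3) : E3 := (cutoff C k / √(S.ω k)) • S.u σ k

theorem ω_nonneg (k : E3) : 0 ≤ S.ω k := mul_nonneg S.c_pos.le (norm_nonneg k)

theorem cutoff_nonneg (C : ℝ) (k : E3) : 0 ≤ cutoff C k := by
  unfold cutoff; split_ifs <;> norm_num

theorem cutoff_le_one (C : ℝ) (k : E3) : cutoff C k ≤ 1 := by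
  unfold cutoff; split_ifs <;> norm_num

theorem measurable_cutoff (C : ℝ) : Measurable (cutoff C) := by
  unfold cutoff
  exact Measurable.ite (measurableSet_lt measurable_norm measurable_const) measurable_const
    measurable_const

theorem continuous_ω : Continuous S.ω := continuous_const.mul continuous_norm

theorem norm_u (σ : Fin 2) {k : E3} (hk : k ≠ 0) : ‖S.u σ k‖ = 1 := by
  have h := (S.u_orthonormal k hk).1
  fin_cases σ
  · simpa using h 0
  · simpa using h 1

theorem norm_yField (C : ℝ) (σ : Fin 2) (k : E3) : ‖S.yField C σ k‖ = cutoff C k / √(S.ω k) := by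
  by_cases hk : k = 0
  · simp [yField, hk, ω]
  · rw [yField, norm_smul, S.norm_u σ hk, mul_one, Real.norm_eq_abs, abs_of_nonneg]
    exact div_nonneg (cutoff_nonneg C k) (Real.sqrt_nonneg _)

theorem measurable_yField (C : ℝ) (σ : Fin 2) : Measurable (S.yField C σ) :=
  ((measurable_cutoff C).div (Real.continuous_sqrt.comp S.continuous_ω).measurable).smul
    (S.u_measurable σ)

/-- The infrared singularity is of order `|k|^(-1/2)`, locally integrable in three dimensions, so
the mean values over cubes containing the origin are meaningful. -/
theorem locallyIntegrable_yField (C : ℝ) (σ : Fin 2) : LocallyIntegrable (S.yField C σ) := by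
  refine locallyIntegrable_of_norm_le_rpow (C := 1 / √S.c) (α := 1 / 2) (by simp)
    (by simp; norm_num) (Eventually.of_forall fun k => ?_) (S.measurable_yField C σ).aestronglyMeasurable
  rw [norm_yField, ω, Real.sqrt_mul S.c_pos.le, Real.rpow_neg (norm_nonneg k), ← Real.sqrt_eq_rpow,
    ← div_eq_mul_inv, div_div]
  exact div_le_div_of_nonneg_right (cutoff_le_one C k) (by positivity)

theorem integrableOn_cube {N : ℕ} (hN : 1 ≤ N) {F : Type*} [NormedAddCommGroup F] {f : E3 → F}
    (hf : LocallyIntegrable f) (z : Fin 3 → ℤ) : IntegrableOn f (cube N z) := by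
  obtain ⟨R, hR⟩ := exists_norm_le_of_mem_cube hN z
  exact (hf.integrableOn_isCompact (isCompact_closedBall 0 R)).mono_set fun x hx => by
    simpa using hR x hx

theorem integrableOn_ω {N : ℕ} (hN : 1 ≤ N) (z : Fin 3 → ℤ) : IntegrableOn S.ω (cube N z) :=
  integrableOn_cube hN S.continuous_ω.locallyIntegrable z

theorem integrableOn_yField (C : ℝ) (σ : Fin 2) {N : ℕ} (hN : 1 ≤ N) (z : Fin 3 → ℤ) :
    IntegrableOn (S.yField C σ) (cube N z) := integrableOn_cube hN (S.locallyIntegrable_yField C σ) z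

theorem coupling_eq (C : ℝ) (σ : Fin 2) (q k : E3) : S.coupling C σ q k =
    S.e / S.m * √(S.hbar / (4 * Real.pi ^ 2)) * inner ℝ q (S.yField C σ k) := by
  have h0 : 0 ≤ S.hbar / (4 * Real.pi ^ 2) := div_nonneg S.hbar_pos.le (by positivity)
  rw [coupling, yField, inner_smul_right, ← div_div, Real.sqrt_div h0]
  ring

theorem integrableOn_coupling (C : ℝ) (σ : Fin 2) (q : E3) {N : ℕ} (hN : 1 ≤ N) (z : Fin 3 → ℤ) :
    IntegrableOn (S.coupling C σ q) (cube N z) := by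
  have : S.coupling C σ q = fun k =>
    S.e / S.m * √(S.hbar / (4 * Real.pi ^ 2)) * inner ℝ q (S.yField C σ k) :=
    funext (S.coupling_eq C σ q)
  rw [this]
  exact ((S.integrableOn_yField C σ hN z).const_inner q).const_mul _

theorem average_coupling (C : ℝ) (σ : Fin 2) (q : E3) {N : ℕ} (hN : 1 ≤ N) (z : Fin 3 → ℤ) :
    ⨍ k in cube N z, S.coupling C σ q k =
      S.e / S.m * √(S.hbar / (4 * Real.pi ^ 2)) * inner ℝ q (S.yMean C N σ z) := by
  have h1 : S.yMean C N σ z = ⨍ k in cube N z, S.yField C σ k := rfl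
  simp only [coupling_eq]
  rw [h1, setAverage_eq, setAverage_eq, integral_const_mul,
    integral_inner (S.integrableOn_yField C σ hN z), inner_smul_right, smul_eq_mul]
  ring

/-- The matrix of the mass renormalization term. -/
noncomputable def renormMatrix (C : ℝ) (N : ℕ) (i j : Fin 3) : ℝ :=
  ∑ z : cubeIndices N, ∑ σ : Fin 2, cubeVol N * (S.e ^ 2 / (4 * Real.pi ^ 2 * S.m ^ 2)) *
    (1 / S.ωMean N z) * (S.yMean C N σ z i * S.yMean C N σ z j)

/-- The energy renormalization. -/
noncomputable def renormEnergy (C : ℝ) (N : ℕ) : ℝ :=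
  ∑ z : cubeIndices N, cubeVol N * S.hbar * (S.e ^ 2 * S.η ^ 2 / (4 * Real.pi ^ 2 * S.m)) *
      (cutoffMean C N z / ((S.ωMean N z) ^ 2 * (S.ωMean N z + S.η)))

theorem finsum_cubeIndices {M : Type*} [AddCommMonoid M] (N : ℕ) (f : (Fin 3 → ℤ) → M) :
    ∑ᶠ z ∈ cubeIndices N, f z = ∑ z : cubeIndices N, f z := by
  rw [← finsum_set_coe_eq_finsum_mem, finsum_eq_sum_of_fintype]

theorem renorm_eq (C : ℝ) (N : ℕ) (q : E3) : S.renorm C N q =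
    ∑ i, ∑ j, S.renormMatrix C N i j * (q i * q j) - S.renormEnergy C N := by
  rw [renorm, finsum_cubeIndices, finsum_cubeIndices, renormEnergy]
  congr 1
  simp only [renormMatrix, Finset.sum_mul]
  have h : ∀ (z : cubeIndices N) (σ : Fin 2), (inner ℝ (S.yMean C N σ z) q) ^ 2 =
      ∑ i, ∑ j, (S.yMean C N σ z i * S.yMean C N σ z j) * (q i * q j) := by
    intro z σ
    rw [PiLp.inner_apply, sq, Finset.sum_mul_sum]
    refine Finset.sum_congr rfl fun i _ => Finset.sum_congr rfl fun j _ => ?_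
    simp only [RCLike.inner_apply, conj_trivial]
    ring
  simp only [h, Finset.mul_sum]
  rw [Finset.sum_comm' (t' := Finset.univ) (s' := fun _ => Finset.univ) (by simp)]
  simp only [Fin.sum_univ_three, Fin.sum_univ_two, Finset.sum_add_distrib, mul_assoc]
  ring

/-- The frequency vanishes only at the origin, a null set, so even the cube containing it yields a
genuine oscillator. -/
theorem ωMean_pos {N : ℕ} (hN : 1 ≤ N) (z : Fin 3 → ℤ) : 0 < S.ωMean N z := by
  rw [ωMean, setAverage_eq, volumeReal_cube hN, smul_eq_mul]
  refine mul_pos (inv_pos.mpr (cubeVol_pos hN)) ?_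
  rw [setIntegral_pos_iff_support_of_nonneg_ae (Eventually.of_forall fun k => S.ω_nonneg k)
    (S.integrableOn_ω hN z)]
  have h1 : Function.support S.ω ∩ cube N z = cube N z \ {0} := by
    ext x; simp [ω, S.c_pos.ne', and_comm]
  rw [h1, measure_sdiff_null (measure_singleton 0), volume_cube hN]
  exact ENNReal.ofReal_pos.mpr (cubeVol_pos hN)

theorem fieldEnergy_sum {N : ℕ} {κ : Type*} (s : Finset κ) (β : κ → Fin 2 × cubeIndices N → ℕ)
    (d : κ → ℂ) : S.fieldEnergy (fun p => ∑ i ∈ s, d i * fieldMode N (β i) p) =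
      fun p => ∑ i ∈ s, d i * S.fieldEnergy (fieldMode N (β i)) p := by
  funext p
  simp only [fieldEnergy]
  rw [onFst_sum s β (fun d => dGamma_sum _ s d _) (dGamma_mul_const _),
    onSnd_sum s β (fun d => dGamma_sum _ s d _) (dGamma_mul_const _)]
  simp only [mul_add, Finset.sum_add_distrib]

theorem interaction_sum (C : ℝ) (q : E3) {N : ℕ} (hN : 1 ≤ N) {κ : Type*} (s : Finset κ)
    (β : κ → Fin 2 × cubeIndices N → ℕ) (d : κ → ℂ) :
    S.interaction C q (fun p => ∑ i ∈ s, d i * fieldMode N (β i) p) =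
      fun p => ∑ i ∈ s, d i * S.interaction C q (fieldMode N (β i)) p := by
  funext p
  simp only [interaction]
  rw [onFst_sum s β (fun d => creation_sum _ s d _) (creation_mul_const _),
    onSnd_sum s β (fun d => creation_sum _ s d _) (creation_mul_const _),
    onFst_sum s β (fun d => annihilation_sum (S.integrableOn_coupling C 0 q hN) s d _)
      (annihilation_mul_const _),
    onSnd_sum s β (fun d => annihilation_sum (S.integrableOn_coupling C 1 q hN) s d _)
      (annihilation_mul_const _)]
  simp only [mul_add, Finset.sum_add_distrib]

/-- The energy of an occupation number state of the free field. -/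
noncomputable def modeEnergy {N : ℕ} (α : Fin 2 × cubeIndices N → ℕ) : ℝ :=
  ∑ i, (α i : ℝ) * (S.hbar * S.ωMean N i.2)

theorem projTo_fieldEnergy {N : ℕ} (hN : 1 ≤ N) (α : Fin 2 × cubeIndices N → ℕ) :
    ProjTo N (S.fieldEnergy (fieldMode N α)) (fun p => (S.modeEnergy α : ℂ) * fieldMode N α p) := by
  have h := projTo_dGamma hN (fun z => (S.integrableOn_ω hN z).const_mul S.hbar) α
  have e : ∀ z, ⨍ k in cube N z, S.hbar * S.ω k = S.hbar * S.ωMean N z := by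
    intro z
    rw [setAverage_eq, integral_const_mul, ωMean, setAverage_eq, smul_eq_mul, smul_eq_mul]
    ring
  simp only [e] at h
  exact h

/-- The coefficients of the interaction. -/
noncomputable def couplingCoef (C : ℝ) (N : ℕ) (i : Fin 2 × cubeIndices N) (j : Fin 3) : ℝ :=
  √(cubeVol N) * √2 * (S.e / S.m * √(S.hbar / (4 * Real.pi ^ 2))) * S.yMean C N i.1 i.2 j

theorem projTo_interaction (C : ℝ) (q : E3) {N : ℕ} (hN : 1 ≤ N) (α : Fin 2 × cubeIndices N → ℕ) :
    ProjTo N (S.interaction C q (fieldMode N α)) (fun p => ∑ i, ∑ j,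
      (S.couplingCoef C N i j : ℂ) * (q j : ℂ) * ladderX (fieldMode N) i α p) := by
  have h := (projTo_fst hN (S.integrableOn_coupling C 0 q hN) α).add
    (projTo_snd hN (S.integrableOn_coupling C 1 q hN) α)
  have e1 : S.interaction C q (fieldMode N α) = fun p =>
    (onFst (creation (S.coupling C 0 q)) (fieldMode N α) p +
      onFst (annihilation (S.coupling C 0 q)) (fieldMode N α) p) +
    (onSnd (creation (S.coupling C 1 q)) (fieldMode N α) p +
      onSnd (annihilation (S.coupling C 1 q)) (fieldMode N α) p) := by
    funext p; simp only [interaction]; ring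
  rw [e1]
  refine ⟨h.1, h.2.1, h.2.2.trans ?_⟩
  funext p
  simp only [S.average_coupling C _ q hN]
  rw [Fintype.sum_prod_type, Fin.sum_univ_two]
  congr 1 <;>
  · refine Finset.sum_congr rfl fun z _ => ?_
    rw [← Finset.sum_mul]
    congr 1
    simp only [couplingCoef, PiLp.inner_apply, RCLike.inner_apply, conj_trivial, Finset.mul_sum]
    push_cast
    exact Finset.sum_congr rfl fun j _ => by ring

end OscillatorModel

/-! ### Inner products of product states and symmetry of ladder coordinates -/

section Tensors

theorem memLp_two_mul_prod {α β : Type*} [MeasurableSpace α] [MeasurableSpace β] {μ : Measure α}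
    {ν : Measure β} [SFinite μ] [SFinite ν] {f : α → ℂ} {g : β → ℂ} (hf : MemLp f 2 μ)
    (hg : MemLp g 2 ν) : MemLp (fun p : α × β => f p.1 * g p.2) 2 (μ.prod ν) := by
  have hm : AEStronglyMeasurable (fun p : α × β => f p.1 * g p.2) (μ.prod ν) :=
    hf.1.comp_fst.mul hg.1.comp_snd
  rw [memLp_two_iff_integrable_sq_norm hm]
  have := ((memLp_two_iff_integrable_sq_norm hf.1).mp hf).mul_prod
    ((memLp_two_iff_integrable_sq_norm hg.1).mp hg)
  simpa only [norm_mul, mul_pow] using this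

variable {N : ℕ}

theorem memLp_fieldMode (hN : 1 ≤ N) (α : Fin 2 × cubeIndices N → ℕ) :
    MemLp (fieldMode N α) 2 (fockMeasure.prod fockMeasure) :=
  memLp_two_mul_prod (memLp_modeFun hN _) (memLp_modeFun hN _)

open ComplexConjugate in
theorem integral_fieldMode_mul (hN : 1 ≤ N) (α β : Fin 2 × cubeIndices N → ℕ) :
    ∫ p, conj (fieldMode N α p) * fieldMode N β p ∂(fockMeasure.prod fockMeasure) =
      if α = β then 1 else 0 := by
  have h1 : ∀ p : FockConf × FockConf, conj (fieldMode N α p) * fieldMode N β p =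
      (conj (modeFun N (fun z => α (0, z)) p.1) * modeFun N (fun z => β (0, z)) p.1) *
      (conj (modeFun N (fun z => α (1, z)) p.2) * modeFun N (fun z => β (1, z)) p.2) := by
    intro p; simp only [fieldMode, map_mul]; ring
  simp_rw [h1]
  rw [integral_prod_mul (fun x => conj (modeFun N (fun z => α (0, z)) x) *
    modeFun N (fun z => β (0, z)) x) (fun x => conj (modeFun N (fun z => α (1, z)) x) *
    modeFun N (fun z => β (1, z)) x), integral_modeFun_mul hN, integral_modeFun_mul hN]
  have h2 : α = β ↔ (fun z => α (0, z)) = (fun z => β (0, z)) ∧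
      (fun z => α (1, z)) = (fun z => β (1, z)) := by
    simp only [funext_iff, Prod.forall, Fin.forall_fin_two]
  by_cases h3 : (fun z => α (0, z)) = (fun z => β (0, z)) <;>
  by_cases h4 : (fun z => α (1, z)) = (fun z => β (1, z)) <;>
  simp [h2, h3, h4]

theorem ladderX_comm {ι : Type*} [DecidableEq ι] {M : Type*} [AddCommGroup M] [Module ℂ M]
    (v : (ι → ℕ) → M) {i j : ι} (hij : i ≠ j) (α : ι → ℕ) :
    ladderX (ladderX v i) j α = ladderX (ladderX v j) i α := by
  have c1 : α + Pi.single j 1 - Pi.single i 1 = α - Pi.single i 1 + Pi.single j 1 := by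
    funext k
    by_cases hk : k = i
    · subst hk; simp [hij]
    · simp [hk]
  have c2 : α + Pi.single i 1 - Pi.single j 1 = α - Pi.single j 1 + Pi.single i 1 := by
    funext k
    by_cases hk : k = j
    · subst hk; simp [Ne.symm hij]
    · simp [hk]
  simp only [ladderX, Pi.add_apply, Pi.sub_apply, Pi.single_apply, if_neg hij, if_neg hij.symm,
    add_zero, tsub_zero, c1, c2, add_right_comm α (Pi.single j 1) (Pi.single i 1),
    tsub_right_comm (a := α) (b := Pi.single j 1) (c := Pi.single i 1)]
  module

/-- Raising on one side matches lowering on the other. Two families with a common constant `k` are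
admitted because the particle wave functions on the two sides of the inner product may differ. -/
theorem inner_ladderX {ι : Type*} [DecidableEq ι] {H : Type*} [NormedAddCommGroup H]
    [InnerProductSpace ℂ H] {v v' : (ι → ℕ) → H} {k : ℂ}
    (h0 : ∀ α β, α ≠ β → inner ℂ (v α) (v' β) = 0) (h1 : ∀ α, inner ℂ (v α) (v' α) = k)
    (i : ι) (α β : ι → ℕ) :
    inner ℂ (ladderX v i α) (v' β) = inner ℂ (v α) (ladderX v' i β) := by
  classical
  have hv : ∀ α β, inner ℂ (v α) (v' β) = if α = β then k else 0 := by
    intro α β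
    split_ifs with h
    · rw [h, h1]
    · exact h0 α β h
  simp only [ladderX, inner_smul_left, inner_smul_right, inner_add_left, inner_add_right, hv,
    Complex.conj_ofReal]
  congr 1
  have h2 : ∀ a b : ι → ℕ, ((√((a i : ℝ) + 1) : ℝ) : ℂ) * (if a + Pi.single i 1 = b then k else 0) =
      ((√(b i : ℝ) : ℝ) : ℂ) * (if a = b - Pi.single i 1 then k else 0) := by
    intro a b
    by_cases hb : b i = 0
    · rw [if_neg]
      · simp [hb]
      · rintro rfl; simp at hb
    · by_cases h : a = b - Pi.single i 1
      · have h2 : a + Pi.single i 1 = b := by rw [h, multiIndex_sub_add hb]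
        rw [if_pos h, if_pos h2, ← h2]
        simp
      · rw [if_neg h, if_neg]
        · simp
        · intro h2; exact h (by rw [← h2, multiIndex_add_sub])
  rw [h2 α β]
  have h3 := h2 β α
  simp only [eq_comm (a := β + Pi.single i 1), eq_comm (a := β)] at h3
  rw [h3]
  ring

end Tensors

/-! ### Superpositions of field modes with Schwartz coefficients -/

section States
open scoped SchwartzMap LineDeriv

variable {N : ℕ}

/-- Finite superpositions of occupation number states of the field, with the particle wave
functions as coefficients. -/
noncomputable def stateFun (N : ℕ) :
    ((Fin 2 × cubeIndices N → ℕ) →₀ 𝓢(E3, ℂ)) →ₗ[ℂ] (E3 × FockConf × FockConf → ℂ) :=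
  Finsupp.lsum ℂ fun α =>
    { toFun := fun f p => f p.1 * fieldMode N α p.2
      map_add' := fun f g => by funext p; simp [add_mul]
      map_smul' := fun c f => by funext p; simp [mul_assoc] }

theorem stateFun_single (α : Fin 2 × cubeIndices N → ℕ) (f : 𝓢(E3, ℂ)) (p : E3 × FockConf × FockConf) :
    stateFun N (Finsupp.single α f) p = f p.1 * fieldMode N α p.2 := by
  rw [stateFun, Finsupp.lsum_single]
  rfl

theorem stateFun_apply (c : (Fin 2 × cubeIndices N → ℕ) →₀ 𝓢(E3, ℂ)) (p : E3 × FockConf × FockConf) :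
    stateFun N c p = ∑ α ∈ c.support, c α p.1 * fieldMode N α p.2 := by
  rw [stateFun, Finsupp.lsum_apply, Finsupp.sum, Finset.sum_apply]
  rfl

theorem memLp_stateFun_single (hN : 1 ≤ N) (α : Fin 2 × cubeIndices N → ℕ) (f : 𝓢(E3, ℂ)) :
    MemLp (fun p : E3 × FockConf × FockConf => f p.1 * fieldMode N α p.2) 2
      ((volume : Measure E3).prod (fockMeasure.prod fockMeasure)) :=
  memLp_two_mul_prod (f.memLp 2 volume) (memLp_fieldMode hN α)

/-- `stateFun` as a map into the Hilbert space. -/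
noncomputable def stateL2 (hN : 1 ≤ N) : ((Fin 2 × cubeIndices N → ℕ) →₀ 𝓢(E3, ℂ)) →ₗ[ℂ]
    Lp ℂ 2 ((volume : Measure E3).prod (fockMeasure.prod fockMeasure)) :=
  Finsupp.lsum ℂ fun α =>
    { toFun := fun f => (memLp_stateFun_single hN α f).toLp _
      map_add' := fun f g => by
        rw [← MemLp.toLp_add]
        exact MemLp.toLp_congr _ _ (Eventually.of_forall fun p => by simp [add_mul])
      map_smul' := fun c f => by
        rw [RingHom.id_apply, ← MemLp.toLp_const_smul]
        exact MemLp.toLp_congr _ _ (Eventually.of_forall fun p => by simp [mul_assoc]) }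

theorem stateL2_single (hN : 1 ≤ N) (α : Fin 2 × cubeIndices N → ℕ) (f : 𝓢(E3, ℂ)) :
    stateL2 hN (Finsupp.single α f) = (memLp_stateFun_single hN α f).toLp _ := by
  rw [stateL2, Finsupp.lsum_single]
  rfl

theorem coeFn_stateL2 (hN : 1 ≤ N) (c : (Fin 2 × cubeIndices N → ℕ) →₀ 𝓢(E3, ℂ)) :
    stateL2 hN c =ᵐ[(volume : Measure E3).prod (fockMeasure.prod fockMeasure)] stateFun N c := by
  induction c using Finsupp.induction_linear with
  | zero =>
    rw [map_zero, map_zero]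
    exact Lp.coeFn_zero _ _ _
  | add c d hc hd =>
    rw [map_add, map_add]
    exact (Lp.coeFn_add _ _).trans (hc.add hd)
  | single α f =>
    rw [stateL2_single]
    refine (MemLp.coeFn_toLp _).trans (Eventually.of_forall fun p => ?_)
    rw [stateFun_single]

theorem inner_stateL2_single (hN : 1 ≤ N) (α β : Fin 2 × cubeIndices N → ℕ) (f g : 𝓢(E3, ℂ)) :
    inner ℂ (stateL2 hN (Finsupp.single α f)) (stateL2 hN (Finsupp.single β g)) =
      inner ℂ (toL2 f) (toL2 g) * if α = β then (1 : ℂ) else 0 := by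
  rw [L2.inner_def, inner_toL2, ← integral_fieldMode_mul hN, ← integral_prod_mul
    (fun q => starRingEnd ℂ (f q) * g q)]
  refine integral_congr_ae ?_
  filter_upwards [coeFn_stateL2 hN (Finsupp.single α f), coeFn_stateL2 hN (Finsupp.single β g)]
    with p h1 h2
  rw [h1, h2, stateFun_single, stateFun_single, RCLike.inner_apply, map_mul]
  ring

theorem norm_stateL2_single (hN : 1 ≤ N) (α : Fin 2 × cubeIndices N → ℕ) (f : 𝓢(E3, ℂ)) :
    ‖stateL2 hN (Finsupp.single α f)‖ = ‖toL2 f‖ := by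
  rw [@norm_eq_sqrt_re_inner ℂ, @norm_eq_sqrt_re_inner ℂ, inner_stateL2_single, if_pos rfl, mul_one]

end States

/-! ### The compressed Hamiltonian as an operator on coefficients -/

namespace OscillatorModel
open scoped SchwartzMap LineDeriv

variable (S : OscillatorModel)

/-- The Hamiltonian of the particle, including the renormalization terms, on Schwartz functions. -/
noncomputable def particleOp (C : ℝ) (N : ℕ) : 𝓢(E3, ℂ) →ₗ[ℂ] 𝓢(E3, ℂ) :=
  ∑ i : Fin 3, (-((S.hbar ^ 2 * (S.m / 2) * S.η ^ 2 : ℝ) : ℂ) •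
      (((LineDeriv.lineDerivOpCLM ℂ 𝓢(E3, ℂ) (EuclideanSpace.single i (1 : ℝ) : E3)).comp
        (LineDeriv.lineDerivOpCLM ℂ 𝓢(E3, ℂ) (EuclideanSpace.single i (1 : ℝ) : E3))) :
        𝓢(E3, ℂ) →ₗ[ℂ] 𝓢(E3, ℂ)) +
    ((1 / (2 * S.m) : ℝ) : ℂ) • (((mulCoord i).comp (mulCoord i)) : 𝓢(E3, ℂ) →ₗ[ℂ] 𝓢(E3, ℂ))) +
  ∑ i : Fin 3, ∑ j : Fin 3, (S.renormMatrix C N i j : ℂ) •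
    (((mulCoord i).comp (mulCoord j)) : 𝓢(E3, ℂ) →ₗ[ℂ] 𝓢(E3, ℂ)) -
  (S.renormEnergy C N : ℂ) • LinearMap.id

theorem particleOp_eq (C : ℝ) (N : ℕ) (f : 𝓢(E3, ℂ)) : S.particleOp C N f =
    ∑ i : Fin 3, (-((S.hbar ^ 2 * (S.m / 2) * S.η ^ 2 : ℝ) : ℂ) •
      (∂_{(EuclideanSpace.single i (1 : ℝ) : E3)} (∂_{(EuclideanSpace.single i (1 : ℝ) : E3)} f)) +
      ((1 / (2 * S.m) : ℝ) : ℂ) • mulCoord i (mulCoord i f)) +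
    ∑ i : Fin 3, ∑ j : Fin 3, (S.renormMatrix C N i j : ℂ) • mulCoord i (mulCoord j f) -
    (S.renormEnergy C N : ℂ) • f := by
  simp only [particleOp, LinearMap.sub_apply, LinearMap.add_apply, LinearMap.sum_apply,
    LinearMap.smul_apply, LinearMap.id_apply]
  rfl

theorem particleOp_apply (C : ℝ) (N : ℕ) (f : 𝓢(E3, ℂ)) (q : E3) :
    S.particleOp C N f q = S.particleEnergy f q + (S.renorm C N q : ℂ) * f q := by
  rw [particleOp_eq, particleEnergy, ← SchwartzMap.laplacian_apply,
    SchwartzMap.laplacian_eq_sum (EuclideanSpace.basisFun (Fin 3) ℝ), renorm_eq,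
    EuclideanSpace.real_norm_sq_eq]
  simp only [sub_apply, add_apply, smul_apply, smul_eq_mul, mulCoord_apply,
    EuclideanSpace.basisFun_apply, Fin.sum_univ_three]
  push_cast
  ring

theorem inner_particleOp (C : ℝ) (N : ℕ) (f g : 𝓢(E3, ℂ)) :
    inner ℂ (toL2 (S.particleOp C N f)) (toL2 g) = inner ℂ (toL2 f) (toL2 (S.particleOp C N g)) := by
  simp only [particleOp_eq, map_sub, map_add, map_sum, map_smul, inner_sub_left, inner_sub_right,
    inner_add_left, inner_add_right, sum_inner, inner_sum, inner_smul_left, inner_smul_right,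
    inner_mulCoord, inner_lineDeriv, neg_neg, map_neg, Complex.conj_ofReal]
  congr 2
  refine Finset.sum_congr rfl fun i _ => Finset.sum_congr rfl fun j _ => ?_
  rw [mulCoord_comm]

/-- The Hamiltonian as an operator on the coefficients of occupation number states. -/
noncomputable def coefHam (C : ℝ) (N : ℕ) : ((Fin 2 × cubeIndices N → ℕ) →₀ 𝓢(E3, ℂ)) →ₗ[ℂ]
    ((Fin 2 × cubeIndices N → ℕ) →₀ 𝓢(E3, ℂ)) :=
  Finsupp.lsum ℂ fun α =>
    (Finsupp.lsingle α) ∘ₗ (S.particleOp C N + (S.modeEnergy α : ℂ) • LinearMap.id) +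
    ∑ i, ∑ j, (S.couplingCoef C N i j : ℂ) • ladderX (fun β => (Finsupp.lsingle β :
      𝓢(E3, ℂ) →ₗ[ℂ] ((Fin 2 × cubeIndices N → ℕ) →₀ 𝓢(E3, ℂ))) ∘ₗ
        ((mulCoord j : 𝓢(E3, ℂ) →L[ℂ] 𝓢(E3, ℂ)) : 𝓢(E3, ℂ) →ₗ[ℂ] 𝓢(E3, ℂ))) i α

theorem coefHam_single (C : ℝ) (N : ℕ) (α : Fin 2 × cubeIndices N → ℕ) (f : 𝓢(E3, ℂ)) :
    S.coefHam C N (Finsupp.single α f) =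
      Finsupp.single α (S.particleOp C N f + (S.modeEnergy α : ℂ) • f) +
      ∑ i, ∑ j, (S.couplingCoef C N i j : ℂ) •
        ladderX (fun β => Finsupp.single β (mulCoord j f)) i α := by
  simp only [coefHam, Finsupp.lsum_single, LinearMap.add_apply, LinearMap.sum_apply,
    LinearMap.smul_apply]
  congr 1

theorem stateFun_coefHam_single (C : ℝ) (N : ℕ) (α : Fin 2 × cubeIndices N → ℕ) (f : 𝓢(E3, ℂ))
    (p : E3 × FockConf × FockConf) : stateFun N (S.coefHam C N (Finsupp.single α f)) p =
      (S.particleEnergy f p.1 + (S.renorm C N p.1 : ℂ) * f p.1) * fieldMode N α p.2 +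
      f p.1 * ((S.modeEnergy α : ℂ) * fieldMode N α p.2 + ∑ i, ∑ j, (S.couplingCoef C N i j : ℂ) *
        (p.1 j : ℂ) * ladderX (fieldMode N) i α p.2) := by
  rw [coefHam_single, map_add, Pi.add_apply, stateFun_single, add_apply, particleOp_apply,
    smul_apply, smul_eq_mul]
  have h : ∀ i, ∀ j, stateFun N (ladderX (fun β => Finsupp.single β (mulCoord j f)) i α) p =
      (p.1 j : ℂ) * f p.1 * ladderX (fieldMode N) i α p.2 := by
    intro i j
    rw [map_ladderX]
    simp only [ladderX, Pi.smul_apply, Pi.add_apply, stateFun_single, mulCoord_apply, smul_eq_mul]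
    ring
  simp only [map_sum, map_smul, Finset.sum_apply, Pi.smul_apply, smul_eq_mul, h, mul_add,
    Finset.mul_sum]
  rw [add_mul, add_assoc]
  congr 1
  congr 1
  · ring
  · exact Finset.sum_congr rfl fun i _ => Finset.sum_congr rfl fun j _ => by ring

/-- The projection acts on the field variables only, so at fixed momentum `q` it can be evaluated
mode by mode, with the particle part entering as scalars. Analysis of the compressed operator is
thereby reduced to algebra with ladder operators. -/
theorem jointProj_hamiltonian (C : ℝ) {N : ℕ} (hN : 1 ≤ N)
    (c : (Fin 2 × cubeIndices N → ℕ) →₀ 𝓢(E3, ℂ)) :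
    jointProj N (S.hamiltonian C N (stateFun N c)) = stateFun N (S.coefHam C N c) := by
  funext ⟨q, x⟩
  have h1 : ∀ x', S.hamiltonian C N (stateFun N c) (q, x') = ∑ α ∈ c.support,
      ((S.particleEnergy (c α) q + (S.renorm C N q : ℂ) * c α q) * fieldMode N α x' +
        c α q * (S.fieldEnergy (fieldMode N α) x' + S.interaction C q (fieldMode N α) x')) := by
    intro x'
    have h2 : (fun q' => stateFun N c (q', x')) = ⇑(∑ α ∈ c.support, fieldMode N α x' • c α) := by
      funext q'
      rw [stateFun_apply, sum_apply]
      exact Finset.sum_congr rfl fun α _ => by rw [smul_apply, smul_eq_mul, mul_comm]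
    have h3 : S.particleEnergy (⇑(∑ α ∈ c.support, fieldMode N α x' • c α)) q +
        (S.renorm C N q : ℂ) * stateFun N c (q, x') = ∑ α ∈ c.support,
        (S.particleEnergy (c α) q + (S.renorm C N q : ℂ) * c α q) * fieldMode N α x' := by
      have h := S.particleOp_apply C N (∑ α ∈ c.support, fieldMode N α x' • c α) q
      rw [← congrFun h2 q] at h
      rw [← h, map_sum, sum_apply]
      refine Finset.sum_congr rfl fun α _ => ?_
      rw [map_smul, smul_apply, smul_eq_mul, particleOp_apply, mul_comm]
    have h4 : (fun x => stateFun N c (q, x)) = fun x => ∑ α ∈ c.support, c α q * fieldMode N α x := by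
      funext x; rw [stateFun_apply]
    simp only [hamiltonian]
    rw [h2, h3, h4, S.fieldEnergy_sum c.support (fun α => α), S.interaction_sum C q hN c.support
      (fun α => α)]
    simp only [Finset.sum_add_distrib, mul_add]
    ring
  have h5 := ProjTo.sum c.support fun α _ => ((projTo_fieldMode hN α).const_mul
    (S.particleEnergy (c α) q + (S.renorm C N q : ℂ) * c α q)).add
    (((S.projTo_fieldEnergy hN α).add (S.projTo_interaction C q hN α)).const_mul (c α q))
  have h6 : c = ∑ α ∈ c.support, Finsupp.single α (c α) := c.sum_single.symm
  have h7 : jointProj N (S.hamiltonian C N (stateFun N c)) (q, x) =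
    fieldProj N (fun x' => S.hamiltonian C N (stateFun N c) (q, x')) x := rfl
  rw [h7]
  simp only [h1]
  rw [h5.2.2]
  conv_rhs => rw [h6, map_sum, map_sum, Finset.sum_apply]
  refine Finset.sum_congr rfl fun α _ => ?_
  rw [stateFun_coefHam_single]

theorem inner_coefHam_single (C : ℝ) {N : ℕ} (hN : 1 ≤ N) (α β : Fin 2 × cubeIndices N → ℕ)
    (f g : 𝓢(E3, ℂ)) :
    inner ℂ (stateL2 hN (S.coefHam C N (Finsupp.single α f))) (stateL2 hN (Finsupp.single β g)) =
    inner ℂ (stateL2 hN (Finsupp.single α f)) (stateL2 hN (S.coefHam C N (Finsupp.single β g))) := by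
  have h : ∀ i, ∀ j, inner ℂ (ladderX (fun β => stateL2 hN (Finsupp.single β (mulCoord j f))) i α)
      (stateL2 hN (Finsupp.single β g)) = inner ℂ (stateL2 hN (Finsupp.single α f))
      (ladderX (fun α => stateL2 hN (Finsupp.single α (mulCoord j g))) i β) := by
    intro i j
    have hswap : ∀ β', inner ℂ (stateL2 hN (Finsupp.single α (mulCoord j f)))
        (stateL2 hN (Finsupp.single β' g)) = inner ℂ (stateL2 hN (Finsupp.single α f))
        (stateL2 hN (Finsupp.single β' (mulCoord j g))) := by
      intro β'
      rw [inner_stateL2_single, inner_stateL2_single, inner_mulCoord]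
    rw [inner_ladderX (v := fun β => stateL2 hN (Finsupp.single β (mulCoord j f)))
      (v' := fun β => stateL2 hN (Finsupp.single β g)) (k := inner ℂ (toL2 (mulCoord j f)) (toL2 g))]
    · simp only [ladderX, inner_smul_right, inner_add_right, hswap]
    · intro a b hab
      rw [inner_stateL2_single, if_neg hab, mul_zero]
    · intro a
      rw [inner_stateL2_single, if_pos rfl, mul_one]
  simp only [coefHam_single, map_add, map_sum, map_smul, map_ladderX, inner_add_left,
    inner_add_right, sum_inner, inner_sum, inner_smul_left, inner_smul_right, h, Complex.conj_ofReal]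
  congr 1
  rw [Finsupp.single_add, Finsupp.single_add, map_add, map_add, inner_add_left, inner_add_right,
    inner_stateL2_single, inner_stateL2_single, inner_stateL2_single, inner_stateL2_single,
    inner_particleOp]
  congr 1
  by_cases hαβ : α = β
  · subst hαβ
    simp only [map_smul, inner_smul_left, inner_smul_right, Complex.conj_ofReal]
  · simp [hαβ]

theorem inner_coefHam (C : ℝ) {N : ℕ} (hN : 1 ≤ N) (c d : (Fin 2 × cubeIndices N → ℕ) →₀ 𝓢(E3, ℂ)) :
    inner ℂ (stateL2 hN (S.coefHam C N c)) (stateL2 hN d) =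
    inner ℂ (stateL2 hN c) (stateL2 hN (S.coefHam C N d)) := by
  induction c using Finsupp.induction_linear with
  | zero => simp
  | add c c' hc hc' => simp only [map_add, inner_add_left, hc, hc']
  | single α f =>
    induction d using Finsupp.induction_linear with
    | zero => simp
    | add d d' hd hd' => simp only [map_add, inner_add_right, hd, hd']
    | single β g => exact S.inner_coefHam_single C hN α β f g

/-- Projected core vectors are finite combinations of occupation number states; conversely such a
state is itself a core vector fixed by the projection. -/
theorem jointCore_eq {N : ℕ} (hN : 1 ≤ N) : jointCore N = LinearMap.range (stateFun N) := by
  apply le_antisymm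
  · rw [jointCore, Submodule.span_le]
    rintro _ ⟨f, F₁, F₂, h1, h2, rfl⟩
    have h3 : ∀ A ∈ Submodule.span ℂ (Set.range (modeFun N)), ∀ B ∈ Submodule.span ℂ
        (Set.range (modeFun N)), (fun p : E3 × FockConf × FockConf => f p.1 * (A p.2.1 * B p.2.2)) ∈
        LinearMap.range (stateFun N) := by
      intro A hA B hB
      induction hA using Submodule.span_induction with
      | mem A hA =>
        obtain ⟨a, rfl⟩ := hA
        induction hB using Submodule.span_induction with
        | mem B hB =>
          obtain ⟨b, rfl⟩ := hB
          refine ⟨Finsupp.single (fun i => if i.1 = 0 then a i.2 else b i.2) f, ?_⟩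
          funext p
          rw [stateFun_single, fieldMode]
          simp
        | zero => exact ⟨0, by funext p; simp⟩
        | add B B' _ _ hB hB' =>
          convert! (LinearMap.range (stateFun N)).add_mem hB hB' using 1
          funext p; simp [mul_add]
        | smul t B _ hB =>
          convert! (LinearMap.range (stateFun N)).smul_mem t hB using 1
          funext p; simp; ring
      | zero => exact ⟨0, by funext p; simp⟩
      | add A A' _ _ hA hA' =>
        convert! (LinearMap.range (stateFun N)).add_mem hA hA' using 1
        funext p; simp; ring
      | smul t A _ hA =>
        convert! (LinearMap.range (stateFun N)).smul_mem t hA using 1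
        funext p; simp; ring
    exact h3 _ (fockProj_mem_span hN h1) _ (fockProj_mem_span hN h2)
  · rintro _ ⟨c, rfl⟩
    induction c using Finsupp.induction_linear with
    | zero => rw [map_zero]; exact Submodule.zero_mem _
    | add c d hc hd => rw [map_add]; exact Submodule.add_mem _ hc hd
    | single α f =>
      refine Submodule.subset_span ⟨f, modeFun N fun z => α (0, z), modeFun N fun z => α (1, z),
        isFockCore_modeFun hN _, isFockCore_modeFun hN _, ?_⟩
      funext p
      rw [stateFun_single, fockProj_modeFun hN, fockProj_modeFun hN]
      rfl

/-- The graph becomes the range of a linear map, hence a submodule, and symmetry and membership can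
be checked on coefficients. -/
theorem jointGraph_eq (C : ℝ) {N : ℕ} (hN : 1 ≤ N) : S.jointGraph C N =
    (LinearMap.range ((stateL2 hN).prod (stateL2 hN ∘ₗ S.coefHam C N)) : Set _) := by
  ext ⟨x, y⟩
  simp only [jointGraph, Set.mem_ofPred_eq, jointCore_eq hN, LinearMap.mem_range, SetLike.mem_coe,
    LinearMap.prod_apply, Function.prod, LinearMap.comp_apply, Prod.mk.injEq]
  constructor
  · rintro ⟨_, ⟨c, rfl⟩, hx, hy⟩
    rw [S.jointProj_hamiltonian C hN] at hy
    exact ⟨c, Lp.ext ((coeFn_stateL2 hN c).trans hx.symm),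
      Lp.ext ((coeFn_stateL2 hN _).trans hy.symm)⟩
  · rintro ⟨c, rfl, rfl⟩
    refine ⟨_, ⟨c, rfl⟩, coeFn_stateL2 hN c, ?_⟩
    rw [S.jointProj_hamiltonian C hN]
    exact coeFn_stateL2 hN _

end OscillatorModel

/-! ### The trace of the free field -/

section FieldTrace

variable {N : ℕ}

/-- Finite superpositions of occupation number states in the Hilbert space of the field. -/
noncomputable def fieldL2 (hN : 1 ≤ N) : ((Fin 2 × cubeIndices N → ℕ) →₀ ℂ) →ₗ[ℂ]
    Lp ℂ 2 (fockMeasure.prod fockMeasure) :=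
  Finsupp.linearCombination ℂ fun α => (memLp_fieldMode hN α).toLp _

theorem coeFn_fieldL2 (hN : 1 ≤ N) (c : (Fin 2 × cubeIndices N → ℕ) →₀ ℂ) :
    fieldL2 hN c =ᵐ[fockMeasure.prod fockMeasure] Finsupp.linearCombination ℂ (fieldMode N) c := by
  induction c using Finsupp.induction_linear with
  | zero =>
    rw [map_zero, map_zero]
    exact Lp.coeFn_zero _ _ _
  | add c d hc hd =>
    rw [map_add, map_add]
    exact (Lp.coeFn_add _ _).trans (hc.add hd)
  | single α t =>
    rw [fieldL2, Finsupp.linearCombination_single, Finsupp.linearCombination_single]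
    refine (Lp.coeFn_smul _ _).trans ?_
    filter_upwards [(memLp_fieldMode hN α).coeFn_toLp] with p hp
    simp only [Pi.smul_apply, hp]

theorem orthonormal_fieldMode (hN : 1 ≤ N) : Orthonormal ℂ fun α : Fin 2 × cubeIndices N → ℕ =>
    (memLp_fieldMode hN α).toLp (fieldMode N α) := by
  classical
  rw [orthonormal_iff_ite]
  intro α β
  rw [L2.inner_def]
  trans if α = β then (1 : ℂ) else 0
  · rw [← integral_fieldMode_mul hN]
    refine integral_congr_ae ?_
    filter_upwards [(memLp_fieldMode hN α).coeFn_toLp, (memLp_fieldMode hN β).coeFn_toLp] with p h1 h2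
    rw [h1, h2, RCLike.inner_apply, mul_comm]
  · exact if_congr Iff.rfl rfl rfl

end FieldTrace

namespace OscillatorModel
open scoped SchwartzMap LineDeriv

variable (S : OscillatorModel) {N : ℕ}

theorem fieldCore_eq (hN : 1 ≤ N) :
    fieldCore N = LinearMap.range (Finsupp.linearCombination ℂ (fieldMode N)) := by
  rw [Finsupp.range_linearCombination]
  apply le_antisymm
  · rw [fieldCore, Submodule.span_le]
    rintro _ ⟨F₁, F₂, h1, h2, rfl⟩
    have h3 : ∀ A ∈ Submodule.span ℂ (Set.range (modeFun N)), ∀ B ∈ Submodule.span ℂ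
        (Set.range (modeFun N)), (fun p : FockConf × FockConf => A p.1 * B p.2) ∈
        Submodule.span ℂ (Set.range (fieldMode N)) := by
      intro A hA B hB
      induction hA using Submodule.span_induction with
      | mem A hA =>
        obtain ⟨a, rfl⟩ := hA
        induction hB using Submodule.span_induction with
        | mem B hB =>
          obtain ⟨b, rfl⟩ := hB
          refine Submodule.subset_span ⟨fun i => if i.1 = 0 then a i.2 else b i.2, ?_⟩
          funext p
          rw [fieldMode]
          simp
        | zero =>
          convert! Submodule.zero_mem _ using 1
          funext p; simp
        | add B B' _ _ hB hB' =>
          convert! Submodule.add_mem _ hB hB' using 1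
          funext p; simp [mul_add]
        | smul t B _ hB =>
          convert! Submodule.smul_mem _ t hB using 1
          funext p; simp; ring
      | zero =>
        convert! Submodule.zero_mem _ using 1
        funext p; simp
      | add A A' _ _ hA hA' =>
        convert! Submodule.add_mem _ hA hA' using 1
        funext p; simp; ring
      | smul t A _ hA =>
        convert! Submodule.smul_mem _ t hA using 1
        funext p; simp; ring
    exact h3 _ (fockProj_mem_span hN h1) _ (fockProj_mem_span hN h2)
  · rw [Submodule.span_le]
    rintro _ ⟨α, rfl⟩
    refine Submodule.subset_span ⟨modeFun N fun z => α (0, z), modeFun N fun z => α (1, z),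
      isFockCore_modeFun hN _, isFockCore_modeFun hN _, ?_⟩
    rw [fockProj_modeFun hN, fockProj_modeFun hN]
    rfl

/-- The free field energy as an operator on the coefficients of occupation number states. -/
noncomputable def coefField (N : ℕ) :
    ((Fin 2 × cubeIndices N → ℕ) →₀ ℂ) →ₗ[ℂ] ((Fin 2 × cubeIndices N → ℕ) →₀ ℂ) :=
  Finsupp.linearCombination ℂ fun α => Finsupp.single α (S.modeEnergy α : ℂ)

theorem coefField_single (α : Fin 2 × cubeIndices N → ℕ) (t : ℂ) :
    S.coefField N (Finsupp.single α t) = (S.modeEnergy α : ℂ) • Finsupp.single α t := by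
  rw [coefField, Finsupp.linearCombination_single, Finsupp.smul_single, Finsupp.smul_single,
    smul_eq_mul, smul_eq_mul, mul_comm]

theorem fieldProj_fieldEnergy (hN : 1 ≤ N) (c : (Fin 2 × cubeIndices N → ℕ) →₀ ℂ) :
    fieldProj N (S.fieldEnergy (Finsupp.linearCombination ℂ (fieldMode N) c)) =
      Finsupp.linearCombination ℂ (fieldMode N) (S.coefField N c) := by
  have h1 : Finsupp.linearCombination ℂ (fieldMode N) c =
      fun p => ∑ α ∈ c.support, c α * fieldMode N α p := by
    funext p
    rw [Finsupp.linearCombination_apply, Finsupp.sum, Finset.sum_apply]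
    rfl
  have h2 := ProjTo.sum c.support fun α _ => (S.projTo_fieldEnergy hN α).const_mul (c α)
  rw [h1, S.fieldEnergy_sum c.support fun α => α, h2.2.2]
  conv_rhs => rw [← c.sum_single, Finsupp.sum, map_sum, map_sum]
  funext p
  rw [Finset.sum_apply]
  refine Finset.sum_congr rfl fun α _ => ?_
  rw [coefField_single, map_smul, Finsupp.linearCombination_single]
  simp only [Pi.smul_apply, smul_eq_mul]
  ring

theorem inner_coefField (hN : 1 ≤ N) (c d : (Fin 2 × cubeIndices N → ℕ) →₀ ℂ) :
    inner ℂ (fieldL2 hN (S.coefField N c)) (fieldL2 hN d) =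
    inner ℂ (fieldL2 hN c) (fieldL2 hN (S.coefField N d)) := by
  induction c using Finsupp.induction_linear with
  | zero => simp
  | add c c' hc hc' => simp only [map_add, inner_add_left, hc, hc']
  | single α t =>
    induction d using Finsupp.induction_linear with
    | zero => simp
    | add d d' hd hd' => simp only [map_add, inner_add_right, hd, hd']
    | single β t' =>
      rw [coefField_single, coefField_single, map_smul, map_smul, inner_smul_left, inner_smul_right,
        Complex.conj_ofReal]
      by_cases h : α = β
      · rw [h]
      · have : inner ℂ (fieldL2 hN (Finsupp.single α t)) (fieldL2 hN (Finsupp.single β t')) = 0 := by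
          rw [fieldL2, Finsupp.linearCombination_single, Finsupp.linearCombination_single,
            inner_smul_left, inner_smul_right, (orthonormal_fieldMode hN).2 h]
          simp
        rw [this, mul_zero, mul_zero]

theorem fieldGraph_eq (hN : 1 ≤ N) : S.fieldGraph N =
    (LinearMap.range ((fieldL2 hN).prod (fieldL2 hN ∘ₗ S.coefField N)) : Set _) := by
  ext ⟨x, y⟩
  simp only [fieldGraph, Set.mem_ofPred_eq, fieldCore_eq hN, LinearMap.mem_range, SetLike.mem_coe,
    LinearMap.prod_apply, Function.prod, LinearMap.comp_apply, Prod.mk.injEq]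
  constructor
  · rintro ⟨_, ⟨c, rfl⟩, hx, hy⟩
    rw [S.fieldProj_fieldEnergy hN] at hy
    exact ⟨c, Lp.ext ((coeFn_fieldL2 hN c).trans hx.symm),
      Lp.ext ((coeFn_fieldL2 hN _).trans hy.symm)⟩
  · rintro ⟨c, rfl, rfl⟩
    refine ⟨_, ⟨c, rfl⟩, coeFn_fieldL2 hN c, ?_⟩
    rw [S.fieldProj_fieldEnergy hN]
    exact coeFn_fieldL2 hN _

/-- The occupation number states are themselves eigenvectors in the graph. The free energy has no
zero-point part, so a mode contributes `(1 - e^(-tħω))⁻¹` rather than `1/(2 sinh)`; the discrepancy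
is settled in the energy shift of the coupled system. -/
theorem hasHeatTrace_fieldGraph (hN : 1 ≤ N) {t : ℝ} (ht : 0 < t) :
    HasHeatTrace (S.fieldGraph N) t
      (∏ i : Fin 2 × cubeIndices N, (1 - Real.exp (-(t * (S.hbar * S.ωMean N i.2))))⁻¹) := by
  rw [S.fieldGraph_eq hN]
  have hs : ∀ (α : Fin 2 × cubeIndices N → ℕ),
      fieldL2 hN (Finsupp.single α 1) = (memLp_fieldMode hN α).toLp (fieldMode N α) := by
    intro α
    rw [fieldL2, Finsupp.linearCombination_single, one_smul]
  refine ⟨?_, Fin 2 × cubeIndices N → ℕ, fun α => (memLp_fieldMode hN α).toLp (fieldMode N α),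
    S.modeEnergy, orthonormal_fieldMode hN, ?_, fun α => subset_closure ?_, ?_⟩
  · rintro _ ⟨c, rfl⟩ _ ⟨d, rfl⟩
    exact S.inner_coefField hN c d
  · rintro _ ⟨c, rfl⟩
    refine Submodule.le_topologicalClosure _ ?_
    rw [← Finsupp.range_linearCombination]
    exact ⟨c, rfl⟩
  · refine ⟨Finsupp.single α 1, ?_⟩
    simp only [LinearMap.prod_apply, Function.prod, LinearMap.comp_apply, coefField_single, map_smul, hs]
  · have h1 : ∀ i : Fin 2 × cubeIndices N, HasSum
        (fun n : ℕ => Real.exp (-(t * (S.hbar * S.ωMean N i.2))) ^ n)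
        (1 - Real.exp (-(t * (S.hbar * S.ωMean N i.2))))⁻¹ := by
      intro i
      refine hasSum_geometric_of_lt_one (Real.exp_pos _).le (Real.exp_lt_one_iff.mpr ?_)
      have := mul_pos ht (mul_pos S.hbar_pos (S.ωMean_pos hN i.2))
      linarith
    have h2 := hasSum_prod_pi (fun i n => by positivity) h1
    convert! h2 using 1
    funext α
    simp only [← Real.exp_nat_mul]
    rw [← Real.exp_sum, modeEnergy, Finset.mul_sum]
    congr 1
    exact Finset.sum_congr rfl fun i _ => by ring

end OscillatorModel

/-! ### Positivity of the coupled potential -/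

section CouplingForm

variable {κ : Type} [Fintype κ]

/-- The quadratic coupling of the three particle coordinates to further oscillators. -/
noncomputable def couplingForm (G : κ → Fin 3 → ℝ) (ν : κ → ℝ) : Matrix (Fin 3 ⊕ κ) (Fin 3 ⊕ κ) ℝ :=
  Matrix.fromBlocks (Matrix.of fun j j' => ∑ i, G i j * G i j' / ν i) (Matrix.of fun j i => G i j)
    (Matrix.of G) 0

/-- The block `∑ G G/ν` on the particle coordinates is what completes the squares in the field
coordinates, leaving `η|X|² + ∑ νᵢ (xᵢ + gᵢ/νᵢ)²` with `gᵢ = ∑ G i j X j`. Positivity therefore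
holds for every strength of the coupling. -/
theorem posDef_add_couplingForm [DecidableEq κ] (G : κ → Fin 3 → ℝ) {ν : κ → ℝ} (hν : ∀ i, 0 < ν i)
    {η : ℝ} (hη : 0 < η) :
    (Matrix.diagonal (Sum.elim (fun _ => η) ν) + couplingForm G ν).PosDef := by
  refine Matrix.PosDef.of_dotProduct_mulVec_pos ?_ fun {x} hx => ?_
  · ext a b
    rcases a with a | a <;> rcases b with b | b <;>
      simp [couplingForm, Matrix.diagonal_apply, mul_comm, eq_comm]
    rcases eq_or_ne a b with h | h <;> simp [h]
  · set g : κ → ℝ := fun i => ∑ j, G i j * x (Sum.inl j) with hg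
    have key : star x ⬝ᵥ ((Matrix.diagonal (Sum.elim (fun _ => η) ν) + couplingForm G ν).mulVec x) =
        η * ∑ j, x (Sum.inl j) ^ 2 + ∑ i, ν i * (x (Sum.inr i) + g i / ν i) ^ 2 := by
      have e1 : ∀ i, ν i * (x (Sum.inr i) + g i / ν i) ^ 2 =
          ν i * x (Sum.inr i) ^ 2 + 2 * x (Sum.inr i) * g i + g i * g i / ν i := by
        intro i
        have := (hν i).ne'
        field_simp
        ring
      simp only [e1, Finset.sum_add_distrib]
      have e2 : ∑ i, g i * g i / ν i =
          ∑ j, ∑ j', x (Sum.inl j) * (∑ i, G i j * G i j' / ν i) * x (Sum.inl j') := by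
        simp only [hg, Finset.sum_div, Finset.mul_sum, Finset.sum_mul]
        rw [Finset.sum_comm]
        refine Finset.sum_congr rfl fun j _ => ?_
        rw [Finset.sum_comm]
        exact Finset.sum_congr rfl fun j' _ => Finset.sum_congr rfl fun i _ => by ring
      have e3 : ∑ i, x (Sum.inr i) * g i = ∑ j, x (Sum.inl j) * ∑ i, G i j * x (Sum.inr i) := by
        simp only [hg, Finset.mul_sum]
        rw [Finset.sum_comm]
        exact Finset.sum_congr rfl fun j _ => Finset.sum_congr rfl fun i _ => by ring
      have e4 : ∑ i, 2 * x (Sum.inr i) * g i = ∑ i, x (Sum.inr i) * g i +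
          ∑ j, x (Sum.inl j) * ∑ i, G i j * x (Sum.inr i) := by
        rw [← e3, ← Finset.sum_add_distrib]
        exact Finset.sum_congr rfl fun i _ => by ring
      rw [e2, e4, Matrix.add_mulVec, dotProduct_add]
      simp only [dotProduct, Matrix.mulVec, Fintype.sum_sum_type, star_trivial, couplingForm,
        Matrix.fromBlocks_apply₁₁, Matrix.fromBlocks_apply₁₂, Matrix.fromBlocks_apply₂₁,
        Matrix.fromBlocks_apply₂₂, Matrix.of_apply, Matrix.zero_apply, zero_mul, mul_add,
        Finset.sum_add_distrib, Matrix.diagonal_apply, ite_mul, Finset.sum_ite_eq, Finset.mem_univ,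
        if_true, Sum.elim_inl, Sum.elim_inr, hg, Finset.mul_sum]
      have e5 : ∀ j, x (Sum.inl j) * (η * x (Sum.inl j)) = η * x (Sum.inl j) ^ 2 := fun j => by ring
      have e6 : ∀ j, x (Sum.inr j) * (ν j * x (Sum.inr j)) = ν j * x (Sum.inr j) ^ 2 := fun j => by ring
      simp only [e5, e6, Finset.sum_mul, Finset.mul_sum, mul_zero, Finset.sum_const_zero]
      ring_nf
    rw [key]
    have h0 : ∀ i, 0 ≤ ν i * (x (Sum.inr i) + g i / ν i) ^ 2 := fun i =>
      mul_nonneg (hν i).le (sq_nonneg _)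
    by_cases hX : ∀ j, x (Sum.inl j) = 0
    · have hZ : ∃ i, x (Sum.inr i) ≠ 0 := by
        by_contra! hZ
        exact hx (funext fun a => by rcases a with a | a <;> simp [hX, hZ])
      obtain ⟨i, hi⟩ := hZ
      have hg0 : g i = 0 := by simp [hg, hX]
      refine add_pos_of_nonneg_of_pos (by positivity) (Finset.sum_pos' (fun i _ => h0 i)
        ⟨i, Finset.mem_univ i, ?_⟩)
      rw [hg0, zero_div, add_zero]
      exact mul_pos (hν i) (by positivity)
    · push Not at hX
      obtain ⟨j, hj⟩ := hX
      refine add_pos_of_pos_of_nonneg (mul_pos hη (Finset.sum_pos' (fun j _ => sq_nonneg _)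
        ⟨j, Finset.mem_univ j, by positivity⟩)) (Finset.sum_nonneg fun i _ => h0 i)

theorem posDef_freqMatrix_couplingForm [DecidableEq κ] (G : κ → Fin 3 → ℝ) {ν : κ → ℝ}
    (hν : ∀ i, 0 < ν i) {η : ℝ} (hη : 0 < η) :
    (freqMatrix (Sum.elim (fun _ => η) ν) (couplingForm G ν)).PosDef := by
  have hw : ∀ a, 0 < Sum.elim (fun _ : Fin 3 => η) ν a := by
    rintro (a | a)
    · exact hη
    · exact hν a
  have h := (posDef_add_couplingForm G hν hη).conjTranspose_mul_mul_same
    (B := Matrix.diagonal fun a => √(Sum.elim (fun _ : Fin 3 => η) ν a)) ?_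
  · simpa [freqMatrix, Matrix.diagonal_conjTranspose] using h
  · intro x y hxy
    funext a
    have := congrFun hxy a
    simp only [Matrix.mulVec_diagonal] at this
    exact mul_left_cancel₀ (Real.sqrt_pos.mpr (hw a)).ne' this

end CouplingForm

/-! ### Natural units for the particle momentum -/

section Scaling
open scoped SchwartzMap LineDeriv

/-- Dilation of momentum space. -/
noncomputable def dilation (s : ℝ) (hs : 0 < s) : E3 ≃L[ℝ] E3 :=
  (LinearEquiv.smulOfNeZero ℝ E3 s⁻¹ (inv_ne_zero hs.ne')).toContinuousLinearEquiv

theorem dilation_apply (s : ℝ) (hs : 0 < s) (x : E3) : dilation s hs x = s⁻¹ • x := rfl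

theorem ladderX_hermiteComp_apply (s : ℝ) (hs : 0 < s) (a : Fin 3 → ℕ) (i : Fin 3) (x : E3) :
    ladderX (hermiteComp (dilation s hs)) i a x =
      ((√|LinearMap.det (dilation s hs : E3 →ₗ[ℝ] E3)| : ℝ) : ℂ) *
        ladderX hermiteS i a (dilation s hs x) := by
  simp only [ladderX, smul_apply, add_apply, hermiteComp_apply, smul_eq_mul]
  ring

theorem mulCoord_hermiteComp (s : ℝ) (hs : 0 < s) (a : Fin 3 → ℕ) (i : Fin 3) :
    mulCoord i (hermiteComp (dilation s hs) a) =
      (s : ℂ) • ladderX (hermiteComp (dilation s hs)) i a := by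
  ext x
  rw [smul_apply, ladderX_hermiteComp_apply, ← mulCoord_hermiteS, mulCoord_apply, mulCoord_apply,
    hermiteComp_apply]
  have h : ((dilation s hs x i : ℝ) : ℂ) = (s : ℂ)⁻¹ * (x i : ℂ) := by simp [dilation_apply]
  rw [h, smul_eq_mul]
  have hs' : (s : ℂ) ≠ 0 := by exact_mod_cast hs.ne'
  field_simp

/-- The scale `s` is the one for which kinetic and potential coefficients balance after dilation: `A
s⁻² = B s² = ε/2`. -/
theorem oscillator_hermiteComp (s : ℝ) (hs : 0 < s) (a : Fin 3 → ℕ) (i : Fin 3) {A B ε : ℂ}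
    (hA : A = ε / 2 * s ^ 2) (hB : B * s ^ 2 = ε / 2) :
    -A • (∂_{(EuclideanSpace.single i (1 : ℝ) : E3)} (∂_{(EuclideanSpace.single i (1 : ℝ) : E3)}
      (hermiteComp (dilation s hs) a))) + B • mulCoord i (mulCoord i (hermiteComp (dilation s hs) a)) =
      (ε * ((a i : ℂ) + 1 / 2)) • hermiteComp (dilation s hs) a := by
  have hs' : (s : ℂ) ≠ 0 := by exact_mod_cast hs.ne'
  ext x
  have hd : (∂_{(EuclideanSpace.single i (1 : ℝ) : E3)} (∂_{(EuclideanSpace.single i (1 : ℝ) : E3)}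
      (hermiteComp (dilation s hs) a))) x =
      ((√|LinearMap.det (dilation s hs : E3 →ₗ[ℝ] E3)| : ℝ) : ℂ) * (((s : ℂ)⁻¹ * (s : ℂ)⁻¹) *
      (∂_{(EuclideanSpace.single i (1 : ℝ) : E3)} (∂_{(EuclideanSpace.single i (1 : ℝ) : E3)}
      (hermiteS a))) (dilation s hs x)) := by
    have hdz : ∀ (m : E3) (f : 𝓢(E3, ℂ)), ∂_{m} f = LineDeriv.lineDerivOpCLM ℂ 𝓢(E3, ℂ) m f :=
      fun m f => rfl
    have h1 := lineDeriv_lineDeriv_comp (dilation s hs) (s⁻¹ • (1 : Matrix (Fin 3) (Fin 3) ℝ))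
      (fun x k => by simp [dilation_apply, Matrix.one_apply]) i (hermiteS a) x
    have h2 : (∂_{(EuclideanSpace.single i (1 : ℝ) : E3)} (∂_{(EuclideanSpace.single i (1 : ℝ) : E3)}
      (hermiteComp (dilation s hs) a))) x =
      ((√|LinearMap.det (dilation s hs : E3 →ₗ[ℝ] E3)| : ℝ) : ℂ) *
      (∂_{(EuclideanSpace.single i (1 : ℝ) : E3)} (∂_{(EuclideanSpace.single i (1 : ℝ) : E3)}
      (SchwartzMap.compCLMOfContinuousLinearEquiv ℂ (dilation s hs) (hermiteS a)))) x := by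
      simp only [hermiteComp, hdz, map_smul, smul_apply, smul_eq_mul]
    rw [h2, h1, Finset.sum_eq_single i, Finset.sum_eq_single i]
    · simp
    · intro l _ hl; simp [hl]
    · simp
    · intro k _ hk
      exact Finset.sum_eq_zero fun l _ => by simp [hk]
    · simp
  have ho := congrArg (fun f : 𝓢(E3, ℂ) => f (dilation s hs x)) (oscEnergy_hermiteS a i)
  simp only [oscEnergy, smul_apply, sub_apply, smul_eq_mul, mulCoord_apply] at ho
  simp only [add_apply, smul_apply, smul_eq_mul, mulCoord_apply, hd]
  rw [hermiteComp_apply]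
  have h : ((dilation s hs x i : ℝ) : ℂ) = (s : ℂ)⁻¹ * (x i : ℂ) := by simp [dilation_apply]
  rw [h] at ho
  have hB' : B = ε / 2 * ((s : ℂ)⁻¹ * (s : ℂ)⁻¹) := by rw [← hB]; field_simp
  have hss : (s : ℂ) ^ 2 * ((s : ℂ)⁻¹ * (s : ℂ)⁻¹) = 1 := by field_simp
  set r : ℂ := ((√|LinearMap.det (dilation s hs : E3 →ₗ[ℝ] E3)| : ℝ) : ℂ)
  set D := (∂_{(EuclideanSpace.single i (1 : ℝ) : E3)} (∂_{(EuclideanSpace.single i (1 : ℝ) : E3)}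
      (hermiteS a))) (dilation s hs x)
  rw [hA, hB']
  linear_combination (r * ε) * ho - (r * ε / 2 * D) * hss

end Scaling

/-! ### The coupled system as a quadratic Hamiltonian, and its trace -/

namespace OscillatorModel
open scoped SchwartzMap LineDeriv

variable (S : OscillatorModel) {N : ℕ}

/-- The natural unit of momentum. -/
noncomputable def momentumUnit : ℝ := √(S.m * S.hbar * S.η)

theorem momentumUnit_pos : 0 < S.momentumUnit :=
  Real.sqrt_pos.mpr (mul_pos (mul_pos S.m_pos S.hbar_pos) S.η_pos)

theorem momentumUnit_sq : S.momentumUnit ^ 2 = S.m * S.hbar * S.η :=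
  Real.sq_sqrt (mul_pos (mul_pos S.m_pos S.hbar_pos) S.η_pos).le

/-- The coupling of the particle to the field oscillators in natural units. -/
noncomputable def oscCoupling (C : ℝ) (N : ℕ) (i : Fin 2 × cubeIndices N) (j : Fin 3) : ℝ :=
  S.momentumUnit * S.couplingCoef C N i j / S.hbar

/-- The frequencies of the field oscillators. -/
noncomputable def fieldFreq (N : ℕ) (i : Fin 2 × cubeIndices N) : ℝ := S.ωMean N i.2

theorem fieldFreq_pos (hN : 1 ≤ N) (i : Fin 2 × cubeIndices N) : 0 < S.fieldFreq N i :=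
  S.ωMean_pos hN i.2

/-- In natural units the mass renormalization is precisely the particle block of `couplingForm`,
with no remainder. This is where its discretized form, with separate means of `y` and `ω`, matters.
-/
theorem renormMatrix_eq (C : ℝ) (hN : 1 ≤ N) (j j' : Fin 3) : S.momentumUnit ^ 2 * S.renormMatrix C N j j' =
    S.hbar / 2 * ∑ i, S.oscCoupling C N i j * S.oscCoupling C N i j' / S.fieldFreq N i := by
  rw [renormMatrix, Fintype.sum_prod_type_right, Finset.mul_sum, Finset.mul_sum]
  refine Finset.sum_congr rfl fun z _ => ?_
  rw [Finset.mul_sum, Finset.mul_sum]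
  refine Finset.sum_congr rfl fun σ _ => ?_
  have hV := (cubeVol_pos hN).le
  have h1 : √(cubeVol N) * √(cubeVol N) = cubeVol N := Real.mul_self_sqrt hV
  have h2 : √2 * √2 = (2 : ℝ) := Real.mul_self_sqrt (by norm_num)
  have h3 : √(S.hbar / (4 * Real.pi ^ 2)) * √(S.hbar / (4 * Real.pi ^ 2)) = S.hbar / (4 * Real.pi ^ 2) :=
    Real.mul_self_sqrt (div_nonneg S.hbar_pos.le (by positivity))
  have hm := S.m_pos.ne'
  have hh := S.hbar_pos.ne'
  have hw := (S.ωMean_pos hN z).ne'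
  simp only [oscCoupling, couplingCoef, fieldFreq]
  have e : S.momentumUnit * (√(cubeVol N) * √2 * (S.e / S.m * √(S.hbar / (4 * Real.pi ^ 2))) *
      S.yMean C N σ z j) / S.hbar * (S.momentumUnit * (√(cubeVol N) * √2 *
      (S.e / S.m * √(S.hbar / (4 * Real.pi ^ 2))) * S.yMean C N σ z j') / S.hbar) / S.ωMean N z =
      S.momentumUnit ^ 2 * (√(cubeVol N) * √(cubeVol N)) * (√2 * √2) * (S.e / S.m) ^ 2 *
      (√(S.hbar / (4 * Real.pi ^ 2)) * √(S.hbar / (4 * Real.pi ^ 2))) *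
      (S.yMean C N σ z j * S.yMean C N σ z j') / S.hbar ^ 2 / S.ωMean N z := by
    field_simp
  rw [e, h1, h2, h3]
  have hpi := Real.pi_ne_zero
  field_simp

/-- Product states, built from Hermite functions of the particle momentum and occupation number
states of the field. -/
noncomputable def productState (N : ℕ) (α : Fin 3 ⊕ (Fin 2 × cubeIndices N) → ℕ) :
    (Fin 2 × cubeIndices N → ℕ) →₀ 𝓢(E3, ℂ) :=
  Finsupp.single (fun i => α (Sum.inr i))
    (hermiteComp (dilation S.momentumUnit S.momentumUnit_pos) fun i => α (Sum.inl i))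

theorem _root_.sum_inl_add_single {κ : Type*} [DecidableEq κ] (α : Fin 3 ⊕ κ → ℕ) (i : Fin 3) :
    (fun j => (α + Pi.single (Sum.inl i) 1 : Fin 3 ⊕ κ → ℕ) (Sum.inl j)) =
      (fun j => α (Sum.inl j)) + Pi.single i 1 := by
  funext j
  by_cases h : j = i
  · subst h; simp
  · simp [h]

theorem _root_.sum_inl_sub_single {κ : Type*} [DecidableEq κ] (α : Fin 3 ⊕ κ → ℕ) (i : Fin 3) :
    (fun j => (α - Pi.single (Sum.inl i) 1 : Fin 3 ⊕ κ → ℕ) (Sum.inl j)) =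
      (fun j => α (Sum.inl j)) - Pi.single i 1 := by
  funext j
  by_cases h : j = i
  · subst h; simp
  · simp [h]

theorem _root_.sum_inr_add_single {κ : Type*} [DecidableEq κ] (α : Fin 3 ⊕ κ → ℕ) (i : κ) :
    (fun j => (α + Pi.single (Sum.inr i) 1 : Fin 3 ⊕ κ → ℕ) (Sum.inr j)) =
      (fun j => α (Sum.inr j)) + Pi.single i 1 := by
  funext j
  by_cases h : j = i
  · subst h; simp
  · simp [h]

theorem _root_.sum_inr_sub_single {κ : Type*} [DecidableEq κ] (α : Fin 3 ⊕ κ → ℕ) (i : κ) :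
    (fun j => (α - Pi.single (Sum.inr i) 1 : Fin 3 ⊕ κ → ℕ) (Sum.inr j)) =
      (fun j => α (Sum.inr j)) - Pi.single i 1 := by
  funext j
  by_cases h : j = i
  · subst h; simp
  · simp [h]

theorem ladderX_productState_inl (α : Fin 3 ⊕ (Fin 2 × cubeIndices N) → ℕ) (j : Fin 3) :
    ladderX (S.productState N) (Sum.inl j) α = Finsupp.single (fun i => α (Sum.inr i))
      (ladderX (hermiteComp (dilation S.momentumUnit S.momentumUnit_pos)) j fun i => α (Sum.inl i)) := by
  have h : ∀ β, (β = α + Pi.single (Sum.inl j) 1 ∨ β = α - Pi.single (Sum.inl j) 1) →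
      (fun i => β (Sum.inr i)) = fun i => α (Sum.inr i) := by
    rintro β (rfl | rfl) <;> funext i <;> simp
  simp only [ladderX, productState]
  rw [h _ (Or.inl rfl), h _ (Or.inr rfl), sum_inl_add_single, sum_inl_sub_single]
  simp only [Finsupp.smul_single, ← Finsupp.single_add]

theorem ladderX_ladderX_productState_inl_inl (α : Fin 3 ⊕ (Fin 2 × cubeIndices N) → ℕ) (i j : Fin 3) :
    (S.momentumUnit ^ 2 : ℂ) • ladderX (ladderX (S.productState N) (Sum.inl i)) (Sum.inl j) α =
      Finsupp.single (fun i => α (Sum.inr i)) (mulCoord i (mulCoord j (hermiteComp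
        (dilation S.momentumUnit S.momentumUnit_pos) fun i => α (Sum.inl i)))) := by
  have h : ∀ β, (β = α + Pi.single (Sum.inl j) 1 ∨ β = α - Pi.single (Sum.inl j) 1) →
      (fun i => β (Sum.inr i)) = fun i => α (Sum.inr i) := by
    rintro β (rfl | rfl) <;> funext i <;> simp
  rw [mulCoord_hermiteComp, map_smul]
  have h1 := map_ladderX ((mulCoord i : 𝓢(E3, ℂ) →L[ℂ] 𝓢(E3, ℂ)) : 𝓢(E3, ℂ) →ₗ[ℂ] 𝓢(E3, ℂ))
    (hermiteComp (dilation S.momentumUnit S.momentumUnit_pos)) j (fun i => α (Sum.inl i))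
  simp only [ContinuousLinearMap.coe_coe, mulCoord_hermiteComp] at h1
  rw [h1, ladderX]
  simp only [ladderX_productState_inl]
  rw [h _ (Or.inl rfl), h _ (Or.inr rfl), sum_inl_add_single, sum_inl_sub_single]
  conv_rhs => rw [ladderX]
  simp only [Finsupp.smul_single, ← Finsupp.single_add]
  congr 1
  module

theorem ladderX_ladderX_productState_inl_inr (α : Fin 3 ⊕ (Fin 2 × cubeIndices N) → ℕ) (j : Fin 3)
    (i : Fin 2 × cubeIndices N) :
    (S.momentumUnit : ℂ) • ladderX (ladderX (S.productState N) (Sum.inl j)) (Sum.inr i) α =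
      ladderX (fun β => Finsupp.single β (mulCoord j (hermiteComp
        (dilation S.momentumUnit S.momentumUnit_pos) fun i => α (Sum.inl i)))) i
        (fun i => α (Sum.inr i)) := by
  have h : ∀ β, (β = α + Pi.single (Sum.inr i) 1 ∨ β = α - Pi.single (Sum.inr i) 1) →
      (fun i => β (Sum.inl i)) = fun i => α (Sum.inl i) := by
    rintro β (rfl | rfl) <;> funext i <;> simp
  rw [ladderX]
  simp only [ladderX_productState_inl]
  rw [h _ (Or.inl rfl), h _ (Or.inr rfl), sum_inr_add_single, sum_inr_sub_single]
  conv_rhs => rw [ladderX]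
  simp only [mulCoord_hermiteComp, ← Finsupp.smul_single]
  module

/-- The ground state energy shift. -/
noncomputable def energyShift (C : ℝ) (N : ℕ) : ℝ :=
  -(S.hbar / 2 * ∑ i, S.fieldFreq N i) - S.renormEnergy C N

/-- The interaction appears once in the Hamiltonian and twice, with factor `1/2`, in the symmetric
form `V`; the two orders agree because the coordinates commute. The zero-point energies of the
field, present in `ladderHam` but absent from the model, are subtracted in `energyShift`; that of
the particle stays. -/
theorem coefHam_productState (C : ℝ) (hN : 1 ≤ N) (α : Fin 3 ⊕ (Fin 2 × cubeIndices N) → ℕ) :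
    S.coefHam C N (S.productState N α) =
      (S.hbar : ℂ) • ladderHam (Sum.elim (fun _ => S.η) (S.fieldFreq N))
        (couplingForm (S.oscCoupling C N) (S.fieldFreq N)) (S.productState N) α +
      (S.energyShift C N : ℂ) • S.productState N α := by
  have hs := S.momentumUnit_pos
  have hsC : (S.momentumUnit : ℂ) ≠ 0 := by exact_mod_cast hs.ne'
  have hhC : (S.hbar : ℂ) ≠ 0 := by exact_mod_cast S.hbar_pos.ne'
  set a : Fin 3 → ℕ := fun i => α (Sum.inl i) with ha
  set b : Fin 2 × cubeIndices N → ℕ := fun i => α (Sum.inr i) with hb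
  set h := hermiteComp (dilation S.momentumUnit S.momentumUnit_pos) a with hh
  have hp : S.productState N α = Finsupp.single b h := rfl
  have h1 : ∀ i : Fin 3, -((S.hbar ^ 2 * (S.m / 2) * S.η ^ 2 : ℝ) : ℂ) •
      (∂_{(EuclideanSpace.single i (1 : ℝ) : E3)} (∂_{(EuclideanSpace.single i (1 : ℝ) : E3)} h)) +
      ((1 / (2 * S.m) : ℝ) : ℂ) • mulCoord i (mulCoord i h) =
      (((S.hbar * S.η : ℝ) : ℂ) * ((a i : ℂ) + 1 / 2)) • h := by
    intro i
    refine oscillator_hermiteComp _ _ a i ?_ ?_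
    · rw [← Complex.ofReal_pow, momentumUnit_sq]
      push_cast; ring
    · rw [← Complex.ofReal_pow, momentumUnit_sq]
      have := S.m_pos.ne'
      have hmC : (S.m : ℂ) ≠ 0 := by exact_mod_cast this
      push_cast
      field_simp
  rw [hp, coefHam_single, particleOp_eq]
  simp only [h1]
  rw [ladderHam, Fintype.sum_sum_type]
  simp only [Fintype.sum_sum_type, Sum.elim_inl, Sum.elim_inr, couplingForm,
    Matrix.fromBlocks_apply₁₁, Matrix.fromBlocks_apply₁₂, Matrix.fromBlocks_apply₂₁,
    Matrix.fromBlocks_apply₂₂, Matrix.of_apply, Matrix.zero_apply, Complex.ofReal_zero, zero_smul,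
    Finset.sum_const_zero, add_zero]
  have h2 : ∀ i j, ladderX (ladderX (S.productState N) (Sum.inl i)) (Sum.inl j) α =
      ((S.momentumUnit ^ 2 : ℂ)⁻¹) • Finsupp.single b (mulCoord i (mulCoord j h)) := by
    intro i j
    rw [← ladderX_ladderX_productState_inl_inl, smul_smul, inv_mul_cancel₀ (pow_ne_zero 2 hsC), one_smul]
  have h3 : ∀ j i, ladderX (ladderX (S.productState N) (Sum.inl j)) (Sum.inr i) α =
      ((S.momentumUnit : ℂ)⁻¹) • ladderX (fun β => Finsupp.single β (mulCoord j h)) i b := by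
    intro i j
    rw [← ladderX_ladderX_productState_inl_inr, smul_smul, inv_mul_cancel₀ hsC, one_smul]
  have h4 : ∀ j i, ladderX (ladderX (S.productState N) (Sum.inr i)) (Sum.inl j) α =
      ((S.momentumUnit : ℂ)⁻¹) • ladderX (fun β => Finsupp.single β (mulCoord j h)) i b := by
    intro j i
    rw [ladderX_comm _ (by simp), h3]
  have hr : ∀ j j', (S.renormMatrix C N j j' : ℂ) = (S.hbar : ℂ) * ((1 / 2) *
      (((∑ i, S.oscCoupling C N i j * S.oscCoupling C N i j' / S.fieldFreq N i : ℝ) : ℂ) *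
        (S.momentumUnit ^ 2 : ℂ)⁻¹)) := by
    intro j j'
    have := congrArg Complex.ofReal (S.renormMatrix_eq C hN j j')
    rw [Complex.ofReal_mul, Complex.ofReal_mul] at this
    push_cast at this ⊢
    field_simp
    linear_combination 2 * this
  have hk : ∀ i j, (S.couplingCoef C N i j : ℂ) =
      (S.hbar : ℂ) * ((S.oscCoupling C N i j : ℂ) * (S.momentumUnit : ℂ)⁻¹) := by
    intro i j
    rw [oscCoupling]
    push_cast
    field_simp
  have hE : (S.modeEnergy b : ℂ) = (S.hbar : ℂ) * ∑ i, (S.fieldFreq N i : ℂ) * ((b i : ℂ) + 1 / 2) -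
      (S.hbar : ℂ) / 2 * ∑ i, (S.fieldFreq N i : ℂ) := by
    rw [modeEnergy, Finset.mul_sum, Finset.mul_sum, ← Finset.sum_sub_distrib]
    push_cast
    refine Finset.sum_congr rfl fun i _ => ?_
    rw [fieldFreq]; ring
  simp only [h2, h3, h4, hr, hk, hp, smul_smul]
  set R : Fin 3 → Fin 3 → ℂ := fun x y => ((∑ i, S.oscCoupling C N i x * S.oscCoupling C N i y /
    S.fieldFreq N i : ℝ) : ℂ) * (S.momentumUnit ^ 2 : ℂ)⁻¹ with hR
  set K : Fin 2 × cubeIndices N → Fin 3 → ℂ := fun x y =>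
    (S.oscCoupling C N x y : ℂ) * (S.momentumUnit : ℂ)⁻¹ with hK
  set X : (Fin 2 × cubeIndices N → ℕ) →₀ 𝓢(E3, ℂ) := Finsupp.single b h with hX
  have e1 : Finsupp.single b (∑ x, (((S.hbar * S.η : ℝ) : ℂ) * ((a x : ℂ) + 1 / 2)) • h +
      ∑ x, ∑ y, ((S.hbar : ℂ) * (1 / 2 * R x y)) • mulCoord x (mulCoord y h) -
      (S.renormEnergy C N : ℂ) • h + (S.modeEnergy b : ℂ) • h) =
      (∑ x, (S.hbar : ℂ) * ((S.η : ℂ) * ((a x : ℂ) + 1 / 2))) • X +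
      ((S.hbar : ℂ) / 2) • ∑ x, ∑ y, R x y • Finsupp.single b (mulCoord x (mulCoord y h)) -
      (S.renormEnergy C N : ℂ) • X + (S.modeEnergy b : ℂ) • X := by
    have hl : ∀ g : 𝓢(E3, ℂ), Finsupp.single b g = Finsupp.lsingle (R := ℂ) b g := fun g => rfl
    simp only [hX, hl, map_add, map_sub, map_sum, map_smul, Finset.smul_sum, smul_smul,
      Finset.sum_smul]
    congr 2
    congr 1
    · exact Finset.sum_congr rfl fun x _ => by push_cast; rw [mul_assoc]
    · exact Finset.sum_congr rfl fun x _ => Finset.sum_congr rfl fun y _ => by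
        congr 1; ring
  have e2 : ∑ x, ∑ y, ((S.hbar : ℂ) * K x y) •
      ladderX (fun β => Finsupp.single β (mulCoord y h)) x b = (S.hbar : ℂ) • ∑ x, ∑ y, K x y •
      ladderX (fun β => Finsupp.single β (mulCoord y h)) x b := by
    simp only [Finset.smul_sum, smul_smul]
  have e3 : ∑ y, ∑ x, K x y • ladderX (fun β => Finsupp.single β (mulCoord y h)) x b =
      ∑ x, ∑ y, K x y • ladderX (fun β => Finsupp.single β (mulCoord y h)) x b := Finset.sum_comm
  rw [e1, e2, Finset.sum_add_distrib, e3, hE, energyShift, ← Finset.mul_sum, ← Finset.sum_smul,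
    ← Finset.sum_smul]
  generalize (∑ x, ∑ y, K x y • ladderX (fun β => Finsupp.single β (mulCoord y h)) x b) = B
  generalize (∑ x, ∑ y, R x y • Finsupp.single b (mulCoord x (mulCoord y h))) = A
  have ha' : ∀ i, α (Sum.inl i) = a i := fun _ => rfl
  have hb' : ∀ i, α (Sum.inr i) = b i := fun _ => rfl
  simp only [ha', hb']
  generalize (∑ i, (S.η : ℂ) * ((a i : ℂ) + 1 / 2)) = t1
  generalize (∑ i, (S.fieldFreq N i : ℂ) * ((b i : ℂ) + 1 / 2)) = t2
  push_cast
  module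

theorem orthonormal_productState (hN : 1 ≤ N) :
    Orthonormal ℂ fun α => stateL2 hN (S.productState N α) := by
  classical
  rw [orthonormal_iff_ite]
  intro α β
  have h1 := orthonormal_iff_ite.mp (orthonormal_hermiteComp (dilation S.momentumUnit S.momentumUnit_pos))
    (fun i => α (Sum.inl i)) (fun i => β (Sum.inl i))
  rw [productState, productState, inner_stateL2_single, h1]
  have h2 : α = β ↔ (fun i => α (Sum.inl i)) = (fun i => β (Sum.inl i)) ∧
      (fun i => α (Sum.inr i)) = (fun i => β (Sum.inr i)) := by
    simp only [funext_iff, Sum.forall]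
  by_cases h3 : (fun i => α (Sum.inl i)) = (fun i => β (Sum.inl i)) <;>
  by_cases h4 : (fun i => α (Sum.inr i)) = (fun i => β (Sum.inr i)) <;>
  simp [h2, h3, h4]

/-- For a fixed field mode the map from particle wave functions to states is isometric, so density
of the dilated Hermite functions in `L²(ℝ³)` carries over. -/
theorem stateL2_mem_closure_productState (hN : 1 ≤ N)
    (c : (Fin 2 × cubeIndices N → ℕ) →₀ 𝓢(E3, ℂ)) :
    stateL2 hN c ∈ (Submodule.span ℂ
      (Set.range fun α => stateL2 hN (S.productState N α))).topologicalClosure := by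
  induction c using Finsupp.induction_linear with
  | zero => rw [map_zero]; exact Submodule.zero_mem _
  | add c d hc hd => rw [map_add]; exact Submodule.add_mem _ hc hd
  | single b f =>
    set L := dilation S.momentumUnit S.momentumUnit_pos
    have h1 : toL2 f ∈ closure ((Submodule.span ℂ (Set.range fun a : Fin 3 → ℕ =>
        toL2 (hermiteComp L a)) : Submodule ℂ _) : Set _) := by
      have h2 := (Submodule.topologicalClosure_eq_top_iff).mpr (hermiteComp_total L)
      have h3 : toL2 f ∈ (Submodule.span ℂ (Set.range fun a : Fin 3 → ℕ =>
        toL2 (hermiteComp L a))).topologicalClosure := by rw [h2]; trivial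
      exact h3
    change _ ∈ closure _
    rw [Metric.mem_closure_iff] at h1 ⊢
    intro ε hε
    have h4 : ∀ y ∈ Submodule.span ℂ (Set.range fun a : Fin 3 → ℕ => toL2 (hermiteComp L a)),
        ∃ g : 𝓢(E3, ℂ), toL2 g = y ∧ stateL2 hN (Finsupp.single b g) ∈ Submodule.span ℂ
        (Set.range fun α => stateL2 hN (S.productState N α)) := by
      intro y hy
      induction hy using Submodule.span_induction with
      | mem y hy =>
        obtain ⟨a, rfl⟩ := hy
        exact ⟨hermiteComp L a, rfl, Submodule.subset_span ⟨Sum.elim a b, rfl⟩⟩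
      | zero => exact ⟨0, map_zero _, by simp⟩
      | add y y' _ _ hy hy' =>
        obtain ⟨g, rfl, hg⟩ := hy
        obtain ⟨g', rfl, hg'⟩ := hy'
        refine ⟨g + g', map_add _ _ _, ?_⟩
        rw [Finsupp.single_add, map_add]
        exact Submodule.add_mem _ hg hg'
      | smul t y _ hy =>
        obtain ⟨g, rfl, hg⟩ := hy
        refine ⟨t • g, map_smul _ _ _, ?_⟩
        rw [← Finsupp.smul_single, map_smul]
        exact Submodule.smul_mem _ t hg
    obtain ⟨y, hy, hd⟩ := h1 ε hε
    obtain ⟨g, rfl, hg⟩ := h4 y hy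
    refine ⟨_, hg, ?_⟩
    rw [dist_eq_norm, ← map_sub, ← Finsupp.single_sub, norm_stateL2_single, map_sub, ← dist_eq_norm]
    exact hd

theorem hasHeatTrace_jointGraph (C : ℝ) (hN : 1 ≤ N) {t : ℝ} (ht : 0 < t) :
    HasHeatTrace (S.jointGraph C N) t (Real.exp (-t * S.energyShift C N) *
      ∏ i, (2 * Real.sinh (t * S.hbar * √((posDef_freqMatrix_couplingForm (S.oscCoupling C N)
        (S.fieldFreq_pos hN) S.η_pos).1.eigenvalues i) / 2))⁻¹) := by
  have hw : ∀ a, 0 < Sum.elim (fun _ : Fin 3 => S.η) (S.fieldFreq N) a := by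
    rintro (a | a)
    · exact S.η_pos
    · exact S.fieldFreq_pos hN a
  rw [S.jointGraph_eq C hN]
  refine hasHeatTrace_of_ladder _ (S.orthonormal_productState hN) hw
    (posDef_freqMatrix_couplingForm (S.oscCoupling C N) (S.fieldFreq_pos hN) S.η_pos) S.hbar_pos ht
    ?_ ?_ ?_
  · intro α
    refine ⟨S.productState N α, ?_⟩
    simp only [LinearMap.prod_apply, Function.prod, LinearMap.comp_apply, S.coefHam_productState C hN,
      map_add, map_smul]
    rw [← map_ladderHam]
  · rintro _ ⟨c, rfl⟩ _ ⟨d, rfl⟩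
    exact S.inner_coefHam C hN c d
  · rintro _ ⟨c, rfl⟩
    exact S.stateL2_mem_closure_productState hN c

end OscillatorModel

/-! ### From products of hyperbolic sines to determinants of size three -/

section Determinants

theorem Matrix.IsHermitian.det_smul_one_add {n : Type*} [Fintype n] [DecidableEq n]
    {A : Matrix n n ℝ} (hA : A.IsHermitian) (x : ℝ) :
    (x • (1 : Matrix n n ℝ) + A).det = ∏ i, (x + hA.eigenvalues i) := by
  have h := congrArg (Polynomial.eval (-x)) hA.charpoly_eq
  rw [Matrix.eval_charpoly, Polynomial.eval_prod] at h
  have e1 : (Matrix.scalar n) (-x) - A = -(x • (1 : Matrix n n ℝ) + A) := by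
    rw [Matrix.scalar_apply, ← Matrix.smul_one_eq_diagonal, neg_smul, neg_add, sub_eq_add_neg]
  have e2 : ∀ i, Polynomial.eval (-x) (Polynomial.X - Polynomial.C ((hA.eigenvalues i : ℝ))) =
      (-1) * (x + hA.eigenvalues i) := fun i => by simp; ring
  simp only [RCLike.ofReal_real_eq_id, id] at h
  rw [e1, Matrix.det_neg, Finset.prod_congr rfl fun i _ => e2 i, Finset.prod_mul_distrib,
    Finset.prod_const, Finset.card_univ] at h
  exact mul_left_cancel₀ (pow_ne_zero _ (by norm_num)) h

/-- Euler's product for the hyperbolic sine. -/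
theorem tendsto_euler_sinh_prod (a : ℝ) :
    Tendsto (fun M : ℕ => a * ∏ n ∈ Finset.range M, (1 + a ^ 2 / (Real.pi * (n + 1)) ^ 2)) atTop
      (𝓝 (Real.sinh a)) := by
  have hpi : (Real.pi : ℂ) ≠ 0 := by exact_mod_cast Real.pi_ne_zero
  have h := (Complex.tendsto_euler_sin_prod (a * Complex.I / Real.pi)).const_mul (-Complex.I)
  have e1 : (Real.pi : ℂ) * (a * Complex.I / Real.pi) = a * Complex.I := by field_simp
  rw [e1, Complex.sin_mul_I] at h
  have e2 : -Complex.I * (Complex.sinh a * Complex.I) = ((Real.sinh a : ℝ) : ℂ) := by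
    rw [Complex.ofReal_sinh]
    linear_combination (-Complex.sinh (a : ℂ)) * Complex.I_mul_I
  rw [e2] at h
  have e3 : ∀ M : ℕ, -Complex.I * (a * Complex.I * ∏ j ∈ Finset.range M,
      (1 - (a * Complex.I / Real.pi) ^ 2 / ((j : ℂ) + 1) ^ 2)) =
      ((a * ∏ n ∈ Finset.range M, (1 + a ^ 2 / (Real.pi * (n + 1)) ^ 2) : ℝ) : ℂ) := by
    intro M
    have e4 : ∀ j : ℕ, (1 - (a * Complex.I / Real.pi) ^ 2 / ((j : ℂ) + 1) ^ 2) =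
        (1 + a ^ 2 / (Real.pi * (j + 1)) ^ 2 : ℂ) := by
      intro j
      rw [div_pow, mul_pow, Complex.I_sq, mul_pow, mul_neg_one, neg_div, neg_div, div_div]; ring
    simp only [e4]
    push_cast
    linear_combination (-(a : ℂ) * ∏ x ∈ Finset.range M, (1 + (a : ℂ) ^ 2 / (Real.pi * (x + 1)) ^ 2)) *
      Complex.I_mul_I
  simp only [e3] at h
  exact Complex.continuous_re.continuousAt.tendsto.comp h

variable {κ : Type} [Fintype κ]

/-- The matrix to which the elimination of the field oscillators leads. -/
noncomputable def responseMatrix (η : ℝ) (G : κ → Fin 3 → ℝ) (ν : κ → ℝ) (y : ℝ) :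
    Matrix (Fin 3) (Fin 3) ℝ :=
  (1 + η ^ 2 / y ^ 2) • (1 : Matrix (Fin 3) (Fin 3) ℝ) +
    Matrix.of fun j j' => ∑ i, η * (G i j * G i j') / (ν i * (ν i ^ 2 + y ^ 2))

variable [DecidableEq κ]

theorem freqMatrix_couplingForm {η : ℝ} (hη : 0 < η) (G : κ → Fin 3 → ℝ) {ν : κ → ℝ}
    (hν : ∀ i, 0 < ν i) :
    freqMatrix (Sum.elim (fun _ => η) ν) (couplingForm G ν) = Matrix.fromBlocks
      ((η ^ 2) • (1 : Matrix (Fin 3) (Fin 3) ℝ) + Matrix.of fun j j' => ∑ i, η * (G i j * G i j') / ν i)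
      (Matrix.of fun j i => √η * √(ν i) * G i j) (Matrix.of fun i j => √η * √(ν i) * G i j)
      (Matrix.diagonal fun i => ν i ^ 2) := by
  have h1 : √η * √η = η := Real.mul_self_sqrt hη.le
  have h2 : ∀ i, √(ν i) * √(ν i) = ν i := fun i => Real.mul_self_sqrt (hν i).le
  ext (a | a) (b | b)
  · simp only [freqMatrix, couplingForm, Matrix.mul_diagonal, Matrix.diagonal_mul, Matrix.add_apply,
      Matrix.fromBlocks_apply₁₁, Matrix.diagonal_apply, Sum.elim_inl, Matrix.of_apply, Sum.inl.injEq,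
      Matrix.smul_apply, Matrix.one_apply, smul_eq_mul]
    have h3 : ∑ i, η * (G i a * G i b) / ν i = η * ∑ i, G i a * G i b / ν i := by
      rw [Finset.mul_sum]
      exact Finset.sum_congr rfl fun i _ => by ring
    rw [h3]
    split_ifs
    · linear_combination (η + ∑ i, G i a * G i b / ν i) * h1
    · linear_combination (∑ i, G i a * G i b / ν i) * h1
  · simp [freqMatrix, couplingForm, Matrix.mul_diagonal, Matrix.diagonal_mul]
    ring
  · simp [freqMatrix, couplingForm, Matrix.mul_diagonal, Matrix.diagonal_mul]
    ring
  · simp only [freqMatrix, couplingForm, Matrix.mul_diagonal, Matrix.diagonal_mul, Matrix.add_apply,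
      Matrix.fromBlocks_apply₂₂, Matrix.diagonal_apply, Sum.elim_inr, Sum.inr.injEq, Matrix.zero_apply]
    split_ifs with h
    · subst h
      linear_combination (ν a) * h2 a
    · ring

/-- Schur complement of the diagonal field block. Eliminating a mode subtracts `η G G ν/(ν² + x)`
from its renormalization term `η G G/ν`, and the difference is `x η G G/(ν(ν² + x))`. It vanishes at
`x = 0`, so the coupling does not alter the total determinant. -/
theorem det_add_freqMatrix {η : ℝ} (hη : 0 < η) (G : κ → Fin 3 → ℝ) {ν : κ → ℝ}
    (hν : ∀ i, 0 < ν i) {x : ℝ} (hx : 0 ≤ x) :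
    (x • (1 : Matrix (Fin 3 ⊕ κ) (Fin 3 ⊕ κ) ℝ) +
      freqMatrix (Sum.elim (fun _ => η) ν) (couplingForm G ν)).det =
    (∏ i, (ν i ^ 2 + x)) * ((x + η ^ 2) • (1 : Matrix (Fin 3) (Fin 3) ℝ) +
      Matrix.of fun j j' => x * ∑ i, η * (G i j * G i j') / (ν i * (ν i ^ 2 + x))).det := by
  have hpos : ∀ i, 0 < ν i ^ 2 + x := fun i => by have := hν i; positivity
  have h0 : x • (1 : Matrix (Fin 3 ⊕ κ) (Fin 3 ⊕ κ) ℝ) +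
      freqMatrix (Sum.elim (fun _ => η) ν) (couplingForm G ν) = Matrix.fromBlocks
      ((x + η ^ 2) • (1 : Matrix (Fin 3) (Fin 3) ℝ) + Matrix.of fun j j' => ∑ i, η * (G i j * G i j') / ν i)
      (Matrix.of fun j i => √η * √(ν i) * G i j) (Matrix.of fun i j => √η * √(ν i) * G i j)
      (Matrix.diagonal fun i => ν i ^ 2 + x) := by
    rw [freqMatrix_couplingForm hη G hν, ← Matrix.fromBlocks_one, Matrix.fromBlocks_smul,
      Matrix.fromBlocks_add]
    congr 1
    · rw [add_smul, add_assoc]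
    · simp
    · simp
    · ext i j
      by_cases h : i = j
      · subst h; simp [add_comm]
      · simp [h]
  let _ : Invertible (Matrix.diagonal fun i => ν i ^ 2 + x) :=
    ⟨Matrix.diagonal fun i => (ν i ^ 2 + x)⁻¹, by
      rw [Matrix.diagonal_mul_diagonal, ← Matrix.diagonal_one]
      congr 1; funext i; exact inv_mul_cancel₀ (hpos i).ne', by
      rw [Matrix.diagonal_mul_diagonal, ← Matrix.diagonal_one]
      congr 1; funext i; exact mul_inv_cancel₀ (hpos i).ne'⟩
  rw [h0, Matrix.det_fromBlocks₂₂, Matrix.det_diagonal]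
  congr 2
  have hinv : ⅟(Matrix.diagonal fun i => ν i ^ 2 + x) = Matrix.diagonal fun i => (ν i ^ 2 + x)⁻¹ := rfl
  rw [hinv, add_sub_assoc]
  congr 1
  ext j j'
  rw [Matrix.sub_apply, Matrix.mul_apply]
  simp only [Matrix.of_apply, Matrix.mul_diagonal, Finset.mul_sum]
  rw [← Finset.sum_sub_distrib]
  refine Finset.sum_congr rfl fun i _ => ?_
  have h1 : √η * √η = η := Real.mul_self_sqrt hη.le
  have h2 : √(ν i) * √(ν i) = ν i := Real.mul_self_sqrt (hν i).le
  have e : √η * √(ν i) * G i j * (ν i ^ 2 + x)⁻¹ * (√η * √(ν i) * G i j') =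
      (√η * √η) * (√(ν i) * √(ν i)) * (G i j * G i j') * (ν i ^ 2 + x)⁻¹ := by ring
  rw [e, h1, h2]
  have := (hν i).ne'
  have := (hpos i).ne'
  field_simp
  ring

/-- The quotient of the partition functions of the coupled and of the free oscillators is an infinite
product of determinants of size three. -/
theorem tendsto_prod_det_responseMatrix {η : ℝ} (hη : 0 < η) (G : κ → Fin 3 → ℝ) {ν : κ → ℝ}
    (hν : ∀ i, 0 < ν i) {b : ℝ} (hb : 0 < b) :
    Tendsto (fun M : ℕ => ∏ n ∈ Finset.range M,
      (responseMatrix η G ν (2 * Real.pi * (n + 1) / b)).det) atTop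
      (𝓝 ((∏ i, 2 * Real.sinh (b * √((posDef_freqMatrix_couplingForm G hν hη).1.eigenvalues i) / 2)) /
        ((b * η) ^ 3 * ∏ i, 2 * Real.sinh (b * ν i / 2)))) := by
  have hP := posDef_freqMatrix_couplingForm G hν hη
  set lam := hP.1.eigenvalues with hlam
  have hlam0 : ∀ i, 0 < lam i := hP.eigenvalues_pos
  -- At `x = 0` the product of the normal frequencies equals that of the uncoupled ones, so the
  -- linear prefactors of the Euler products cancel up to `(bη)³`.
  have hdet0 : ∏ i, lam i = (∏ i, ν i ^ 2) * (η ^ 2) ^ 3 := by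
    have h := hP.1.det_smul_one_add 0
    rw [det_add_freqMatrix hη G hν le_rfl] at h
    simp only [zero_add, zero_mul, add_zero] at h
    rw [← h]
    congr 1
    have : (Matrix.of fun _ _ => (0 : ℝ) : Matrix (Fin 3) (Fin 3) ℝ) = 0 := rfl
    rw [this, add_zero, Matrix.det_smul]
    simp
  have hsq : ∏ i, √(lam i) = (∏ i, ν i) * η ^ 3 := by
    have h1 : (∏ i, √(lam i)) ^ 2 = ((∏ i, ν i) * η ^ 3) ^ 2 := by
      rw [← Finset.prod_pow, Finset.prod_congr rfl fun i _ => Real.sq_sqrt (hlam0 i).le, hdet0,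
        mul_pow, ← Finset.prod_pow]
      ring
    exact (sq_eq_sq₀ (Finset.prod_nonneg fun i _ => Real.sqrt_nonneg _)
      (mul_nonneg (Finset.prod_nonneg fun i _ => (hν i).le) (by positivity))).mp h1
  have hsinh : ∀ a : ℝ, Tendsto (fun M : ℕ => b * a * ∏ n ∈ Finset.range M,
      (1 + a ^ 2 / (2 * Real.pi * (n + 1) / b) ^ 2)) atTop (𝓝 (2 * Real.sinh (b * a / 2))) := by
    intro a
    have h := (tendsto_euler_sinh_prod (b * a / 2)).const_mul 2
    refine h.congr fun M => ?_
    rw [← mul_assoc, mul_div_cancel₀ _ (two_ne_zero)]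
    congr 1
    refine Finset.prod_congr rfl fun n _ => ?_
    have := hb.ne'
    have hpi := Real.pi_ne_zero
    have : (n : ℝ) + 1 ≠ 0 := by positivity
    field_simp
  have hnum := tendsto_finsetProd (Finset.univ : Finset (Fin 3 ⊕ κ)) fun i _ => hsinh (√(lam i))
  have hden := tendsto_finsetProd (Finset.univ : Finset κ) fun i _ => hsinh (ν i)
  have hden0 : ∏ i, 2 * Real.sinh (b * ν i / 2) ≠ 0 := by
    refine Finset.prod_ne_zero_iff.mpr fun i _ => ?_
    have : 0 < Real.sinh (b * ν i / 2) := Real.sinh_pos_iff.mpr (by have := hν i; positivity)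
    positivity
  have hbη : (b * η) ^ 3 ≠ 0 := by positivity
  refine (hnum.div (hden.const_mul ((b * η) ^ 3)) (mul_ne_zero hbη hden0)).congr fun M => ?_
  simp only [Pi.div_apply]
  rw [div_eq_iff]
  swap
  · refine mul_ne_zero hbη (Finset.prod_ne_zero_iff.mpr fun i _ => ?_)
    have h1 := hν i
    refine (mul_pos (mul_pos hb h1) (Finset.prod_pos fun n _ => ?_)).ne'
    positivity
  simp only [Finset.prod_mul_distrib, Finset.prod_const, Finset.card_univ, Fintype.card_sum,
    Fintype.card_fin, hsq]
  rw [Finset.prod_comm, Finset.prod_comm (s := (Finset.univ : Finset κ))]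
  -- The `n`-th Euler factors of all normal modes together are a characteristic polynomial at `-y²`,
  -- divided by a power of `y²`; the Schur complement separates off the factors of the free modes.
  have hone : ∀ n : ℕ, ∏ i, (1 + √(lam i) ^ 2 / (2 * Real.pi * (n + 1) / b) ^ 2) =
      (responseMatrix η G ν (2 * Real.pi * (n + 1) / b)).det *
        ∏ i, (1 + ν i ^ 2 / (2 * Real.pi * (n + 1) / b) ^ 2) := by
    intro n
    set y : ℝ := 2 * Real.pi * (n + 1) / b with hy
    have hy0 : 0 < y := by positivity
    have h1 : ∀ a : ℝ, 1 + a / y ^ 2 = (y ^ 2)⁻¹ * (y ^ 2 + a) := fun a => by field_simp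
    have h2 := hP.1.det_smul_one_add (y ^ 2)
    rw [det_add_freqMatrix hη G hν (sq_nonneg y)] at h2
    have h3 : responseMatrix η G ν y = (y ^ 2)⁻¹ • ((y ^ 2 + η ^ 2) • (1 : Matrix (Fin 3) (Fin 3) ℝ) +
      Matrix.of fun j j' => y ^ 2 * ∑ i, η * (G i j * G i j') / (ν i * (ν i ^ 2 + y ^ 2))) := by
      ext j j'
      simp only [responseMatrix, Matrix.add_apply, Matrix.smul_apply, Matrix.of_apply, smul_eq_mul, h1]
      generalize (1 : Matrix (Fin 3) (Fin 3) ℝ) j j' = d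
      generalize ∑ i, η * (G i j * G i j') / (ν i * (ν i ^ 2 + y ^ 2)) = s
      field_simp
    simp only [Real.sq_sqrt (hlam0 _).le, h1, Finset.prod_mul_distrib, Finset.prod_const,
      Finset.card_univ, Fintype.card_sum, Fintype.card_fin]
    rw [← h2, h3, Matrix.det_smul, Fintype.card_fin, pow_add]
    simp only [add_comm (y ^ 2) (ν _ ^ 2)]
    ring
  rw [Finset.prod_congr rfl fun n _ => hone n, Finset.prod_mul_distrib, pow_add]
  ring

end Determinants

/-! ### Riemann sums over the cubes -/

theorem cubeIndex_mem_cubeIndices {N : ℕ} {x : E3} (h : ‖x‖ < N) : cubeIndex N x ∈ cubeIndices N :=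
  ⟨x, mem_cube_iff.mpr rfl, by simpa using h⟩

theorem norm_sub_le_of_mem_cube {N : ℕ} (hN : 1 ≤ N) {z : Fin 3 → ℤ} {x y : E3} (hx : x ∈ cube N z)
    (hy : y ∈ cube N z) : ‖x - y‖ ≤ 2 / N := by
  have hN0 : (0 : ℝ) < N := by exact_mod_cast hN
  have h1 : ∀ i, (x i - y i) ^ 2 ≤ (1 / N : ℝ) ^ 2 := by
    intro i
    have hx1 := Int.floor_le ((N : ℝ) * x i)
    have hx2 := Int.lt_floor_add_one ((N : ℝ) * x i)
    have hy1 := Int.floor_le ((N : ℝ) * y i)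
    have hy2 := Int.lt_floor_add_one ((N : ℝ) * y i)
    rw [hx i] at hx1 hx2
    rw [hy i] at hy1 hy2
    rw [sq_le_sq, abs_of_pos (show (0 : ℝ) < 1 / N by positivity), abs_le]
    constructor
    · rw [← neg_div, div_le_iff₀ hN0]; linarith
    · rw [le_div_iff₀ hN0]; linarith
  rw [EuclideanSpace.norm_eq, Real.sqrt_le_left (by positivity), Fin.sum_univ_three]
  simp only [PiLp.sub_apply, Real.norm_eq_abs, sq_abs]
  have := h1 0
  have := h1 1
  have := h1 2
  have h4 : (2 / N : ℝ) ^ 2 = 4 * (1 / N : ℝ) ^ 2 := by ring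
  rw [h4]
  have : 0 ≤ (1 / N : ℝ) ^ 2 := sq_nonneg _
  linarith

/-- Almost every point is a Lebesgue point with respect to the cubes. -/
theorem ae_tendsto_average_cube {F : Type*} [NormedAddCommGroup F] [NormedSpace ℝ F] [CompleteSpace F]
    {f : E3 → F} (hf : LocallyIntegrable f) :
    ∀ᵐ k, Tendsto (fun N : ℕ => ⨍ x in cube N (cubeIndex N k), f x) atTop (𝓝 (f k)) := by
  have hmp := PiLp.volume_preserving_ofLp (Fin 3)
  have hmp' := PiLp.volume_preserving_toLp (Fin 3)
  -- In the supremum norm on `Fin 3 → ℝ` closed cubes are balls, so the Lebesgue differentiation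
  -- theorem for balls with varying centres applies; half-open and closed cubes differ by a null
  -- set.
  set g : (Fin 3 → ℝ) → F := fun x => f (WithLp.toLp 2 x) with hg
  have hgl : LocallyIntegrable g := by
    have hmap : Measure.map (WithLp.toLp 2) (volume : Measure (Fin 3 → ℝ)) = (volume : Measure E3) :=
      hmp'.map_eq
    have h1 := locallyIntegrable_map_homeomorph (PiLp.homeomorph 2 (fun _ : Fin 3 => ℝ)).symm
      (f := f) (μ := (volume : Measure (Fin 3 → ℝ)))
    exact h1.mp (by rw [← hmap] at hf; exact hf)
  have h := IsUnifLocDoublingMeasure.ae_tendsto_average (volume : Measure (Fin 3 → ℝ)) hgl 1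
  have h2 := hmp.quasiMeasurePreserving.ae h
  filter_upwards [h2] with k hk
  set w : ℕ → Fin 3 → ℝ := fun N i => ((cubeIndex N k i : ℝ) + 1 / 2) / N with hw
  set δ : ℕ → ℝ := fun N => 1 / 2 / N with hδ
  have hδt : Tendsto δ atTop (𝓝[>] 0) := by
    refine tendsto_nhdsWithin_iff.mpr ⟨?_, ?_⟩
    · exact tendsto_const_div_atTop_nhds_zero_nat _
    · filter_upwards [eventually_ge_atTop 1] with N hN
      have : (0 : ℝ) < N := by exact_mod_cast hN
      exact Set.mem_Ioi.mpr (by positivity)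
  have hIcc : ∀ N : ℕ, 1 ≤ N → Metric.closedBall (w N) (δ N) =
      Set.Icc (fun i => (cubeIndex N k i : ℝ) / N) (fun i => ((cubeIndex N k i : ℝ) + 1) / N) := by
    intro N hN
    have hN0 : (0 : ℝ) < N := by exact_mod_cast hN
    rw [closedBall_pi _ (by positivity)]
    simp only [Real.closedBall_eq_Icc]
    rw [Set.pi_univ_Icc]
    congr 1 <;> funext i <;> simp only [hw, hδ] <;> field_simp <;> ring
  have h3 := hk w δ hδt ?_
  · refine h3.congr' ?_
    filter_upwards [eventually_ge_atTop 1] with N hN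
    have hset : cube N (cubeIndex N k) =ᵐ[volume] (WithLp.ofLp : E3 → Fin 3 → ℝ) ⁻¹'
        Metric.closedBall (w N) (δ N) := by
      rw [cube_eq_preimage hN, hIcc N hN]
      exact hmp.quasiMeasurePreserving.preimage_ae_eq Measure.univ_pi_Ico_ae_eq_Icc
    rw [setAverage_congr hset, setAverage_eq, setAverage_eq,
      hmp.measureReal_preimage Metric.isClosed_closedBall.measurableSet.nullMeasurableSet]
    congr 1
    exact ((hmp.setIntegral_preimage_emb
      (MeasurableEquiv.measurableEmbedding (MeasurableEquiv.toLp 2 (Fin 3 → ℝ)).symm) g _)).symm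
  · filter_upwards [eventually_ge_atTop 1] with N hN
    rw [one_mul, hIcc N hN]
    have hN0 : (0 : ℝ) < N := by exact_mod_cast hN
    constructor <;> intro i
    · rw [div_le_iff₀ hN0, mul_comm]
      exact Int.floor_le _
    · rw [le_div_iff₀ hN0, mul_comm]
      exact (Int.lt_floor_add_one _).le

open Classical in
/-- Sums over the cubes as integrals of step functions. -/
theorem sum_cubeIndices_eq_integral {N : ℕ} (hN : 1 ≤ N) (Φ : (Fin 3 → ℤ) → ℝ) :
    ∑ z : cubeIndices N, cubeVol N * Φ z =
      ∫ k, if cubeIndex N k ∈ cubeIndices N then Φ (cubeIndex N k) else 0 := by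
  have h2 : ∀ k, (if cubeIndex N k ∈ cubeIndices N then Φ (cubeIndex N k) else 0) =
      ∑ z : cubeIndices N, (cube N z.1).indicator (fun _ => Φ z) k := by
    intro k
    simp only [Set.indicator_apply, mem_cube_iff]
    split_ifs with h
    · rw [Finset.sum_eq_single ⟨_, h⟩]
      · simp
      · intro z _ hz
        rw [if_neg]
        intro he
        exact hz (Subtype.ext he.symm)
      · simp
    · refine (Finset.sum_eq_zero fun z _ => if_neg ?_).symm
      intro he
      exact h (he ▸ z.2)
  simp only [h2]
  have hfin : ∀ z : cubeIndices N, volume (cube N z.1) ≠ ⊤ := fun z => by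
    intro h
    have h3 := volumeReal_cube hN z.1
    rw [measureReal_def, h] at h3
    exact (cubeVol_pos hN).ne' (by rw [← h3]; simp)
  rw [integral_finsetSum]
  · refine Finset.sum_congr rfl fun z _ => ?_
    rw [integral_indicator_const _ (measurableSet_cube _ _), volumeReal_cube hN, smul_eq_mul]
  · intro z _
    exact (integrable_indicator_iff (measurableSet_cube _ _)).mpr
      (integrableOn_const (hfin z))

theorem abs_sum_cubeIndices_le {N : ℕ} (hN : 1 ≤ N) {Φ : (Fin 3 → ℤ) → ℝ} {G : E3 → ℝ}
    (hG : Integrable G) (hΦG : ∀ᵐ k, |Φ (cubeIndex N k)| ≤ G k) :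
    |∑ z : cubeIndices N, cubeVol N * Φ z| ≤ ∫ k, G k := by
  rw [sum_cubeIndices_eq_integral hN, ← Real.norm_eq_abs]
  refine norm_integral_le_of_norm_le hG ?_
  filter_upwards [hΦG] with k hk
  split_ifs
  · exact hk
  · simpa using (abs_nonneg _).trans hk

/-- Convergence of Riemann sums over cubes. -/
theorem tendsto_sum_cubeIndices {Φ : ℕ → (Fin 3 → ℤ) → ℝ} {F G : E3 → ℝ} (hG : Integrable G)
    (hΦG : ∀ N, 1 ≤ N → ∀ᵐ k, |Φ N (cubeIndex N k)| ≤ G k)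
    (hΦF : ∀ᵐ k, Tendsto (fun N => Φ N (cubeIndex N k)) atTop (𝓝 (F k))) :
    Tendsto (fun N => ∑ z : cubeIndices N, cubeVol N * Φ N z) atTop (𝓝 (∫ k, F k)) := by
  classical
  have h3 : Tendsto (fun N => ∫ k, if cubeIndex N k ∈ cubeIndices N then Φ N (cubeIndex N k) else 0) atTop
      (𝓝 (∫ k, F k)) := by
    refine tendsto_integral_filter_of_dominated_convergence G ?_ ?_ hG ?_
    · refine Eventually.of_forall fun N => ?_
      have : Measurable fun z : Fin 3 → ℤ => if z ∈ cubeIndices N then Φ N z else 0 :=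
        measurable_of_countable _
      exact (this.comp (measurable_cubeIndex N)).aestronglyMeasurable
    · filter_upwards [eventually_ge_atTop 1] with N hN
      filter_upwards [hΦG N hN] with k hk
      split_ifs
      · exact hk
      · simpa using (abs_nonneg _).trans hk
    · filter_upwards [hΦF] with k hk
      refine hk.congr' ?_
      obtain ⟨n, hn⟩ := exists_nat_gt ‖k‖
      filter_upwards [eventually_ge_atTop n] with N hN
      rw [if_pos]
      exact cubeIndex_mem_cubeIndices (hn.trans_le (by exact_mod_cast hN))
  refine h3.congr' ?_
  filter_upwards [eventually_ge_atTop 1] with N hN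
  rw [sum_cubeIndices_eq_integral hN]

theorem locallyIntegrable_inv_norm : LocallyIntegrable fun x : E3 => ‖x‖⁻¹ := by
  refine locallyIntegrable_of_norm_le_rpow (C := 1) (α := 1) (by simp) (by simp)
    (Eventually.of_forall fun k => ?_) (by fun_prop)
  rw [Real.rpow_neg (norm_nonneg k), Real.rpow_one, one_mul, norm_inv, norm_norm]

theorem integrableOn_inv_norm_sq (r : ℝ) : IntegrableOn (fun x : E3 => (‖x‖ ^ 2)⁻¹) (Metric.ball 0 r) := by
  have h : LocallyIntegrable fun x : E3 => (‖x‖ ^ 2)⁻¹ := by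
    refine locallyIntegrable_of_norm_le_rpow (C := 1) (α := 2) (by simp) (by simp; norm_num)
      (Eventually.of_forall fun k => ?_) (by fun_prop)
    rw [Real.rpow_neg (norm_nonneg k), one_mul, norm_inv, norm_pow, norm_norm]
    norm_cast
  exact (h.integrableOn_isCompact (isCompact_closedBall 0 r)).mono_set Metric.ball_subset_closedBall

/-- The mean value of `1/|k|` over a cube is bounded by its value at any point of the cube, up to
a constant. -/
theorem exists_average_inv_norm_le : ∃ A : ℝ, 1 ≤ A ∧ ∀ N : ℕ, 1 ≤ N → ∀ k : E3, k ≠ 0 →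
    ⨍ x in cube N (cubeIndex N k), ‖x‖⁻¹ ≤ A / ‖k‖ := by
  set M : ℝ := ∫ x in Metric.ball (0 : E3) 1, ‖x‖⁻¹ with hM
  have hM0 : 0 ≤ M := integral_nonneg fun x => by positivity
  -- A cube has diameter at most `2/N`. If `‖k‖ ≥ 4/N`, then `‖x‖ ≥ ‖k‖/2` on it, which gives the
  -- `2`. Otherwise the cube lies in the ball of radius `7/N`, where the integral is `49 M/N²`;
  -- division by the volume gives `49 M N`, and `N < 4/‖k‖` gives `196 M/‖k‖`.
  refine ⟨2 + 196 * M, by linarith, fun N hN k hk => ?_⟩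
  have hN0 : (0 : ℝ) < N := by exact_mod_cast hN
  have hk0 : 0 < ‖k‖ := norm_pos_iff.mpr hk
  have hkc : k ∈ cube N (cubeIndex N k) := mem_cube_iff.mpr rfl
  have hint := OscillatorModel.integrableOn_cube hN locallyIntegrable_inv_norm (cubeIndex N k)
  have hV := cubeVol_pos hN
  rw [setAverage_eq, volumeReal_cube hN, smul_eq_mul]
  by_cases hc : 4 / N ≤ ‖k‖
  · have h1 : ∫ x in cube N (cubeIndex N k), ‖x‖⁻¹ ≤ ∫ x in cube N (cubeIndex N k), 2 / ‖k‖ := by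
      refine setIntegral_mono_on hint ?_ (measurableSet_cube _ _) fun x hx => ?_
      · exact OscillatorModel.integrableOn_cube hN (locallyIntegrable_const _) _
      · have h2 := norm_sub_le_of_mem_cube hN hkc hx
        have h3 : ‖k‖ ≤ ‖k - x‖ + ‖x‖ := by simpa using norm_add_le (k - x) x
        have h4 : (2 : ℝ) / N = 4 / N / 2 := by ring
        have h5 : ‖k‖ / 2 ≤ ‖x‖ := by linarith
        rw [inv_le_comm₀ (by linarith) (by positivity), inv_div]
        exact h5
    rw [setIntegral_const, volumeReal_cube hN, smul_eq_mul] at h1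
    rw [inv_mul_le_iff₀ hV]
    refine h1.trans (mul_le_mul_of_nonneg_left ?_ hV.le)
    gcongr
    linarith
  · push Not at hc
    have hsub : cube N (cubeIndex N k) ⊆ Metric.ball (0 : E3) (7 / N) := by
      intro x hx
      have h2 := norm_sub_le_of_mem_cube hN hx hkc
      have h3 : ‖x‖ ≤ ‖x - k‖ + ‖k‖ := by simpa using norm_add_le (x - k) k
      have h4 : (7 : ℝ) / N = 2 / N + 4 / N + 1 / N := by ring
      have h5 : (0 : ℝ) < 1 / N := by positivity
      rw [mem_ball_zero_iff]
      linarith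
    have hball : ∫ x in Metric.ball (0 : E3) (7 / N), ‖x‖⁻¹ = (7 / N) ^ 2 * M := by
      have h6 := Measure.setIntegral_comp_smul_of_pos (volume : Measure E3) (fun x : E3 => ‖x‖⁻¹)
        (Metric.ball 0 1) (R := 7 / N) (by positivity)
      rw [smul_unitBall_of_pos (by positivity)] at h6
      simp only [norm_smul, mul_inv, integral_const_mul, finrank_euclideanSpace, Fintype.card_fin,
        Real.norm_eq_abs, abs_of_pos (show (0 : ℝ) < 7 / N by positivity), smul_eq_mul] at h6
      rw [← hM] at h6
      field_simp at h6 ⊢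
      linarith
    have h7 : ∫ x in cube N (cubeIndex N k), ‖x‖⁻¹ ≤ (7 / N) ^ 2 * M := by
      rw [← hball]
      exact setIntegral_mono_set ((locallyIntegrable_inv_norm.integrableOn_isCompact
        (isCompact_closedBall 0 (7 / N))).mono_set Metric.ball_subset_closedBall)
        (Eventually.of_forall fun x => by positivity) hsub.eventuallyLE
    rw [inv_mul_le_iff₀ hV, cubeVol]
    refine h7.trans ?_
    have h8 : (N : ℝ) ≤ 4 / ‖k‖ := by
      rw [le_div_iff₀ hk0]
      rw [lt_div_iff₀ hN0] at hc
      linarith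
    have h9 : (7 / N : ℝ) ^ 2 * M = 1 / (N : ℝ) ^ 3 * (49 * M * N) := by field_simp; ring
    rw [h9]
    refine mul_le_mul_of_nonneg_left ?_ (by positivity)
    calc 49 * M * N ≤ 49 * M * (4 / ‖k‖) := mul_le_mul_of_nonneg_left h8 (by linarith)
      _ = 196 * M / ‖k‖ := by ring
      _ ≤ _ := div_le_div_of_nonneg_right (by linarith) hk0.le

/-! ### Bounds for the cube means -/

namespace OscillatorModel
variable (S : OscillatorModel)

theorem yMean_eq_average (C : ℝ) (N : ℕ) (σ : Fin 2) (z : Fin 3 → ℤ) :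
    S.yMean C N σ z = ⨍ k in cube N z, S.yField C σ k := rfl

theorem locallyIntegrable_cutoff (C : ℝ) : LocallyIntegrable (cutoff C) := by
  refine (locallyIntegrable_const (1 : ℝ)).mono (measurable_cutoff C).aestronglyMeasurable
    (Eventually.of_forall fun k => ?_)
  rw [Real.norm_eq_abs, abs_of_nonneg (cutoff_nonneg C k), norm_one]
  exact cutoff_le_one C k

theorem cutoffMean_nonneg (C : ℝ) (N : ℕ) (z : Fin 3 → ℤ) : 0 ≤ cutoffMean C N z := by
  rw [cutoffMean, setAverage_eq]
  exact smul_nonneg (by positivity) (integral_nonneg fun k => cutoff_nonneg C k)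

theorem cutoffMean_le_one (C : ℝ) {N : ℕ} (hN : 1 ≤ N) (z : Fin 3 → ℤ) : cutoffMean C N z ≤ 1 := by
  have hV := cubeVol_pos hN
  rw [cutoffMean, setAverage_eq, volumeReal_cube hN, smul_eq_mul, inv_mul_le_iff₀ hV, mul_one]
  have h : ∫ k in cube N z, cutoff C k ≤ ∫ k in cube N z, (1 : ℝ) :=
    setIntegral_mono (integrableOn_cube hN (locallyIntegrable_cutoff C) z)
      (integrableOn_cube hN (locallyIntegrable_const _) z) fun k => cutoff_le_one C k
  rwa [setIntegral_const, volumeReal_cube hN, smul_eq_mul, mul_one] at h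

theorem cutoff_eq_zero_of_mem_cube {C : ℝ} {N : ℕ} (hN : 1 ≤ N) {k : E3} (hk : C + 2 ≤ ‖k‖) {x : E3}
    (hx : x ∈ cube N (cubeIndex N k)) : cutoff C x = 0 := by
  have h1 := norm_sub_le_of_mem_cube hN (mem_cube_iff.mpr rfl : k ∈ cube N (cubeIndex N k)) hx
  have h2 : (2 : ℝ) / N ≤ 2 := div_le_self (by norm_num) (by exact_mod_cast hN)
  have h3 : ‖k‖ ≤ ‖k - x‖ + ‖x‖ := by simpa using norm_add_le (k - x) x
  rw [cutoff, if_neg]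
  push Not
  linarith

theorem cutoffMean_eq_zero {C : ℝ} {N : ℕ} (hN : 1 ≤ N) {k : E3} (hk : C + 2 ≤ ‖k‖) :
    cutoffMean C N (cubeIndex N k) = 0 := by
  have h : ∫ x in cube N (cubeIndex N k), cutoff C x = 0 :=
    setIntegral_eq_zero_of_forall_eq_zero fun x hx => cutoff_eq_zero_of_mem_cube hN hk hx
  rw [cutoffMean, setAverage_eq, h, smul_zero]

theorem yMean_eq_zero {C : ℝ} {N : ℕ} (hN : 1 ≤ N) (σ : Fin 2) {k : E3} (hk : C + 2 ≤ ‖k‖) :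
    S.yMean C N σ (cubeIndex N k) = 0 := by
  have h : ∫ x in cube N (cubeIndex N k), S.yField C σ x = 0 :=
    setIntegral_eq_zero_of_forall_eq_zero fun x hx => by
      rw [yField, cutoff_eq_zero_of_mem_cube hN hk hx, zero_div, zero_smul]
  rw [yMean_eq_average, setAverage_eq, h, smul_zero]

theorem average_inv_ω {N : ℕ} (z : Fin 3 → ℤ) :
    ⨍ x in cube N z, (S.ω x)⁻¹ = S.c⁻¹ * ⨍ x in cube N z, ‖x‖⁻¹ := by
  simp only [setAverage_eq, ω, mul_inv, integral_const_mul, smul_eq_mul]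
  ring

/-- Bounds for the mean values over the cubes by the values at the points of the cubes. -/
theorem exists_mean_bounds : ∃ A : ℝ, 1 ≤ A ∧ ∀ N : ℕ, 1 ≤ N → ∀ k : E3, k ≠ 0 →
    S.ω k ≤ A * S.ωMean N (cubeIndex N k) ∧
    ∀ C σ, ‖S.yMean C N σ (cubeIndex N k)‖ ^ 2 ≤ A ^ 2 / S.ω k := by
  obtain ⟨A, hA, h⟩ := exists_average_inv_norm_le
  refine ⟨A, hA, fun N hN k hk => ?_⟩
  have hA0 : 0 < A := by linarith
  have hk0 : 0 < ‖k‖ := norm_pos_iff.mpr hk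
  have hωk : 0 < S.ω k := mul_pos S.c_pos hk0
  set z := cubeIndex N k
  have hV := cubeVol_pos hN
  have hinv : ⨍ x in cube N z, (S.ω x)⁻¹ ≤ A / S.ω k := by
    rw [average_inv_ω, ω, mul_comm S.c, ← div_div, div_eq_inv_mul _ S.c]
    exact mul_le_mul_of_nonneg_left (h N hN k hk) (inv_nonneg.mpr S.c_pos.le)
  have hint : IntegrableOn (fun x => (S.ω x)⁻¹) (cube N z) := by
    simp only [ω, mul_inv]
    exact (integrableOn_cube hN locallyIntegrable_inv_norm z).const_mul _
  have hc : ∀ a : ℝ, IntegrableOn (fun _ : E3 => a) (cube N z) := fun a =>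
    integrableOn_cube hN (locallyIntegrable_const a) z
  have hcav : ∀ a : ℝ, ∫ x in cube N z, a = cubeVol N * a := fun a => by
    rw [setIntegral_const, volumeReal_cube hN, smul_eq_mul]
  have hI : ∫ x in cube N z, (S.ω x)⁻¹ ≤ cubeVol N * (A / S.ω k) := by
    rw [setAverage_eq, volumeReal_cube hN, smul_eq_mul, inv_mul_le_iff₀ hV] at hinv
    exact hinv
  constructor
  -- The arithmetic-geometric mean inequality converts the upper bound on the mean of `1/ω` into a
  -- lower bound on the mean of `ω`.
  · have hae : ∀ᵐ x ∂(volume.restrict (cube N z)), 2 ≤ A / S.ω k * S.ω x + S.ω k / A * (S.ω x)⁻¹ := by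
      filter_upwards [ae_restrict_of_ae (Measure.ae_ne volume (0 : E3))] with x hx
      have hωx : 0 < S.ω x := mul_pos S.c_pos (norm_pos_iff.mpr hx)
      have h1 : A / S.ω k * S.ω x + S.ω k / A * (S.ω x)⁻¹ - 2 =
          (A * S.ω x - S.ω k) ^ 2 / (A * S.ω x * S.ω k) := by
        field_simp
        ring
      have h2 : 0 ≤ (A * S.ω x - S.ω k) ^ 2 / (A * S.ω x * S.ω k) := by positivity
      linarith
    have h1 := integral_mono_ae (hc 2) (((S.integrableOn_ω hN z).const_mul _).add (hint.const_mul _)) hae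
    simp only [Pi.add_apply] at h1
    rw [integral_add ((S.integrableOn_ω hN z).const_mul _) (hint.const_mul _), integral_const_mul,
      integral_const_mul, hcav] at h1
    have h2 : S.ω k / A * ∫ x in cube N z, (S.ω x)⁻¹ ≤ cubeVol N := by
      calc _ ≤ S.ω k / A * (cubeVol N * (A / S.ω k)) := by gcongr
        _ = cubeVol N := by field_simp
    have h3 : S.ωMean N z = (cubeVol N)⁻¹ * ∫ x in cube N z, S.ω x := by
      rw [ωMean, setAverage_eq, volumeReal_cube hN, smul_eq_mul]
    have h4 : cubeVol N ≤ A / S.ω k * ∫ x in cube N z, S.ω x := by linarith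
    rw [h3]
    rw [div_mul_eq_mul_div, le_div_iff₀ hωk] at h4
    rw [mul_left_comm, le_inv_mul_iff₀ hV]
    exact h4
  · intro C σ
    have hs : 0 < √(S.ω k) := Real.sqrt_pos.mpr hωk
    have h1 : ‖S.yMean C N σ z‖ ≤ A / √(S.ω k) := by
      rw [yMean_eq_average, setAverage_eq, volumeReal_cube hN, norm_smul, Real.norm_eq_abs,
        abs_of_pos (inv_pos.mpr hV), inv_mul_le_iff₀ hV]
      refine (norm_integral_le_integral_norm _).trans ?_
      -- Again by the arithmetic-geometric mean inequality, `ω(x)^(-1/2)` is bounded by `1/ω(x)` and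
      -- a constant, with weights adapted to `ω(k)`.
      have h2 : ∫ x in cube N z, ‖S.yField C σ x‖ ≤
          ∫ x in cube N z, (√(S.ω k) / 2 * (S.ω x)⁻¹ + 1 / (2 * √(S.ω k))) := by
        refine integral_mono_ae (S.integrableOn_yField C σ hN z).norm
          ((hint.const_mul _).add (hc _)) ?_
        filter_upwards [ae_restrict_of_ae (Measure.ae_ne volume (0 : E3))] with x hx
        have hωx : 0 < S.ω x := mul_pos S.c_pos (norm_pos_iff.mpr hx)
        rw [norm_yField]
        have hsx : 0 < √(S.ω x) := Real.sqrt_pos.mpr hωx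
        have h3 : cutoff C x / √(S.ω x) ≤ 1 / √(S.ω x) := by
          gcongr
          exact cutoff_le_one C x
        refine h3.trans ?_
        have h4 : (S.ω x)⁻¹ = (1 / √(S.ω x)) ^ 2 := by
          rw [div_pow, Real.sq_sqrt hωx.le, one_pow, one_div]
        rw [h4]
        have h5 : √(S.ω k) / 2 * (1 / √(S.ω x)) ^ 2 + 1 / (2 * √(S.ω k)) - 1 / √(S.ω x) =
            (√(S.ω k) - √(S.ω x)) ^ 2 / (2 * √(S.ω k) * √(S.ω x) ^ 2) := by
          field_simp
          ring
        have h6 : 0 ≤ (√(S.ω k) - √(S.ω x)) ^ 2 / (2 * √(S.ω k) * √(S.ω x) ^ 2) := by positivity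
        linarith
      refine h2.trans ?_
      rw [integral_add (hint.const_mul _) (hc _), integral_const_mul, hcav]
      have h7 : √(S.ω k) / 2 * ∫ x in cube N z, (S.ω x)⁻¹ ≤ √(S.ω k) / 2 * (cubeVol N * (A / S.ω k)) := by
        gcongr
      have h8 : √(S.ω k) / 2 * (cubeVol N * (A / S.ω k)) = cubeVol N * (A / √(S.ω k)) / 2 := by
        have : S.ω k = √(S.ω k) ^ 2 := (Real.sq_sqrt hωk.le).symm
        rw [this, Real.sqrt_sq hs.le]
        field_simp
      have h9 : cubeVol N * (1 / (2 * √(S.ω k))) ≤ cubeVol N * (A / √(S.ω k)) / 2 := by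
        have : cubeVol N * (A / √(S.ω k)) / 2 = cubeVol N * (A / (2 * √(S.ω k))) := by field_simp
        rw [this]
        gcongr
      linarith
    calc ‖S.yMean C N σ z‖ ^ 2 ≤ (A / √(S.ω k)) ^ 2 := by gcongr
      _ = _ := by rw [div_pow, Real.sq_sqrt hωk.le]

end OscillatorModel

/-! ### Radial integrals and angular averages -/

section Radial

/-- Polar coordinates. Only `r² f(r)` on `(0, C)` matters, so `f` may be singular at the origin and
`g` is its regular representative. -/
theorem integral_cutoff_mul_radial {C : ℝ} (hC : 0 < C) {f g : ℝ → ℝ}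
    (hfg : ∀ r ∈ Set.Ioo 0 C, r ^ 2 * f r = g r) :
    ∫ k : E3, OscillatorModel.cutoff C k * f ‖k‖ = 4 * Real.pi * ∫ r in (0 : ℝ)..C, g r := by
  classical
  have h1 := integral_fun_norm_addHaar (volume : Measure E3) fun r => (if r < C then 1 else 0) * f r
  have h2 : (volume : Measure E3).real (Metric.ball 0 1) = Real.pi * 4 / 3 := by
    rw [measureReal_def, EuclideanSpace.volume_ball_fin_three, ENNReal.toReal_mul,
      ENNReal.toReal_ofReal (by positivity)]
    simp
  have h3 : ∀ k : E3, OscillatorModel.cutoff C k * f ‖k‖ = (if ‖k‖ < C then 1 else 0) * f ‖k‖ :=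
    fun k => rfl
  simp only [h3, h1, h2, finrank_euclideanSpace, Fintype.card_fin]
  have h4 : ∫ y in Set.Ioi (0 : ℝ), y ^ (3 - 1) • ((if y < C then 1 else 0) * f y) =
      ∫ r in (0 : ℝ)..C, g r := by
    rw [intervalIntegral.integral_of_le hC.le, integral_Ioc_eq_integral_Ioo]
    have h5 : ∀ y : ℝ, y ^ (3 - 1) • ((if y < C then 1 else 0) * f y) =
        (Set.Iio C).indicator (fun y => y ^ 2 * f y) y := by
      intro y
      by_cases hy : y < C <;> simp [hy]
    simp only [h5]
    rw [setIntegral_indicator measurableSet_Iio, Set.Ioi_inter_Iio]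
    exact setIntegral_congr_fun measurableSet_Ioo hfg
  rw [h4]
  simp
  ring

/-- Permuting coordinates shows that the three diagonal averages of `kⱼ²/|k|²` agree, hence each is
a third of the whole; reflecting one coordinate makes the mixed averages vanish. The factor `2/3` is
the isotropic mean of the transverse projection. -/
theorem integral_coord_mul_coord {f : ℝ → ℝ} (hf : Integrable fun k : E3 => f ‖k‖) (j j' : Fin 3) :
    ∫ k : E3, f ‖k‖ * ((if j = j' then 1 else 0) - k j * k j' / ‖k‖ ^ 2) =
      if j = j' then 2 / 3 * ∫ k : E3, f ‖k‖ else 0 := by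
  have hbd : ∀ (i i' : Fin 3) (k : E3), ‖k i * k i' / ‖k‖ ^ 2‖ ≤ 1 := by
    intro i i' k
    rw [norm_div, norm_mul, norm_pow, norm_norm]
    refine div_le_one_of_le₀ ?_ (by positivity)
    rw [pow_two]
    exact mul_le_mul (PiLp.norm_apply_le k i) (PiLp.norm_apply_le k i') (norm_nonneg _) (norm_nonneg _)
  have hint : ∀ i i' : Fin 3, Integrable fun k : E3 => f ‖k‖ * (k i * k i' / ‖k‖ ^ 2) := by
    intro i i'
    refine hf.mul_bdd (c := 1) ?_ (Eventually.of_forall (hbd i i'))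
    have : Measurable fun k : E3 => k i * k i' / ‖k‖ ^ 2 := by fun_prop
    exact this.aestronglyMeasurable
  simp only [mul_sub]
  rw [integral_sub (hf.mul_const _) (hint j j'), integral_mul_const]
  split_ifs with h
  · subst h
    have hsymm : ∀ i : Fin 3, ∫ k : E3, f ‖k‖ * (k i * k i / ‖k‖ ^ 2) =
        ∫ k : E3, f ‖k‖ * (k j * k j / ‖k‖ ^ 2) := by
      intro i
      set L : E3 ≃ₗᵢ[ℝ] E3 := LinearIsometryEquiv.piLpCongrLeft 2 ℝ ℝ (Equiv.swap i j)
      have h1 := L.measurePreserving.integral_comp L.toHomeomorph.measurableEmbedding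
        fun k : E3 => f ‖k‖ * (k j * k j / ‖k‖ ^ 2)
      rw [← h1]
      refine integral_congr_ae (Eventually.of_forall fun k => ?_)
      have h2 : (L k) j = k i := by
        simp [L, LinearIsometryEquiv.piLpCongrLeft_apply, Equiv.piCongrLeft']
      simp only [L.norm_map, h2]
    have hsum : ∑ i : Fin 3, ∫ k : E3, f ‖k‖ * (k i * k i / ‖k‖ ^ 2) = ∫ k : E3, f ‖k‖ := by
      rw [← integral_finsetSum _ fun i _ => hint i i]
      refine integral_congr_ae ?_
      filter_upwards [Measure.ae_ne volume (0 : E3)] with k hk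
      have hk0 : ‖k‖ ^ 2 ≠ 0 := pow_ne_zero 2 (norm_ne_zero_iff.mpr hk)
      have h3 : ∑ i : Fin 3, k i * k i = ‖k‖ ^ 2 := by
        rw [EuclideanSpace.norm_sq_eq]
        exact Finset.sum_congr rfl fun i _ => by rw [Real.norm_eq_abs, sq_abs, pow_two]
      rw [← Finset.mul_sum, ← Finset.sum_div, h3, div_self hk0, mul_one]
    rw [Finset.sum_congr rfl fun i _ => hsymm i] at hsum
    simp only [Finset.sum_const, Finset.card_univ, Fintype.card_fin, nsmul_eq_mul, Nat.cast_ofNat] at hsum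
    linarith
  · set L : E3 ≃ₗᵢ[ℝ] E3 := LinearIsometryEquiv.piLpCongrRight 2 fun i =>
      if i = j then LinearIsometryEquiv.neg ℝ else LinearIsometryEquiv.refl ℝ ℝ
    have h1 := L.measurePreserving.integral_comp L.toHomeomorph.measurableEmbedding
        fun k : E3 => f ‖k‖ * (k j * k j' / ‖k‖ ^ 2)
    have h2 : ∀ k : E3, f ‖L k‖ * ((L k) j * (L k) j' / ‖L k‖ ^ 2) =
        -(f ‖k‖ * (k j * k j' / ‖k‖ ^ 2)) := by
      intro k
      have h3 : (L k) j = -k j := by simp [L]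
      have h4 : (L k) j' = k j' := by simp [L, Ne.symm h]
      rw [L.norm_map, h3, h4]
      ring
    simp only [h2, integral_neg] at h1
    linarith

theorem integral_inv_mul_sq_add_sq {C c y : ℝ} (hc : 0 < c) (hy : 0 < y) :
    ∫ r in (0 : ℝ)..C, 1 / (c ^ 2 * r ^ 2 + y ^ 2) = Real.arctan (c * C / y) / (c * y) := by
  have h : ∀ r ∈ Set.uIcc 0 C, HasDerivAt (fun r => Real.arctan (c * r / y) / (c * y))
      (1 / (c ^ 2 * r ^ 2 + y ^ 2)) r := by
    intro r _
    have h1 := ((((hasDerivAt_id r).const_mul c).div_const y).arctan).div_const (c * y)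
    refine h1.congr_deriv ?_
    have : 0 < c ^ 2 * r ^ 2 + y ^ 2 := by positivity
    simp only [id]
    field_simp
    ring
  rw [intervalIntegral.integral_eq_sub_of_hasDerivAt h]
  · simp
  · refine ContinuousOn.intervalIntegrable (Continuous.continuousOn ?_)
    exact continuous_const.div (by fun_prop) fun r => by positivity

theorem integral_inv_add {C c η : ℝ} (hC : 0 < C) (hc : 0 < c) (hη : 0 < η) :
    ∫ r in (0 : ℝ)..C, 1 / (c * r + η) = Real.log (1 + c * C / η) / c := by
  have h : ∀ r ∈ Set.uIcc 0 C, HasDerivAt (fun r => Real.log (c * r + η) / c)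
      (1 / (c * r + η)) r := by
    intro r hr
    rw [Set.uIcc_of_le hC.le] at hr
    have h0 : 0 < c * r + η := by have := hr.1; positivity
    have h1 := ((((hasDerivAt_id r).const_mul c).add_const η).log h0.ne').div_const c
    refine h1.congr_deriv ?_
    simp only [id]
    field_simp
  rw [intervalIntegral.integral_eq_sub_of_hasDerivAt h]
  · rw [← sub_div, ← Real.log_div (by positivity) (by simpa using hη.ne')]
    congr 2
    simp only [mul_zero, zero_add]
    field_simp
    ring
  · refine ContinuousOn.intervalIntegrable (continuousOn_const.div (by fun_prop) fun r hr => ?_)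
    rw [Set.uIcc_of_le hC.le] at hr
    have := hr.1
    positivity

end Radial

/-! ### Continuum limits of the response sums and of the energy renormalization -/

namespace OscillatorModel
variable (S : OscillatorModel)

/-- The sum over the polarizations. -/
theorem sum_u_mul_u {k : E3} (hk : k ≠ 0) (j j' : Fin 3) :
    ∑ σ, S.u σ k j * S.u σ k j' = (if j = j' then 1 else 0) - k j * k j' / ‖k‖ ^ 2 := by
  have ho := S.u_orthonormal k hk
  set v : Fin 3 → E3 := ![S.u 0 k, S.u 1 k, ‖k‖⁻¹ • k] with hv
  set M : Matrix (Fin 3) (Fin 3) ℝ := Matrix.of fun a b => v a b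
  have h1 : M * M.transpose = 1 := by
    ext a b
    have := orthonormal_iff_ite.mp ho a b
    rw [Matrix.mul_apply, Matrix.one_apply, ← this, PiLp.inner_apply]
    exact Finset.sum_congr rfl fun i _ => by simp [M, mul_comm]
  -- Orthonormal rows of a square matrix imply orthonormal columns, which is the completeness
  -- relation of the frame.
  have h2 : M.transpose * M = 1 := mul_eq_one_comm.mp h1
  have h3 := congrFun (congrFun h2 j) j'
  rw [Matrix.mul_apply, Matrix.one_apply, Fin.sum_univ_three] at h3
  simp only [M, Matrix.transpose_apply, Matrix.of_apply, hv, Matrix.cons_val_zero, Matrix.cons_val_one,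
    Matrix.cons_val, PiLp.smul_apply, smul_eq_mul] at h3
  rw [Fin.sum_univ_two, ← h3]
  ring

theorem ae_tendsto_means (C : ℝ) : ∀ᵐ k, Tendsto (fun N => S.ωMean N (cubeIndex N k)) atTop (𝓝 (S.ω k)) ∧
    Tendsto (fun N => cutoffMean C N (cubeIndex N k)) atTop (𝓝 (cutoff C k)) ∧
    ∀ σ, Tendsto (fun N => S.yMean C N σ (cubeIndex N k)) atTop (𝓝 (S.yField C σ k)) := by
  filter_upwards [ae_tendsto_average_cube S.continuous_ω.locallyIntegrable,
    ae_tendsto_average_cube (locallyIntegrable_cutoff C),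
    ae_all_iff.mpr fun σ => ae_tendsto_average_cube (S.locallyIntegrable_yField C σ)] with k h1 h2 h3
  exact ⟨h1, h2, h3⟩

/-- The function dominating the Riemann sums. -/
theorem integrable_dominant (C B : ℝ) :
    Integrable ((Metric.ball (0 : E3) (C + 2)).indicator fun k => B * (‖k‖ ^ 2)⁻¹) :=
  (integrable_indicator_iff measurableSet_ball).mpr ((integrableOn_inv_norm_sq _).const_mul B)

/-- The summands of the response matrix. -/
noncomputable def responseTerm (C y : ℝ) (j j' : Fin 3) (N : ℕ) (z : Fin 3 → ℤ) : ℝ :=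
  S.e ^ 2 * S.η ^ 2 / (2 * Real.pi ^ 2 * S.m) *
    ∑ σ, S.yMean C N σ z j * S.yMean C N σ z j' / (S.ωMean N z * (S.ωMean N z ^ 2 + y ^ 2))

theorem responseSum_eq (C : ℝ) {N : ℕ} (hN : 1 ≤ N) (y : ℝ) (j j' : Fin 3) :
    ∑ i, S.η * (S.oscCoupling C N i j * S.oscCoupling C N i j') /
      (S.fieldFreq N i * (S.fieldFreq N i ^ 2 + y ^ 2)) =
    ∑ z : cubeIndices N, cubeVol N * S.responseTerm C y j j' N z := by
  simp only [responseTerm]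
  rw [Fintype.sum_prod_type_right]
  refine Finset.sum_congr rfl fun z _ => ?_
  rw [Finset.mul_sum, Finset.mul_sum]
  refine Finset.sum_congr rfl fun σ _ => ?_
  have hV := (cubeVol_pos hN).le
  have h1 : √(cubeVol N) * √(cubeVol N) = cubeVol N := Real.mul_self_sqrt hV
  have h2 : √2 * √2 = (2 : ℝ) := Real.mul_self_sqrt (by norm_num)
  have h3 : √(S.hbar / (4 * Real.pi ^ 2)) * √(S.hbar / (4 * Real.pi ^ 2)) = S.hbar / (4 * Real.pi ^ 2) :=
    Real.mul_self_sqrt (div_nonneg S.hbar_pos.le (by positivity))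
  have hm := S.m_pos.ne'
  have hh := S.hbar_pos.ne'
  have hw := S.ωMean_pos hN z
  simp only [oscCoupling, couplingCoef, fieldFreq]
  have e : S.η * (S.momentumUnit * (√(cubeVol N) * √2 * (S.e / S.m * √(S.hbar / (4 * Real.pi ^ 2))) *
      S.yMean C N σ z j) / S.hbar * (S.momentumUnit * (√(cubeVol N) * √2 *
      (S.e / S.m * √(S.hbar / (4 * Real.pi ^ 2))) * S.yMean C N σ z j') / S.hbar)) =
      S.η * S.momentumUnit ^ 2 * (√(cubeVol N) * √(cubeVol N)) * (√2 * √2) * (S.e / S.m) ^ 2 *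
      (√(S.hbar / (4 * Real.pi ^ 2)) * √(S.hbar / (4 * Real.pi ^ 2))) *
      (S.yMean C N σ z j * S.yMean C N σ z j') / S.hbar ^ 2 := by
    field_simp
  rw [e, h1, h2, h3, momentumUnit_sq]
  have hpi := Real.pi_ne_zero
  have : S.ωMean N z ^ 2 + y ^ 2 ≠ 0 := by positivity
  field_simp
  ring

/-- Bound of the summands of the response matrix. -/
theorem exists_abs_responseTerm_le (C : ℝ) : ∃ B : ℝ, ∀ N, 1 ≤ N → ∀ y : ℝ, 0 < y → ∀ j j' : Fin 3,
    ∀ᵐ k, |S.responseTerm C y j j' N (cubeIndex N k)| ≤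
      (Metric.ball (0 : E3) (C + 2)).indicator (fun k => B / y ^ 2 * (‖k‖ ^ 2)⁻¹) k := by
  obtain ⟨A, hA, h⟩ := S.exists_mean_bounds
  simp only [responseTerm]
  set a : ℝ := S.e ^ 2 * S.η ^ 2 / (2 * Real.pi ^ 2 * S.m) with ha
  have ha0 : 0 ≤ a := by have := S.m_pos; positivity
  -- The `2` counts the polarizations, `A²` comes from the two factors `y` and a further `A` from
  -- the frequency in the denominator; together they leave `1/ω(k)²`, integrable near the origin.
  refine ⟨a * (2 * A ^ 3) / S.c ^ 2, fun N hN y hy j j' => ?_⟩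
  filter_upwards [Measure.ae_ne volume (0 : E3)] with k hk
  have hk0 : 0 < ‖k‖ := norm_pos_iff.mpr hk
  by_cases hc : C + 2 ≤ ‖k‖
  · simp only [S.yMean_eq_zero hN _ hc]
    rw [Set.indicator_of_notMem (by simpa using hc)]
    simp
  rw [Set.indicator_of_mem (by simpa using hc)]
  obtain ⟨h1, h2⟩ := h N hN k hk
  set z := cubeIndex N k
  have hw := S.ωMean_pos hN z
  have hωk : 0 < S.ω k := mul_pos S.c_pos hk0
  have hterm : ∀ σ, |S.yMean C N σ z j * S.yMean C N σ z j' / (S.ωMean N z * (S.ωMean N z ^ 2 + y ^ 2))| ≤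
      A ^ 2 / S.ω k / (S.ω k / A * y ^ 2) := by
    intro σ
    rw [abs_div, abs_of_pos (show 0 < S.ωMean N z * (S.ωMean N z ^ 2 + y ^ 2) by positivity)]
    have h3 : |S.yMean C N σ z j * S.yMean C N σ z j'| ≤ A ^ 2 / S.ω k := by
      refine le_trans ?_ (h2 C σ)
      have hcoord : ∀ i, |S.yMean C N σ z i| ≤ ‖S.yMean C N σ z‖ := fun i =>
        PiLp.norm_apply_le (S.yMean C N σ z) i
      rw [abs_mul, pow_two]
      exact mul_le_mul (hcoord j) (hcoord j') (abs_nonneg _) (norm_nonneg _)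
    have h4 : S.ω k / A ≤ S.ωMean N z := by
      rw [div_le_iff₀ (by linarith), mul_comm]; exact h1
    have h5 : y ^ 2 ≤ S.ωMean N z ^ 2 + y ^ 2 := by linarith [sq_nonneg (S.ωMean N z)]
    have h6 : 0 < S.ω k / A := by positivity
    gcongr
  rw [abs_mul, abs_of_nonneg ha0, Fin.sum_univ_two]
  have h7 := (abs_add_le (S.yMean C N 0 z j * S.yMean C N 0 z j' / (S.ωMean N z * (S.ωMean N z ^ 2 + y ^ 2)))
    (S.yMean C N 1 z j * S.yMean C N 1 z j' / (S.ωMean N z * (S.ωMean N z ^ 2 + y ^ 2)))).trans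
    (add_le_add (hterm 0) (hterm 1))
  refine (mul_le_mul_of_nonneg_left h7 ha0).trans (le_of_eq ?_)
  rw [ω]
  have := S.c_pos.ne'
  field_simp
  ring

theorem exists_abs_responseSum_le (C : ℝ) : ∃ B : ℝ, ∀ N, 1 ≤ N → ∀ y : ℝ, 0 < y → ∀ j j' : Fin 3,
    |∑ i, S.η * (S.oscCoupling C N i j * S.oscCoupling C N i j') /
      (S.fieldFreq N i * (S.fieldFreq N i ^ 2 + y ^ 2))| ≤ B / y ^ 2 := by
  obtain ⟨B, hB⟩ := S.exists_abs_responseTerm_le C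
  refine ⟨B * ∫ k in Metric.ball (0 : E3) (C + 2), (‖k‖ ^ 2)⁻¹, fun N hN y hy j j' => ?_⟩
  rw [S.responseSum_eq C hN]
  refine (abs_sum_cubeIndices_le (Φ := S.responseTerm C y j j' N) hN
    (integrable_dominant C _) (hB N hN y hy j j')).trans (le_of_eq ?_)
  rw [integral_indicator measurableSet_ball, integral_const_mul]
  ring

/-- The means converge almost everywhere, and in the limit the polarizations sum to the transverse
projection. After angular averaging the infrared factor `ω⁻²` is absorbed by the volume element, and
the remaining integral of `1/(c²r² + y²)` is the arctangent. -/
theorem tendsto_responseSum {C : ℝ} (hC : 0 < C) {y : ℝ} (hy : 0 < y) (j j' : Fin 3) :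
    Tendsto (fun N => ∑ i, S.η * (S.oscCoupling C N i j * S.oscCoupling C N i j') /
      (S.fieldFreq N i * (S.fieldFreq N i ^ 2 + y ^ 2))) atTop
      (𝓝 (if j = j' then 4 / Real.pi * (S.η / (3 * S.m * S.c ^ 3) * S.e ^ 2) * (S.η / y) *
        Real.arctan (S.c * C / y) else 0)) := by
  obtain ⟨B, hB⟩ := S.exists_abs_responseTerm_le C
  have hc := S.c_pos
  have hm := S.m_pos
  set a : ℝ := S.e ^ 2 * S.η ^ 2 / (2 * Real.pi ^ 2 * S.m) with ha
  set f : ℝ → ℝ := fun r => a * ((S.c ^ 2 * r ^ 2)⁻¹ * (1 / (S.c ^ 2 * r ^ 2 + y ^ 2))) with hf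
  set f' : ℝ → ℝ := fun r => (if r < C then 1 else 0) * f r with hf'
  have hff' : ∀ k : E3, f' ‖k‖ = cutoff C k * f ‖k‖ := fun k => rfl
  have h := tendsto_sum_cubeIndices (Φ := S.responseTerm C y j j') (F := fun k => f' ‖k‖ *
    ((if j = j' then 1 else 0) - k j * k j' / ‖k‖ ^ 2)) (integrable_dominant C _)
    (fun N hN => hB N hN y hy j j') ?_
  · have hint : Integrable fun k : E3 => f' ‖k‖ := by
      refine (integrable_dominant C (a / (S.c ^ 2 * y ^ 2))).mono' ?_ (Eventually.of_forall fun k => ?_)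
      · have : Measurable f' := by
          refine Measurable.mul (Measurable.ite measurableSet_Iio measurable_const measurable_const) ?_
          fun_prop
        exact (this.comp measurable_norm).aestronglyMeasurable
      · have hf0 : ∀ r, 0 ≤ f r := fun r => by positivity
        rw [hff', Real.norm_eq_abs, abs_of_nonneg (mul_nonneg (cutoff_nonneg C k) (hf0 _))]
        by_cases hk : ‖k‖ < C
        · rw [Set.indicator_of_mem (by simpa using by linarith), cutoff, if_pos hk, one_mul]
          have h1 : 1 / (S.c ^ 2 * ‖k‖ ^ 2 + y ^ 2) ≤ 1 / y ^ 2 :=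
            one_div_le_one_div_of_le (by positivity) (by linarith [show 0 ≤ S.c ^ 2 * ‖k‖ ^ 2 by positivity])
          calc f ‖k‖ ≤ a * ((S.c ^ 2 * ‖k‖ ^ 2)⁻¹ * (1 / y ^ 2)) := by
                simp only [hf]; gcongr
            _ = _ := by rw [mul_inv]; field_simp
        · rw [cutoff, if_neg hk, zero_mul]
          exact Set.indicator_nonneg (fun k _ => by positivity) k
    rw [integral_coord_mul_coord hint] at h
    have hval : ∫ k : E3, f' ‖k‖ = 4 * Real.pi * (a / S.c ^ 2 * (Real.arctan (S.c * C / y) / (S.c * y))) := by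
      simp only [hff']
      rw [integral_cutoff_mul_radial hC (g := fun r => a / S.c ^ 2 * (1 / (S.c ^ 2 * r ^ 2 + y ^ 2))),
        intervalIntegral.integral_const_mul, integral_inv_mul_sq_add_sq hc hy]
      intro r hr
      have := hr.1
      simp only [hf]
      field_simp
    have hlim : (if j = j' then 4 / Real.pi * (S.η / (3 * S.m * S.c ^ 3) * S.e ^ 2) * (S.η / y) *
        Real.arctan (S.c * C / y) else 0) = if j = j' then 2 / 3 * ∫ k : E3, f' ‖k‖ else 0 := by
      rw [hval, ha]
      congr 1
      have := Real.pi_ne_zero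
      field_simp
    rw [hlim]
    refine h.congr' ?_
    filter_upwards [eventually_ge_atTop 1] with N hN
    rw [S.responseSum_eq C hN]
  · filter_upwards [S.ae_tendsto_means C, Measure.ae_ne volume (0 : E3)] with k hk hk0
    obtain ⟨h1, -, h3⟩ := hk
    have hωk : 0 < S.ω k := mul_pos hc (norm_pos_iff.mpr hk0)
    have hco : ∀ σ (i : Fin 3), Tendsto (fun N => S.yMean C N σ (cubeIndex N k) i) atTop
        (𝓝 (S.yField C σ k i)) := fun σ i =>
      ((PiLp.continuous_apply 2 (fun _ : Fin 3 => ℝ) i).tendsto _).comp (h3 σ)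
    have h4 := (tendsto_finsetSum (Finset.univ : Finset (Fin 2)) fun σ _ =>
      ((hco σ j).mul (hco σ j')).div (h1.mul ((h1.pow 2).add_const (y ^ 2))) (by positivity)).const_mul a
    convert! h4 using 2
    have h5 : ∀ σ, S.yField C σ k j * S.yField C σ k j' / (S.ω k * (S.ω k ^ 2 + y ^ 2)) =
        cutoff C k ^ 2 / (S.ω k ^ 2 * (S.ω k ^ 2 + y ^ 2)) * (S.u σ k j * S.u σ k j') := by
      intro σ
      have h6 : √(S.ω k) ^ 2 = S.ω k := Real.sq_sqrt hωk.le
      have h7 : 0 < √(S.ω k) := Real.sqrt_pos.mpr hωk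
      simp only [yField, PiLp.smul_apply, smul_eq_mul]
      have h8 : cutoff C k / √(S.ω k) * S.u σ k j * (cutoff C k / √(S.ω k) * S.u σ k j') =
        cutoff C k ^ 2 / √(S.ω k) ^ 2 * (S.u σ k j * S.u σ k j') := by ring
      rw [h8, h6]
      field_simp
    simp only [h5, ← Finset.mul_sum, S.sum_u_mul_u hk0, hff']
    have h9 : cutoff C k ^ 2 = cutoff C k := by rw [cutoff]; split_ifs <;> simp
    rw [h9, ω]
    simp only [hf]
    field_simp

/-- The volume element cancels `ω⁻²`, and the integral of `1/(cr + η)` up to the cutoff is the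
logarithm that later offsets the divergence of the product. -/
theorem tendsto_renormEnergy {C : ℝ} (hC : 0 < C) : Tendsto (S.renormEnergy C) atTop
    (𝓝 (S.hbar * (3 / Real.pi) * (S.η / (3 * S.m * S.c ^ 3) * S.e ^ 2) * S.η *
      Real.log (1 + S.c * C / S.η))) := by
  obtain ⟨A, hA, hb⟩ := S.exists_mean_bounds
  have hc := S.c_pos
  have hm := S.m_pos
  have hη := S.η_pos
  have hh := S.hbar_pos
  set a : ℝ := S.hbar * (S.e ^ 2 * S.η ^ 2 / (4 * Real.pi ^ 2 * S.m)) with ha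
  have ha0 : 0 ≤ a := by positivity
  set f : ℝ → ℝ := fun r => a * ((S.c ^ 2 * r ^ 2)⁻¹ * (1 / (S.c * r + S.η))) with hf
  have h := tendsto_sum_cubeIndices (Φ := fun N z =>
    a * (cutoffMean C N z / ((S.ωMean N z) ^ 2 * (S.ωMean N z + S.η)))) (F := fun k => cutoff C k * f ‖k‖)
    (integrable_dominant C (a * A ^ 2 / (S.c ^ 2 * S.η))) ?_ ?_
  · have hval : ∫ k : E3, cutoff C k * f ‖k‖ = 4 * Real.pi * (a / S.c ^ 2 *
        (Real.log (1 + S.c * C / S.η) / S.c)) := by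
      rw [integral_cutoff_mul_radial hC (g := fun r => a / S.c ^ 2 * (1 / (S.c * r + S.η))),
        intervalIntegral.integral_const_mul, integral_inv_add hC hc hη]
      intro r hr
      have := hr.1
      simp only [hf]
      field_simp
    have hlim : S.hbar * (3 / Real.pi) * (S.η / (3 * S.m * S.c ^ 3) * S.e ^ 2) * S.η *
      Real.log (1 + S.c * C / S.η) = ∫ k : E3, cutoff C k * f ‖k‖ := by
      rw [hval, ha]
      have := Real.pi_ne_zero
      field_simp
    rw [hlim]
    refine h.congr fun N => ?_
    rw [renormEnergy]
    exact Finset.sum_congr rfl fun z _ => by rw [ha]; ring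
  · intro N hN
    filter_upwards [Measure.ae_ne volume (0 : E3)] with k hk
    have hk0 : 0 < ‖k‖ := norm_pos_iff.mpr hk
    by_cases hc' : C + 2 ≤ ‖k‖
    · rw [cutoffMean_eq_zero hN hc', Set.indicator_of_notMem (by simpa using hc')]
      simp
    rw [Set.indicator_of_mem (by simpa using hc')]
    have h1 := (hb N hN k hk).1
    set z := cubeIndex N k
    have hw := S.ωMean_pos hN z
    have hωk : 0 < S.ω k := mul_pos S.c_pos hk0
    have h4 : S.ω k / A ≤ S.ωMean N z := by
      rw [div_le_iff₀ (by linarith), mul_comm]; exact h1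
    have h5 : S.η ≤ S.ωMean N z + S.η := by linarith
    have h6 : 0 < S.ω k / A := by positivity
    have h7 : 0 ≤ cutoffMean C N z := cutoffMean_nonneg C N z
    have h8 := cutoffMean_le_one C hN z
    rw [abs_of_nonneg (by positivity)]
    calc a * (cutoffMean C N z / (S.ωMean N z ^ 2 * (S.ωMean N z + S.η)))
        ≤ a * (1 / ((S.ω k / A) ^ 2 * S.η)) := by gcongr
      _ = _ := by
        rw [ω]
        field_simp
  · filter_upwards [S.ae_tendsto_means C, Measure.ae_ne volume (0 : E3)] with k hk hk0
    obtain ⟨h1, h2, -⟩ := hk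
    have hωk : 0 < S.ω k := mul_pos hc (norm_pos_iff.mpr hk0)
    have h4 := (h2.div ((h1.pow 2).mul (h1.add_const S.η)) (by positivity)).const_mul a
    convert! h4 using 2
    rw [ω]
    simp only [hf]
    field_simp

end OscillatorModel

/-! ### The infinite product of the cutoff partition function -/

/-- In the expansion of the determinant there are three linear, six quadratic and six cubic
monomials in the entries of `E`, all with coefficient `±1`. -/
theorem abs_det_one_add_sub_one_le {E : Matrix (Fin 3) (Fin 3) ℝ} {x : ℝ} (h : ∀ i j, |E i j| ≤ x) :
    |(1 + E).det - 1| ≤ 3 * x + 6 * x ^ 2 + 6 * x ^ 3 := by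
  have h2 : ∀ i j k l, |E i j * E k l| ≤ x ^ 2 := fun i j k l => by
    rw [abs_mul, pow_two]
    exact mul_le_mul (h i j) (h k l) (abs_nonneg _) ((abs_nonneg _).trans (h i j))
  have h3 : ∀ i j k l p q, |E i j * E k l * E p q| ≤ x ^ 3 := fun i j k l p q => by
    rw [abs_mul, pow_succ]
    exact mul_le_mul (h2 i j k l) (h p q) (abs_nonneg _) (sq_nonneg x)
  have h1 := fun i j => abs_le.mp (h i j)
  replace h2 := fun i j k l => abs_le.mp (h2 i j k l)
  replace h3 := fun i j k l p q => abs_le.mp (h3 i j k l p q)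
  have e : (1 + E).det - 1 = E 0 0 + E 1 1 + E 2 2 + (E 0 0 * E 1 1 + E 0 0 * E 2 2 + E 1 1 * E 2 2 -
      E 0 1 * E 1 0 - E 0 2 * E 2 0 - E 1 2 * E 2 1) + (E 0 0 * E 1 1 * E 2 2 - E 0 0 * E 1 2 * E 2 1 -
      E 0 1 * E 1 0 * E 2 2 + E 0 1 * E 1 2 * E 2 0 + E 0 2 * E 1 0 * E 2 1 - E 0 2 * E 1 1 * E 2 0) := by
    rw [Matrix.det_fin_three]
    simp only [Matrix.add_apply, Matrix.one_apply]
    norm_num [Fin.ext_iff]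
    ring
  rw [e, abs_le]
  constructor
  · linarith [(h1 0 0).1, (h1 1 1).1, (h1 2 2).1, (h2 0 0 1 1).1, (h2 0 0 2 2).1, (h2 1 1 2 2).1,
      (h2 0 1 1 0).2, (h2 0 2 2 0).2, (h2 1 2 2 1).2, (h3 0 0 1 1 2 2).1, (h3 0 0 1 2 2 1).2,
      (h3 0 1 1 0 2 2).2, (h3 0 1 1 2 2 0).1, (h3 0 2 1 0 2 1).1, (h3 0 2 1 1 2 0).2]
  · linarith [(h1 0 0).2, (h1 1 1).2, (h1 2 2).2, (h2 0 0 1 1).2, (h2 0 0 2 2).2, (h2 1 1 2 2).2,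
      (h2 0 1 1 0).1, (h2 0 2 2 0).1, (h2 1 2 2 1).1, (h3 0 0 1 1 2 2).2, (h3 0 0 1 2 2 1).1,
      (h3 0 1 1 0 2 2).1, (h3 0 1 1 2 2 0).2, (h3 0 2 1 0 2 1).2, (h3 0 2 1 1 2 0).1]

theorem summable_inv_add_one_sq : Summable fun n : ℕ => (((n : ℝ) + 1) ^ 2)⁻¹ := by
  have h := (summable_nat_add_iff 1).mpr (Real.summable_nat_pow_inv (p := 2).mpr (by norm_num))
  simpa using h

/-- The deviation from `1` of a factor of the infinite product for the cutoff partition function. -/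
noncomputable def productTerm (s ρ γ : ℝ) (n : ℕ) : ℝ :=
  ρ ^ 2 / (n + 1) ^ 2 + 4 / Real.pi * s * (ρ / (n + 1)) * Real.arctan (γ * ρ / (n + 1))

/-- The cutoff partition function. -/
noncomputable def cutoffPartition (s ρ γ : ℝ) : ℝ :=
  (Real.exp (2 * ρ * s * Real.log (1 + γ)) / (2 * Real.pi * ρ) * (∏' n, (1 + productTerm s ρ γ n))⁻¹) ^ 3

theorem productTerm_nonneg {s ρ γ : ℝ} (hs : 0 ≤ s) (hρ : 0 < ρ) (hγ : 0 < γ) (n : ℕ) :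
    0 ≤ productTerm s ρ γ n := by
  have : 0 ≤ Real.arctan (γ * ρ / (n + 1)) := Real.arctan_nonneg.mpr (by positivity)
  have := Real.pi_pos
  unfold productTerm
  positivity

theorem Real.arctan_le_self {x : ℝ} (hx : 0 ≤ x) : Real.arctan x ≤ x := by
  rcases hx.eq_or_lt with rfl | hx
  · simp
  have h1 := Real.lt_tan (Real.arctan_pos.mpr hx) (Real.arctan_lt_pi_div_two x)
  rw [Real.tan_arctan] at h1
  exact h1.le

theorem productTerm_le {s ρ γ : ℝ} (hs : 0 ≤ s) (hρ : 0 < ρ) (hγ : 0 < γ) (n : ℕ) :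
    productTerm s ρ γ n ≤ (ρ ^ 2 + 4 / Real.pi * s * ρ * (γ * ρ)) * (((n : ℝ) + 1) ^ 2)⁻¹ := by
  have h1 : Real.arctan (γ * ρ / (n + 1)) ≤ γ * ρ / (n + 1) := Real.arctan_le_self (by positivity)
  have := Real.pi_pos
  calc productTerm s ρ γ n ≤ ρ ^ 2 / (n + 1) ^ 2 + 4 / Real.pi * s * (ρ / (n + 1)) * (γ * ρ / (n + 1)) := by
        unfold productTerm; gcongr
    _ = _ := by field_simp

theorem summable_productTerm {s ρ γ : ℝ} (hs : 0 ≤ s) (hρ : 0 < ρ) (hγ : 0 < γ) :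
    Summable (productTerm s ρ γ) :=
  Summable.of_nonneg_of_le (productTerm_nonneg hs hρ hγ) (productTerm_le hs hρ hγ)
    (summable_inv_add_one_sq.mul_left _)

theorem multipliable_one_add_productTerm {s ρ γ : ℝ} (hs : 0 ≤ s) (hρ : 0 < ρ) (hγ : 0 < γ) :
    Multipliable fun n => 1 + productTerm s ρ γ n :=
  multipliable_one_add_of_summable (summable_productTerm hs hρ hγ).norm

theorem one_le_tprod_productTerm {s ρ γ : ℝ} (hs : 0 ≤ s) (hρ : 0 < ρ) (hγ : 0 < γ) :
    1 ≤ ∏' n, (1 + productTerm s ρ γ n) := by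
  refine ge_of_tendsto' (multipliable_one_add_productTerm hs hρ hγ).hasProd.tendsto_prod_nat fun M => ?_
  refine Finset.prod_induction _ (fun x => 1 ≤ x) (fun _ _ => one_le_mul_of_one_le_of_one_le) le_rfl
    fun n _ => ?_
  linarith [productTerm_nonneg hs hρ hγ n]

/-! ### Existence and value of the cutoff partition function -/

namespace OscillatorModel
variable (S : OscillatorModel)

/-- The dimensionless coupling constant. -/
noncomputable def couplingConst : ℝ := S.η / (3 * S.m * S.c ^ 3) * S.e ^ 2

theorem couplingConst_nonneg : 0 ≤ S.couplingConst := by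
  have := S.η_pos
  have := S.m_pos
  have := S.c_pos
  unfold couplingConst
  positivity

/-- The limit `N → ∞` is exchanged with the infinite product by dominated convergence: the deviation
of each determinant from `1` is bounded by a multiple of `(n+1)⁻²` that does not depend on `N`. In
the limit the matrices are scalar, whence the cube. -/
theorem exists_tendsto_tprod_det {β γ : ℝ} (hβ : 0 < β) (hγ : 0 < γ) : ∃ D : ℕ → ℝ,
    (∀ N, 1 ≤ N → Tendsto (fun M : ℕ => ∏ n ∈ Finset.range M,
      (responseMatrix S.η (S.oscCoupling (γ * S.η / S.c) N) (S.fieldFreq N)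
        (2 * Real.pi * (n + 1) / β)).det) atTop (𝓝 (D N))) ∧
    Tendsto D atTop (𝓝 ((∏' n, (1 + productTerm S.couplingConst (S.η * β / (2 * Real.pi)) γ n)) ^ 3)) := by
  have hη := S.η_pos
  have hc := S.c_pos
  have hC : 0 < γ * S.η / S.c := by positivity
  set ρ : ℝ := S.η * β / (2 * Real.pi) with hρ
  have hpi := Real.pi_pos
  have hρ0 : 0 < ρ := by positivity
  set s := S.couplingConst with hs
  have hs0 : 0 ≤ s := S.couplingConst_nonneg
  set y : ℕ → ℝ := fun n => 2 * Real.pi * (n + 1) / β with hy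
  have hy0 : ∀ n, 0 < y n := fun n => by positivity
  obtain ⟨B, hB⟩ := S.exists_abs_responseSum_le (γ * S.η / S.c)
  set E : ℕ → ℕ → Matrix (Fin 3) (Fin 3) ℝ := fun N n => (S.η ^ 2 / y n ^ 2) • 1 + Matrix.of fun j j' =>
    ∑ i, S.η * (S.oscCoupling (γ * S.η / S.c) N i j * S.oscCoupling (γ * S.η / S.c) N i j') /
      (S.fieldFreq N i * (S.fieldFreq N i ^ 2 + y n ^ 2)) with hE
  have hRE : ∀ N n, responseMatrix S.η (S.oscCoupling (γ * S.η / S.c) N) (S.fieldFreq N) (y n) =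
      1 + E N n := by
    intro N n
    rw [responseMatrix, hE, add_smul, one_smul, add_assoc]
  -- Since `y n` is proportional to `n + 1`, both parts of the matrix entries are bounded by `X
  -- (n+1)⁻²`; the absolute value is taken because `B` carries no sign information.
  set X : ℝ := (S.η ^ 2 + |B|) * (β / (2 * Real.pi)) ^ 2 with hX
  have hX0 : 0 ≤ X := by positivity
  have hyX : ∀ n, (S.η ^ 2 + |B|) / y n ^ 2 = X * (((n : ℝ) + 1) ^ 2)⁻¹ := fun n => by
    simp only [hy, hX]; field_simp
  have hEb : ∀ N, 1 ≤ N → ∀ n i j, |E N n i j| ≤ X * (((n : ℝ) + 1) ^ 2)⁻¹ := by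
    intro N hN n i j
    rw [← hyX, add_div]
    simp only [hE, Matrix.add_apply, Matrix.smul_apply, Matrix.of_apply, smul_eq_mul]
    refine (abs_add_le _ _).trans (add_le_add ?_ ((hB N hN (y n) (hy0 n) i j).trans ?_))
    · rw [Matrix.one_apply]
      split_ifs
      · rw [mul_one, abs_of_nonneg (by positivity)]
      · rw [mul_zero, abs_zero]; positivity
    · gcongr
      exact le_abs_self B
  have hdet : ∀ N, 1 ≤ N → ∀ n, |(1 + E N n).det - 1| ≤
      (3 * X + 6 * X ^ 2 + 6 * X ^ 3) * (((n : ℝ) + 1) ^ 2)⁻¹ := by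
    intro N hN n
    refine (abs_det_one_add_sub_one_le (hEb N hN n)).trans ?_
    set q : ℝ := (((n : ℝ) + 1) ^ 2)⁻¹ with hq
    have hq0 : 0 ≤ q := by positivity
    have hq1 : q ≤ 1 := inv_le_one_of_one_le₀ (one_le_pow₀ (by linarith [n.cast_nonneg (α := ℝ)]))
    have h2 : q ^ 2 ≤ q := by nlinarith
    have h3 : q ^ 3 ≤ q := by nlinarith
    rw [mul_pow, mul_pow]
    have := mul_le_mul_of_nonneg_left h2 (sq_nonneg X)
    have := mul_le_mul_of_nonneg_left h3 (pow_nonneg hX0 3)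
    linarith
  have hsum : Summable fun n : ℕ => (3 * X + 6 * X ^ 2 + 6 * X ^ 3) * (((n : ℝ) + 1) ^ 2)⁻¹ :=
    summable_inv_add_one_sq.mul_left _
  refine ⟨fun N => ∏' n, (1 + ((1 + E N n).det - 1)), fun N hN => ?_, ?_⟩
  · have hm : Multipliable fun n => 1 + ((1 + E N n).det - 1) :=
      multipliable_one_add_of_summable (Summable.of_nonneg_of_le (fun n => norm_nonneg _)
        (fun n => hdet N hN n) hsum)
    refine hm.hasProd.tendsto_prod_nat.congr fun M => Finset.prod_congr rfl fun n _ => ?_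
    rw [add_sub_cancel, ← hRE]
  · have hlim : ∀ n, Tendsto (fun N => (1 + E N n).det - 1) atTop
        (𝓝 ((1 + productTerm s ρ γ n) ^ 3 - 1)) := by
      intro n
      have h1 : Tendsto (fun N => 1 + E N n) atTop
          (𝓝 ((1 + productTerm s ρ γ n) • (1 : Matrix (Fin 3) (Fin 3) ℝ))) := by
        refine tendsto_pi_nhds.mpr fun i => tendsto_pi_nhds.mpr fun j => ?_
        have h2 := ((S.tendsto_responseSum hC (hy0 n) i j).const_add
          ((S.η ^ 2 / y n ^ 2) * (1 : Matrix (Fin 3) (Fin 3) ℝ) i j)).const_add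
          ((1 : Matrix (Fin 3) (Fin 3) ℝ) i j)
        convert! h2 using 2
        simp only [Matrix.smul_apply, Matrix.one_apply, smul_eq_mul]
        split_ifs
        · rw [productTerm, hs, couplingConst]
          have e1 : S.c * (γ * S.η / S.c) / y n = γ * ρ / (n + 1) := by
            simp only [hy, hρ]; field_simp
          have e2 : S.η / y n = ρ / (n + 1) := by simp only [hy, hρ]; field_simp
          have e3 : S.η ^ 2 / y n ^ 2 = ρ ^ 2 / (n + 1) ^ 2 := by rw [← div_pow, e2, div_pow]
          rw [e1, e2, e3]
          ring
        · simp
      have h3 := ((Continuous.matrix_det continuous_id).tendsto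
        ((1 + productTerm s ρ γ n) • (1 : Matrix (Fin 3) (Fin 3) ℝ))).comp h1
      simp only [id, Matrix.det_smul, Matrix.det_one, mul_one, Fintype.card_fin] at h3
      exact h3.sub_const 1
    have h4 := tendsto_tprod_one_add_of_dominated_convergence hsum hlim (by
      filter_upwards [eventually_ge_atTop 1] with N hN n
      exact hdet N hN n)
    convert! h4 using 2
    have h5 := (multipliable_one_add_productTerm hs0 hρ0 hγ).hasProd
    have h6 : HasProd (fun n => (1 + productTerm s ρ γ n) ^ 3)
        ((∏' n, (1 + productTerm s ρ γ n)) ^ 3) := by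
      simpa only [pow_succ, pow_zero, one_mul] using (h5.mul h5).mul h5
    simp only [add_sub_cancel]
    exact h6.tprod_eq.symm

/-- Three factors combine: the exponential of the energy renormalization, the prefactor `(βη)⁻³ =
(2πρ)⁻³`, and the inverse product of determinants. The zero-point energies of the field, which
diverge with `N`, drop out exactly. -/
theorem isCutoffPartitionFunction {β γ : ℝ} (hβ : 0 < β) (hγ : 0 < γ) :
    S.IsCutoffPartitionFunction β γ
      (cutoffPartition S.couplingConst (S.η * β / (2 * Real.pi)) γ) := by
  classical
  have hη := S.η_pos
  have hh := S.hbar_pos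
  have hc := S.c_pos
  have hpi := Real.pi_pos
  have hC : 0 < γ * S.η / S.c := by positivity
  have ht : 0 < β / S.hbar := by positivity
  have hth : β / S.hbar * S.hbar = β := div_mul_cancel₀ _ hh.ne'
  set C := γ * S.η / S.c with hCdef
  obtain ⟨D, hD, hDlim⟩ := S.exists_tendsto_tprod_det hβ hγ
  set ρ : ℝ := S.η * β / (2 * Real.pi) with hρ
  have hρ0 : 0 < ρ := by positivity
  set P := ∏' n, (1 + productTerm S.couplingConst ρ γ n) with hP
  have hP1 : 1 ≤ P := one_le_tprod_productTerm S.couplingConst_nonneg hρ0 hγ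
  -- Positive definiteness is available only for `N ≥ 1`; the value at `N = 0` is arbitrary.
  refine ⟨fun N => if hN : 1 ≤ N then Real.exp (-(β / S.hbar) * S.energyShift C N) *
      ∏ i, (2 * Real.sinh (β / S.hbar * S.hbar * √((posDef_freqMatrix_couplingForm (S.oscCoupling C N)
        (S.fieldFreq_pos hN) S.η_pos).1.eigenvalues i) / 2))⁻¹ else 0,
    fun N => ∏ i : Fin 2 × cubeIndices N,
      (1 - Real.exp (-(β / S.hbar * (S.hbar * S.ωMean N i.2))))⁻¹, fun N hN => ⟨?_, ?_⟩, ?_⟩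
  · simp only [dif_pos hN]
    exact S.hasHeatTrace_jointGraph C hN ht
  · exact S.hasHeatTrace_fieldGraph hN ht
  · have hE := (S.tendsto_renormEnergy hC).const_mul (β / S.hbar)
    have hE2 := ((Real.continuous_exp.tendsto _).comp hE).div (hDlim.const_mul ((β * S.η) ^ 3))
      (by positivity)
    have hval : Real.exp (β / S.hbar * (S.hbar * (3 / Real.pi) * (S.η / (3 * S.m * S.c ^ 3) * S.e ^ 2) *
        S.η * Real.log (1 + S.c * C / S.η))) / ((β * S.η) ^ 3 * P ^ 3) =
        cutoffPartition S.couplingConst ρ γ := by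
      rw [cutoffPartition, ← hP, mul_pow (Real.exp _ / _), div_pow (Real.exp _), ← Real.exp_nat_mul]
      have e1 : S.c * C / S.η = γ := by rw [hCdef]; field_simp
      have e2 : β * S.η = 2 * Real.pi * ρ := by rw [hρ]; field_simp
      have e3 : β / S.hbar * (S.hbar * (3 / Real.pi) * (S.η / (3 * S.m * S.c ^ 3) * S.e ^ 2) *
        S.η * Real.log (1 + γ)) = ((3 : ℕ) : ℝ) * (2 * ρ * S.couplingConst * Real.log (1 + γ)) := by
        rw [couplingConst, hρ]
        have := S.m_pos
        push_cast
        field_simp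
      rw [e1, e2, e3, div_mul_eq_div_div, inv_pow, ← div_eq_mul_inv]
    rw [hval] at hE2
    refine hE2.congr' ?_
    filter_upwards [eventually_ge_atTop 1] with N hN
    have hDN := tendsto_nhds_unique (hD N hN) (tendsto_prod_det_responseMatrix hη (S.oscCoupling C N)
      (S.fieldFreq_pos hN) hβ)
    simp only [dif_pos hN, hth, Function.comp_apply, Pi.div_apply]
    set J := ∏ i, 2 * Real.sinh (β * √((posDef_freqMatrix_couplingForm (S.oscCoupling C N)
        (S.fieldFreq_pos hN) S.η_pos).1.eigenvalues i) / 2) with hJ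
    set K := ∏ i, 2 * Real.sinh (β * S.fieldFreq N i / 2) with hK
    have hK0 : 0 < K := Finset.prod_pos fun i _ => by
      have : 0 < Real.sinh (β * S.fieldFreq N i / 2) :=
        Real.sinh_pos_iff.mpr (by have := S.fieldFreq_pos hN i; positivity)
      positivity
    -- Written with hyperbolic sines, the free trace shows the same exponential of zero-point
    -- energies that `energyShift` puts into the numerator.
    have hTrF : ∏ i : Fin 2 × cubeIndices N, (1 - Real.exp (-(β / S.hbar * (S.hbar * S.ωMean N i.2))))⁻¹ =
        Real.exp (β / 2 * ∑ i, S.fieldFreq N i) * K⁻¹ := by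
      rw [hK, ← Finset.prod_inv_distrib, Finset.mul_sum, Real.exp_sum, ← Finset.prod_mul_distrib]
      refine Finset.prod_congr rfl fun i _ => ?_
      rw [← mul_assoc, hth]
      change (1 - Real.exp (-(β * S.fieldFreq N i)))⁻¹ = _
      set a := β * S.fieldFreq N i with ha
      have e1 : β / 2 * S.fieldFreq N i = a / 2 := by rw [ha]; ring
      have e2 : 2 * Real.sinh (a / 2) = Real.exp (a / 2) * (1 - Real.exp (-a)) := by
        rw [Real.sinh_eq, mul_sub, ← Real.exp_add]
        ring_nf
      rw [e1, e2, mul_inv, ← mul_assoc, mul_inv_cancel₀ (Real.exp_ne_zero _), one_mul]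
    have hsh : Real.exp (-(β / S.hbar) * S.energyShift C N) =
        Real.exp (β / 2 * ∑ i, S.fieldFreq N i) * Real.exp (β / S.hbar * S.renormEnergy C N) := by
      rw [← Real.exp_add, energyShift]
      congr 1
      field_simp
      ring
    rw [hTrF, hsh, Finset.prod_inv_distrib, ← hJ, hDN]
    have := Real.exp_pos (β / 2 * ∑ i, S.fieldFreq N i)
    have h3 : (β * S.η) ^ 3 ≠ 0 := by positivity
    field_simp

end OscillatorModel

/-! ### A regularized harmonic series -/

section ArctanSum

theorem integrableOn_log_mul_inv_one_add_sq :
    IntegrableOn (fun τ : ℝ => Real.log τ * (1 + τ ^ 2)⁻¹) (Set.Ioi 0) := by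
  have hmeas : Measurable fun τ : ℝ => Real.log τ * (1 + τ ^ 2)⁻¹ := by fun_prop
  rw [← Set.Ioc_union_Ioi_eq_Ioi zero_le_one]
  refine IntegrableOn.union ?_ ?_
  · have h1 : IntegrableOn (fun τ : ℝ => 2 * τ ^ (-(1 / 2) : ℝ)) (Set.Ioc 0 1) := by
      rw [integrableOn_Ioc_iff_integrableOn_Ioo]
      exact ((intervalIntegral.integrableOn_Ioo_rpow_iff one_pos).mpr (by norm_num)).const_mul 2
    refine h1.mono' hmeas.aestronglyMeasurable ?_
    filter_upwards [ae_restrict_mem measurableSet_Ioc] with τ hτ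
    have h2 := Real.log_le_rpow_div (x := τ⁻¹) (ε := 1 / 2) (inv_nonneg.mpr hτ.1.le) (by norm_num)
    rw [Real.log_inv, Real.inv_rpow hτ.1.le, ← Real.rpow_neg hτ.1.le] at h2
    have h3 : Real.log τ ≤ 0 := Real.log_nonpos hτ.1.le hτ.2
    rw [norm_mul, Real.norm_eq_abs, abs_of_nonpos h3, Real.norm_eq_abs, abs_of_pos (by positivity)]
    have h4 : (1 + τ ^ 2)⁻¹ ≤ 1 := inv_le_one_of_one_le₀ (by linarith [sq_nonneg τ])
    calc -Real.log τ * (1 + τ ^ 2)⁻¹ ≤ -Real.log τ * 1 :=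
          mul_le_mul_of_nonneg_left h4 (by linarith)
      _ ≤ _ := by rw [mul_one]; refine h2.trans (le_of_eq ?_); ring
  · have h1 : IntegrableOn (fun τ : ℝ => 2 * τ ^ (-(3 / 2) : ℝ)) (Set.Ioi 1) :=
      (integrableOn_Ioi_rpow_of_lt (by norm_num) one_pos).const_mul 2
    refine h1.mono' hmeas.aestronglyMeasurable ?_
    filter_upwards [ae_restrict_mem measurableSet_Ioi] with τ hτ
    have hτ1 : 1 < τ := hτ
    have hτ0 : 0 < τ := by linarith
    have h2 := Real.log_le_rpow_div (x := τ) (ε := 1 / 2) hτ0.le (by norm_num)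
    have h3 : 0 ≤ Real.log τ := Real.log_nonneg hτ1.le
    rw [norm_mul, Real.norm_eq_abs, abs_of_nonneg h3, Real.norm_eq_abs, abs_of_pos (by positivity)]
    have h4 : (1 + τ ^ 2)⁻¹ ≤ (τ ^ 2)⁻¹ := inv_anti₀ (by positivity) (by linarith)
    have h5 : τ ^ (-(3 / 2) : ℝ) = τ ^ (1 / 2 : ℝ) * (τ ^ 2)⁻¹ := by
      have h6 : (τ ^ 2)⁻¹ = τ ^ (-2 : ℝ) := by
        rw [Real.rpow_neg hτ0.le]; norm_cast
      rw [h6, ← Real.rpow_add hτ0]; norm_num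
    rw [h5]
    calc Real.log τ * (1 + τ ^ 2)⁻¹ ≤ (τ ^ (1 / 2 : ℝ) / (1 / 2)) * (τ ^ 2)⁻¹ :=
          mul_le_mul h2 h4 (by positivity) (by positivity)
      _ = _ := by ring

/-- The substitution `τ ↦ 1/τ` preserves the measure `dτ/(1+τ²)` and reverses the sign of the
logarithm. -/
theorem integral_log_mul_inv_one_add_sq :
    ∫ τ in Set.Ioi (0 : ℝ), Real.log τ * (1 + τ ^ 2)⁻¹ = 0 := by
  have h := integral_comp_rpow_Ioi (fun τ : ℝ => Real.log τ * (1 + τ ^ 2)⁻¹) (p := -1) (by norm_num)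
  have h1 : ∫ x in Set.Ioi (0 : ℝ), (|(-1 : ℝ)| * x ^ ((-1 : ℝ) - 1)) •
      (Real.log (x ^ (-1 : ℝ)) * (1 + (x ^ (-1 : ℝ)) ^ 2)⁻¹) =
      -∫ τ in Set.Ioi (0 : ℝ), Real.log τ * (1 + τ ^ 2)⁻¹ := by
    rw [← integral_neg]
    refine setIntegral_congr_fun measurableSet_Ioi fun x hx => ?_
    have hx0 : (0 : ℝ) < x := hx
    have h2 : x ^ ((-1 : ℝ) - 1) = (x ^ 2)⁻¹ := by
      rw [show (-1 : ℝ) - 1 = -2 by norm_num, Real.rpow_neg hx0.le]; norm_cast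
    simp only [Real.rpow_neg_one, h2, Real.log_inv, smul_eq_mul, abs_neg, abs_one, one_mul]
    field_simp
    ring
  linarith

/-- Serves as an integrable majorant independent of `Λ`. For `τΛ < 1` the harmonic number is zero,
and `Λ ≥ 1` bounds the logarithm by `|log τ|`. -/
theorem abs_harmonic_floor_sub_log_le {Λ τ : ℝ} (hΛ : 1 ≤ Λ) (hτ : 0 < τ) :
    |(harmonic ⌊τ * Λ⌋₊ : ℝ) - Real.log (τ * Λ)| ≤ 1 + |Real.log τ| := by
  have hx : 0 < τ * Λ := by positivity
  by_cases h : 1 ≤ τ * Λ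
  · have h1 := harmonic_floor_le_one_add_log _ h
    have h2 := log_le_harmonic_floor _ hx.le
    rw [abs_of_nonneg (by linarith)]
    linarith [abs_nonneg (Real.log τ)]
  · push Not at h
    rw [Nat.floor_eq_zero.mpr h, harmonic_zero, Rat.cast_zero, zero_sub, abs_neg,
      abs_of_nonpos (Real.log_nonpos hx.le h.le)]
    have h1 : τ ≤ τ * Λ := le_mul_of_one_le_right hτ.le hΛ
    have h2 := Real.log_le_log hτ h1
    linarith [neg_abs_le (Real.log τ)]

theorem tendsto_harmonic_floor_sub_log :
    Tendsto (fun x : ℝ => (harmonic ⌊x⌋₊ : ℝ) - Real.log x) atTop (𝓝 Real.eulerMascheroniConstant) := by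
  have h1 := Real.tendsto_harmonic_sub_log.comp (tendsto_nat_floor_atTop (α := ℝ))
  have h2 : Tendsto (fun x : ℝ => Real.log (⌊x⌋₊ / x)) atTop (𝓝 0) := by
    have := (Real.continuousAt_log one_ne_zero).tendsto.comp (tendsto_nat_floor_div_atTop (R := ℝ))
    rwa [Real.log_one] at this
  have h3 := h1.add h2
  rw [add_zero] at h3
  refine h3.congr' ?_
  filter_upwards [eventually_ge_atTop 1] with x hx
  have h4 : (0 : ℝ) < ⌊x⌋₊ := by exact_mod_cast Nat.floor_pos.mpr hx
  rw [Real.log_div h4.ne' (by linarith)]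
  simp

theorem integral_Ioi_zero_inv_one_add_sq : ∫ τ in Set.Ioi (0 : ℝ), (1 + τ ^ 2)⁻¹ = Real.pi / 2 := by
  rw [integral_Ioi_inv_one_add_sq, Real.arctan_zero, sub_zero]

theorem hasSum_indicator_inv {x : ℝ} (hx : 0 ≤ x) :
    HasSum (fun n : ℕ => if (n : ℝ) + 1 ≤ x then ((n : ℝ) + 1)⁻¹ else 0) (harmonic ⌊x⌋₊ : ℝ) := by
  have h := hasSum_sum_of_ne_finset_zero (L := SummationFilter.unconditional ℕ) (f := fun n : ℕ => if (n : ℝ) + 1 ≤ x then ((n : ℝ) + 1)⁻¹ else 0)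
    (s := Finset.range ⌊x⌋₊) fun n hn => by
      rw [if_neg]
      intro h1
      refine hn (Finset.mem_range.mpr (Nat.lt_of_succ_le (Nat.le_floor ?_)))
      push_cast
      exact h1
  convert! h using 1
  rw [harmonic]
  push_cast
  refine Finset.sum_congr rfl fun n hn => ?_
  rw [if_pos]
  have h1 : n + 1 ≤ ⌊x⌋₊ := Finset.mem_range.mp hn
  have h2 := (Nat.le_floor_iff hx).mp h1
  exact_mod_cast h2

/-- The arctangent is a mixture of sharp cutoffs: `arctan(Λ/(n+1))` is the mass of `[(n+1)/Λ, ∞)`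
under `dτ/(1+τ²)`. The series with arctangents is therefore an average of harmonic numbers at `τΛ`.
-/
theorem arctan_div_eq_integral {Λ : ℝ} (hΛ : 0 < Λ) (n : ℕ) :
    ∫ τ in Set.Ioi (0 : ℝ), (if (n : ℝ) + 1 ≤ τ * Λ then ((n : ℝ) + 1)⁻¹ else 0) * (1 + τ ^ 2)⁻¹ =
      ((n : ℝ) + 1)⁻¹ * Real.arctan (Λ / (n + 1)) := by
  have hn : (0 : ℝ) < n + 1 := by positivity
  have h1 : ∀ τ : ℝ, (if (n : ℝ) + 1 ≤ τ * Λ then ((n : ℝ) + 1)⁻¹ else 0) * (1 + τ ^ 2)⁻¹ =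
      (Set.Ici (((n : ℝ) + 1) / Λ)).indicator (fun τ => ((n : ℝ) + 1)⁻¹ * (1 + τ ^ 2)⁻¹) τ := by
    intro τ
    simp only [Set.indicator_apply, Set.mem_Ici, div_le_iff₀ hΛ]
    split_ifs <;> simp
  simp only [h1]
  rw [setIntegral_indicator measurableSet_Ici,
    Set.inter_eq_right.mpr (Set.Ici_subset_Ioi.mpr (by positivity)), integral_Ici_eq_integral_Ioi,
    integral_const_mul, integral_Ioi_inv_one_add_sq, ← inv_div Λ, Real.arctan_inv_of_pos (by positivity)]
  ring

theorem hasSum_arctan {Λ : ℝ} (hΛ : 0 < Λ) :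
    HasSum (fun n : ℕ => ((n : ℝ) + 1)⁻¹ * Real.arctan (Λ / (n + 1)))
      (∫ τ in Set.Ioi (0 : ℝ), (harmonic ⌊τ * Λ⌋₊ : ℝ) * (1 + τ ^ 2)⁻¹) := by
  set F : ℕ → ℝ → ℝ := fun n τ =>
    (if (n : ℝ) + 1 ≤ τ * Λ then ((n : ℝ) + 1)⁻¹ else 0) * (1 + τ ^ 2)⁻¹ with hF
  have hF0 : ∀ n τ, 0 ≤ F n τ := fun n τ => by
    simp only [hF]
    split_ifs <;> positivity
  have hFm : ∀ n, Measurable (F n) := fun n => by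
    refine Measurable.mul (Measurable.ite ?_ measurable_const measurable_const) (by fun_prop)
    exact measurableSet_le measurable_const (by fun_prop)
  have hFi : ∀ n, Integrable (F n) (volume.restrict (Set.Ioi 0)) := fun n => by
    refine ((integrable_inv_one_add_sq.integrableOn (s := Set.Ioi 0)).const_mul
      ((n : ℝ) + 1)⁻¹).mono' (hFm n).aestronglyMeasurable (Eventually.of_forall fun τ => ?_)
    rw [Real.norm_eq_abs, abs_of_nonneg (hF0 n τ)]
    refine mul_le_mul_of_nonneg_right ?_ (by positivity)
    split_ifs
    · exact le_rfl
    · positivity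
  have hsum : Summable fun n : ℕ => ∫ τ in Set.Ioi (0 : ℝ), ‖F n τ‖ := by
    simp only [Real.norm_eq_abs, abs_of_nonneg (hF0 _ _)]
    refine Summable.of_nonneg_of_le (fun n => integral_nonneg (hF0 n)) (fun n => ?_)
      (summable_inv_add_one_sq.mul_left Λ)
    simp only [hF]
    rw [arctan_div_eq_integral hΛ]
    have h1 : Real.arctan (Λ / (n + 1)) ≤ Λ / (n + 1) := Real.arctan_le_self (by positivity)
    calc ((n : ℝ) + 1)⁻¹ * Real.arctan (Λ / (n + 1)) ≤ ((n : ℝ) + 1)⁻¹ * (Λ / (n + 1)) := by gcongr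
      _ = _ := by field_simp
  have htsum : ∀ τ ∈ Set.Ioi (0 : ℝ), ∑' n, F n τ = (harmonic ⌊τ * Λ⌋₊ : ℝ) * (1 + τ ^ 2)⁻¹ := by
    intro τ hτ
    have hτ0 : (0 : ℝ) < τ := hτ
    exact ((hasSum_indicator_inv (by positivity)).mul_right _).tsum_eq
  have h := hasSum_integral_of_summable_integral_norm hFi hsum
  have hcongr : ∫ τ in Set.Ioi (0 : ℝ), ∑' n, F n τ =
      ∫ τ in Set.Ioi (0 : ℝ), (harmonic ⌊τ * Λ⌋₊ : ℝ) * (1 + τ ^ 2)⁻¹ :=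
    setIntegral_congr_fun measurableSet_Ioi htsum
  rw [hcongr] at h
  simpa only [hF, arctan_div_eq_integral hΛ] using h

theorem measurable_harmonic_floor (Λ : ℝ) : Measurable fun τ : ℝ => (harmonic ⌊τ * Λ⌋₊ : ℝ) :=
  (measurable_of_countable fun n : ℕ => (harmonic n : ℝ)).comp (Nat.measurable_floor.comp (by fun_prop))

theorem integrableOn_harmonic_floor_sub_log {Λ : ℝ} (hΛ : 1 ≤ Λ) : IntegrableOn (fun τ : ℝ =>
    ((harmonic ⌊τ * Λ⌋₊ : ℝ) - Real.log (τ * Λ)) * (1 + τ ^ 2)⁻¹) (Set.Ioi 0) := by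
  refine (integrable_inv_one_add_sq.integrableOn.add integrableOn_log_mul_inv_one_add_sq.abs).mono'
    (((measurable_harmonic_floor Λ).sub (by fun_prop)).mul (by fun_prop)).aestronglyMeasurable ?_
  filter_upwards [ae_restrict_mem measurableSet_Ioi] with τ hτ
  have h4 : (0 : ℝ) < (1 + τ ^ 2)⁻¹ := by positivity
  simp only [Pi.add_apply]
  rw [norm_mul, Real.norm_eq_abs, Real.norm_eq_abs, abs_mul, abs_of_pos h4]
  have := mul_le_mul_of_nonneg_right (abs_harmonic_floor_sub_log_le hΛ hτ) h4.le
  linarith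

/-- A regularized harmonic series. -/
theorem tendsto_tsum_arctan_sub_log :
    Tendsto (fun Λ : ℝ => 2 / Real.pi * ∑' n : ℕ, ((n : ℝ) + 1)⁻¹ * Real.arctan (Λ / (n + 1)) - Real.log Λ)
      atTop (𝓝 Real.eulerMascheroniConstant) := by
  have hpi := Real.pi_pos
  have h1 : Tendsto (fun Λ : ℝ => ∫ τ in Set.Ioi (0 : ℝ),
      ((harmonic ⌊τ * Λ⌋₊ : ℝ) - Real.log (τ * Λ)) * (1 + τ ^ 2)⁻¹) atTop
      (𝓝 (∫ τ in Set.Ioi (0 : ℝ), Real.eulerMascheroniConstant * (1 + τ ^ 2)⁻¹)) := by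
    refine tendsto_integral_filter_of_dominated_convergence
      (fun τ => (1 + τ ^ 2)⁻¹ + |Real.log τ * (1 + τ ^ 2)⁻¹|) ?_ ?_ ?_ ?_
    · exact Eventually.of_forall fun Λ =>
        (((measurable_harmonic_floor Λ).sub (by fun_prop)).mul (by fun_prop)).aestronglyMeasurable
    · filter_upwards [eventually_ge_atTop 1] with Λ hΛ
      filter_upwards [ae_restrict_mem measurableSet_Ioi] with τ hτ
      have h4 : (0 : ℝ) < (1 + τ ^ 2)⁻¹ := by positivity
      rw [norm_mul, Real.norm_eq_abs, Real.norm_eq_abs, abs_mul, abs_of_pos h4]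
      have := mul_le_mul_of_nonneg_right (abs_harmonic_floor_sub_log_le hΛ hτ) h4.le
      linarith
    · exact integrable_inv_one_add_sq.integrableOn.add integrableOn_log_mul_inv_one_add_sq.abs
    · filter_upwards [ae_restrict_mem measurableSet_Ioi] with τ hτ
      exact (tendsto_harmonic_floor_sub_log.comp
        (tendsto_id.const_mul_atTop (show (0 : ℝ) < τ from hτ))).mul_const _
  rw [integral_const_mul, integral_Ioi_zero_inv_one_add_sq] at h1
  have h2 := h1.const_mul (2 / Real.pi)
  have e : 2 / Real.pi * (Real.eulerMascheroniConstant * (Real.pi / 2)) =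
    Real.eulerMascheroniConstant := by field_simp
  rw [e] at h2
  refine h2.congr' ?_
  filter_upwards [eventually_ge_atTop 1] with Λ hΛ
  have hΛ0 : 0 < Λ := by linarith
  have h3 := hasSum_arctan hΛ0
  have hlog : IntegrableOn (fun τ : ℝ => Real.log τ * (1 + τ ^ 2)⁻¹ + Real.log Λ * (1 + τ ^ 2)⁻¹)
    (Set.Ioi 0) := integrableOn_log_mul_inv_one_add_sq.add
      (integrable_inv_one_add_sq.integrableOn.const_mul _)
  -- Splitting `log(τΛ)`: the part `log τ` integrates to zero, and `log Λ` carries the total mass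
  -- `π/2`, which is exactly the subtracted term.
  have h5 : ∫ τ in Set.Ioi (0 : ℝ), (harmonic ⌊τ * Λ⌋₊ : ℝ) * (1 + τ ^ 2)⁻¹ =
      ∫ τ in Set.Ioi (0 : ℝ), (((harmonic ⌊τ * Λ⌋₊ : ℝ) - Real.log (τ * Λ)) * (1 + τ ^ 2)⁻¹ +
        (Real.log τ * (1 + τ ^ 2)⁻¹ + Real.log Λ * (1 + τ ^ 2)⁻¹)) := by
    refine setIntegral_congr_fun measurableSet_Ioi fun τ hτ => ?_
    have hτ0 : τ ≠ 0 := ne_of_gt (show (0 : ℝ) < τ from hτ)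
    simp only [Real.log_mul hτ0 hΛ0.ne']
    ring
  rw [h3.tsum_eq, h5, integral_add (integrableOn_harmonic_floor_sub_log hΛ) hlog,
    integral_add integrableOn_log_mul_inv_one_add_sq
    (integrable_inv_one_add_sq.integrableOn.const_mul _), integral_log_mul_inv_one_add_sq,
    integral_const_mul, integral_Ioi_zero_inv_one_add_sq]
  generalize ∫ τ in Set.Ioi (0 : ℝ), ((harmonic ⌊τ * Λ⌋₊ : ℝ) - Real.log (τ * Λ)) * (1 + τ ^ 2)⁻¹ = I
  field_simp
  ring

end ArctanSum

/-! ### Removal of the cutoff and the Gamma function -/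

section CutoffRemoval

/-- The logarithm of a factor of Euler's product, without its divergent part. -/
noncomputable def logTerm (ρ b θ : ℝ) (n : ℕ) : ℝ :=
  Real.log (1 + ρ ^ 2 / (n + 1) ^ 2 + b * θ / (n + 1)) - b * θ / (n + 1)

/-- With `u` the deviation of the argument from `1`, `u - u² ≤ log(1+u) ≤ u`. Subtracting the linear
part leaves `ρ²/(n+1)²` and an error at most `u²`, uniformly in `θ ∈ [0,1]`. -/
theorem abs_logTerm_le {ρ b θ : ℝ} (hb : 0 ≤ b) (hθ0 : 0 ≤ θ) (hθ1 : θ ≤ 1) (n : ℕ) :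
    |logTerm ρ b θ n| ≤ (ρ ^ 2 + (ρ ^ 2 + b) ^ 2) * (((n : ℝ) + 1) ^ 2)⁻¹ := by
  have hn : (1 : ℝ) ≤ n + 1 := by linarith [n.cast_nonneg (α := ℝ)]
  have hn0 : (0 : ℝ) < n + 1 := by linarith
  set u : ℝ := ρ ^ 2 / (n + 1) ^ 2 + b * θ / (n + 1) with hu
  have hu0 : 0 ≤ u := by positivity
  have hu1 : u ≤ (ρ ^ 2 + b) / (n + 1) := by
    rw [hu, add_div]
    refine add_le_add ?_ ?_
    · exact div_le_div_of_nonneg_left (sq_nonneg ρ) hn0 (by nlinarith)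
    · gcongr
      nlinarith
  have h1 : Real.log (1 + u) ≤ u := by
    have := Real.log_le_sub_one_of_pos (show 0 < 1 + u by linarith)
    linarith
  have h2 : u - u ^ 2 ≤ Real.log (1 + u) := by
    have h3 := Real.one_sub_inv_le_log_of_pos (show 0 < 1 + u by linarith)
    have h4 : u - u ^ 2 ≤ 1 - (1 + u)⁻¹ := by
      rw [le_sub_iff_add_le, ← le_sub_iff_add_le', inv_le_iff_one_le_mul₀ (by linarith)]
      nlinarith [pow_nonneg hu0 3]
    linarith
  have e : logTerm ρ b θ n = Real.log (1 + u) - u + ρ ^ 2 / (n + 1) ^ 2 := by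
    rw [logTerm, hu, ← add_assoc]; ring
  have h5 : u ^ 2 ≤ (ρ ^ 2 + b) ^ 2 * (((n : ℝ) + 1) ^ 2)⁻¹ := by
    calc u ^ 2 ≤ ((ρ ^ 2 + b) / (n + 1)) ^ 2 := by gcongr
      _ = _ := by rw [div_pow, div_eq_mul_inv]
  have h6 : 0 ≤ ρ ^ 2 * (((n : ℝ) + 1) ^ 2)⁻¹ := by positivity
  rw [e, abs_le, div_eq_mul_inv]
  constructor <;> linarith [sq_nonneg u]

theorem tendsto_logTerm {ρ b : ℝ} (hb : 0 ≤ b) {θ : ℝ → ℕ → ℝ}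
    (h0 : ∀ᶠ x in atTop, ∀ n, 0 ≤ θ x n ∧ θ x n ≤ 1)
    (h1 : ∀ n, Tendsto (fun x => θ x n) atTop (𝓝 1)) :
    Tendsto (fun x => ∑' n, logTerm ρ b (θ x n) n) atTop (𝓝 (∑' n, logTerm ρ b 1 n)) := by
  refine tendsto_tsum_of_dominated_convergence (summable_inv_add_one_sq.mul_left
    (ρ ^ 2 + (ρ ^ 2 + b) ^ 2)) (fun n => ?_) ?_
  · unfold logTerm
    have h2 : Tendsto (fun x => b * θ x n / (n + 1)) atTop (𝓝 (b * 1 / (n + 1))) :=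
      ((h1 n).const_mul b).div_const _
    have h3 : (1 + ρ ^ 2 / ((n : ℝ) + 1) ^ 2 + b * 1 / (n + 1)) ≠ 0 := by positivity
    exact ((h2.const_add _).log h3).sub h2
  · filter_upwards [h0] with x hx n
    exact abs_logTerm_le hb (hx n).1 (hx n).2 n

theorem summable_logTerm {ρ b : ℝ} (hb : 0 ≤ b) {θ : ℕ → ℝ} (h0 : ∀ n, 0 ≤ θ n ∧ θ n ≤ 1) :
    Summable fun n => logTerm ρ b (θ n) n :=
  Summable.of_norm_bounded (summable_inv_add_one_sq.mul_left (ρ ^ 2 + (ρ ^ 2 + b) ^ 2)) fun n =>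
    abs_logTerm_le hb (h0 n).1 (h0 n).2 n

/-- Taking out `exp` of the terms of order `1/n` separates a product which converges uniformly in
`γ` from the arctangent series, which carries the whole divergence. -/
theorem tprod_productTerm_eq {s ρ γ : ℝ} (hs : 0 ≤ s) (hρ : 0 < ρ) (hγ : 0 < γ) :
    ∏' n, (1 + productTerm s ρ γ n) = Real.exp (
      (∑' n : ℕ, logTerm ρ (2 * s * ρ) (2 / Real.pi * Real.arctan (γ * ρ / (n + 1))) n) +
      2 * s * ρ * (2 / Real.pi * ∑' n : ℕ, ((n : ℝ) + 1)⁻¹ * Real.arctan (γ * ρ / (n + 1)))) := by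
  have hpi := Real.pi_pos
  set θ : ℕ → ℝ := fun n => 2 / Real.pi * Real.arctan (γ * ρ / (n + 1)) with hθ
  have hθ01 : ∀ n, 0 ≤ θ n ∧ θ n ≤ 1 := fun n => by
    have h1 : 0 ≤ Real.arctan (γ * ρ / (n + 1)) := Real.arctan_nonneg.mpr (by positivity)
    refine ⟨by positivity, ?_⟩
    have h2 := (Real.arctan_lt_pi_div_two (γ * ρ / (n + 1))).le
    calc θ n ≤ 2 / Real.pi * (Real.pi / 2) := by simp only [hθ]; gcongr
      _ = 1 := by field_simp
  have h1 := (summable_logTerm (ρ := ρ) (b := 2 * s * ρ) (by positivity) hθ01).hasSum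
  have h2 := (((hasSum_arctan (Λ := γ * ρ) (by positivity)).summable.hasSum.mul_left
    (2 / Real.pi)).mul_left (2 * s * ρ))
  have h3 := (h1.add h2).rexp
  refine HasProd.tprod_eq (h3.congr_fun fun n => ?_)
  have h4 := productTerm_nonneg hs hρ hγ n
  have e : logTerm ρ (2 * s * ρ) (θ n) n +
      2 * s * ρ * (2 / Real.pi * (((n : ℝ) + 1)⁻¹ * Real.arctan (γ * ρ / (n + 1)))) =
      Real.log (1 + productTerm s ρ γ n) := by
    rw [logTerm, productTerm, hθ]
    have e1 : 1 + ρ ^ 2 / ((n : ℝ) + 1) ^ 2 + 2 * s * ρ * (2 / Real.pi * Real.arctan (γ * ρ / (n + 1))) /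
        (n + 1) = 1 + (ρ ^ 2 / (n + 1) ^ 2 + 4 / Real.pi * s * (ρ / (n + 1)) *
        Real.arctan (γ * ρ / (n + 1))) := by ring
    rw [e1]
    ring
  simp only [Function.comp_apply]
  rw [e, Real.exp_log (by linarith)]

/-- With `b = 2sρ`, the energy renormalization supplies `b log(1+γ)` and the product removes
`b(log(γρ) + γ_E)` up to a vanishing term, with Euler's constant `γ_E`. The difference tends to
`b(-log ρ - γ_E)`, and the rest converges by domination. -/
theorem tendsto_cutoffPartition {s ρ : ℝ} (hs : 0 ≤ s) (hρ : 0 < ρ) :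
    Tendsto (fun γ => cutoffPartition s ρ γ) atTop
      (𝓝 ((Real.exp (2 * s * ρ * (-Real.log ρ - Real.eulerMascheroniConstant) -
        ∑' n, logTerm ρ (2 * s * ρ) 1 n) / (2 * Real.pi * ρ)) ^ 3)) := by
  have hpi := Real.pi_pos
  set b := 2 * s * ρ with hb
  have hb0 : 0 ≤ b := by positivity
  have hγρ : Tendsto (fun γ : ℝ => γ * ρ) atTop atTop := tendsto_id.atTop_mul_const hρ
  have hT := tendsto_tsum_arctan_sub_log.comp hγρ
  have hlog : Tendsto (fun γ : ℝ => Real.log (1 + γ) - Real.log (γ * ρ)) atTop (𝓝 (-Real.log ρ)) := by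
    have h1 : Tendsto (fun γ : ℝ => 1 + γ⁻¹) atTop (𝓝 1) := by
      simpa using tendsto_inv_atTop_zero.const_add (1 : ℝ)
    have h2 := (h1.log one_ne_zero).sub_const (Real.log ρ)
    rw [Real.log_one, zero_sub] at h2
    refine h2.congr' ?_
    filter_upwards [eventually_gt_atTop 0] with γ hγ
    rw [Real.log_mul hγ.ne' hρ.ne', ← sub_sub, ← Real.log_div (by positivity) hγ.ne']
    congr 2
    field_simp
    ring
  have hL : Tendsto (fun γ : ℝ => ∑' n : ℕ, logTerm ρ b (2 / Real.pi * Real.arctan (γ * ρ / (n + 1))) n) atTop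
      (𝓝 (∑' n, logTerm ρ b 1 n)) := by
    refine tendsto_logTerm hb0 ?_ fun n => ?_
    · filter_upwards [eventually_gt_atTop 0] with γ hγ n
      have h1 : 0 ≤ Real.arctan (γ * ρ / (n + 1)) := Real.arctan_nonneg.mpr (by positivity)
      refine ⟨by positivity, ?_⟩
      have h2 := (Real.arctan_lt_pi_div_two (γ * ρ / (n + 1))).le
      calc 2 / Real.pi * Real.arctan (γ * ρ / (n + 1)) ≤ 2 / Real.pi * (Real.pi / 2) := by gcongr
        _ = 1 := by field_simp
    · have h1 : Tendsto (fun γ : ℝ => γ * ρ / (n + 1)) atTop atTop :=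
        hγρ.atTop_div_const (by positivity)
      have h2 := ((tendsto_nhds_of_tendsto_nhdsWithin Real.tendsto_arctan_atTop).comp h1).const_mul
        (2 / Real.pi)
      have e : 2 / Real.pi * (Real.pi / 2) = 1 := by field_simp
      rwa [e] at h2
  have hE := (((hlog.sub hT).const_mul b).sub hL).rexp
  have h3 := (hE.div_const (2 * Real.pi * ρ)).pow 3
  refine h3.congr' ?_
  filter_upwards [eventually_gt_atTop 0] with γ hγ
  rw [cutoffPartition, tprod_productTerm_eq hs hρ hγ, ← Real.exp_neg, div_mul_eq_mul_div, ← Real.exp_add]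
  congr 3
  simp only [Function.comp_apply, ← hb]
  rw [hb]
  ring

theorem tendsto_prod_one_add {ρ b : ℝ} (hb : 0 ≤ b) :
    Tendsto (fun n : ℕ => (n : ℝ) ^ b / ∏ j ∈ Finset.range n,
      (1 + ρ ^ 2 / ((j : ℝ) + 1) ^ 2 + b / (j + 1))) atTop
      (𝓝 (Real.exp (-(b * Real.eulerMascheroniConstant) - ∑' n, logTerm ρ b 1 n))) := by
  have h1 := (summable_logTerm (ρ := ρ) hb (θ := fun _ => 1) fun _ => ⟨zero_le_one, le_rfl⟩).hasSum.tendsto_sum_nat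
  have h2 := ((Real.tendsto_harmonic_sub_log.const_mul b).neg.sub h1).rexp
  refine h2.congr' ?_
  filter_upwards [eventually_ge_atTop 1] with n hn
  have hn0 : (0 : ℝ) < n := by exact_mod_cast hn
  have hp : ∀ j : ℕ, 0 < 1 + ρ ^ 2 / ((j : ℝ) + 1) ^ 2 + b / (j + 1) := fun j => by positivity
  have e : ∑ j ∈ Finset.range n, logTerm ρ b 1 j = ∑ j ∈ Finset.range n,
      Real.log (1 + ρ ^ 2 / ((j : ℝ) + 1) ^ 2 + b / (j + 1)) - b * (harmonic n : ℝ) := by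
    rw [harmonic]
    push_cast
    rw [Finset.mul_sum, ← Finset.sum_sub_distrib]
    exact Finset.sum_congr rfl fun j _ => by rw [logTerm, mul_one]; ring
  have e2 : -(b * ((harmonic n : ℝ) - Real.log n)) - (∑ j ∈ Finset.range n,
      Real.log (1 + ρ ^ 2 / ((j : ℝ) + 1) ^ 2 + b / (j + 1)) - b * (harmonic n : ℝ)) =
      Real.log n * b - ∑ j ∈ Finset.range n, Real.log (1 + ρ ^ 2 / ((j : ℝ) + 1) ^ 2 + b / (j + 1)) := by
    ring
  rw [e, e2, Real.exp_sub, ← Real.rpow_def_of_pos hn0, Real.exp_sum]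
  congr 1
  exact Finset.prod_congr rfl fun j _ => Real.exp_log (hp j)

/-- The absolute value of the Gamma function as a real infinite product. -/
theorem norm_Gamma_sq {w : ℂ} {ρ s : ℝ} (hρ : 0 < ρ) (hs : 0 ≤ s) (hw : ‖w‖ = ρ) (hre : w.re = s * ρ) :
    ‖Complex.Gamma w‖ ^ 2 = (ρ ^ 2)⁻¹ * Real.exp (-(2 * s * ρ * Real.eulerMascheroniConstant) -
      ∑' n, logTerm ρ (2 * s * ρ) 1 n) := by
  have h1 := (Complex.GammaSeq_tendsto_Gamma w).norm.pow 2
  refine tendsto_nhds_unique h1 (((tendsto_prod_one_add (ρ := ρ) (b := 2 * s * ρ)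
    (by positivity)).const_mul (ρ ^ 2)⁻¹).congr' ?_)
  filter_upwards [eventually_ge_atTop 1] with n hn
  have hn0 : (0 : ℝ) < n := by exact_mod_cast hn
  have hsq : w.re ^ 2 + w.im ^ 2 = ρ ^ 2 := by
    rw [← hw, Complex.sq_norm, Complex.normSq_apply]; ring
  -- Only `|w|² = ρ²` and `2 Re w = 2sρ` enter, so each modulus in Euler's limit is a factor of the
  -- real product.
  have hj : ∀ j : ℕ, ‖w + ((j + 1 : ℕ) : ℂ)‖ ^ 2 =
      ((j : ℝ) + 1) ^ 2 * (1 + ρ ^ 2 / ((j : ℝ) + 1) ^ 2 + 2 * s * ρ / (j + 1)) := by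
    intro j
    rw [Complex.sq_norm, Complex.normSq_apply]
    simp only [Complex.add_re, Complex.add_im, Complex.natCast_re, Complex.natCast_im, add_zero]
    push_cast
    have : (j : ℝ) + 1 ≠ 0 := by positivity
    field_simp
    rw [hre] at hsq ⊢
    linarith
  rw [Complex.GammaSeq, norm_div, norm_mul, Finset.prod_range_succ', norm_mul, norm_prod, div_pow,
    mul_pow, mul_pow, ← Finset.prod_pow, Finset.prod_congr rfl fun j _ => hj j, Finset.prod_mul_distrib,
    Finset.prod_pow, Complex.norm_natCast_cpow_of_pos hn, Complex.norm_natCast]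
  have hfac : ∏ j ∈ Finset.range n, ((j : ℝ) + 1) = n.factorial := by
    rw [← Finset.prod_range_add_one_eq_factorial]; push_cast; rfl
  rw [hfac]
  have e : ((n : ℝ) ^ w.re) ^ 2 = (n : ℝ) ^ (2 * s * ρ) := by
    rw [← Real.rpow_natCast, ← Real.rpow_mul hn0.le, hre]; congr 1; push_cast; ring
  have hf : (n.factorial : ℝ) ≠ 0 := by exact_mod_cast n.factorial_ne_zero
  have hp : ∏ j ∈ Finset.range n, (1 + ρ ^ 2 / ((j : ℝ) + 1) ^ 2 + 2 * s * ρ / (j + 1)) ≠ 0 :=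
    Finset.prod_ne_zero_iff.mpr fun j _ => by positivity
  rw [e]
  simp only [Nat.cast_zero, add_zero, hw]
  field_simp

theorem gammaArg {ρ : ℝ} (hρ : 0 < ρ) (φ : ℝ) :
    ‖Complex.I * ρ * Complex.exp (-Complex.I * φ)‖ = ρ ∧
    (Complex.I * ρ * Complex.exp (-Complex.I * φ)).re = Real.sin φ * ρ ∧
    (Complex.I * ρ * Complex.exp (-Complex.I * φ)).im = Real.cos φ * ρ := by
  have h0 : -Complex.I * (φ : ℂ) = ((-φ : ℝ) : ℂ) * Complex.I := by push_cast; ring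
  rw [h0]
  refine ⟨?_, ?_, ?_⟩
  · rw [norm_mul, norm_mul, Complex.norm_I, Complex.norm_exp_ofReal_mul_I, Complex.norm_real,
      Real.norm_eq_abs, abs_of_pos hρ]
    ring
  · simp [Complex.exp_ofReal_mul_I_re, Complex.exp_ofReal_mul_I_im, -Complex.ofReal_neg]
    ring
  · simp [Complex.exp_ofReal_mul_I_re, Complex.exp_ofReal_mul_I_im, -Complex.ofReal_neg]
    ring

theorem tendsto_cutoffPartition_closedForm {φ ρ : ℝ} (hs : 0 ≤ Real.sin φ) (hρ : 0 < ρ) :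
    Tendsto (fun γ => cutoffPartition (Real.sin φ) ρ γ) atTop (𝓝 (closedForm φ ρ)) := by
  convert! tendsto_cutoffPartition hs hρ using 2
  obtain ⟨h1, h2, -⟩ := gammaArg hρ φ
  rw [closedForm, norm_Gamma_sq hρ hs h1 h2]
  congr 1
  have hpi := Real.pi_pos
  have e : Real.exp (2 * Real.sin φ * ρ * (-Real.log ρ - Real.eulerMascheroniConstant) -
      ∑' n, logTerm ρ (2 * Real.sin φ * ρ) 1 n) = Real.exp (-2 * ρ * Real.log ρ * Real.sin φ) *
      Real.exp (-(2 * Real.sin φ * ρ * Real.eulerMascheroniConstant) -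
      ∑' n, logTerm ρ (2 * Real.sin φ * ρ) 1 n) := by
    rw [← Real.exp_add]; congr 1; ring
  rw [e]
  field_simp

end CutoffRemoval

/-! ### Closure properties of Laplace transforms of positive measures -/

/-- `g` is on `(0, ∞)` the Laplace transform of a measure on `[0, ∞)`. -/
def IsLaplaceTransform (g : ℝ → ℝ) : Prop :=
  ∃ μ : Measure ℝ, SFinite μ ∧ (∀ᵐ x ∂μ, 0 ≤ x) ∧
    ∀ ρ : ℝ, 0 < ρ → ∫⁻ x, ENNReal.ofReal (Real.exp (-ρ * x)) ∂μ = ENNReal.ofReal (g ρ)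

namespace IsLaplaceTransform

variable {g h : ℝ → ℝ}

theorem congr (hg : IsLaplaceTransform g) (hgh : ∀ ρ, 0 < ρ → g ρ = h ρ) : IsLaplaceTransform h := by
  obtain ⟨μ, h1, h2, h3⟩ := hg
  exact ⟨μ, h1, h2, fun ρ hρ => by rw [h3 ρ hρ, hgh ρ hρ]⟩

theorem exp_linear {B : ℝ} (hB : B ≤ 0) : IsLaplaceTransform fun ρ => Real.exp (B * ρ) := by
  refine ⟨Measure.dirac (-B), inferInstance, ?_, fun ρ _ => ?_⟩
  · rw [ae_dirac_eq]
    simpa using hB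
  · rw [lintegral_dirac]
    ring_nf

theorem const_mul {c : ℝ} (hc : 0 ≤ c) (hg : IsLaplaceTransform g) :
    IsLaplaceTransform fun ρ => c * g ρ := by
  obtain ⟨μ, h1, h2, h3⟩ := hg
  refine ⟨ENNReal.ofReal c • μ, inferInstance, Measure.ae_smul_measure h2 _, fun ρ hρ => ?_⟩
  rw [lintegral_smul_measure, h3 ρ hρ, smul_eq_mul, ENNReal.ofReal_mul hc]

/-- A product corresponds to the convolution of the measures, whose mass stays on the half line. -/
theorem mul (hg : IsLaplaceTransform g) (hh : IsLaplaceTransform h) (hg0 : ∀ ρ, 0 < ρ → 0 ≤ g ρ) :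
    IsLaplaceTransform fun ρ => g ρ * h ρ := by
  obtain ⟨μ, h1, h2, h3⟩ := hg
  obtain ⟨ν, k1, k2, k3⟩ := hh
  refine ⟨(μ.prod ν).map fun p => p.1 + p.2, inferInstance, ?_, fun ρ hρ => ?_⟩
  · rw [ae_map_iff (by fun_prop) measurableSet_Ici]
    have e1 : ∀ᵐ p ∂(μ.prod ν), 0 ≤ p.1 := Measure.quasiMeasurePreserving_fst.ae h2
    have e2 : ∀ᵐ p ∂(μ.prod ν), 0 ≤ p.2 := Measure.quasiMeasurePreserving_snd.ae k2
    filter_upwards [e1, e2] with p hp1 hp2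
    exact add_nonneg hp1 hp2
  · rw [lintegral_map (by fun_prop) (by fun_prop)]
    have e : ∀ p : ℝ × ℝ, ENNReal.ofReal (Real.exp (-ρ * (p.1 + p.2))) =
        ENNReal.ofReal (Real.exp (-ρ * p.1)) * ENNReal.ofReal (Real.exp (-ρ * p.2)) := fun p => by
      rw [← ENNReal.ofReal_mul (Real.exp_pos _).le, ← Real.exp_add, mul_add]
    simp only [e]
    rw [lintegral_prod_mul (f := fun x => ENNReal.ofReal (Real.exp (-ρ * x)))
      (g := fun x => ENNReal.ofReal (Real.exp (-ρ * x))) (by fun_prop) (by fun_prop), h3 ρ hρ, k3 ρ hρ, ENNReal.ofReal_mul (hg0 ρ hρ)]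

theorem pow (hg : IsLaplaceTransform g) (hg0 : ∀ ρ, 0 < ρ → 0 ≤ g ρ) (n : ℕ) :
    IsLaplaceTransform fun ρ => g ρ ^ n := by
  induction n with
  | zero => exact (exp_linear le_rfl).congr fun ρ _ => by simp
  | succ n ih => exact (hg.mul ih hg0).congr fun ρ _ => by rw [pow_succ, mul_comm]

theorem tsum {f : ℕ → ℝ → ℝ} (hf : ∀ n, IsLaplaceTransform (f n)) (hf0 : ∀ n ρ, 0 < ρ → 0 ≤ f n ρ)
    (hs : ∀ ρ, 0 < ρ → HasSum (fun n => f n ρ) (g ρ)) : IsLaplaceTransform g := by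
  choose μ h1 h2 h3 using hf
  refine ⟨Measure.sum μ, inferInstance, Measure.ae_sum_iff.mpr h2, fun ρ hρ => ?_⟩
  rw [lintegral_sum_measure, ← (hs ρ hρ).tsum_eq,
    ENNReal.ofReal_tsum_of_nonneg (fun n => hf0 n ρ hρ) (hs ρ hρ).summable]
  exact tsum_congr fun n => h3 n ρ hρ

/-- The exponential series has positive coefficients, so the measure is a positive combination of
convolution powers, as for a compound Poisson law. -/
theorem exp (hg : IsLaplaceTransform g) (hg0 : ∀ ρ, 0 < ρ → 0 ≤ g ρ) :
    IsLaplaceTransform fun ρ => Real.exp (g ρ) := by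
  refine tsum (f := fun n ρ => (n.factorial : ℝ)⁻¹ * g ρ ^ n) (fun n => (hg.pow hg0 n).const_mul (by positivity))
    (fun n ρ hρ => mul_nonneg (by positivity) (pow_nonneg (hg0 ρ hρ) n)) fun ρ _ => ?_
  have h := NormedSpace.expSeries_div_hasSum_exp (𝔸 := ℝ) (g ρ)
  rw [← Real.exp_eq_exp_ℝ] at h
  exact h.congr_fun fun n => by rw [div_eq_inv_mul]

theorem integral {q : ℝ → ℝ} (hq : Measurable q) (hq0 : ∀ t, 0 < t → 0 ≤ q t)
    (hi : ∀ ρ, 0 < ρ → IntegrableOn (fun t => Real.exp (-ρ * t) * q t) (Set.Ioi 0)) :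
    IsLaplaceTransform fun ρ => ∫ t in Set.Ioi (0 : ℝ), Real.exp (-ρ * t) * q t := by
  refine ⟨(volume.restrict (Set.Ioi 0)).withDensity fun t => ENNReal.ofReal (q t), inferInstance, ?_,
    fun ρ hρ => ?_⟩
  · refine (withDensity_absolutelyContinuous _ _).ae_le ?_
    filter_upwards [ae_restrict_mem measurableSet_Ioi] with t ht
    exact (show (0 : ℝ) < t from ht).le
  · rw [lintegral_withDensity_eq_lintegral_mul _ (by fun_prop) (by fun_prop),
      ofReal_integral_eq_lintegral_ofReal (hi ρ hρ)]
    · refine setLIntegral_congr_fun measurableSet_Ioi fun t ht => ?_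
      simp only [Pi.mul_apply]
      rw [← ENNReal.ofReal_mul (hq0 t ht), mul_comm]
    · filter_upwards [ae_restrict_mem measurableSet_Ioi] with t ht
      exact mul_nonneg (Real.exp_pos _).le (hq0 t ht)

theorem comp_mul {a : ℝ} (ha : 0 < a) (hg : IsLaplaceTransform g) :
    IsLaplaceTransform fun ρ => g (a * ρ) := by
  obtain ⟨μ, h1, h2, h3⟩ := hg
  refine ⟨μ.map fun x => a * x, inferInstance, ?_, fun ρ hρ => ?_⟩
  · rw [ae_map_iff (by fun_prop) measurableSet_Ici]
    filter_upwards [h2] with x hx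
    exact mul_nonneg ha.le hx
  · rw [lintegral_map (by fun_prop) (by fun_prop), ← h3 (a * ρ) (by positivity)]
    refine lintegral_congr fun x => ?_
    ring_nf

theorem exists_measure (hg : IsLaplaceTransform g) (hg0 : ∀ ρ, 0 < ρ → 0 ≤ g ρ) :
    ∃ μ : Measure ℝ, μ (Set.Iio 0) = 0 ∧ ∀ ρ : ℝ, 0 < ρ →
      Integrable (fun x : ℝ => Real.exp (-ρ * x)) μ ∧ ∫ x, Real.exp (-ρ * x) ∂μ = g ρ := by
  obtain ⟨μ, h1, h2, h3⟩ := hg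
  refine ⟨μ, ?_, fun ρ hρ => ⟨⟨by fun_prop, ?_⟩, ?_⟩⟩
  · simpa only [ae_iff, not_le] using! h2
  · rw [hasFiniteIntegral_iff_ofReal (Eventually.of_forall fun x => (Real.exp_pos _).le), h3 ρ hρ]
    exact ENNReal.ofReal_lt_top
  · rw [integral_eq_lintegral_of_nonneg_ae (Eventually.of_forall fun x => (Real.exp_pos _).le)
      (by fun_prop), h3 ρ hρ, ENNReal.toReal_ofReal (hg0 ρ hρ)]

end IsLaplaceTransform

/-! ### Frullani integrals and the functional which annihilates affine functions -/

section Frullani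

theorem integrableOn_exp_neg_mul {m : ℝ} (hm : 0 < m) :
    IntegrableOn (fun t : ℝ => Real.exp (-m * t)) (Set.Ioi 0) :=
  integrableOn_exp_mul_Ioi (by linarith) 0

theorem integral_exp_mul_cos {a β : ℝ} (ha : 0 < a) :
    ∫ t in Set.Ioi (0 : ℝ), Real.exp (-a * t) * Real.cos (β * t) = a / (a ^ 2 + β ^ 2) := by
  have hre : ((-a : ℝ) + (β : ℝ) * Complex.I : ℂ).re < 0 := by simpa using ha
  have h1 := integral_exp_mul_complex_Ioi hre 0
  have h2 := congrArg Complex.re h1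
  have h3 : ∫ t in Set.Ioi (0 : ℝ), (Complex.exp (((-a : ℝ) + (β : ℝ) * Complex.I : ℂ) * t)).re =
      (∫ t in Set.Ioi (0 : ℝ), Complex.exp (((-a : ℝ) + (β : ℝ) * Complex.I : ℂ) * t)).re :=
    integral_re (integrableOn_exp_mul_complex_Ioi hre 0)
  rw [← h3] at h2
  have h4 : ∀ t : ℝ, (Complex.exp (((-a : ℝ) + (β : ℝ) * Complex.I : ℂ) * t)).re =
      Real.exp (-a * t) * Real.cos (β * t) := fun t => by
    rw [Complex.exp_re]
    simp
  simp only [h4] at h2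
  rw [h2]
  have h5 : 0 < a ^ 2 + β ^ 2 := by positivity
  simp [Complex.div_re, Complex.normSq_apply]
  field_simp

/-- The quotient `(e^(-pt) - e^(-t))/t` is minus the integral of `e^(-xt)` over `x` from `1` to `p`.
After exchanging the integrations the inner one is the Laplace transform of a cosine, whose integral
over `x` is a logarithm. -/
theorem frullani_cos {p : ℝ} (hp : 0 < p) {α : ℝ} (hα : 0 ≤ α) (β : ℝ) :
    IntegrableOn (fun t => (Real.exp (-p * t) - Real.exp (-t)) / t *
      (Real.exp (-α * t) * Real.cos (β * t))) (Set.Ioi 0) ∧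
    ∫ t in Set.Ioi (0 : ℝ), (Real.exp (-p * t) - Real.exp (-t)) / t *
      (Real.exp (-α * t) * Real.cos (β * t)) =
    -(1 / 2) * (Real.log ((p + α) ^ 2 + β ^ 2) - Real.log ((1 + α) ^ 2 + β ^ 2)) := by
  set f : ℝ → ℝ → ℝ := fun x t => Real.exp (-x * t) * (Real.exp (-α * t) * Real.cos (β * t)) with hf
  set m := min 1 p with hm
  have hm0 : 0 < m := lt_min one_pos hp
  have hmx : ∀ x ∈ Set.uIcc 1 p, m ≤ x := fun x hx => hx.1
  have hint : Integrable (Function.uncurry f)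
      ((volume.restrict (Set.uIoc 1 p)).prod (volume.restrict (Set.Ioi (0 : ℝ)))) := by
    have hdom : Integrable (fun z : ℝ × ℝ => (1 : ℝ) * Real.exp (-m * z.2))
        ((volume.restrict (Set.uIoc 1 p)).prod (volume.restrict (Set.Ioi (0 : ℝ)))) := by
      refine Integrable.mul_prod (f := fun _ : ℝ => (1 : ℝ)) ?_ (integrableOn_exp_neg_mul hm0)
      exact integrableOn_const (by simp [Set.uIoc])
    refine hdom.mono' (by simp only [hf, Function.uncurry_def]; fun_prop) ?_
    rw [Measure.prod_restrict]
    filter_upwards [ae_restrict_mem (measurableSet_uIoc.prod measurableSet_Ioi)] with z hz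
    have h1 : m ≤ z.1 := hmx _ (Set.uIoc_subset_uIcc hz.1)
    have h2 : 0 < z.2 := hz.2
    simp only [hf, Function.uncurry_def]
    rw [norm_mul, norm_mul, Real.norm_eq_abs, Real.norm_eq_abs, Real.norm_eq_abs, Real.abs_exp,
      Real.abs_exp, one_mul]
    have h3 : Real.exp (-α * z.2) ≤ 1 := Real.exp_le_one_iff.mpr (by nlinarith)
    have h4 : Real.exp (-z.1 * z.2) ≤ Real.exp (-m * z.2) := Real.exp_le_exp.mpr (by nlinarith)
    calc _ ≤ Real.exp (-m * z.2) * (1 * 1) := by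
          refine mul_le_mul h4 (mul_le_mul h3 (Real.abs_cos_le_one _) (abs_nonneg _) zero_le_one)
            (by positivity) (Real.exp_pos _).le
      _ = _ := by ring
  have hin : ∀ t : ℝ, t ∈ Set.Ioi (0 : ℝ) → ∫ x in (1 : ℝ)..p, f x t =
      -((Real.exp (-p * t) - Real.exp (-t)) / t * (Real.exp (-α * t) * Real.cos (β * t))) := by
    intro t ht
    have ht0 : t ≠ 0 := ne_of_gt (show (0 : ℝ) < t from ht)
    simp only [hf]
    rw [intervalIntegral.integral_mul_const]
    have h1 : ∫ x in (1 : ℝ)..p, Real.exp (-x * t) = -((Real.exp (-p * t) - Real.exp (-t)) / t) := by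
      rw [intervalIntegral.integral_eq_sub_of_hasDerivAt (f := fun x => -(Real.exp (-x * t) / t))]
      · rw [neg_one_mul]; ring
      · intro x _
        have h2 := ((((hasDerivAt_id x).neg.mul_const t).exp).div_const t).neg
        refine h2.congr_deriv ?_
        simp only [Pi.neg_apply, id]
        field_simp
      · exact (Continuous.intervalIntegrable (by fun_prop) _ _)
    rw [h1]
    ring
  have hF := intervalIntegral_integral_swap hint
  have hout : ∀ x ∈ Set.uIcc 1 p, ∫ t in Set.Ioi (0 : ℝ), f x t = (x + α) / ((x + α) ^ 2 + β ^ 2) := by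
    intro x hx
    have hx0 : 0 < x := hm0.trans_le (hmx x hx)
    rw [← integral_exp_mul_cos (by linarith)]
    refine integral_congr_ae (Eventually.of_forall fun t => ?_)
    simp only [hf]
    rw [← mul_assoc, ← Real.exp_add]
    ring_nf
  rw [intervalIntegral.integral_congr hout, setIntegral_congr_fun measurableSet_Ioi hin, integral_neg] at hF
  have hlog : ∫ x in (1 : ℝ)..p, (x + α) / ((x + α) ^ 2 + β ^ 2) =
      1 / 2 * (Real.log ((p + α) ^ 2 + β ^ 2) - Real.log ((1 + α) ^ 2 + β ^ 2)) := by
    have hpos : ∀ x ∈ Set.uIcc 1 p, 0 < (x + α) ^ 2 + β ^ 2 := fun x hx => by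
      have := hm0.trans_le (hmx x hx)
      positivity
    rw [intervalIntegral.integral_eq_sub_of_hasDerivAt
      (f := fun x => 1 / 2 * Real.log ((x + α) ^ 2 + β ^ 2))]
    · ring
    · intro x hx
      have h3 : HasDerivAt (fun x => (x + α) ^ 2 + β ^ 2) (2 * (x + α)) x := by
        simpa using (((hasDerivAt_id x).add_const α).pow 2).add_const (β ^ 2)
      have h2 := (h3.log (hpos x hx).ne').const_mul (1 / 2)
      refine h2.congr_deriv ?_
      have := (hpos x hx).ne'
      field_simp
    · exact (ContinuousOn.div (by fun_prop) (by fun_prop) fun x hx => (hpos x hx).ne').intervalIntegrable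
  constructor
  · have h1 : Integrable (fun t => ∫ x in Set.uIoc 1 p, f x t) (volume.restrict (Set.Ioi (0 : ℝ))) :=
      hint.integral_prod_right
    -- Integrability in `t` comes from the same application of Fubini; passing from the oriented to
    -- the unordered interval costs a sign depending on whether `1 ≤ p`.
    have h2 : ∃ σ : ℝ, ∀ t ∈ Set.Ioi (0 : ℝ), σ * ∫ x in Set.uIoc 1 p, f x t =
        (Real.exp (-p * t) - Real.exp (-t)) / t * (Real.exp (-α * t) * Real.cos (β * t)) := by
      refine ⟨-(if 1 ≤ p then 1 else -1), fun t ht => ?_⟩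
      have h3 := hin t ht
      rw [intervalIntegral.intervalIntegral_eq_integral_uIoc, smul_eq_mul] at h3
      linarith
    obtain ⟨σ, hσ⟩ := h2
    exact (h1.const_mul σ).congr ((ae_restrict_mem measurableSet_Ioi).mono hσ)
  · linarith

/-- The combination of exponentials in which affine functions of the parameter cancel. -/
noncomputable def affineFreeExp (ρ t : ℝ) : ℝ :=
  Real.exp (-ρ * t) - (2 - ρ) * Real.exp (-1 * t) - (ρ - 1) * Real.exp (-2 * t)

theorem continuous_affineFreeExp (ρ : ℝ) : Continuous (affineFreeExp ρ) := by
  unfold affineFreeExp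
  fun_prop

theorem exp_neg_second_order {x : ℝ} (hx : 0 ≤ x) : |Real.exp (-x) - 1 + x| ≤ x ^ 2 := by
  have h1 := Real.add_one_le_exp (-x)
  have h2 : Real.exp (-x) ≤ (1 + x)⁻¹ := by
    rw [Real.exp_neg]
    exact inv_anti₀ (by linarith) (by linarith [Real.add_one_le_exp x])
  have h3 : (1 + x)⁻¹ - 1 + x ≤ x ^ 2 := by
    have : (1 + x)⁻¹ - 1 + x = x ^ 2 / (1 + x) := by
      have : 1 + x ≠ 0 := by linarith
      field_simp
      ring
    rw [this]
    exact div_le_self (sq_nonneg x) (by linarith)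
  rw [abs_le]
  constructor <;> linarith [sq_nonneg x]

/-- The terms of order `1` and `t` of the exponentials cancel, so the zero of second order at `t =
0` compensates `1/t²`; at infinity all exponentials decay at least with rate `min ρ 1`. -/
theorem exists_abs_affineFreeExp_le {ρ : ℝ} (hρ : 0 < ρ) : ∃ c m : ℝ, 0 ≤ c ∧ 0 < m ∧ ∀ t, 0 < t →
    |affineFreeExp ρ t| * (1 / t + 1 / t ^ 2) ≤ c * Real.exp (-m * t) := by
  set m := min ρ 1 with hm
  have hm0 : 0 < m := lt_min hρ one_pos
  set C₀ : ℝ := ρ ^ 2 + |2 - ρ| + |ρ - 1| * 4 with hC₀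
  set C₁ : ℝ := 1 + |2 - ρ| + |ρ - 1| with hC₁
  have hC₀0 : 0 ≤ C₀ := by positivity
  have hC₁0 : 0 ≤ C₁ := by positivity
  refine ⟨2 * C₀ * Real.exp m + 2 * C₁, m, by positivity, hm0, fun t ht => ?_⟩
  by_cases h1 : t ≤ 1
  · have h2 : |affineFreeExp ρ t| ≤ C₀ * t ^ 2 := by
      have e : affineFreeExp ρ t = (Real.exp (-(ρ * t)) - 1 + ρ * t) -
          (2 - ρ) * (Real.exp (-t) - 1 + t) - (ρ - 1) * (Real.exp (-(2 * t)) - 1 + 2 * t) := by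
        rw [affineFreeExp]; ring_nf
      have a1 := exp_neg_second_order (show 0 ≤ ρ * t by positivity)
      have a2 := exp_neg_second_order ht.le
      have a3 := exp_neg_second_order (show 0 ≤ 2 * t by positivity)
      rw [e]
      calc _ ≤ |Real.exp (-(ρ * t)) - 1 + ρ * t| + |(2 - ρ) * (Real.exp (-t) - 1 + t)| +
            |(ρ - 1) * (Real.exp (-(2 * t)) - 1 + 2 * t)| :=
            (abs_sub _ _).trans (add_le_add (abs_sub _ _) le_rfl)
        _ ≤ (ρ * t) ^ 2 + |2 - ρ| * t ^ 2 + |ρ - 1| * (2 * t) ^ 2 := by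
            rw [abs_mul, abs_mul]; gcongr
        _ = _ := by rw [hC₀]; ring
    have h3 : 1 ≤ Real.exp m * Real.exp (-m * t) := by
      rw [← Real.exp_add]
      exact Real.one_le_exp (by nlinarith)
    calc |affineFreeExp ρ t| * (1 / t + 1 / t ^ 2) ≤ C₀ * t ^ 2 * (1 / t + 1 / t ^ 2) := by gcongr
      _ = C₀ * (t + 1) := by field_simp
      _ ≤ 2 * C₀ * 1 := by nlinarith
      _ ≤ 2 * C₀ * (Real.exp m * Real.exp (-m * t)) := by gcongr
      _ ≤ _ := by
        have : 0 ≤ 2 * C₁ * Real.exp (-m * t) := by positivity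
        linarith
  · push Not at h1
    have hmt : ∀ x : ℝ, m ≤ x → Real.exp (-x * t) ≤ Real.exp (-m * t) := fun x hx =>
      Real.exp_le_exp.mpr (by nlinarith)
    have h2 : |affineFreeExp ρ t| ≤ C₁ * Real.exp (-m * t) := by
      rw [affineFreeExp]
      calc _ ≤ |Real.exp (-ρ * t)| + |(2 - ρ) * Real.exp (-1 * t)| + |(ρ - 1) * Real.exp (-2 * t)| :=
            (abs_sub _ _).trans (add_le_add (abs_sub _ _) le_rfl)
        _ ≤ Real.exp (-m * t) + |2 - ρ| * Real.exp (-m * t) + |ρ - 1| * Real.exp (-m * t) := by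
            rw [abs_mul, abs_mul, Real.abs_exp, Real.abs_exp, Real.abs_exp]
            gcongr
            · exact min_le_left _ _
            · exact min_le_right _ _
            · exact (min_le_right _ _).trans (by norm_num)
        _ = _ := by rw [hC₁]; ring
    have h3 : 1 / t + 1 / t ^ 2 ≤ 2 := by
      have a1 : 1 / t ≤ 1 := by rw [div_le_one ht]; exact h1.le
      have a2 : 1 / t ^ 2 ≤ 1 := by rw [div_le_one (by positivity)]; nlinarith
      linarith
    calc |affineFreeExp ρ t| * (1 / t + 1 / t ^ 2) ≤ C₁ * Real.exp (-m * t) * 2 := by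
          gcongr
      _ ≤ _ := by
        have : 0 ≤ 2 * C₀ * Real.exp m * Real.exp (-m * t) := by positivity
        linarith

theorem integral_affineFreeExp_mul_cos {ρ : ℝ} (hρ : 0 < ρ) {α : ℝ} (hα : 0 ≤ α) (β : ℝ) :
    IntegrableOn (fun t => affineFreeExp ρ t / t * (Real.exp (-α * t) * Real.cos (β * t))) (Set.Ioi 0) ∧
    ∫ t in Set.Ioi (0 : ℝ), affineFreeExp ρ t / t * (Real.exp (-α * t) * Real.cos (β * t)) =
      -(1 / 2) * (Real.log ((ρ + α) ^ 2 + β ^ 2) - (2 - ρ) * Real.log ((1 + α) ^ 2 + β ^ 2) -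
        (ρ - 1) * Real.log ((2 + α) ^ 2 + β ^ 2)) := by
  obtain ⟨h1, h2⟩ := frullani_cos hρ hα β
  obtain ⟨h3, h4⟩ := frullani_cos two_pos hα β
  have e : ∀ t : ℝ, affineFreeExp ρ t / t * (Real.exp (-α * t) * Real.cos (β * t)) =
      (Real.exp (-ρ * t) - Real.exp (-t)) / t * (Real.exp (-α * t) * Real.cos (β * t)) -
      (ρ - 1) * ((Real.exp (-2 * t) - Real.exp (-t)) / t * (Real.exp (-α * t) * Real.cos (β * t))) := by
    intro t
    rw [affineFreeExp, neg_one_mul]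
    ring
  simp only [e]
  refine ⟨h1.sub (h3.const_mul _), ?_⟩
  rw [integral_sub h1 (h3.const_mul _), integral_const_mul, h2, h4]
  ring

theorem integrableOn_affineFreeExp_mul {ρ : ℝ} (hρ : 0 < ρ) {h : ℝ → ℝ} (hm : Measurable h) {A : ℝ}
    (hh : ∀ t, 0 < t → |h t| ≤ A * (1 / t + 1 / t ^ 2)) :
    IntegrableOn (fun t => affineFreeExp ρ t * h t) (Set.Ioi 0) := by
  obtain ⟨c, m, hc, hm0, hb⟩ := exists_abs_affineFreeExp_le hρ
  refine ((integrableOn_exp_neg_mul hm0).const_mul (|A| * c)).mono'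
    ((continuous_affineFreeExp ρ).measurable.mul hm).aestronglyMeasurable ?_
  filter_upwards [ae_restrict_mem measurableSet_Ioi] with t ht
  have ht0 : (0 : ℝ) < t := ht
  rw [norm_mul, Real.norm_eq_abs, Real.norm_eq_abs]
  calc _ ≤ |affineFreeExp ρ t| * (|A| * (1 / t + 1 / t ^ 2)) := by
        refine mul_le_mul_of_nonneg_left ((hh t ht).trans ?_) (abs_nonneg _)
        exact mul_le_mul_of_nonneg_right (le_abs_self A) (by positivity)
    _ = |A| * (|affineFreeExp ρ t| * (1 / t + 1 / t ^ 2)) := by ring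
    _ ≤ |A| * (c * Real.exp (-m * t)) := mul_le_mul_of_nonneg_left (hb t ht0) (abs_nonneg _)
    _ = _ := by ring

/-- Partial integration reduces `1/t²` to `1/t`. The value is `ρ log ρ` up to an affine function of
`ρ`, which matches the entropy-like term of the closed form. -/
theorem integral_affineFreeExp_div_sq {ρ : ℝ} (hρ : 0 < ρ) :
    IntegrableOn (fun t => affineFreeExp ρ t * (1 / t ^ 2)) (Set.Ioi 0) ∧
    ∫ t in Set.Ioi (0 : ℝ), affineFreeExp ρ t * (1 / t ^ 2) =
      ρ * Real.log ρ - (ρ - 1) * (2 * Real.log 2) := by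
  have hI : IntegrableOn (fun t => affineFreeExp ρ t * (1 / t ^ 2)) (Set.Ioi 0) :=
    integrableOn_affineFreeExp_mul hρ (by fun_prop) (A := 1) fun t ht => by
      rw [abs_of_pos (by positivity), one_mul]
      have : 0 < 1 / t := by positivity
      linarith
  refine ⟨hI, ?_⟩
  obtain ⟨h1, h2⟩ := frullani_cos hρ le_rfl 0
  obtain ⟨h3, h4⟩ := frullani_cos two_pos le_rfl 0
  simp only [neg_zero, zero_mul, Real.exp_zero, Real.cos_zero, mul_one, add_zero, zero_pow two_ne_zero,
    one_pow, Real.log_one, sub_zero, Real.log_pow] at h1 h2 h3 h4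
  -- This is the derivative of `affineFreeExp ρ` divided by `t`, arranged into two Frullani
  -- quotients.
  set k : ℝ → ℝ := fun t => -ρ * ((Real.exp (-ρ * t) - Real.exp (-t)) / t) +
    2 * (ρ - 1) * ((Real.exp (-2 * t) - Real.exp (-t)) / t) with hk
  have hkI : IntegrableOn k (Set.Ioi 0) := (h1.const_mul _).add (h3.const_mul _)
  have hkv : ∫ t in Set.Ioi (0 : ℝ), k t = ρ * Real.log ρ - (ρ - 1) * (2 * Real.log 2) := by
    simp only [hk]
    rw [integral_add (h1.const_mul _) (h3.const_mul _), integral_const_mul, integral_const_mul, h2, h4]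
    push_cast
    ring
  obtain ⟨c, m, hc, hm0, hb⟩ := exists_abs_affineFreeExp_le hρ
  have hb1 : ∀ t, 0 < t → |-(affineFreeExp ρ t / t)| ≤ c * t := by
    intro t ht
    have a1 := hb t ht
    have a2 : Real.exp (-m * t) ≤ 1 := Real.exp_le_one_iff.mpr (by nlinarith)
    have a3 : |affineFreeExp ρ t| * (1 / t + 1 / t ^ 2) = |affineFreeExp ρ t| / t +
      |affineFreeExp ρ t| / t / t := by field_simp
    have a4 : 0 ≤ |affineFreeExp ρ t| / t := by positivity
    have a5 : |affineFreeExp ρ t| / t / t ≤ c := by nlinarith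
    rw [abs_neg, abs_div, abs_of_pos ht]
    rwa [div_le_iff₀ ht] at a5
  have hb2 : ∀ t, 0 < t → |-(affineFreeExp ρ t / t)| ≤ c * Real.exp (-m * t) := by
    intro t ht
    have a1 := hb t ht
    have a3 : |affineFreeExp ρ t| * (1 / t + 1 / t ^ 2) = |affineFreeExp ρ t| / t +
      |affineFreeExp ρ t| / t / t := by field_simp
    have a4 : 0 ≤ |affineFreeExp ρ t| / t / t := by positivity
    rw [abs_neg, abs_div, abs_of_pos ht]
    linarith
  -- Division by zero gives the primitive the value `0` at `t = 0`, which is also its limit there,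
  -- so it is right continuous as required.
  have hFTC := integral_Ioi_of_hasDerivAt_of_tendsto (f := fun t => -(affineFreeExp ρ t / t))
    (f' := fun t => affineFreeExp ρ t * (1 / t ^ 2) - k t) (a := 0) (m := 0) ?_ ?_ (hI.sub hkI) ?_
  · rw [integral_sub hI hkI, hkv] at hFTC
    simp only [div_zero, neg_zero, sub_zero] at hFTC
    linarith
  · rw [ContinuousWithinAt, div_zero, neg_zero]
    refine squeeze_zero_norm' (a := fun t => c * t) ?_ ?_
    · filter_upwards [self_mem_nhdsWithin] with t ht
      rcases (show (0 : ℝ) ≤ t from ht).eq_or_lt with rfl | ht0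
      · simp
      · exact hb1 t ht0
    · have : Tendsto (fun t : ℝ => c * t) (𝓝 0) (𝓝 (c * 0)) := tendsto_id.const_mul c
      rw [mul_zero] at this
      exact this.mono_left nhdsWithin_le_nhds
  · intro t ht
    have ht0 : t ≠ 0 := ne_of_gt (show (0 : ℝ) < t from ht)
    have hexp : ∀ a : ℝ, HasDerivAt (fun t => Real.exp (-a * t)) (Real.exp (-a * t) * -a) t := fun a => by
      simpa using ((hasDerivAt_id t).const_mul (-a)).exp
    have hd : HasDerivAt (affineFreeExp ρ) (Real.exp (-ρ * t) * -ρ - (2 - ρ) * (Real.exp (-1 * t) * -1) -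
        (ρ - 1) * (Real.exp (-2 * t) * -2)) t :=
      ((hexp ρ).sub ((hexp 1).const_mul (2 - ρ))).sub ((hexp 2).const_mul (ρ - 1))
    refine ((hd.div (hasDerivAt_id t) ht0).neg).congr_deriv ?_
    simp only [hk, id, affineFreeExp, neg_one_mul]
    field_simp
    ring
  · refine squeeze_zero_norm' (a := fun t => c * Real.exp (-m * t)) ?_ ?_
    · filter_upwards [eventually_gt_atTop 0] with t ht
      exact hb2 t ht
    · have h5 : Tendsto (fun t : ℝ => -m * t) atTop atBot :=
        tendsto_id.const_mul_atTop_of_neg (by linarith)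
      simpa using (Real.tendsto_exp_atBot.comp h5).const_mul c

end Frullani

/-! ### Positivity and size of the Lévy density -/

section LevyDensity

theorem cosh_sub_cos_pos {u : ℝ} (hu : 0 < u) (v : ℝ) : 0 < Real.cosh u - Real.cos v := by
  have h1 := Real.one_lt_cosh.mpr hu.ne'
  linarith [Real.cos_le_one v]

theorem cosh_sub_one_eq (u : ℝ) : Real.cosh u - 1 = 2 * Real.sinh (u / 2) ^ 2 := by
  have h1 := Real.cosh_two_mul (u / 2)
  have h2 := Real.cosh_sq (u / 2)
  rw [mul_div_cancel₀ _ two_ne_zero] at h1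
  linarith

theorem sinh_eq_half (u : ℝ) : Real.sinh u = 2 * Real.sinh (u / 2) * Real.cosh (u / 2) := by
  have h1 := Real.sinh_two_mul (u / 2)
  rwa [mul_div_cancel₀ _ two_ne_zero] at h1

theorem sinh_le_mul_cosh {u : ℝ} (hu : 0 ≤ u) : Real.sinh u ≤ u * Real.cosh u := by
  have hd : ∀ x : ℝ, HasDerivAt (fun x => x * Real.cosh x - Real.sinh x)
      (1 * Real.cosh x + x * Real.sinh x - Real.cosh x) x := fun x =>
    ((hasDerivAt_id x).mul (Real.hasDerivAt_cosh x)).sub (Real.hasDerivAt_sinh x)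
  have hmono : MonotoneOn (fun x => x * Real.cosh x - Real.sinh x) (Set.Ici 0) := by
    refine monotoneOn_of_deriv_nonneg (convex_Ici 0) (fun x _ => (hd x).continuousAt.continuousWithinAt)
      (fun x _ => (hd x).differentiableAt.differentiableWithinAt) fun x hx => ?_
    rw [interior_Ici] at hx
    have hx0 : (0 : ℝ) < x := hx
    rw [(hd x).deriv]
    have := Real.sinh_pos_iff.mpr hx0
    have := mul_pos hx0 this
    linarith
  have := hmono (Set.mem_Ici.mpr le_rfl) (Set.mem_Ici.mpr hu) hu
  simp only [zero_mul, Real.sinh_zero, sub_zero] at this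
  linarith

/-- The contribution of the pole at the origin is a lower bound for the partial fraction expansion. -/
theorem two_mul_div_le_sinh_div {u : ℝ} (hu : 0 < u) (v : ℝ) :
    2 * u / (u ^ 2 + v ^ 2) ≤ Real.sinh u / (Real.cosh u - Real.cos v) := by
  rw [div_le_div_iff₀ (by positivity) (cosh_sub_cos_pos hu v)]
  have h1 : u ≤ Real.sinh u := Real.self_le_sinh_iff.mpr hu.le
  have h2 : 1 - v ^ 2 / 2 ≤ Real.cos v := Real.one_sub_sq_div_two_le_cos
  have h3 : 2 * (Real.cosh u - 1) ≤ u * Real.sinh u := by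
    rw [cosh_sub_one_eq, sinh_eq_half u]
    have h4 := sinh_le_mul_cosh (u := u / 2) (by linarith)
    have h5 : 0 ≤ Real.sinh (u / 2) := Real.sinh_nonneg_iff.mpr (by linarith)
    have := mul_le_mul_of_nonneg_right h4 h5
    linarith
  have h4 : Real.cosh u - Real.cos v ≤ (Real.cosh u - 1) + v ^ 2 / 2 := by linarith
  have h5 := mul_le_mul_of_nonneg_left h4 (show 0 ≤ 2 * u by linarith)
  have h6 := mul_le_mul_of_nonneg_left h3 hu.le
  have h7 := mul_le_mul_of_nonneg_right h1 (sq_nonneg v)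
  nlinarith

/-- Replacing `cos v` by `1` gives `coth(u/2)`. The bound is meant for large `t`, where it is
uniform in the oscillating argument. -/
theorem sinh_div_le {u : ℝ} (hu : 0 < u) (v : ℝ) :
    Real.sinh u / (Real.cosh u - Real.cos v) ≤ 1 + 2 / u := by
  have h0 : 0 < Real.cosh u - 1 := by linarith [Real.one_lt_cosh.mpr hu.ne']
  have h1 : Real.sinh u / (Real.cosh u - Real.cos v) ≤ Real.sinh u / (Real.cosh u - 1) := by
    have := Real.sinh_pos_iff.mpr hu
    have := Real.cos_le_one v
    gcongr
  refine h1.trans ?_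
  rw [div_le_iff₀ h0, cosh_sub_one_eq, sinh_eq_half]
  have h2 : u / 2 ≤ Real.sinh (u / 2) := Real.self_le_sinh_iff.mpr (by linarith)
  have h3 : Real.cosh (u / 2) - Real.sinh (u / 2) ≤ 1 := by
    rw [Real.cosh_sub_sinh]
    exact Real.exp_le_one_iff.mpr (by linarith)
  have h4 : 0 ≤ Real.sinh (u / 2) := by linarith
  have h5 : Real.cosh (u / 2) ≤ (1 + 2 / u) * Real.sinh (u / 2) := by
    have h6 : 1 ≤ 2 / u * Real.sinh (u / 2) := by
      rw [div_mul_eq_mul_div, one_le_div hu]; linarith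
    linarith
  calc 2 * Real.sinh (u / 2) * Real.cosh (u / 2)
      ≤ 2 * Real.sinh (u / 2) * ((1 + 2 / u) * Real.sinh (u / 2)) := by gcongr
    _ = _ := by ring

/-- Near the origin the subtraction removes the pole and leaves a remainder of first order in `u`;
this makes the density divided by `t` bounded for small `t`. -/
theorem sinh_div_sub_le {u v : ℝ} (hu : 0 < u) (huv : u ^ 2 + v ^ 2 ≤ 1) :
    Real.sinh u / (Real.cosh u - Real.cos v) - 2 * u / (u ^ 2 + v ^ 2) ≤ 3 * u := by
  have hu1 : u ≤ 1 := by nlinarith [sq_nonneg v]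
  have hv1 : |v| ≤ 1 := by
    rw [← sq_le_one_iff_abs_le_one]; linarith [sq_nonneg u]
  have hT0 : 0 < u ^ 2 + v ^ 2 := by positivity
  have hcos := abs_le.mp (Real.cos_bound hv1)
  have hv4 : |v| ^ 4 = v ^ 4 := by rw [← abs_pow, abs_of_nonneg (by positivity)]
  rw [hv4] at hcos
  have hcosh1 : 1 + u ^ 2 / 2 ≤ Real.cosh u := by
    have h2 : u / 2 ≤ Real.sinh (u / 2) := Real.self_le_sinh_iff.mpr (by linarith)
    have h3 := cosh_sub_one_eq u
    nlinarith
  have hcosh2 : Real.cosh u ≤ 1 + u ^ 2 := by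
    refine (Real.cosh_le_exp_half_sq u).trans ?_
    have h4 : u ^ 2 / 2 < 1 := by nlinarith
    refine (Real.exp_bound_div_one_sub_of_interval (by positivity) h4).trans ?_
    rw [div_le_iff₀ (by linarith)]
    nlinarith [sq_nonneg u]
  have hsinh : Real.sinh u ≤ u * (1 + u ^ 2) :=
    (sinh_le_mul_cosh hu.le).trans (mul_le_mul_of_nonneg_left hcosh2 hu.le)
  -- The remainder `5/96` is the one in `Real.cos_bound`, and `1/2 - 5/96 = 43/96` still exceeds
  -- `4/9`.
  have hden : (u ^ 2 + v ^ 2) * (4 / 9) ≤ Real.cosh u - Real.cos v := by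
    have h5 : v ^ 4 ≤ v ^ 2 := by nlinarith [sq_nonneg v, sq_nonneg u]
    nlinarith [sq_nonneg v, sq_nonneg u]
  have hden0 := cosh_sub_cos_pos hu v
  rw [sub_le_iff_le_add, div_le_iff₀ hden0]
  have hkey : u * (1 + u ^ 2) ≤ (3 * u + 2 * u / (u ^ 2 + v ^ 2)) * (Real.cosh u - Real.cos v) := by
    have h6 : (u ^ 2 + v ^ 2) / 2 - v ^ 4 * (5 / 96) ≤ Real.cosh u - Real.cos v := by linarith [hcos.2]
    have h7 : 2 * u / (u ^ 2 + v ^ 2) * ((u ^ 2 + v ^ 2) / 2 - v ^ 4 * (5 / 96)) ≤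
        2 * u / (u ^ 2 + v ^ 2) * (Real.cosh u - Real.cos v) := by gcongr
    have h8 : u - u * v ^ 2 * (5 / 48) ≤
        2 * u / (u ^ 2 + v ^ 2) * ((u ^ 2 + v ^ 2) / 2 - v ^ 4 * (5 / 96)) := by
      have e : 2 * u / (u ^ 2 + v ^ 2) * ((u ^ 2 + v ^ 2) / 2 - v ^ 4 * (5 / 96)) =
          u - u * (5 / 48) * (v ^ 4 / (u ^ 2 + v ^ 2)) := by field_simp; ring
      have h9 : v ^ 4 / (u ^ 2 + v ^ 2) ≤ v ^ 2 := by
        rw [div_le_iff₀ hT0]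
        nlinarith [mul_nonneg (sq_nonneg u) (sq_nonneg v)]
      rw [e]
      nlinarith
    have h10 : 3 * u * ((u ^ 2 + v ^ 2) * (4 / 9)) ≤ 3 * u * (Real.cosh u - Real.cos v) := by gcongr
    have h11 := mul_nonneg hu.le (sq_nonneg v)
    nlinarith
  exact hsinh.trans hkey

/-- The density of the Lévy measure. -/
noncomputable def levyDensity (φ t : ℝ) : ℝ :=
  Real.sinh (Real.sin φ * t) / (Real.cosh (Real.sin φ * t) - Real.cos (Real.cos φ * t)) -
    2 * Real.sin φ / t

variable {φ : ℝ}

/-- Because `sin² + cos² = 1`, the subtracted term is the pole contribution `2u/(u²+v²)` at `u = t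
sin φ`, `v = t cos φ`; this identification is the source of positivity. -/
theorem two_sin_div_eq {t : ℝ} (ht : 0 < t) : 2 * Real.sin φ / t =
    2 * (Real.sin φ * t) / ((Real.sin φ * t) ^ 2 + (Real.cos φ * t) ^ 2) := by
  have h : (Real.sin φ * t) ^ 2 + (Real.cos φ * t) ^ 2 = t ^ 2 := by
    linear_combination t ^ 2 * Real.sin_sq_add_cos_sq φ
  rw [h]
  field_simp

theorem levyDensity_nonneg (hs : 0 < Real.sin φ) {t : ℝ} (ht : 0 < t) : 0 ≤ levyDensity φ t := by
  rw [levyDensity, two_sin_div_eq ht, sub_nonneg]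
  exact two_mul_div_le_sinh_div (by positivity) _

theorem exists_levyDensity_le (hs : 0 < Real.sin φ) : ∃ A : ℝ, ∀ t, 0 < t →
    levyDensity φ t / t ≤ A := by
  refine ⟨3 + (1 + 2 / Real.sin φ), fun t ht => ?_⟩
  have hs1 := Real.sin_le_one φ
  have h0 : 0 < 2 / Real.sin φ := by positivity
  rw [div_le_iff₀ ht]
  by_cases h1 : t ≤ 1
  · have h : (Real.sin φ * t) ^ 2 + (Real.cos φ * t) ^ 2 = t ^ 2 := by
      linear_combination t ^ 2 * Real.sin_sq_add_cos_sq φ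
    rw [levyDensity, two_sin_div_eq ht]
    refine (sinh_div_sub_le (by positivity) (by rw [h]; nlinarith)).trans ?_
    nlinarith
  · push Not at h1
    have h2 := sinh_div_le (show 0 < Real.sin φ * t by positivity) (Real.cos φ * t)
    have h3 : 2 / (Real.sin φ * t) ≤ 2 / Real.sin φ := by
      apply div_le_div_of_nonneg_left (by norm_num) hs
      nlinarith
    have h4 : 0 ≤ 2 * Real.sin φ / t := by positivity
    rw [levyDensity]
    nlinarith

theorem measurable_levyDensity : Measurable (levyDensity φ) := by
  unfold levyDensity
  fun_prop

theorem integrableOn_exp_mul_levyDensity (hs : 0 < Real.sin φ) {ρ : ℝ} (hρ : 0 < ρ) :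
    IntegrableOn (fun t => Real.exp (-ρ * t) * (levyDensity φ t / t)) (Set.Ioi 0) := by
  obtain ⟨A, hA⟩ := exists_levyDensity_le hs
  refine ((integrableOn_exp_neg_mul hρ).mul_const A).mono'
    ((by fun_prop : Measurable fun t : ℝ => Real.exp (-ρ * t)).mul
      (measurable_levyDensity.div measurable_id)).aestronglyMeasurable ?_
  filter_upwards [ae_restrict_mem measurableSet_Ioi] with t ht
  have h1 : 0 ≤ levyDensity φ t / t := div_nonneg (levyDensity_nonneg hs ht) (le_of_lt ht)
  rw [norm_mul, Real.norm_eq_abs, Real.abs_exp, Real.norm_eq_abs, abs_of_nonneg h1]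
  exact mul_le_mul_of_nonneg_left (hA t ht) (Real.exp_pos _).le

/-- The Laplace transform of the Lévy measure. -/
noncomputable def levyTransform (φ ρ : ℝ) : ℝ :=
  ∫ t in Set.Ioi (0 : ℝ), Real.exp (-ρ * t) * (levyDensity φ t / t)

theorem levyTransform_nonneg (hs : 0 < Real.sin φ) (ρ : ℝ) : 0 ≤ levyTransform φ ρ :=
  setIntegral_nonneg measurableSet_Ioi fun _ ht =>
    mul_nonneg (Real.exp_pos _).le (div_nonneg (levyDensity_nonneg hs ht) (le_of_lt ht))

theorem integral_affineFreeExp_mul_levyDensity (hs : 0 < Real.sin φ) {ρ : ℝ} (hρ : 0 < ρ) :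
    ∫ t in Set.Ioi (0 : ℝ), affineFreeExp ρ t * (levyDensity φ t / t) =
      levyTransform φ ρ - (2 - ρ) * levyTransform φ 1 - (ρ - 1) * levyTransform φ 2 := by
  have h1 := integrableOn_exp_mul_levyDensity hs hρ
  have h2 := integrableOn_exp_mul_levyDensity hs one_pos
  have h3 := integrableOn_exp_mul_levyDensity hs two_pos
  simp only [levyTransform]
  have h4 : IntegrableOn (fun t => Real.exp (-ρ * t) * (levyDensity φ t / t) -
      (2 - ρ) * (Real.exp (-1 * t) * (levyDensity φ t / t))) (Set.Ioi 0) := h1.sub (h2.const_mul _)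
  rw [← integral_const_mul, ← integral_const_mul, ← integral_sub h1 (h2.const_mul _),
    ← integral_sub h4 (h3.const_mul _)]
  refine integral_congr_ae (Eventually.of_forall fun t => ?_)
  simp only [affineFreeExp]
  ring

/-- The sum of a geometric series with complex ratio. -/
theorem tendsto_geom_cos {u : ℝ} (hu : 0 < u) (v : ℝ) :
    Tendsto (fun n : ℕ => ∑ j ∈ Finset.range n, Real.exp (-(j * u)) * Real.cos (j * v)) atTop
      (𝓝 (1 / 2 * (1 + Real.sinh u / (Real.cosh u - Real.cos v)))) ∧
    ∀ n : ℕ, |∑ j ∈ Finset.range n, Real.exp (-(j * u)) * Real.cos (j * v)| ≤ 2 * (1 + 1 / u) := by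
  set z : ℂ := Complex.exp ((-u : ℝ) + v * Complex.I) with hz
  have hnorm : ‖z‖ = Real.exp (-u) := by
    rw [hz, Complex.norm_exp]; simp
  have hlt : ‖z‖ < 1 := by rw [hnorm]; exact Real.exp_lt_one_iff.mpr (by linarith)
  have hre : ∀ j : ℕ, (z ^ j).re = Real.exp (-(j * u)) * Real.cos (j * v) := by
    intro j
    rw [hz, ← Complex.exp_nat_mul, Complex.exp_re]
    simp
  have hsum : ∀ n : ℕ, ∑ j ∈ Finset.range n, Real.exp (-(j * u)) * Real.cos (j * v) =
      (∑ j ∈ Finset.range n, z ^ j).re := fun n => by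
    rw [Complex.re_sum]
    exact Finset.sum_congr rfl fun j _ => (hre j).symm
  have hz1 : 1 - z ≠ 0 := by
    intro h
    have : z = 1 := (sub_eq_zero.mp h).symm
    rw [this] at hlt
    simp at hlt
  constructor
  · simp only [hsum]
    have h1 := (hasSum_geometric_of_norm_lt_one hlt).tendsto_sum_nat
    have h2 := (Complex.continuous_re.tendsto _).comp h1
    convert! h2 using 2
    have hzre : z.re = Real.exp (-u) * Real.cos v := by
      rw [hz, Complex.exp_re]; simp
    have hzim : z.im = Real.exp (-u) * Real.sin v := by
      rw [hz, Complex.exp_im]; simp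
    have hE : Real.exp u * Real.exp (-u) = 1 := by rw [← Real.exp_add]; simp
    set E := Real.exp (-u) with hEdef
    have hE0 : 0 < E := Real.exp_pos _
    have hEu : Real.exp u = E⁻¹ := eq_inv_of_mul_eq_one_left hE
    have hden : 0 < Complex.normSq (1 - z) := Complex.normSq_pos.mpr hz1
    have hns : Complex.normSq (1 - z) = 1 - 2 * E * Real.cos v + E ^ 2 := by
      rw [Complex.normSq_apply]
      simp only [Complex.sub_re, Complex.sub_im, Complex.one_re, Complex.one_im, hzre, hzim]
      linear_combination E ^ 2 * Real.sin_sq_add_cos_sq v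
    rw [Complex.inv_re, hns, Complex.sub_re, Complex.one_re, hzre, Real.sinh_eq, Real.cosh_eq, hEu,
      ← hEdef]
    rw [hns] at hden
    have e : (E⁻¹ + E) / 2 - Real.cos v = (1 - 2 * E * Real.cos v + E ^ 2) / (2 * E) := by
      field_simp
      ring
    rw [e]
    have := hden.ne'
    field_simp
    ring
  -- Partial sums are `(1 - zⁿ)/(1 - z)`, and `|1 - z| ≥ 1 - e^(-u) ≥ u/(1+u)`.
  · intro n
    rw [hsum]
    refine (Complex.abs_re_le_norm _).trans ?_
    have h3 : ∑ j ∈ Finset.range n, z ^ j = (1 - z ^ n) / (1 - z) := by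
      rw [eq_div_iff hz1, geom_sum_mul_neg]
    have h4 : 1 - Real.exp (-u) ≤ ‖1 - z‖ := by
      have := norm_sub_norm_le (1 : ℂ) z
      rwa [norm_one, hnorm] at this
    have h5 : ‖1 - z ^ n‖ ≤ 2 := by
      refine (norm_sub_le _ _).trans ?_
      rw [norm_one, norm_pow]
      have := pow_le_one₀ (norm_nonneg z) hlt.le (n := n)
      linarith
    have h6 : Real.exp (-u) ≤ (1 + u)⁻¹ := by
      rw [Real.exp_neg]
      exact inv_anti₀ (by linarith) (by linarith [Real.add_one_le_exp u])
    have h7 : u / (1 + u) ≤ ‖1 - z‖ := by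
      have : u / (1 + u) = 1 - (1 + u)⁻¹ := by field_simp; ring
      linarith
    rw [h3, norm_div]
    calc ‖1 - z ^ n‖ / ‖1 - z‖ ≤ 2 / (u / (1 + u)) := by gcongr
      _ = _ := by field_simp; ring

end LevyDensity

/-! ### The closed form as a Laplace transform -/

section LaplaceRepresentation

variable {φ : ℝ}

/-- The argument of the Gamma function in the closed form. -/
noncomputable def gammaPoint (φ ρ : ℝ) : ℂ := Complex.I * ρ * Complex.exp (-Complex.I * φ)

theorem norm_gammaPoint_add_sq {ρ : ℝ} (hρ : 0 < ρ) (φ : ℝ) (j : ℕ) :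
    ‖gammaPoint φ ρ + j‖ ^ 2 = (ρ + j * Real.sin φ) ^ 2 + (j * Real.cos φ) ^ 2 := by
  obtain ⟨-, h2, h3⟩ := gammaArg hρ φ
  rw [Complex.sq_norm, Complex.normSq_apply]
  simp only [Complex.add_re, Complex.add_im, Complex.natCast_re, Complex.natCast_im, add_zero, gammaPoint,
    h2, h3]
  linear_combination (ρ ^ 2 - (j : ℝ) ^ 2) * Real.sin_sq_add_cos_sq φ

theorem re_gammaPoint_pos (hs : 0 < Real.sin φ) {ρ : ℝ} (hρ : 0 < ρ) : 0 < (gammaPoint φ ρ).re := by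
  obtain ⟨-, h2, -⟩ := gammaArg hρ φ
  rw [gammaPoint, h2]
  positivity

/-- The logarithm of the factor of the closed form belonging to one degree of freedom. -/
noncomputable def logFactor (φ ρ : ℝ) : ℝ :=
  Real.log ρ - Real.log (2 * Real.pi) - 2 * ρ * Real.log ρ * Real.sin φ +
    Real.log (‖Complex.Gamma (gammaPoint φ ρ)‖ ^ 2)

theorem closedForm_eq_exp (hs : 0 < Real.sin φ) {ρ : ℝ} (hρ : 0 < ρ) :
    closedForm φ ρ = Real.exp (logFactor φ ρ) ^ 3 := by
  have hpi := Real.pi_pos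
  have h1 : Complex.Gamma (gammaPoint φ ρ) ≠ 0 := Complex.Gamma_ne_zero_of_re_pos (re_gammaPoint_pos hs hρ)
  have h2 : 0 < ‖Complex.Gamma (gammaPoint φ ρ)‖ ^ 2 := by positivity
  rw [closedForm, logFactor, Real.exp_add, Real.exp_log h2, Real.exp_sub, Real.exp_sub, Real.exp_log hρ,
    Real.exp_log (by positivity)]
  congr 1
  rw [show -2 * ρ * Real.log ρ * Real.sin φ = -(2 * ρ * Real.log ρ * Real.sin φ) by ring, Real.exp_neg]
  rw [gammaPoint]
  field_simp

/-- In the logarithm of Euler's limit everything but the terms `log|w + j|²` is affine in `ρ`, and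
so disappears under the functional used below. -/
theorem tendsto_log_gammaSeq (hs : 0 < Real.sin φ) {ρ : ℝ} (hρ : 0 < ρ) :
    Tendsto (fun n : ℕ => ρ * (2 * Real.sin φ * Real.log n) + 2 * Real.log n.factorial -
      ∑ j ∈ Finset.range (n + 1), Real.log ((ρ + j * Real.sin φ) ^ 2 + (j * Real.cos φ) ^ 2)) atTop
      (𝓝 (Real.log (‖Complex.Gamma (gammaPoint φ ρ)‖ ^ 2))) := by
  have h1 : Complex.Gamma (gammaPoint φ ρ) ≠ 0 := Complex.Gamma_ne_zero_of_re_pos (re_gammaPoint_pos hs hρ)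
  have h2 := ((Complex.GammaSeq_tendsto_Gamma (gammaPoint φ ρ)).norm.pow 2).log
    (pow_ne_zero 2 (norm_ne_zero_iff.mpr h1))
  refine h2.congr' ?_
  filter_upwards [eventually_ge_atTop 1] with n hn
  have hn0 : (0 : ℝ) < n := by exact_mod_cast hn
  have hpos : ∀ j : ℕ, 0 < (ρ + j * Real.sin φ) ^ 2 + (j * Real.cos φ) ^ 2 := fun j => by positivity
  have hf : (0 : ℝ) < n.factorial := by exact_mod_cast n.factorial_pos
  obtain ⟨-, hre, -⟩ := gammaArg hρ φ
  rw [Complex.GammaSeq, norm_div, norm_mul, norm_prod, div_pow, mul_pow, ← Finset.prod_pow,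
    Finset.prod_congr rfl fun j _ => norm_gammaPoint_add_sq hρ φ j,
    Complex.norm_natCast_cpow_of_pos hn, Complex.norm_natCast,
    Real.log_div (by positivity) (Finset.prod_ne_zero_iff.mpr fun j _ => (hpos j).ne'),
    Real.log_mul (by positivity) (by positivity), Real.log_pow, Real.log_pow, Real.log_rpow hn0,
    Real.log_prod fun j _ => (hpos j).ne', gammaPoint, hre]
  push_cast
  ring

/-- Each summand is a Frullani integral, and the integrands add up to a geometric series. Its
partial sums are bounded by a multiple of `1 + 1/t` thanks to `sin φ > 0`, which the zero of
`affineFreeExp` makes integrable against `1/t`. -/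
theorem tendsto_sum_log_integral (hs : 0 < Real.sin φ) {ρ : ℝ} (hρ : 0 < ρ) :
    Tendsto (fun n : ℕ => ∑ j ∈ Finset.range n,
      (Real.log ((ρ + j * Real.sin φ) ^ 2 + (j * Real.cos φ) ^ 2) -
        (2 - ρ) * Real.log ((1 + j * Real.sin φ) ^ 2 + (j * Real.cos φ) ^ 2) -
        (ρ - 1) * Real.log ((2 + j * Real.sin φ) ^ 2 + (j * Real.cos φ) ^ 2))) atTop
      (𝓝 (-∫ t in Set.Ioi (0 : ℝ), affineFreeExp ρ t * ((1 + Real.sinh (Real.sin φ * t) /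
        (Real.cosh (Real.sin φ * t) - Real.cos (Real.cos φ * t))) / t))) := by
  obtain ⟨c, m, hc, hm, hb⟩ := exists_abs_affineFreeExp_le hρ
  have hstep : ∀ j : ℕ, IntegrableOn (fun t => affineFreeExp ρ t / t * (Real.exp (-(j * Real.sin φ) * t) *
      Real.cos ((j * Real.cos φ) * t))) (Set.Ioi 0) ∧ _ := fun j =>
    integral_affineFreeExp_mul_cos hρ (α := j * Real.sin φ) (by positivity) (j * Real.cos φ)
  have hsum : ∀ n : ℕ, ∑ j ∈ Finset.range n,
      (Real.log ((ρ + j * Real.sin φ) ^ 2 + (j * Real.cos φ) ^ 2) -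
        (2 - ρ) * Real.log ((1 + j * Real.sin φ) ^ 2 + (j * Real.cos φ) ^ 2) -
        (ρ - 1) * Real.log ((2 + j * Real.sin φ) ^ 2 + (j * Real.cos φ) ^ 2)) =
      -(2 * ∫ t in Set.Ioi (0 : ℝ), affineFreeExp ρ t / t * ∑ j ∈ Finset.range n,
        Real.exp (-(j * (Real.sin φ * t))) * Real.cos (j * (Real.cos φ * t))) := by
    intro n
    have e : ∀ t : ℝ, affineFreeExp ρ t / t * ∑ j ∈ Finset.range n,
        Real.exp (-(j * (Real.sin φ * t))) * Real.cos (j * (Real.cos φ * t)) =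
        ∑ j ∈ Finset.range n, affineFreeExp ρ t / t * (Real.exp (-(j * Real.sin φ) * t) *
          Real.cos ((j * Real.cos φ) * t)) := fun t => by
      rw [Finset.mul_sum]
      exact Finset.sum_congr rfl fun j _ => by ring_nf
    simp only [e]
    rw [integral_finsetSum _ fun j _ => (hstep j).1, Finset.mul_sum, ← Finset.sum_neg_distrib]
    refine Finset.sum_congr rfl fun j _ => ?_
    rw [(hstep j).2]
    ring
  simp only [hsum]
  have hlim : ∫ t in Set.Ioi (0 : ℝ), affineFreeExp ρ t * ((1 + Real.sinh (Real.sin φ * t) /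
        (Real.cosh (Real.sin φ * t) - Real.cos (Real.cos φ * t))) / t) =
      2 * ∫ t in Set.Ioi (0 : ℝ), affineFreeExp ρ t / t * (1 / 2 * (1 + Real.sinh (Real.sin φ * t) /
        (Real.cosh (Real.sin φ * t) - Real.cos (Real.cos φ * t)))) := by
    rw [← integral_const_mul]
    refine integral_congr_ae (Eventually.of_forall fun t => ?_)
    ring
  rw [hlim]
  refine (Tendsto.const_mul 2 ?_).neg
  refine tendsto_integral_of_dominated_convergence
    (fun t => 2 * (1 + 1 / Real.sin φ) * c * Real.exp (-m * t)) ?_ ?_ ?_ ?_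
  · intro n
    exact (((continuous_affineFreeExp ρ).measurable.div measurable_id).mul
      (by fun_prop)).aestronglyMeasurable
  · exact (integrableOn_exp_neg_mul hm).const_mul _
  · intro n
    filter_upwards [ae_restrict_mem measurableSet_Ioi] with t ht
    have ht0 : (0 : ℝ) < t := ht
    have h1 := (tendsto_geom_cos (show 0 < Real.sin φ * t by positivity) (Real.cos φ * t)).2 n
    rw [norm_mul, Real.norm_eq_abs, Real.norm_eq_abs, abs_div, abs_of_pos ht0]
    have h2 : 2 * (1 + 1 / (Real.sin φ * t)) ≤ 2 * (1 + 1 / Real.sin φ) * (1 + 1 / t) := by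
      have h3 : 0 < 1 / Real.sin φ := by positivity
      have h4 : 0 < 1 / t := by positivity
      have h5 : 1 / (Real.sin φ * t) = 1 / Real.sin φ * (1 / t) := by field_simp
      rw [h5]
      nlinarith
    calc _ ≤ |affineFreeExp ρ t| / t * (2 * (1 + 1 / Real.sin φ) * (1 + 1 / t)) := by
          gcongr
          exact h1.trans h2
      _ = 2 * (1 + 1 / Real.sin φ) * (|affineFreeExp ρ t| * (1 / t + 1 / t ^ 2)) := by
          field_simp
      _ ≤ 2 * (1 + 1 / Real.sin φ) * (c * Real.exp (-m * t)) := by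
          have := hb t ht0
          gcongr
      _ = _ := by ring
  · filter_upwards [ae_restrict_mem measurableSet_Ioi] with t ht
    have ht0 : (0 : ℝ) < t := ht
    exact (tendsto_geom_cos (show 0 < Real.sin φ * t by positivity) (Real.cos φ * t)).1.const_mul _

/-- The logarithm of the factor is the transform of the Lévy measure, up to an affine function. -/
theorem logFactor_second_difference (hs : 0 < Real.sin φ) {ρ : ℝ} (hρ : 0 < ρ) :
    logFactor φ ρ - (2 - ρ) * logFactor φ 1 - (ρ - 1) * logFactor φ 2 =
      levyTransform φ ρ - (2 - ρ) * levyTransform φ 1 - (ρ - 1) * levyTransform φ 2 := by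
  have hG := ((tendsto_log_gammaSeq hs hρ).sub ((tendsto_log_gammaSeq hs one_pos).const_mul (2 - ρ))).sub
    ((tendsto_log_gammaSeq hs two_pos).const_mul (ρ - 1))
  -- The Gamma sequence has the `n + 1` factors `j = 0, …, n`, hence the shift by one.
  have hI := ((tendsto_sum_log_integral hs hρ).comp (tendsto_add_atTop_nat 1)).neg
  rw [neg_neg] at hI
  have hGI := tendsto_nhds_unique hG (hI.congr fun n => by
    simp only [Function.comp_apply, Finset.sum_sub_distrib, ← Finset.mul_sum]
    ring)
  obtain ⟨a1, a2⟩ := integral_affineFreeExp_div_sq hρ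
  obtain ⟨b1, b2⟩ := integral_affineFreeExp_mul_cos hρ le_rfl 0
  simp only [neg_zero, zero_mul, Real.exp_zero, Real.cos_zero, mul_one, add_zero, zero_pow two_ne_zero,
    one_pow, Real.log_one, Real.log_pow, mul_zero, sub_zero] at b1 b2
  obtain ⟨A, hA⟩ := exists_levyDensity_le hs
  have c1 : IntegrableOn (fun t => affineFreeExp ρ t * (levyDensity φ t / t)) (Set.Ioi 0) := by
    have h1 := integrableOn_exp_mul_levyDensity hs hρ
    have h2 := integrableOn_exp_mul_levyDensity hs one_pos
    have h3 := integrableOn_exp_mul_levyDensity hs two_pos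
    refine ((h1.sub (h2.const_mul (2 - ρ))).sub (h3.const_mul (ρ - 1))).congr
      (Eventually.of_forall fun t => ?_)
    simp only [affineFreeExp, Pi.sub_apply]
    ring
  -- The integral of `affineFreeExp ρ t / t` cancels the contribution of `log ρ` to `logFactor`, and
  -- that with `1/t²` cancels `2ρ log ρ sin φ`; only the Lévy density remains.
  have hsplit : ∫ t in Set.Ioi (0 : ℝ), affineFreeExp ρ t * ((1 + Real.sinh (Real.sin φ * t) /
        (Real.cosh (Real.sin φ * t) - Real.cos (Real.cos φ * t))) / t) =
      (∫ t in Set.Ioi (0 : ℝ), affineFreeExp ρ t * (levyDensity φ t / t)) +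
      2 * (∫ t in Set.Ioi (0 : ℝ), affineFreeExp ρ t / t) * (1 / 2) +
      2 * Real.sin φ * ∫ t in Set.Ioi (0 : ℝ), affineFreeExp ρ t * (1 / t ^ 2) := by
    have e : ∀ t : ℝ, affineFreeExp ρ t * ((1 + Real.sinh (Real.sin φ * t) /
        (Real.cosh (Real.sin φ * t) - Real.cos (Real.cos φ * t))) / t) =
        affineFreeExp ρ t * (levyDensity φ t / t) + affineFreeExp ρ t / t +
          2 * Real.sin φ * (affineFreeExp ρ t * (1 / t ^ 2)) := fun t => by
      rw [levyDensity]
      ring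
    simp only [e]
    have c2 : IntegrableOn (fun t => affineFreeExp ρ t * (levyDensity φ t / t) + affineFreeExp ρ t / t)
      (Set.Ioi 0) := c1.add b1
    rw [integral_add c2 (a1.const_mul _), integral_add c1 b1, integral_const_mul]
    ring
  rw [hsplit, a2, b2, integral_affineFreeExp_mul_levyDensity hs hρ] at hGI
  simp only [logFactor, Real.log_one]
  push_cast at hGI
  linear_combination hGI

theorem norm_Gamma_le_Gamma_re {z : ℂ} (hz : 0 < z.re) : ‖Complex.Gamma z‖ ≤ Real.Gamma z.re := by
  rw [Complex.Gamma_eq_integral hz, Real.Gamma_eq_integral hz, Complex.GammaIntegral]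
  refine (norm_integral_le_integral_norm _).trans (le_of_eq ?_)
  refine setIntegral_congr_fun measurableSet_Ioi fun x hx => ?_
  have hx0 : (0 : ℝ) < x := hx
  simp only [norm_mul, Complex.norm_cpow_eq_rpow_re_of_pos hx0, Complex.norm_real, Real.norm_eq_abs,
    Real.abs_exp, Complex.sub_re, Complex.one_re]

/-- At these points the argument of Gamma has real part `n`, and `|Γ(w)|² ≤ n^(2n)` is compensated
by `2ρ log ρ sin φ = 2n log ρ`. The crude logarithmic bound suffices, since only the sign of a
linear growth rate is to be determined from it. -/
theorem logFactor_le (hs : 0 < Real.sin φ) {n : ℕ} (hn : 1 ≤ n) :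
    logFactor φ (n / Real.sin φ) ≤ Real.log (n / Real.sin φ) := by
  have hn0 : (0 : ℝ) < n := by exact_mod_cast hn
  set ρ : ℝ := n / Real.sin φ with hρ
  have hρ0 : 0 < ρ := by positivity
  have hnρ : (n : ℝ) ≤ ρ := by
    rw [hρ, le_div_iff₀ hs]
    exact mul_le_of_le_one_right hn0.le (Real.sin_le_one φ)
  have hre : (gammaPoint φ ρ).re = n := by
    obtain ⟨-, h2, -⟩ := gammaArg hρ0 φ
    rw [gammaPoint, h2, hρ]
    field_simp
  have h1 : ‖Complex.Gamma (gammaPoint φ ρ)‖ ≤ (n : ℝ) ^ n := by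
    refine (norm_Gamma_le_Gamma_re (re_gammaPoint_pos hs hρ0)).trans ?_
    obtain ⟨k, rfl⟩ : ∃ k, n = k + 1 := ⟨n - 1, by omega⟩
    rw [hre]
    push_cast
    rw [Real.Gamma_nat_eq_factorial]
    calc (k.factorial : ℝ) ≤ (k + 1).factorial := by exact_mod_cast Nat.factorial_le (Nat.le_succ k)
      _ ≤ _ := by exact_mod_cast Nat.factorial_le_pow (k + 1)
  have hG : Complex.Gamma (gammaPoint φ ρ) ≠ 0 := Complex.Gamma_ne_zero_of_re_pos (re_gammaPoint_pos hs hρ0)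
  have h2 : Real.log ‖Complex.Gamma (gammaPoint φ ρ)‖ ≤ n * Real.log n := by
    rw [← Real.log_pow]
    exact Real.log_le_log (norm_pos_iff.mpr hG) h1
  have h3 : Real.log n ≤ Real.log ρ := Real.log_le_log hn0 hnρ
  have h4 : 0 ≤ Real.log (2 * Real.pi) := Real.log_nonneg (by linarith [Real.pi_gt_three])
  have h5 : 2 * ρ * Real.log ρ * Real.sin φ = 2 * n * Real.log ρ := by
    rw [hρ]; field_simp
  rw [logFactor, h5, Real.log_pow]
  push_cast
  nlinarith

/-- The identity of second differences says that `logFactor` and `levyTransform` differ by an affine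
function `A + Bρ`. For `B ≤ 0` its exponential is the transform of a point mass at `-B`. -/
theorem isLaplaceTransform_exp_logFactor (hs : 0 < Real.sin φ) :
    IsLaplaceTransform fun ρ => Real.exp (logFactor φ ρ) := by
  set a : ℝ → ℝ := fun ρ => logFactor φ ρ - levyTransform φ ρ with ha
  set A := 2 * a 1 - a 2 with hA
  set B := a 2 - a 1 with hB
  have hrep : ∀ ρ, 0 < ρ → logFactor φ ρ = levyTransform φ ρ + A + B * ρ := by
    intro ρ hρ
    have := logFactor_second_difference hs hρ
    simp only [hA, hB, ha]
    linear_combination this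
  -- Along `ρ = n/sin φ` the affine function is at most `log ρ`, because the Lévy transform is
  -- nonnegative; dividing by `ρ` and letting `n → ∞` bounds the slope.
  have hB0 : B ≤ 0 := by
    have hx : Tendsto (fun n : ℕ => (n : ℝ) / Real.sin φ) atTop atTop :=
      tendsto_natCast_atTop_atTop.atTop_div_const hs
    have h1 := (Real.isLittleO_log_id_atTop.tendsto_div_nhds_zero).comp hx
    have h2 : Tendsto (fun n : ℕ => A / ((n : ℝ) / Real.sin φ) + B) atTop (𝓝 (0 + B)) :=
      (tendsto_const_nhds.div_atTop hx).add_const B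
    rw [zero_add] at h2
    refine le_of_tendsto_of_tendsto h2 h1 ?_
    filter_upwards [eventually_ge_atTop 1] with n hn
    have hn0 : (0 : ℝ) < n := by exact_mod_cast hn
    have hρ0 : 0 < (n : ℝ) / Real.sin φ := by positivity
    have h3 := logFactor_le hs hn
    rw [hrep _ hρ0] at h3
    have h4 := levyTransform_nonneg hs ((n : ℝ) / Real.sin φ)
    simp only [Function.comp_apply, id]
    rw [le_div_iff₀ hρ0, add_mul, div_mul_cancel₀ _ hρ0.ne']
    linarith
  have hV : IsLaplaceTransform (levyTransform φ) :=
    IsLaplaceTransform.integral (measurable_levyDensity.div measurable_id)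
      (fun t ht => div_nonneg (levyDensity_nonneg hs ht) ht.le)
      fun ρ hρ => integrableOn_exp_mul_levyDensity hs hρ
  have h1 := (hV.exp fun ρ _ => levyTransform_nonneg hs ρ).mul
    ((IsLaplaceTransform.exp_linear hB0).const_mul (Real.exp_pos A).le) fun ρ _ => (Real.exp_pos _).le
  refine h1.congr fun ρ hρ => ?_
  rw [hrep ρ hρ, Real.exp_add, Real.exp_add, mul_assoc]

theorem isLaplaceTransform_inv_sinh {a : ℝ} (ha : 0 < a) :
    IsLaplaceTransform fun ρ => (2 * Real.sinh (a * ρ))⁻¹ := by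
  refine IsLaplaceTransform.tsum (f := fun n ρ => Real.exp (-(a * (2 * n + 1)) * ρ))
    (fun n => IsLaplaceTransform.exp_linear (by rw [neg_nonpos]; positivity))
    (fun n ρ _ => (Real.exp_pos _).le) fun ρ hρ => ?_
  have h1 : Real.exp (-(2 * (a * ρ))) < 1 := Real.exp_lt_one_iff.mpr (by
    have := mul_pos ha hρ; linarith)
  have h2 := (hasSum_geometric_of_lt_one (Real.exp_pos _).le h1).mul_left (Real.exp (-(a * ρ)))
  have e1 : Real.exp (-(a * ρ)) * (1 - Real.exp (-(2 * (a * ρ))))⁻¹ = (2 * Real.sinh (a * ρ))⁻¹ := by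
    have h3 : 2 * Real.sinh (a * ρ) = Real.exp (a * ρ) * (1 - Real.exp (-(2 * (a * ρ)))) := by
      rw [Real.sinh_eq, mul_sub, ← Real.exp_add]
      ring_nf
    rw [h3, mul_inv, ← Real.exp_neg]
  rw [e1] at h2
  refine h2.congr_fun fun n => ?_
  rw [← Real.exp_nat_mul, ← Real.exp_add]
  ring_nf

/-- For a vanishing real part the product of the Gamma function is Euler's product of `sinh(πρ)`. -/
theorem closedForm_of_sin_eq_zero (hs : Real.sin φ = 0) {ρ : ℝ} (hρ : 0 < ρ) :
    closedForm φ ρ = ((2 * Real.sinh (Real.pi * ρ))⁻¹) ^ 3 := by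
  have hpi := Real.pi_pos
  obtain ⟨h1, h2, -⟩ := gammaArg hρ φ
  have h3 := tendsto_prod_one_add (ρ := ρ) (b := 2 * Real.sin φ * ρ) (by rw [hs]; simp)
  have h4 := tendsto_euler_sinh_prod (Real.pi * ρ)
  have hsinh : 0 < Real.sinh (Real.pi * ρ) := Real.sinh_pos_iff.mpr (by positivity)
  have h5 := (h4.const_mul (Real.pi * ρ)⁻¹).inv₀ (by positivity)
  have h6 := tendsto_nhds_unique h3 (h5.congr fun n => by
    rw [inv_mul_cancel_left₀ (by positivity), hs]
    simp only [mul_zero, zero_mul, zero_div, add_zero, Real.rpow_zero, one_div]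
    congr 1
    refine Finset.prod_congr rfl fun j _ => ?_
    rw [mul_pow, mul_pow, mul_div_mul_left _ _ (by positivity)])
  rw [closedForm, norm_Gamma_sq hρ hs.ge h1 h2, h6, hs]
  simp only [mul_zero, Real.exp_zero, mul_one]
  congr 1
  field_simp

/-- The undamped case is separate, as the geometric series behind the Lévy density does not decay
for `sin φ = 0`. -/
theorem isLaplaceTransform_closedForm (hs : 0 ≤ Real.sin φ) : IsLaplaceTransform (closedForm φ) := by
  rcases hs.eq_or_lt with hs | hs
  · refine ((isLaplaceTransform_inv_sinh Real.pi_pos).pow (fun ρ hρ => ?_) 3).congr fun ρ hρ =>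
      (closedForm_of_sin_eq_zero hs.symm hρ).symm
    have := Real.sinh_pos_iff.mpr (mul_pos Real.pi_pos hρ)
    positivity
  · exact ((isLaplaceTransform_exp_logFactor hs).pow (fun ρ _ => (Real.exp_pos _).le) 3).congr
      fun ρ hρ => (closedForm_eq_exp hs hρ).symm

end LaplaceRepresentation

theorem theorem3p3 (S : OscillatorModel) (φ : ℝ) (hφ0 : 0 ≤ φ) (hφ1 : φ ≤ Real.pi / 2)
    (hφ : Real.sin φ = S.η / (3 * S.m * S.c ^ 3) * S.e ^ 2) :
    ∃ (Zc : ℝ → ℝ → ℝ) (Z : ℝ → ℝ),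
      (∀ β γ : ℝ, 0 < β → 0 < γ → S.IsCutoffPartitionFunction β γ (Zc β γ)) ∧
      (∀ β : ℝ, 0 < β → Tendsto (fun γ => Zc β γ) atTop (𝓝 (Z β))) ∧
      (∀ β : ℝ, 0 < β → Z β = closedForm φ (S.η * β / (2 * Real.pi))) ∧
      ∃ μ : Measure ℝ, μ (Set.Iio 0) = 0 ∧
        ∀ β : ℝ, 0 < β →
          Integrable (fun ω : ℝ => Real.exp (-β * ω)) μ ∧
          ∫ ω, Real.exp (-β * ω) ∂μ = Z β := by
  have hη := S.η_pos
  have hpi := Real.pi_pos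
  have hs : 0 ≤ Real.sin φ := Real.sin_nonneg_of_nonneg_of_le_pi hφ0 (by linarith)
  refine ⟨fun β γ => cutoffPartition S.couplingConst (S.η * β / (2 * Real.pi)) γ,
    fun β => closedForm φ (S.η * β / (2 * Real.pi)), fun β γ hβ hγ => S.isCutoffPartitionFunction hβ hγ,
    fun β hβ => ?_, fun β _ => rfl, ?_⟩
  · have h := tendsto_cutoffPartition_closedForm hs (ρ := S.η * β / (2 * Real.pi)) (by positivity)
    -- The relation between `φ` and the charge identifies `sin φ` with the coupling constant of the
    -- model.
    rwa [hφ] at h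
  · refine IsLaplaceTransform.exists_measure (((isLaplaceTransform_closedForm hs).comp_mul
      (a := S.η / (2 * Real.pi)) (by positivity)).congr fun β _ => ?_) fun β hβ => ?_
    · rw [div_mul_eq_mul_div]
    · rw [closedForm]
      positivity
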